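/- For $z=x+iy$ with $y>0$ put $q=e^{2\pi i z}$ and $\Theta(z)=\sum_{n\in\mathbb Z}q^{n^2}$; all complex powers are principal, with $-\pi<\arg\le\pi$. Let $\Gamma=\Gamma_0(4)$, let $k\in\{3,5,7\}$ and $\kappa=k/2$. For $\gamma=\left(\begin{smallmatrix}a&b\\c&d\end{smallmatrix}\right)\in\Gamma$ let $$\nu(\gamma)=\left(\frac cd\right)\varepsilon_d^{-k},\qquad \varepsilon_d=\begin{cases}1& d\equiv1\ (\mathrm{mod}\ 4)\\ i& d\equiv3\ (\mathrm{mod}\ 4),\end{cases}$$ where $\left(\frac cd\right)$ is the Jacobi symbol $\left(\frac c{|d|}\right)$, multiplied by $-1$ if $c<0$ and $d<0$. For $g=\left(\begin{smallmatrix}*&*\\c&d\end{smallmatrix}\right)$ write $j(g,z)=cz+d$, and let $w(g_1,g_2)=j(g_1,g_2z)^{\kappa}\,j(g_2,z)^{\kappa}\,j(g_1g_2,z)^{-\kappa}$, which is independent of $z$. Let $\Gamma_\infty$ be the stabiliser of $\infty$ in $\mathrm{SL}(2,\mathbb Z)$. For the cusp $\mathfrak a\in\{\infty,0\}$ of $\Gamma$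 take the scaling matrix $\sigma_\infty=I$, respectively $\sigma_0=\left(\begin{smallmatrix}0&-1/2\\2&0\end{smallmatrix}\right)$, and put $\Gamma_{\mathfrak a}=\Gamma\cap\sigma_{\mathfrak a}\Gamma_\infty\sigma_{\mathfrak a}^{-1}$. For $k=5,7$ define the Eisenstein series $$E_{\kappa}(\Gamma,\nu,z,\mathfrak a)=\sum_{\gamma\in\Gamma_{\mathfrak a}\backslash\Gamma}\overline{\nu(\gamma)}\;\overline{w(\sigma_{\mathfrak a}^{-1},\gamma)}\;j(\sigma_{\mathfrak a}^{-1}\gamma,z)^{-\kappa}.$$ For $k=3$ define it by its Fourier expansion $$E_{3/2}(\Gamma,\nu,z,\mathfrak a)=\delta_{\mathfrak a\infty}+\sum_{n\ge1}\eta_{\mathfrak a}(n)q^n,\qquad \eta_{\mathfrak a}(n)=\left(\frac{2\pi}{i}\right)^{3/2}\frac{n^{1/2}}{\Gamma(3/2)}\,Z_{\mathfrak a,n}(0),$$ where $\delta_{\infty\infty}=1$, $\delta_{0\infty}=0$, and $Z_{\mathfrak a,n}(0)$ is the value at $s=0$ of the meromorphic continuation (to a half-plane $\mathrm{Re}(s)>-\delta$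 with $\delta>0$) of $$Z_{\mathfrak a,n}(s)=\sum_{c>0}S_{\mathfrak a}(n,c)\,c^{-3/2-2s}\quad(\mathrm{Re}(s)>1/4),\qquad S_{\mathfrak a}(n,c)=\sum_{g}\overline{\nu(\sigma_{\mathfrak a}g)\,w(\sigma_{\mathfrak a}^{-1},\sigma_{\mathfrak a}g)}\,e^{2\pi i nd/c},$$ the last sum being over the $g=\left(\begin{smallmatrix}*&*\\c&d\end{smallmatrix}\right)\in\Gamma_\infty\backslash\sigma_{\mathfrak a}^{-1}\Gamma/\Gamma_\infty$ with the given $c>0$. Write $E_{k/2}(\Gamma_0(4),1,z)=E_{\kappa}(\Gamma,\nu,z,\infty)$ and $F_{k/2}(\Gamma_0(4),1,z)=E_{\kappa}(\Gamma,\nu,z,0)$. **Proposition.** For $k\in\{3,5,7\}$ both Eisenstein series are well defined: for $k=5,7$ the series over cosets converge absolutely for every $z$; for $k=3$ each $Z_{\mathfrak a,n}$ ($n\ge1$) has a meromorphic continuation that is analytic at $s=0$, and the Fourier expansions converge absolutely for every $z$. Moreover, for all $z$ in the upper half-plane, $$\Theta^k(z)=E_{k/2}(\Gamma_0(4),1,z)+\left(\frac{1-i}{\sqrt2}\right)^kF_{k/2}(\Gamma_0(4),1,z).$$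 -/

import Mathlib

open scoped MatrixGroups

noncomputable section

namespace ThetaEisenstein

/-- The theta function `Θ(z) = ∑_{n ∈ ℤ} q^(n^2)`, where `q = e^(2πiz)`. -/
def Theta (z : UpperHalfPlane) : ℂ :=
  ∑' n : ℤ, Complex.exp (2 * Real.pi * Complex.I * (n : ℂ) ^ 2 * (z : ℂ))

/-- The extended quadratic symbol `(c/d)` for odd `d` of either sign: the Jacobi symbol `(c/|d|)`,
with an additional minus sign exactly when `c` and `d` are both negative; `(0/±1) = 1`. -/
def quadSymbol (c d : ℤ) : ℤ :=
  if c < 0 ∧ d < 0 then -jacobiSym c d.natAbs else jacobiSym c d.natAbs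

/-- `ε_d` for odd `d`: `1` if `d ≡ 1 (mod 4)` and `i` if `d ≡ 3 (mod 4)`. -/
def eps (d : ℤ) : ℂ := if d % 4 = 1 then 1 else Complex.I

/-- The multiplier system `(a b; c d) ↦ (c/d) ε_d^(-k)` of weight `k/2` (`k` odd) on `Γ₀(4)`,
with trivial character. -/
def Psi (k : ℕ) (γ : SL(2, ℤ)) : ℂ :=
  (quadSymbol (γ 1 0) (γ 1 1) : ℂ) * (eps (γ 1 1))⁻¹ ^ k

/-- The inclusion `SL(2,ℤ) → SL(2,ℝ)`. -/
def toReal : SL(2, ℤ) →* SL(2, ℝ) :=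
  Matrix.SpecialLinearGroup.map (Int.castRingHom ℝ)

/-- `j(g, z) = cz + d`. -/
def j (g : SL(2, ℝ)) (z : UpperHalfPlane) : ℂ :=
  ((g 1 0 : ℝ) : ℂ) * (z : ℂ) + ((g 1 1 : ℝ) : ℂ)

/-- `w(g₁, g₂) = j(g₁, g₂z)^κ j(g₂, z)^κ j(g₁g₂, z)^(-κ)` (principal powers); its value does not
depend on `z`. -/
def w (κ : ℝ) (g₁ g₂ : SL(2, ℝ)) (z : UpperHalfPlane) : ℂ :=
  j g₁ (g₂ • z) ^ (κ : ℂ) * j g₂ z ^ (κ : ℂ) * j (g₁ * g₂) z ^ (-(κ : ℂ))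

/-- The stabiliser `Γ_∞` of `∞` in `SL(2,ℤ)`, that is, the matrices `± (1 n; 0 1)`. -/
def stabInfty : Subgroup SL(2, ℤ) where
  carrier := {g | g 1 0 = 0}
  one_mem' := by simp
  mul_mem' := by
    intro a b ha hb
    simp only [Set.mem_ofPred_eq] at *
    simp [Matrix.mul_apply, Fin.sum_univ_two, ha, hb]
  inv_mem' := by
    intro a ha
    simp only [Set.mem_ofPred_eq] at *
    simp [Matrix.SpecialLinearGroup.SL2_inv_expl, ha]

/-- `Γ_𝔞 = Γ ∩ σ Γ_∞ σ⁻¹`, as a subgroup of `Γ`, where `σ` is a scaling matrix of the cusp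
`𝔞 = σ∞`. -/
def cuspStab (Γ : Subgroup SL(2, ℤ)) (σ : SL(2, ℝ)) : Subgroup Γ :=
  ((stabInfty.map toReal).map (MulAut.conj σ).toMonoidHom).comap (toReal.comp Γ.subtype)

/-- The summand `ν̄(γ) w̄(σ⁻¹, γ) j(σ⁻¹γ, z)^(-κ)` of the Eisenstein series. -/
def eisTerm (κ : ℝ) (ν : SL(2, ℤ) → ℂ) (σ : SL(2, ℝ)) (z : UpperHalfPlane) (γ : SL(2, ℤ)) : ℂ :=
  star (ν γ) * star (w κ σ⁻¹ (toReal γ) z) * j (σ⁻¹ * toReal γ) z ^ (-(κ : ℂ))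

/-- The right cosets `Γ_𝔞 γ`, that is, the quotient `Γ_𝔞 \ Γ`. -/
abbrev Cosets (Γ : Subgroup SL(2, ℤ)) (σ : SL(2, ℝ)) : Type :=
  Quotient (QuotientGroup.rightRel (cuspStab Γ σ))

/-- The series `∑_{γ ∈ Γ_𝔞 \ Γ} ν̄(γ) w̄(σ⁻¹, γ) j(σ⁻¹γ, z)^(-κ)`, over a system of representatives
of the cosets. -/
def eisSeries (κ : ℝ) (Γ : Subgroup SL(2, ℤ)) (ν : SL(2, ℤ) → ℂ) (σ : SL(2, ℝ))
    (z : UpperHalfPlane) : ℂ :=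
  ∑' q : Cosets Γ σ, eisTerm κ ν σ z (q.out : Γ)

/-- The translation `(1 n; 0 1)`. -/
def trans (n : ℤ) : SL(2, ℝ) := toReal (ModularGroup.T ^ n)

/-- The elements `σ⁻¹γ` of `σ⁻¹Γ` with positive lower left entry, recorded through `γ ∈ Γ`. -/
abbrev PosLower (Γ : Subgroup SL(2, ℤ)) (σ : SL(2, ℝ)) : Type :=
  {γ : Γ // 0 < (σ⁻¹ * toReal γ) 1 0}

/-- Two elements of `σ⁻¹Γ` with positive lower left entry lie in the same double coset modulo
`Γ_∞` on both sides iff they differ by translations on the left and on the right. -/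
def doubleCosetSetoid (Γ : Subgroup SL(2, ℤ)) (σ : SL(2, ℝ)) : Setoid (PosLower Γ σ) where
  r γ γ' := ∃ m n : ℤ, σ⁻¹ * toReal γ' = trans m * (σ⁻¹ * toReal γ) * trans n
  iseqv := by
    refine ⟨fun γ => ⟨0, 0, by simp [trans]⟩, ?_, ?_⟩
    · rintro γ γ' ⟨m, n, h⟩
      refine ⟨-m, -n, ?_⟩
      rw [h]
      simp [trans, mul_assoc]
    · rintro γ γ' γ'' ⟨m, n, h⟩ ⟨m', n', h'⟩
      refine ⟨m' + m, n + n', ?_⟩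
      rw [h', h]
      simp [trans, zpow_add, mul_assoc]

/-- `Γ_∞ \ σ⁻¹Γ / Γ_∞`, restricted to lower left entry `c > 0`. -/
abbrev DoubleCosets (Γ : Subgroup SL(2, ℤ)) (σ : SL(2, ℝ)) : Type :=
  Quotient (doubleCosetSetoid Γ σ)

/-- The representative in `σ⁻¹Γ` of a double coset. -/
def DoubleCosets.rep {Γ : Subgroup SL(2, ℤ)} {σ : SL(2, ℝ)} (q : DoubleCosets Γ σ) : SL(2, ℝ) :=
  σ⁻¹ * toReal q.out.1

/-- The Kloosterman sum `S_{𝔞∞}(n, c) = ∑ ν̄_{𝔞∞}(γ) e^(2πi n d / c)` over the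
`γ = (* *; c d) ∈ Γ_∞ \ σ⁻¹Γ / Γ_∞` with the given `c > 0`, where
`ν_{𝔞∞}(γ) = ν(σγ) w(σ⁻¹, σγ)`. As `w` does not depend on `z`, it is evaluated at `z = i`. -/
def kloosterman (κ : ℝ) (Γ : Subgroup SL(2, ℤ)) (ν : SL(2, ℤ) → ℂ) (σ : SL(2, ℝ))
    (n : ℕ) (c : ℝ) : ℂ :=
  ∑ᶠ (q : DoubleCosets Γ σ) (_ : q.rep 1 0 = c),
    star (ν q.out.1 * w κ σ⁻¹ (toReal q.out.1) UpperHalfPlane.I) *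
      Complex.exp (2 * Real.pi * Complex.I * (n : ℂ) * ((q.rep 1 1 : ℝ) : ℂ) / ((c : ℝ) : ℂ))

/-- `v` is the value at `s = 0` of the meromorphic continuation of the Dirichlet series
`∑_{c > 0} S_{𝔞∞}(n, c) c^(-κ-2s)`, which converges absolutely for `κ + 2 Re s > 2`: there is
a meromorphic function on a half-plane `Re s > -δ` with `δ > 0` that equals the series in its region
of convergence, is analytic at `0`, and has the value `v` there. By the identity theorem there is at
most one such `v`. -/
def IsKloostermanZetaValue (κ : ℝ) (Γ : Subgroup SL(2, ℤ)) (ν : SL(2, ℤ) → ℂ) (σ : SL(2, ℝ))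
    (n : ℕ) (v : ℂ) : Prop :=
  ∃ (δ : ℝ) (G : ℂ → ℂ), 0 < δ ∧ MeromorphicOn G {s : ℂ | -δ < s.re} ∧ AnalyticAt ℂ G 0 ∧
    (∀ s : ℂ, 2 < κ + 2 * s.re →
      HasSum (fun c : {c : ℝ // 0 < c} =>
        kloosterman κ Γ ν σ n c * ((c : ℝ) : ℂ) ^ (-((κ : ℂ) + 2 * s))) (G s)) ∧
    G 0 = v

open Classical in
/-- The value at `s = 0` of the continued Dirichlet series (`0` if there is none). -/
def kloostermanZetaValue (κ : ℝ) (Γ : Subgroup SL(2, ℤ)) (ν : SL(2, ℤ) → ℂ) (σ : SL(2, ℝ))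
    (n : ℕ) : ℂ :=
  if h : ∃ v, IsKloostermanZetaValue κ Γ ν σ n v then h.choose else 0

/-- The Fourier coefficient
`η_{𝔞∞}(n) = (2π/i)^κ n^(κ-1) Γ(κ)⁻¹ ∑_{c > 0} S_{𝔞∞}(n, c) c^(-κ)`, the sum over `c` being
understood by analytic continuation. -/
def eta (κ : ℝ) (Γ : Subgroup SL(2, ℤ)) (ν : SL(2, ℤ) → ℂ) (σ : SL(2, ℝ)) (n : ℕ) : ℂ :=
  (2 * Real.pi / Complex.I) ^ (κ : ℂ) * (n : ℂ) ^ ((κ : ℂ) - 1) / Complex.Gamma κ *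
    kloostermanZetaValue κ Γ ν σ n

open Classical in
/-- `δ_{𝔞∞}`: `1` if the cusp `𝔞 = σ∞` is `Γ`-equivalent to `∞`, and `0` otherwise. -/
def deltaInfty (Γ : Subgroup SL(2, ℤ)) (σ : SL(2, ℝ)) : ℂ :=
  if ∃ γ : Γ, (σ⁻¹ * toReal γ) 1 0 = 0 then 1 else 0

/-- The term `η_{𝔞∞}(n) q^n` of the Fourier expansion. -/
def fourierTerm (κ : ℝ) (Γ : Subgroup SL(2, ℤ)) (ν : SL(2, ℤ) → ℂ) (σ : SL(2, ℝ))
    (z : UpperHalfPlane) (n : ℕ) : ℂ :=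
  eta κ Γ ν σ n * Complex.exp (2 * Real.pi * Complex.I * (n : ℂ) * (z : ℂ))

/-- The Eisenstein series `E_κ(Γ, ν, z, 𝔞)` for the cusp `𝔞 = σ∞` with scaling matrix `σ`. For
`κ > 2` it is the sum over cosets; for `κ = 3/2, 2` it is `δ_{𝔞∞} + ∑_{n ≥ 1} η_{𝔞∞}(n) q^n`. -/
def eisenstein (κ : ℝ) (Γ : Subgroup SL(2, ℤ)) (ν : SL(2, ℤ) → ℂ) (σ : SL(2, ℝ))
    (z : UpperHalfPlane) : ℂ :=
  if 2 < κ then eisSeries κ Γ ν σ z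
  else deltaInfty Γ σ + ∑' n : ℕ, fourierTerm κ Γ ν σ z (n + 1)

/-- The Eisenstein series is well defined. For `κ > 2` this says that the sum over cosets converges
absolutely; for `κ = 3/2, 2` it says that for every `n ≥ 1` the continued series in `η_{𝔞∞}(n)` has a
value, and that the Fourier expansion converges absolutely. -/
def EisensteinWellDefined (κ : ℝ) (Γ : Subgroup SL(2, ℤ)) (ν : SL(2, ℤ) → ℂ)
    (σ : SL(2, ℝ)) : Prop :=
  if 2 < κ then ∀ z : UpperHalfPlane, Summable fun q : Cosets Γ σ => eisTerm κ ν σ z (q.out : Γ)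
  else (∀ n : ℕ, 1 ≤ n → ∃ v, IsKloostermanZetaValue κ Γ ν σ n v) ∧
    ∀ z : UpperHalfPlane, Summable fun n : ℕ => fourierTerm κ Γ ν σ z (n + 1)

/-- The scaling matrix `(0 -1/√4; √4 0)` of the cusp `0` of `Γ₀(4)`. -/
def sigmaZero : SL(2, ℝ) := ⟨!![0, -1 / 2; 2, 0], by simp [Matrix.det_fin_two]⟩

/-- `E_{k/2}(Γ₀(4), 1, z)`: the Eisenstein series for the cusp `∞`, with scaling matrix `I`. -/
def E (k : ℕ) (z : UpperHalfPlane) : ℂ :=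
  eisenstein ((k : ℝ) / 2) (CongruenceSubgroup.Gamma0 4) (Psi k) 1 z

/-- `F_{k/2}(Γ₀(4), 1, z)`: the Eisenstein series for the cusp `0`. -/
def F (k : ℕ) (z : UpperHalfPlane) : ℂ :=
  eisenstein ((k : ℝ) / 2) (CongruenceSubgroup.Gamma0 4) (Psi k) sigmaZero z

end ThetaEisenstein

end

/-! Write θ for `th`. The proof rests on a characterisation of θ^k for k < 8 (`eq_th_pow`): a
holomorphic function G on the upper half-plane that obeys the laws of θ^k under z ↦ z + 1 and W : z
↦ -1/(4z), tends to 1 at i∞ and grows at most polynomially in 1/y as y → 0 is equal to θ^k. In τ =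
2z the deviation G/θ^k - 1 is holomorphic, because θ has no zeros (`thetaProd_div_Dl`: the eighth
power of the product of the three theta constants is a multiple of Δ), and it is invariant under the
theta group, of index three in the modular group. The product of its three conjugates is modular of
level one and weight zero. Near i∞ two conjugates are O(e^{-πy}), while the third is at most of
order y^B e^{πky/4}, since θ vanishes at the remaining cusp. For k < 8 the product is therefore
constant and equal to 0, and one conjugate vanishes identically.

It remains to see that the combination of Eisenstein series has these properties. The multiplier law
of θ (`rowLaw_quadSymbol`), proved by Euclidean descent on lower rows, shows that the summands at ∞
are quotients θ(z)^k/θ(γz)^k. The transformation laws then follow by reindexing, and W exchanges the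
two cusps. The constant ((1-i)/√2)^k is i^{-k/2}; it compares the factor (-2iz)^{k/2} of θ^k under W
with the factor (-2z)^{k/2} coming from σ₀. For k = 5, 7 everything converges absolutely and the
characterisation applies at once.

For k = 3 the factor |cz + d|^{-2s} is inserted. Poisson summation gives a Fourier expansion whose
coefficients are an archimedean factor (`hw`) times a Dirichlet series of Kloosterman sums
(`klZeta`). The asymptotics of θ at rational points identify the multipliers with normalised
quadratic Gauss sums, so the Kloosterman sums are, up to a constant, √c β(c) with β = μ ∗ #{x : x² ≡
-n}. This β factors into a part at 2, a ramified part, and the series of the quadratic symbol ψ over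
a series at twice the argument; all of these continue beyond s = 0, with at most a simple pole at 0.

In the combination of the two cusps the pole cancels for every integer n (`bothPart_zero`): either ψ
has mean value zero, or the factor at 2 vanishes. Hence s times the series vanishes at s = 0 and its
derivative there is the central value. Since `hw` at s = 0 is zero for n ≤ 0, that value is
holomorphic in z, and the characterisation gives θ³ (`centreVal_eq`). For n ≥ 1 the mean of ψ is
always zero, so the zeta function of each cusp is regular on its own, and the central coefficient
splits into the prescribed coefficients of the two series (`eta_add`). -/

noncomputable section
namespace ThetaEisenstein
open Complex

/-! ### Theta under z ↦ z + 1, z ↦ -1/(4z), z ↦ z/(4z + 1) and reflection. -/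

/-- The theta function as a function of a complex variable. -/
def th (z : ℂ) : ℂ := jacobiTheta (2 * z)

lemma Theta_eq_th (z : UpperHalfPlane) : Theta z = th z := by
  unfold Theta th jacobiTheta
  refine tsum_congr fun n => ?_
  congr 1
  ring

lemma th_add_one (z : ℂ) : th (z + 1) = th z := by
  unfold th
  rw [mul_add, mul_one, add_comm, jacobiTheta_two_add]

lemma th_add_int (z : ℂ) (n : ℤ) : th (z + n) = th z := by
  induction n using Int.induction_on with
  | zero => simp
  | succ n ih => push_cast at *; rw [← add_assoc, th_add_one, ih]
  | pred n ih =>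
    push_cast at *
    rw [← ih, ← th_add_one (z + (-n - 1))]
    congr 1
    ring

lemma im_neg_inv_pos {z : ℂ} (hz : 0 < z.im) : 0 < (-1 / (4 * z)).im := by
  have h0 : z ≠ 0 := fun h => by simp [h] at hz
  have : (-1 / (4 * z)).im = z.im / (4 * normSq z) := by
    rw [neg_div, neg_im, one_div, inv_im]
    simp
    have := (normSq_pos.2 h0).ne'
    field_simp
  rw [this]
  have := normSq_pos.2 h0
  positivity

lemma th_W {z : ℂ} (hz : 0 < z.im) :
    th (-1 / (4 * z)) = (-2 * I * z) ^ (1 / 2 : ℂ) * th z := by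
  have h0 : z ≠ 0 := fun h => by simp [h] at hz
  have h := jacobiTheta_S_smul ⟨2 * z, by simpa using hz⟩
  rw [UpperHalfPlane.modular_S_smul] at h
  simp only at h
  unfold th
  rw [show (2 : ℂ) * (-1 / (4 * z)) = (-(2 * z))⁻¹ by field_simp; norm_num, h]
  congr 2
  ring

lemma im_mul_eq_sin (u v : ℂ) : (u * v).im = ‖u‖ * ‖v‖ * Real.sin (arg u + arg v) := by
  conv_lhs => rw [← norm_mul_exp_arg_mul_I u, ← norm_mul_exp_arg_mul_I v]
  rw [show ((‖u‖ : ℂ) * cexp (arg u * I)) * ((‖v‖ : ℂ) * cexp (arg v * I))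
    = ((‖u‖ * ‖v‖ : ℝ) : ℂ) * cexp ((arg u + arg v : ℝ) * I) by
      push_cast; rw [add_mul, Complex.exp_add]; ring]
  rw [im_ofReal_mul, exp_ofReal_mul_I_im]


/-- Both arguments lie in [0, π]; a sum beyond π would have nonpositive sine, against
`im_mul_eq_sin`. Together with the next lemma this covers most products of principal powers below.
-/
lemma arg_add_of_im_pos {u v : ℂ} (hu : 0 < u.im) (hv : 0 < v.im) (huv : 0 < (u * v).im) :
    arg u + arg v ∈ Set.Ioc (-Real.pi) Real.pi := by
  have hu0 := (arg_nonneg_iff.2 hu.le)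
  have hv0 := (arg_nonneg_iff.2 hv.le)
  refine ⟨by linarith [Real.pi_pos], ?_⟩
  by_contra! h
  have h2 : Real.sin (arg u + arg v) ≤ 0 := by
    have := Real.sin_nonneg_of_nonneg_of_le_pi (x := arg u + arg v - Real.pi) (by linarith)
      (by linarith [arg_le_pi u, arg_le_pi v])
    rw [Real.sin_sub_pi] at this
    linarith
  rw [im_mul_eq_sin] at huv
  nlinarith [mul_nonneg (norm_nonneg u) (norm_nonneg v)]

lemma arg_add_of_opposite {u v : ℂ} (hu : u.im ≤ 0) (hu' : u.im = 0 → 0 < u.re)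
    (hv : 0 < v.im) : arg u + arg v ∈ Set.Ioc (-Real.pi) Real.pi := by
  have h1 : arg u ≤ 0 := by
    rcases hu.lt_or_eq with h | h
    · exact (arg_neg_iff.2 h).le
    · rw [arg_eq_zero_iff.2 ⟨(hu' h).le, h⟩]
  have hv0 : 0 ≤ arg v := arg_nonneg_iff.2 hv.le
  have hv1 : 0 < arg v := hv0.lt_of_ne fun h => by
    rw [eq_comm, arg_eq_zero_iff] at h; linarith [h.2]
  exact ⟨by linarith [neg_pi_lt_arg u], by linarith [arg_le_pi v]⟩

lemma mul_cpow_of_arg {u v : ℂ} (hu : u ≠ 0) (hv : v ≠ 0)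
    (h : arg u + arg v ∈ Set.Ioc (-Real.pi) Real.pi) (s : ℂ) :
    (u * v) ^ s = u ^ s * v ^ s := by
  rw [cpow_def_of_ne_zero (mul_ne_zero hu hv), cpow_def_of_ne_zero hu, cpow_def_of_ne_zero hv,
    (log_mul_eq_add_log_iff hu hv).2 h, ← Complex.exp_add, add_mul]

/-- Negation lowers the argument by π in the upper half-plane and raises it by π in the lower one,
whence the factors e^{∓πi/2} here and in the next lemma. -/
lemma neg_cpow_half {w : ℂ} (hw : 0 < w.im) : (-w) ^ (1 / 2 : ℂ) = -I * w ^ (1 / 2 : ℂ) := by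
  have h0 : w ≠ 0 := fun h => by simp [h] at hw
  rw [show -w = -1 * w by ring]
  rw [cpow_def_of_ne_zero (by simpa using h0), cpow_def_of_ne_zero h0, log,
    show -1 * w = -w by ring, arg_neg_eq_arg_sub_pi_of_im_pos hw, norm_neg, log]
  rw [show ((Real.log ‖w‖ : ℂ) + ((arg w - Real.pi : ℝ) : ℂ) * I) * (1 / 2)
    = -(Real.pi / 2 * I) + (Real.log ‖w‖ + arg w * I) * (1 / 2) by push_cast; ring,
    Complex.exp_add, Complex.exp_neg, exp_pi_div_two_mul_I, inv_I]

lemma neg_cpow_half' {w : ℂ} (hw : w.im < 0) : (-w) ^ (1 / 2 : ℂ) = I * w ^ (1 / 2 : ℂ) := by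
  have h := neg_cpow_half (w := -w) (by simpa using hw)
  rw [neg_neg] at h
  rw [h, ← mul_assoc, mul_neg, I_mul_I]
  ring

/-- The map is W, then translation by -1, then W again. Both theta factors that arise have positive
real part, so their arguments add up within the principal range. -/
lemma th_V {z : ℂ} (hz : 0 < z.im) :
    th (z / (4 * z + 1)) = (4 * z + 1) ^ (1 / 2 : ℂ) * th z := by
  have h0 : z ≠ 0 := fun h => by simp [h] at hz
  have h1 : 4 * z + 1 ≠ 0 := fun h => by
    have := congrArg im h; simp at this; linarith
  set w := -1 / (4 * z) with hw
  have hwi := im_neg_inv_pos hz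
  rw [← hw] at hwi
  have hw1 : 0 < (w + (-1 : ℤ)).im := by simpa using hwi
  have hw0 : w + (-1 : ℤ) ≠ 0 := fun h => by rw [h] at hw1; simp at hw1
  have e1 : w + (-1 : ℤ) = -(1 + 4 * z) / (4 * z) := by
    rw [hw]; push_cast; field_simp; ring
  have e2 : -1 / (4 * (w + (-1 : ℤ))) = z / (4 * z + 1) := by
    have h1' : 1 + 4 * z ≠ 0 := by rwa [add_comm]
    rw [e1]; field_simp; ring
  have e3 : 4 * z + 1 = (-2 * I * (w + (-1 : ℤ))) * (-2 * I * z) := by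
    rw [e1]; field_simp; rw [I_sq]; ring
  have half : ∀ x : ℂ, 0 < x.im → |arg (-2 * I * x)| < Real.pi / 2 := fun x hx => by
    rw [abs_arg_lt_pi_div_two_iff]; left; simpa using hx
  obtain ⟨b1, b1'⟩ := abs_lt.1 (half _ hw1)
  obtain ⟨b2, b2'⟩ := abs_lt.1 (half _ hz)
  have sum_mem : ∀ x y p : ℝ, -(p / 2) < x → x < p / 2 → -(p / 2) < y → y < p / 2 →
      x + y ∈ Set.Ioc (-p) p := fun x y p _ _ _ _ => ⟨by linarith, by linarith⟩
  rw [← e2, th_W hw1, th_add_int, hw, th_W hz, ← hw, ← mul_assoc, e3,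
    mul_cpow_of_arg (mul_ne_zero (by simp) hw0) (mul_ne_zero (by simp) h0)
      (sum_mem _ _ _ b1 b1' b2 b2')]

lemma jacobiTheta_neg_conj (z : ℂ) : jacobiTheta (-(starRingEnd ℂ) z) =
    (starRingEnd ℂ) (jacobiTheta z) := by
  unfold jacobiTheta
  rw [conj_tsum]
  refine tsum_congr fun n => ?_
  rw [← exp_conj]
  congr 1
  simp

/-- Theta has real Fourier coefficients. The reflection will reverse the sign of c in a lower row
(c, d). -/
lemma th_neg_conj (z : ℂ) : th (-(starRingEnd ℂ) z) = (starRingEnd ℂ) (th z) := by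
  unfold th
  rw [← jacobiTheta_neg_conj]
  congr 1
  simp [conj_ofNat]
end ThetaEisenstein
end

/-! ### The theta multiplier on Γ₀(4), by descent on the lower row. -/

noncomputable section
namespace ThetaEisenstein
open Complex

/-- The transformation law of `th` for matrices with lower row `(c, d)`, with constant `v`. -/
def RowLaw (c d : ℤ) (v : ℂ) : Prop :=
  ∀ a b : ℤ, a * d - b * c = 1 → ∀ z : ℂ, 0 < z.im →
    th ((a * z + b) / (c * z + d)) = v * (c * z + d) ^ (1 / 2 : ℂ) * th z

lemma row_ne_zero {c d : ℤ} (h : c ≠ 0 ∨ d ≠ 0) {z : ℂ} (hz : 0 < z.im) :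
    (c : ℂ) * z + d ≠ 0 := fun h0 => by
  have h1 := congrArg im h0
  have h2 := congrArg re h0
  simp at h1 h2
  rcases h1 with h1 | h1
  · rw [h1] at h2; simp at h2; omega
  · exact hz.ne' h1

/-- Right multiplication by T^n. The upper row plays no role throughout: matrices with equal lower
rows differ by a left translation, under which theta is invariant. -/
lemma RowLaw.T {c d : ℤ} {v : ℂ} (h : RowLaw c d v) (n : ℤ) : RowLaw c (d + n * c) v := by
  intro a b hab z hz
  have := h a (b - n * a) (by rw [← hab]; ring) (z + n) (by simpa using hz)
  rw [th_add_int] at this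
  push_cast at *
  rw [show (c : ℂ) * z + (d + n * c) = c * (z + n) + d by ring, ← this]
  congr 2
  ring

/-- Right multiplication by (1 0; 4 1). With d > 0 the principal powers combine: for c ≤ 0 the first
factor is a positive real or lies below the real axis while 4z + 1 lies above it, and for c > 0 both
factors and their product lie in the upper half-plane. -/
lemma RowLaw.V {c d : ℤ} {v : ℂ} (hd : 0 < d) (h : RowLaw c d v) : RowLaw (c + 4 * d) d v := by
  intro a b hab z hz
  have h0 : 4 * z + 1 ≠ 0 := fun h => by
    have := congrArg im h; simp at this; linarith
  have hVi : 0 < (z / (4 * z + 1)).im := by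
    have : (z / (4 * z + 1)).im = z.im / normSq (4 * z + 1) := by
      have := (normSq_pos.2 h0).ne'
      rw [div_im]; simp; field_simp; ring
    rw [this]
    have := normSq_pos.2 h0
    positivity
  have key := h (a - 4 * b) b (by rw [← hab]; ring) _ hVi
  set u := (c : ℂ) * (z / (4 * z + 1)) + d with hu
  have hu0 : u ≠ 0 := row_ne_zero (Or.inr hd.ne') hVi
  have huv : u * (4 * z + 1) = ((c + 4 * d : ℤ) : ℂ) * z + d := by
    have hx : z / (4 * z + 1) * (4 * z + 1) = z := div_mul_cancel₀ _ h0
    rw [hu]; push_cast; linear_combination (c : ℂ) * hx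
  have e1 : (((a - 4 * b : ℤ) : ℂ) * (z / (4 * z + 1)) + b) / u
      = (a * z + b) / (((c + 4 * d : ℤ) : ℂ) * z + d) := by
    rw [← huv, ← div_div, div_right_comm]
    congr 1
    push_cast; field_simp; ring
  rw [e1] at key
  rw [key, th_V hz, ← huv, mul_cpow_of_arg hu0 h0]
  · ring
  have hui : u.im = c * (z / (4 * z + 1)).im := by simp [hu]
  have hv : 0 < (4 * z + 1).im := by simpa using hz
  rcases le_or_gt c 0 with hc | hc
  · apply arg_add_of_opposite _ _ hv
    · rw [hui]
      exact mul_nonpos_of_nonpos_of_nonneg (by exact_mod_cast hc) hVi.le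
    · intro h'
      rw [hui] at h'
      have : c = 0 := by
        rcases mul_eq_zero.1 h' with h' | h'
        · exact_mod_cast h'
        · exact absurd h' hVi.ne'
      simp [hu, this, hd]
  · apply arg_add_of_im_pos _ hv
    · rw [huv]
      have : (0 : ℝ) < c + 4 * d := by exact_mod_cast (by omega : 0 < c + 4 * d)
      simp
      positivity
    · rw [hui]
      have : (0 : ℝ) < c := by exact_mod_cast hc
      positivity

/-- Reflection z ↦ -z̄. The condition d > 0 keeps the automorphy factor off the negative axis, where
principal powers do not commute with conjugation. -/
lemma RowLaw.conj {c d : ℤ} {v : ℂ} (hd : 0 < d) (h : RowLaw c d v) :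
    RowLaw (-c) d (star v) := by
  intro a b hab z hz
  have hz' : 0 < (-(starRingEnd ℂ) z).im := by simpa using hz
  have := h a (-b) (by rw [← hab]; ring) _ hz'
  rw [th_neg_conj] at this
  have e : ((a : ℂ) * -(starRingEnd ℂ) z + (-b : ℤ)) / (c * -(starRingEnd ℂ) z + d)
      = -(starRingEnd ℂ) ((a * z + b) / ((-c : ℤ) * z + d)) := by
    simp only [map_div₀, map_add, map_mul, map_intCast]
    push_cast
    rw [← neg_div]
    congr 1 <;> ring
  rw [e, th_neg_conj] at this
  apply_fun (starRingEnd ℂ) at this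
  rw [conj_conj] at this
  rw [this]
  simp only [map_mul, conj_conj]
  congr 2
  rw [show ((-c : ℤ) : ℂ) * z + d = (starRingEnd ℂ) (c * -(starRingEnd ℂ) z + d) by simp,
    conj_cpow]
  · congr 2
    simp [conj_ofNat]
  · intro h
    rw [arg_eq_pi_iff] at h
    have h2 : (c : ℝ) * z.im = 0 := by simpa using h.2
    rcases mul_eq_zero.1 h2 with h3 | h3
    · have : (0 : ℝ) < d := by exact_mod_cast hd
      simp [h3] at h
      linarith
    · exact hz.ne' h3

lemma RowLaw.neg_of_pos {c d : ℤ} {v : ℂ} (hc : 0 < c) (h : RowLaw c d v) :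
    RowLaw (-c) (-d) (I * v) := by
  intro a b hab z hz
  have := h (-a) (-b) (by rw [← hab]; ring) z hz
  push_cast at *
  rw [show (-(a : ℂ) * z + -b) = -(a * z + b) by ring] at this
  rw [show -(c : ℂ) * z + -d = -(c * z + d) by ring, div_neg, ← neg_div, this,
    neg_cpow_half]
  · ring_nf; rw [I_sq]; ring
  · have : (0 : ℝ) < c := by exact_mod_cast hc
    simp; positivity

lemma RowLaw.neg_of_neg {c d : ℤ} {v : ℂ} (hc : c < 0) (h : RowLaw c d v) :
    RowLaw (-c) (-d) (-I * v) := by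
  intro a b hab z hz
  have := h (-a) (-b) (by rw [← hab]; ring) z hz
  push_cast at *
  rw [show (-(a : ℂ) * z + -b) = -(a * z + b) by ring] at this
  rw [show -(c : ℂ) * z + -d = -(c * z + d) by ring, div_neg, ← neg_div, this,
    neg_cpow_half']
  · ring_nf; rw [I_sq]; ring
  · have : (c : ℝ) < 0 := by exact_mod_cast hc
    simp; exact mul_neg_of_neg_of_pos this hz

lemma rowLaw_zero_one : RowLaw 0 1 1 := by
  intro a b hab z hz
  obtain rfl : a = 1 := by omega
  simp [th_add_int]

/-! ### Jacobi symbols -/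

/-- With c = 4m the symbol is (m/d), which depends on d only modulo 4|m| = |c|. -/
lemma jacobiSym_add_mul_left {c : ℤ} (hc : 4 ∣ c) {d : ℕ} (hd : Odd d) (n : ℕ) :
    jacobiSym c (d + n * c.natAbs) = jacobiSym c d := by
  obtain ⟨m, rfl⟩ := hc
  have h4 : (4 * m).natAbs = 4 * m.natAbs := by rw [Int.natAbs_mul]; rfl
  have hd' : Odd (d + n * (4 * m).natAbs) := by
    rw [h4]; exact hd.add_even (by rw [Nat.even_mul, Nat.even_mul]; right; left; decide)
  rw [jacobiSym.mul_left, jacobiSym.mul_left, jacobiSym.at_four hd, jacobiSym.at_four hd',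
    jacobiSym.mod_right m hd, jacobiSym.mod_right m hd', h4, Nat.add_mul_mod_self_right]

/-- Modulo either of d, e the sum reduces to the other. As 4 divides d + e, one of the two is 1
modulo 4, so reciprocity introduces no sign. -/
lemma jacobiSym_reflect {d e : ℕ} (hd : Odd d) (h4 : 4 ∣ d + e) :
    jacobiSym (d + e : ℕ) d = jacobiSym (d + e : ℕ) e := by
  have he : Odd e := by
    rcases hd with ⟨r, rfl⟩; obtain ⟨t, ht⟩ := h4; exact ⟨2 * t - r - 1, by omega⟩
  have e1 : jacobiSym (d + e : ℕ) d = jacobiSym e d := by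
    apply jacobiSym.mod_left'; push_cast; simp
  have e2 : jacobiSym (d + e : ℕ) e = jacobiSym d e := by
    apply jacobiSym.mod_left'; push_cast; simp
  rw [e1, e2]
  have hm : d % 4 = 1 ∨ d % 4 = 3 := by rcases hd with ⟨r, rfl⟩; omega
  rcases hm with hm | hm
  · exact (jacobiSym.quadratic_reciprocity_one_mod_four hm he).symm
  · exact jacobiSym.quadratic_reciprocity_one_mod_four (by omega) hd


/-- The theta multiplier for lower rows `(c, d)` with `d > 0`. -/
def rho (c : ℤ) (d : ℕ) : ℂ := (jacobiSym c d : ℂ) * (eps d)⁻¹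

lemma eps_of_one {d : ℤ} (h : d % 4 = 1) : eps d = 1 := by simp [eps, h]
lemma eps_of_three {d : ℤ} (h : d % 4 = 3) : eps d = I := by simp [eps, h]

lemma odd_mod_four {d : ℤ} (h : Odd d) : d % 4 = 1 ∨ d % 4 = 3 := by
  rcases h with ⟨r, rfl⟩; omega

lemma jacobiSym_neg_one_mod {d : ℕ} (hd : d % 4 = 1) (c : ℤ) :
    jacobiSym (-c) d = jacobiSym c d := by
  rw [jacobiSym.neg _ (Nat.odd_iff.2 (by omega)), ZMod.χ₄_nat_one_mod_four hd, one_mul]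

lemma jacobiSym_neg_three_mod {d : ℕ} (hd : d % 4 = 3) (c : ℤ) :
    jacobiSym (-c) d = -jacobiSym c d := by
  rw [jacobiSym.neg _ (Nat.odd_iff.2 (by omega)), ZMod.χ₄_nat_three_mod_four hd, neg_one_mul]

lemma star_rho (c : ℤ) {d : ℕ} (hd : Odd d) : star (rho c d) = rho (-c) d := by
  unfold rho
  rcases odd_mod_four (d := d) (by exact_mod_cast hd) with h | h
  · rw [eps_of_one h, jacobiSym_neg_one_mod (by omega)]
    simp
  · rw [eps_of_three h, jacobiSym_neg_three_mod (by omega)]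
    simp

lemma rowLaw_flip {c : ℤ} {d : ℕ} (hd : Odd d) (h : RowLaw (-c) d (rho (-c) d)) :
    RowLaw c d (rho c d) := by
  have := h.conj (by exact_mod_cast hd.pos)
  rwa [star_rho _ hd, neg_neg] at this

lemma rowLaw_add_four {c : ℤ} {d : ℕ} (hd : Odd d) (h : RowLaw c d (rho c d)) :
    RowLaw (c + 4 * d) d (rho (c + 4 * d) d) := by
  have := h.V (by exact_mod_cast hd.pos)
  convert this using 1
  unfold rho
  congr 2
  apply jacobiSym.mod_left'
  simp

/-- The row passes from (d + e, e) to (-(d + e), e) by reflection, to (d + e, -e) by negation and to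
(d + e, d) by translation. For e < d this reduces the second entry. -/
lemma rowLaw_reflect {d e : ℕ} (hd : Odd d) (he : Odd e) (h4 : 4 ∣ d + e)
    (h : RowLaw (d + e : ℕ) e (rho (d + e : ℕ) e)) :
    RowLaw (d + e : ℕ) d (rho (d + e : ℕ) d) := by
  have h1 : RowLaw (-(d + e : ℕ)) e (rho (-(d + e : ℕ)) e) := by
    apply rowLaw_flip he; rwa [neg_neg]
  have h2 := (h1.neg_of_neg (by have := hd.pos; omega)).T 1
  rw [neg_neg, show -(e : ℤ) + 1 * (d + e : ℕ) = d by push_cast; ring] at h2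
  convert h2 using 1
  unfold rho
  have hm : d % 4 = 1 ∧ e % 4 = 3 ∨ d % 4 = 3 ∧ e % 4 = 1 := by
    rcases hd with ⟨r, rfl⟩; omega
  rw [jacobiSym_reflect hd h4]
  rcases hm with ⟨m1, m2⟩ | ⟨m1, m2⟩
  · rw [eps_of_one (by omega), eps_of_three (by omega), jacobiSym_neg_three_mod m2]
    push_cast
    rw [inv_I]
    ring_nf
    rw [I_sq]
    ring
  · rw [eps_of_three (by omega : (d : ℤ) % 4 = 3), eps_of_one (by omega : (e : ℤ) % 4 = 1),
      jacobiSym_neg_one_mod m2, inv_I]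
    ring

/-- Euclidean descent on d: for 0 < c < d the entry d is reduced modulo c, for d < c < 2d it is
replaced by c - d through `rowLaw_reflect`, and other c are reached by steps of 4d and a change of
sign. -/
lemma rowLaw_of_pos : ∀ (d : ℕ), Odd d → ∀ c : ℤ, 4 ∣ c → IsCoprime c d →
    RowLaw c d (rho c d) := by
  intro d
  induction d using Nat.strong_induction_on with
  | _ d ih =>
  intro hd
  -- multiples of `4` below `2 d`
  have small : ∀ c : ℤ, 0 ≤ c → c < 2 * d → 4 ∣ c → IsCoprime c d → RowLaw c d (rho c d) := by
    intro c hc0 hc hc4 hcd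
    lift c to ℕ using hc0
    rcases Nat.eq_zero_or_pos c with rfl | hcpos
    · have : d = 1 := by
        have := isCoprime_zero_left.1 (by simpa using hcd : IsCoprime (0 : ℤ) d)
        simpa [Int.isUnit_iff_natAbs_eq] using this
      subst this
      simpa [rho, eps] using rowLaw_zero_one
    have hcn : 4 ∣ c := by exact_mod_cast hc4
    rcases lt_or_ge c d with h | h
    · -- reduce `d` modulo `c`
      have hmod := Nat.mod_add_div d c
      have hodd : Odd (d % c) := by
        obtain ⟨t, rfl⟩ := hcn
        rcases hd with ⟨r, hr⟩
        have := Nat.mod_mod_of_dvd d (Dvd.intro t rfl : 4 ∣ 4 * t)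
        rw [Nat.odd_iff]; omega
      have h1 := ih (d % c) ((Nat.mod_lt _ hcpos).trans h) hodd c hc4 (by
        have : ((d % c : ℕ) : ℤ) = d + (-(d / c : ℕ)) * c := by
          have := congrArg (Nat.cast : ℕ → ℤ) hmod
          push_cast at *
          linarith
        rw [this]
        exact IsCoprime.add_mul_right_right hcd _)
      have h2 := h1.T (d / c : ℕ)
      have e : ((d % c : ℕ) : ℤ) + (d / c : ℕ) * (c : ℤ) = d := by
        rw [mul_comm]; exact_mod_cast hmod
      rw [e] at h2
      convert h2 using 1
      unfold rho
      have hJ := jacobiSym_add_mul_left hc4 hodd (d / c)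
      rw [Int.natAbs_natCast, mul_comm, hmod] at hJ
      rw [hJ]
      congr 2
      unfold eps
      have : (d : ℤ) % 4 = ((d % c : ℕ) : ℤ) % 4 := by
        obtain ⟨t, rfl⟩ := hcn
        have := Nat.mod_mod_of_dvd d (Dvd.intro t rfl : 4 ∣ 4 * t)
        omega
      rw [this]
    · have hne : c ≠ d := by rintro rfl; rcases hd with ⟨r, hr⟩; omega
      obtain ⟨e, rfl⟩ := Nat.exists_eq_add_of_le h
      have he : Odd e := by
        rcases hd with ⟨r, rfl⟩; obtain ⟨t, ht⟩ := hcn; exact ⟨2 * t - r - 1, by omega⟩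
      refine rowLaw_reflect hd he hcn (ih e (by push_cast at hc; omega) he _ hc4 ?_)
      push_cast at hcd ⊢
      have h3 : IsCoprime (e : ℤ) d := by
        have := IsCoprime.add_mul_right_left hcd (-1)
        simpa using this
      have := IsCoprime.add_mul_right_left h3.symm 1
      simpa using this
  -- multiples of `4` between `0` and `4 d`
  have medium : ∀ c : ℤ, 0 ≤ c → c < 4 * d → 4 ∣ c → IsCoprime c d → RowLaw c d (rho c d) := by
    intro c hc0 hc hc4 hcd
    rcases lt_or_ge c (2 * d) with h | h
    · exact small c hc0 h hc4 hcd
    -- The value c = 2d cannot occur, since 4 ∣ c and d is odd; for c > 2d the row (4d - c, d) lies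
    -- in the small range.
    rcases eq_or_lt_of_le h with h | h
    · exact absurd hd (by
        rw [Nat.not_odd_iff_even]
        obtain ⟨t, ht⟩ := hc4
        exact ⟨t.toNat, by omega⟩)
    have h1 := small (-(c - 4 * d)) (by omega) (by omega)
      (dvd_neg.2 (dvd_sub hc4 (dvd_mul_right _ _))) (by
        have := (IsCoprime.add_mul_right_left hcd (-4)).neg_left
        rwa [show -(c + -4 * (d : ℤ)) = -(c - 4 * d) by ring] at this)
    have h2 := rowLaw_add_four hd (rowLaw_flip hd h1)
    rwa [sub_add_cancel] at h2
  have large : ∀ n : ℕ, ∀ c : ℤ, 0 ≤ c → c < 4 * d → 4 ∣ c → IsCoprime c d →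
      RowLaw (c + n * (4 * d)) d (rho (c + n * (4 * d)) d) := by
    intro n c hc0 hc hc4 hcd
    induction n with
    | zero => simpa using medium c hc0 hc hc4 hcd
    | succ n ihn =>
      have := rowLaw_add_four hd ihn
      rwa [show c + (n : ℤ) * (4 * d) + 4 * d = c + (n + 1 : ℕ) * (4 * d) by push_cast; ring] at this
  have nonneg : ∀ c : ℤ, 0 ≤ c → 4 ∣ c → IsCoprime c d → RowLaw c d (rho c d) := by
    intro c hc0 hc4 hcd
    have hd0 : (0 : ℤ) < 4 * d := by have := hd.pos; positivity
    obtain ⟨n, hn⟩ := Int.eq_ofNat_of_zero_le (Int.ediv_nonneg hc0 hd0.le)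
    have e := Int.emod_add_mul_ediv c (4 * d)
    rw [hn] at e
    have hm : c % (4 * d) = c + (-n * 4) * d := by linarith
    have := large n (c % (4 * d)) (Int.emod_nonneg _ hd0.ne') (Int.emod_lt_of_pos _ hd0)
      (by rw [hm]; exact dvd_add hc4 ⟨-n * d, by ring⟩)
      (by rw [hm]; exact IsCoprime.add_mul_right_left hcd _)
    rwa [mul_comm (n : ℤ), show c % (4 * d) + 4 * d * (n : ℤ) = c from e] at this
  intro c hc4 hcd
  rcases le_total 0 c with h | h
  · exact nonneg c h hc4 hcd
  · exact rowLaw_flip hd (nonneg (-c) (by omega) (dvd_neg.2 hc4) hcd.neg_left)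

/-- For d < 0 the matrix is negated; the extra sign of the symbol when c, d < 0 reflects the two
different effects of negation on square roots. The row (0, -1) stands apart, because its automorphy
factor is -1, with principal root i. -/
lemma rowLaw_quadSymbol {c d : ℤ} (hd : Odd d) (hc : 4 ∣ c) (hcd : IsCoprime c d) :
    RowLaw c d (quadSymbol c d * (eps d)⁻¹) := by
  have hodd : Odd d.natAbs := Int.natAbs_odd.2 hd
  rcases le_or_gt 0 d with h | h
  · lift d to ℕ using h
    have := rowLaw_of_pos d hodd c hc hcd
    rwa [quadSymbol, if_neg (by omega), Int.natAbs_natCast]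
  · obtain ⟨e, rfl⟩ : ∃ e : ℕ, d = -e := ⟨d.natAbs, by omega⟩
    have he : Odd e := by simpa using hodd
    have hce : IsCoprime (-c) (e : ℤ) := by
      have := hcd.neg_neg; rwa [neg_neg] at this
    have h1 := rowLaw_of_pos e he (-c) (dvd_neg.2 hc) hce
    have hm : (e : ℤ) % 4 = 1 ∨ (e : ℤ) % 4 = 3 := odd_mod_four (by exact_mod_cast he)
    rcases lt_trichotomy c 0 with h0 | rfl | h0
    · have h2 := h1.neg_of_pos (by omega)
      rw [neg_neg] at h2
      convert h2 using 1
      rw [quadSymbol, if_pos ⟨h0, h⟩, Int.natAbs_neg, Int.natAbs_natCast, rho]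
      rcases hm with m | m
      · rw [eps_of_one m, eps_of_three (by omega), jacobiSym_neg_one_mod (by omega)]
        push_cast; rw [inv_I]; ring
      · rw [eps_of_three m, eps_of_one (by omega), jacobiSym_neg_three_mod (by omega)]
        push_cast; rw [inv_I]; linear_combination (-(jacobiSym c e : ℂ)) * I_sq
    · have : e = 1 := by
        have := isCoprime_zero_left.1 (by simpa using hce : IsCoprime (0 : ℤ) e)
        simpa [Int.isUnit_iff_natAbs_eq] using this
      subst this
      intro a b hab z hz
      obtain rfl : a = -1 := by push_cast at hab; omega
      have := th_add_int z (-b)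
      push_cast at *
      have e1 : (-1 * z + (b : ℂ)) / (0 * z + -1) = z + -b := by
        rw [zero_mul, zero_add, div_neg, div_one]; ring
      have e2 : (0 * z + -1 : ℂ) = -1 := by ring
      rw [e1, e2, this]
      have hq : (quadSymbol 0 (-1) : ℂ) = 1 := by simp [quadSymbol]
      have he : eps (-1) = I := by simp [eps]
      have hI : ((-1 : ℂ)) ^ (1 / 2 : ℂ) = I := by
        rw [cpow_def_of_ne_zero (by norm_num), log_neg_one,
          show (Real.pi : ℂ) * I * (1 / 2) = Real.pi / 2 * I by ring, exp_pi_div_two_mul_I]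
      rw [hq, he, hI, one_mul, inv_mul_cancel₀ I_ne_zero, one_mul]
    · have h2 := h1.neg_of_neg (by omega)
      rw [neg_neg] at h2
      convert h2 using 1
      rw [quadSymbol, if_neg (by omega), Int.natAbs_neg, Int.natAbs_natCast, rho]
      rcases hm with m | m
      · rw [eps_of_one m, eps_of_three (by omega), jacobiSym_neg_one_mod (by omega)]
        rw [inv_I]; ring
      · rw [eps_of_three m, eps_of_one (by omega), jacobiSym_neg_three_mod (by omega)]
        push_cast; rw [inv_I]; linear_combination (jacobiSym c e : ℂ) * I_sq

end ThetaEisenstein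
end

/-! ### Theta has no zeros: the product of the theta constants and the discriminant. -/

noncomputable section
namespace ThetaEisenstein
open Complex UpperHalfPlane Filter ModularForm Topology

/-- The open upper half-plane as a set of complex numbers. -/
abbrev Hset : Set ℂ := {z : ℂ | 0 < z.im}

/-- The filter of neighbourhoods of `i∞`. -/
abbrev imInf : Filter ℂ := comap Complex.im atTop

lemma isOpen_Hset : IsOpen Hset := isOpen_lt continuous_const continuous_im

lemma level_one_const {f : ℂ → ℂ} (hol : DifferentiableOn ℂ f Hset)
    (hT : ∀ z ∈ Hset, f (z + 1) = f z) (hS : ∀ z ∈ Hset, f (-1 / z) = f z)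
    (hb : BoundedAtFilter imInf f) : ∃ c, ∀ z ∈ Hset, f z = c := by
  have hS' : ((fun z : ℍ => f z) ∣[(0 : ℤ)] ModularGroup.S) = fun z : ℍ => f z := by
    ext z
    rw [SL_slash_apply, modular_S_smul]
    simp only [neg_zero, zpow_zero, mul_one]
    have := hS z z.2
    rw [neg_div, one_div, ← inv_neg] at this
    simpa using this
  have hT' : ((fun z : ℍ => f z) ∣[(0 : ℤ)] ModularGroup.T) = fun z : ℍ => f z := by
    ext z
    rw [SL_slash_apply, modular_T_smul]
    simp only [neg_zero, zpow_zero, mul_one]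
    have := hT z z.2
    rw [add_comm] at this
    simpa using this
  let F : ModularForm 𝒮ℒ 0 :=
    { toFun := fun z : ℍ => f z
      slash_action_eq' := by
        intro A hA
        obtain ⟨A, rfl⟩ := hA
        exact SlashInvariantForm.slash_action_generators_SL2Z hS' hT' A
      holo' := by
        rw [UpperHalfPlane.mdifferentiable_iff]
        refine hol.congr fun z hz => ?_
        simp [ofComplex_apply_of_im_pos hz]
      bdd_at_cusps' := by
        intro c hc
        rw [Subgroup.IsArithmetic.isCusp_iff_isCusp_SL2Z] at hc
        rw [OnePoint.isBoundedAt_iff_forall_SL2Z hc]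
        intro γ _
        rw [SlashInvariantForm.slash_action_generators_SL2Z hS' hT']
        exact hb.comp_tendsto (tendsto_comap_iff.2 tendsto_comap) }
  obtain ⟨c, hc⟩ := ModularFormClass.levelOne_weight_zero_const F
  exact ⟨c, fun z hz => congrFun hc ⟨z, hz⟩⟩

/-- The modular discriminant on complex numbers. -/
def Dl (z : ℂ) : ℂ := ModularForm.eta z ^ 24

lemma Dl_ne_zero {z : ℂ} (hz : z ∈ Hset) : Dl z ≠ 0 := pow_ne_zero _ (eta_ne_zero hz)

lemma Dl_differentiableOn : DifferentiableOn ℂ Dl Hset := fun _ hz =>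
  ((differentiableAt_eta_of_mem_upperHalfPlaneSet hz).pow 24).differentiableWithinAt

lemma Dl_T {z : ℂ} (hz : z ∈ Hset) : Dl (z + 1) = Dl z := by
  have h := congrFun discriminant_T_invariant ⟨z, hz⟩
  rw [SL_slash_apply, modular_T_smul] at h
  have hd : denom (Matrix.SpecialLinearGroup.toGL
      ((Matrix.SpecialLinearGroup.map (Int.castRingHom ℝ)) ModularGroup.T)) z = 1 := by
    change (((0 : ℤ) : ℝ) : ℂ) * z + (((1 : ℤ) : ℝ) : ℂ) = 1
    simp
  rw [show ((⟨z, hz⟩ : ℍ) : ℂ) = z from rfl, hd, one_zpow, mul_one] at h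
  have e : (((1 : ℝ) +ᵥ (⟨z, hz⟩ : ℍ) : ℍ) : ℂ) = z + 1 := by simp [add_comm]
  unfold Dl
  rw [← e]
  exact h

lemma Dl_S {z : ℂ} (hz : z ∈ Hset) : Dl (-1 / z) = z ^ 12 * Dl z := by
  have := congrFun discriminant_S_invariant ⟨z, hz⟩
  have h0 : z ≠ 0 := fun h => by simp [h] at hz
  rw [SL_slash_apply, modular_S_smul, ModularGroup.denom_S] at this
  simp [ModularForm.discriminant] at this
  unfold Dl
  rw [← this, neg_div, one_div, ← inv_neg]
  field_simp

lemma Dl_asymp : Tendsto (fun z : ℂ => cexp (2 * Real.pi * Complex.I * z) / Dl z) imInf (𝓝 1) := by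
  have h1 := (tendsto_atImInfty_tprod_one_sub_eta_q_pow.inv₀ one_ne_zero).comp
    tendsto_comap_im_ofComplex
  rw [inv_one] at h1
  refine h1.congr' ?_
  filter_upwards [preimage_mem_comap (Ioi_mem_atTop 0)] with z hz
  have hz : 0 < z.im := hz
  simp only [Function.comp_apply, ofComplex_apply_of_im_pos hz]
  have := discriminant_eq_q_prod ⟨z, hz⟩
  change Dl z = _ at this
  rw [this, Function.Periodic.qParam]
  simp only [ofReal_one, div_one]
  rw [← div_div, div_self (Complex.exp_ne_zero _), one_div]


/-- As n² ≡ n modulo 2, the factors e^{πi n²} and e^{πi n} agree. -/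
lemma jacobiTheta_add_one (τ : ℂ) : jacobiTheta (τ + 1) = jacobiTheta₂ (1 / 2) τ := by
  unfold jacobiTheta jacobiTheta₂ jacobiTheta₂_term
  refine tsum_congr fun n => ?_
  rw [mul_add, Complex.exp_add, Complex.exp_add, mul_comm]
  congr 1
  rw [Complex.exp_eq_exp_iff_exists_int]
  obtain ⟨m, hm⟩ := Int.even_mul_pred_self n
  refine ⟨m, ?_⟩
  have : (n : ℂ) * (n - 1) = m + m := by exact_mod_cast hm
  linear_combination Real.pi * Complex.I * this

/-- The function `∑ exp(πi(n² + n)τ)`. -/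
def J2 (τ : ℂ) : ℂ := jacobiTheta₂ (τ / 2) τ

lemma ne_zero_of_Hset {z : ℂ} (hz : z ∈ Hset) : z ≠ 0 := fun h => by simp [h] at hz

lemma neg_inv_mem {z : ℂ} (hz : z ∈ Hset) : -1 / z ∈ Hset := by
  have := im_neg_inv_pos (z := z / 4) (by simpa using hz)
  rwa [mul_div_cancel₀ _ (by norm_num : (4 : ℂ) ≠ 0)] at this

/-- This exhibits the rate e^{πiτ/4} at which theta vanishes at the cusp 1, because `J2` tends to 2
at i∞. -/
lemma jacobiTheta_one_sub_inv {τ : ℂ} (hτ : τ ∈ Hset) : jacobiTheta (-1 / τ + 1) =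
    (-Complex.I * τ) ^ (1 / 2 : ℂ) * cexp (Real.pi * Complex.I * τ / 4) * J2 τ := by
  have h0 := ne_zero_of_Hset hτ
  rw [jacobiTheta_add_one, J2, jacobiTheta₂_functional_equation (τ / 2) τ]
  have h1 : (-Complex.I * τ) ^ (1 / 2 : ℂ) ≠ 0 := by
    rw [Ne, cpow_eq_zero_iff, not_and_or]
    exact Or.inl <| mul_ne_zero (neg_ne_zero.mpr Complex.I_ne_zero) h0
  rw [show τ / 2 / τ = 1 / 2 by field_simp]
  rw [show -(Real.pi : ℂ) * Complex.I * (τ / 2) ^ 2 / τ = -(Real.pi * Complex.I * τ / 4) by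
    field_simp; ring, Complex.exp_neg]
  field_simp

lemma im_add_one (z : ℂ) : (z + 1).im = z.im := by simp

lemma jacobiTheta_tendsto : Tendsto jacobiTheta imInf (𝓝 1) := by
  have h := isBigO_at_im_infty_jacobiTheta_sub_one
  have h2 : Tendsto (fun τ : ℂ => Real.exp (-Real.pi * τ.im)) imInf (𝓝 0) := by
    refine Real.tendsto_exp_atBot.comp ?_
    exact tendsto_comap.const_mul_atTop_of_neg (by linarith [Real.pi_pos])
  have h3 := (h.trans_tendsto h2).add_const 1
  simpa using h3

/-- Only n = 0 and n = -1 give n² + n = 0; every other term decays. The terms at τ = i serve as the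
majorant for Im τ ≥ 1. -/
lemma J2_tendsto : Tendsto J2 imInf (𝓝 2) := by
  have key : Tendsto (fun τ : ℂ => ∑' n : ℤ, jacobiTheta₂_term n (τ / 2) τ) imInf
      (𝓝 (∑' n : ℤ, if n ∈ ({0, -1} : Finset ℤ) then (1 : ℂ) else 0)) := by
    have hn : ∀ (n : ℤ) (τ : ℂ), ‖jacobiTheta₂_term n (τ / 2) τ‖
        = Real.exp (-(Real.pi * (n * (n + 1) : ℤ) * τ.im)) := by
      intro n τ
      rw [norm_jacobiTheta₂_term]
      congr 1
      simp; ring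
    have hpos : ∀ n : ℤ, 0 ≤ n * (n + 1) := fun n => by
      rcases le_or_gt 0 n with h | h <;> nlinarith
    refine tendsto_tsum_of_dominated_convergence
      (bound := fun n => ‖jacobiTheta₂_term n (Complex.I / 2) Complex.I‖) ?_ ?_ ?_
    · exact ((summable_jacobiTheta₂_term_iff _ _).2 (by simp)).norm
    · intro n
      split_ifs with h
      · simp only [Finset.mem_insert, Finset.mem_singleton] at h
        refine tendsto_const_nhds.congr fun τ => ?_
        rw [jacobiTheta₂_term]
        rcases h with rfl | rfl
        · simp
        · rw [eq_comm, Complex.exp_eq_one_iff]; exact ⟨0, by push_cast; ring⟩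
      · rw [tendsto_zero_iff_norm_tendsto_zero]
        simp_rw [hn]
        refine Real.tendsto_exp_atBot.comp ?_
        refine tendsto_neg_atTop_atBot.comp (tendsto_comap.const_mul_atTop ?_)
        refine mul_pos Real.pi_pos ?_
        simp only [Finset.mem_insert, Finset.mem_singleton, not_or] at h
        have : 0 < n * (n + 1) := (hpos n).lt_of_ne' (mul_ne_zero h.1 (by omega))
        exact_mod_cast this
    · filter_upwards [preimage_mem_comap (Ici_mem_atTop 1)] with τ hτ n
      have hτ : 1 ≤ τ.im := hτ
      rw [hn, hn]
      apply Real.exp_le_exp.2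
      have : (0 : ℝ) ≤ (n * (n + 1) : ℤ) := by exact_mod_cast hpos n
      have h2 : 0 ≤ Real.pi * ((n * (n + 1) : ℤ) : ℝ) := by positivity
      simp only [Complex.I_im]
      nlinarith
  rw [tsum_eq_sum (s := {0, -1}) (by intro b hb; simp only [if_neg hb])] at key
  have e : (∑ b ∈ ({0, -1} : Finset ℤ), if b ∈ ({0, -1} : Finset ℤ) then (1 : ℂ) else 0) = 2 := by
    rw [Finset.sum_congr rfl (fun b hb => if_pos hb)]
    norm_num
  rw [e] at key
  exact key

lemma jacobiTheta_differentiableOn : DifferentiableOn ℂ jacobiTheta Hset := fun _ hz =>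
  (differentiableAt_jacobiTheta hz).differentiableWithinAt

lemma cpow_half_pow_eight (x : ℂ) : (x ^ (1 / 2 : ℂ)) ^ 8 = x ^ 4 := by
  have := cpow_nat_inv_pow x (n := 2) (by norm_num)
  rw [one_div, show 8 = 2 * 4 by norm_num, pow_mul]
  push_cast at this
  rw [this]

lemma jacobiTheta_S {τ : ℂ} (hτ : τ ∈ Hset) :
    jacobiTheta (-1 / τ) = (-Complex.I * τ) ^ (1 / 2 : ℂ) * jacobiTheta τ := by
  have h := jacobiTheta_S_smul ⟨τ, hτ⟩
  rw [UpperHalfPlane.modular_S_smul] at h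
  rw [← h]
  congr 1
  rw [neg_div, one_div, ← inv_neg]

/-- The eighth power of the product of the three theta constants. -/
def thetaProd (τ : ℂ) : ℂ :=
  (jacobiTheta τ * jacobiTheta (τ + 1) * jacobiTheta (-1 / τ + 1)) ^ 8 / τ ^ 4

/-- Translation exchanges the first two constants and returns the third up to the inversion factor
of σ. The eighth power removes the roots of unity, and the division by τ⁴ balances the remaining
factor. -/
lemma thetaProd_T {τ : ℂ} (hτ : τ ∈ Hset) : thetaProd (τ + 1) = thetaProd τ := by
  have h1 : τ + 1 ∈ Hset := by simpa using hτ
  have e1 : jacobiTheta (τ + 1 + 1) = jacobiTheta τ := by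
    rw [add_assoc, add_comm, show (1 + 1 : ℂ) = 2 by norm_num, jacobiTheta_two_add]
  have h0 := ne_zero_of_Hset hτ
  have h10 := ne_zero_of_Hset h1
  set σ := -1 / τ + (-1) with hσ
  have hσm : σ ∈ Hset := by
    have := neg_inv_mem hτ
    rw [hσ]; simpa using this
  have e2 : -1 / (τ + 1) + 1 = -1 / σ := by
    have : σ = -(τ + 1) / τ := by rw [hσ]; field_simp; ring
    rw [this]; field_simp; ring
  have e3 : jacobiTheta (-1 / τ + 1) = jacobiTheta σ := by
    rw [← jacobiTheta_two_add σ]; congr 1; rw [hσ]; ring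
  unfold thetaProd
  rw [e1, e2, jacobiTheta_S hσm, e3, mul_pow, mul_pow, mul_pow _ (jacobiTheta σ),
    cpow_half_pow_eight, mul_pow, neg_pow, I_pow_four, hσ]
  field_simp
  ring

lemma thetaProd_S {τ : ℂ} (hτ : τ ∈ Hset) : thetaProd (-1 / τ) = τ ^ 12 * thetaProd τ := by
  have h0 := ne_zero_of_Hset hτ
  unfold thetaProd
  rw [jacobiTheta_S hτ, show -1 / (-1 / τ) + 1 = τ + 1 by field_simp, mul_pow, mul_pow, mul_pow,
    cpow_half_pow_eight, mul_pow, neg_pow, I_pow_four]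
  field_simp

lemma thetaProd_differentiableOn : DifferentiableOn ℂ thetaProd Hset := by
  intro z hz
  have h0 := ne_zero_of_Hset hz
  have h1 : z + 1 ∈ Hset := by simpa using hz
  have h2 : -1 / z + 1 ∈ Hset := by simpa using neg_inv_mem hz
  have d1 := differentiableAt_jacobiTheta hz
  have d2 : DifferentiableAt ℂ (fun τ => jacobiTheta (τ + 1)) z :=
    DifferentiableAt.comp z (f := fun τ : ℂ => τ + 1) (differentiableAt_jacobiTheta h1)
      (differentiableAt_id.add_const _)
  have d3' : DifferentiableAt ℂ (fun τ : ℂ => -1 / τ + 1) z :=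
    ((differentiableAt_const _).div differentiableAt_id h0).add_const _
  have d3 : DifferentiableAt ℂ (fun τ => jacobiTheta (-1 / τ + 1)) z :=
    DifferentiableAt.comp z (f := fun τ : ℂ => -1 / τ + 1) (differentiableAt_jacobiTheta h2) d3'
  have d4 := ((d1.mul d2).mul d3).pow 8
  have d5 : DifferentiableAt ℂ (fun τ : ℂ => τ ^ 4) z := by fun_prop
  exact (d4.div d5 (pow_ne_zero _ h0)).differentiableWithinAt

lemma tendsto_add_one_imInf : Tendsto (fun z : ℂ => z + 1) imInf imInf := by
  rw [tendsto_comap_iff]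
  exact tendsto_comap.congr fun z => (im_add_one z).symm

lemma eventually_Hset : ∀ᶠ z in imInf, z ∈ Hset := preimage_mem_comap (Ioi_mem_atTop 0)

lemma thetaProd_eq (z : ℂ) (hz : z ∈ Hset) : thetaProd z / Dl z =
    (jacobiTheta z * jacobiTheta (z + 1) * J2 z) ^ 8 * (cexp (2 * Real.pi * Complex.I * z) / Dl z) := by
  have h0 := ne_zero_of_Hset hz
  unfold thetaProd
  rw [jacobiTheta_one_sub_inv hz]
  simp only [mul_pow]
  rw [cpow_half_pow_eight, ← Complex.exp_nat_mul, mul_pow, neg_pow, I_pow_four]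
  rw [show ((8 : ℕ) : ℂ) * (Real.pi * Complex.I * z / 4) = 2 * Real.pi * Complex.I * z by
    push_cast; ring]
  field_simp

/-- The eighth power of e^{πiτ/4} is q, so the product vanishes at i∞ to the same order as Δ. The
quotient has weight zero and is bounded; its constant value is the limit 2⁸. -/
lemma thetaProd_div_Dl : ∀ z ∈ Hset, thetaProd z / Dl z = 256 := by
  have hlim : Tendsto (fun z => thetaProd z / Dl z) imInf (𝓝 256) := by
    have := ((jacobiTheta_tendsto.mul (jacobiTheta_tendsto.comp tendsto_add_one_imInf)).mul
      J2_tendsto).pow 8 |>.mul Dl_asymp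
    rw [show ((1 : ℂ) * 1 * 2) ^ 8 * 1 = 256 by norm_num] at this
    refine this.congr' ?_
    filter_upwards [eventually_Hset] with z hz
    exact (thetaProd_eq z hz).symm
  obtain ⟨c, hc⟩ := level_one_const (f := fun z => thetaProd z / Dl z)
    (thetaProd_differentiableOn.div Dl_differentiableOn fun z hz => Dl_ne_zero hz)
    (fun z hz => by rw [thetaProd_T hz, Dl_T hz])
    (fun z hz => by
      rw [thetaProd_S hz, Dl_S hz, mul_div_mul_left _ _ (pow_ne_zero _ (ne_zero_of_Hset hz))])
    (hlim.isBigO_one ℝ)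
  have : Tendsto (fun z => thetaProd z / Dl z) imInf (𝓝 c) := by
    refine tendsto_const_nhds.congr' ?_
    filter_upwards [eventually_Hset] with z hz
    exact (hc z hz).symm
  have hne : NeBot imInf := by
    refine comap_neBot fun t ht => ?_
    obtain ⟨b, hb⟩ := mem_atTop_sets.1 ht
    exact ⟨⟨0, b⟩, hb _ le_rfl⟩
  rw [tendsto_nhds_unique this hlim] at hc
  exact hc

lemma jacobiTheta_ne_zero {τ : ℂ} (hτ : τ ∈ Hset) : jacobiTheta τ ≠ 0 := by
  intro h
  have := thetaProd_div_Dl τ hτ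
  rw [thetaProd, h] at this
  norm_num at this

lemma th_ne_zero {z : ℂ} (hz : z ∈ Hset) : th z ≠ 0 :=
  jacobiTheta_ne_zero (by simpa using hz)

end ThetaEisenstein
end

/-! ### Characterisation of θ^k, k < 8, by transformation laws and growth. -/

noncomputable section
namespace ThetaEisenstein
open Complex Filter Topology UpperHalfPlane

lemma cpow_half_pow (x : ℂ) (k : ℕ) : (x ^ (1 / 2 : ℂ)) ^ k = x ^ ((k : ℂ) / 2) := by
  rw [← cpow_nat_mul]
  congr 1
  ring

/-- The relative deviation of `G` from `Θ^k`, in the variable `τ = 2z`. -/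
def devi (k : ℕ) (G : ℂ → ℂ) (τ : ℂ) : ℂ := G (τ / 2) / jacobiTheta τ ^ k - 1

section
variable {k : ℕ} {G : ℂ → ℂ}

lemma half_mem {τ : ℂ} (h : τ ∈ Hset) : τ / 2 ∈ Hset := by
  have : 0 < τ.im := h
  simpa using this

lemma add_one_mem {τ : ℂ} (h : τ ∈ Hset) : τ + 1 ∈ Hset := by
  have : 0 < τ.im := h
  simpa using this

lemma devi_differentiableOn (hol : DifferentiableOn ℂ G Hset) :
    DifferentiableOn ℂ (devi k G) Hset := by
  refine DifferentiableOn.sub_const ?_ _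
  refine DifferentiableOn.div ?_ (jacobiTheta_differentiableOn.pow k)
    fun z hz => pow_ne_zero _ (jacobiTheta_ne_zero hz)
  exact hol.comp (by fun_prop) fun z hz => half_mem hz

lemma devi_add_two (hT : ∀ z ∈ Hset, G (z + 1) = G z) {τ : ℂ} (hτ : τ ∈ Hset) :
    devi k G (τ + 2) = devi k G τ := by
  unfold devi
  rw [add_comm τ 2, jacobiTheta_two_add, ← hT _ (half_mem hτ)]
  congr 3
  ring

lemma devi_S (hW : ∀ z ∈ Hset, G (-1 / (4 * z)) = (-2 * Complex.I * z) ^ ((k : ℂ) / 2) * G z) {τ : ℂ}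
    (hτ : τ ∈ Hset) : devi k G (-1 / τ) = devi k G τ := by
  have h0 := ne_zero_of_Hset hτ
  have h := hW _ (half_mem hτ)
  rw [show -1 / (4 * (τ / 2)) = -1 / τ / 2 by field_simp; norm_num,
    show -2 * Complex.I * (τ / 2) = -Complex.I * τ by ring] at h
  unfold devi
  rw [h, jacobiTheta_S hτ, mul_pow, cpow_half_pow, mul_div_mul_left]
  rw [Ne, cpow_eq_zero_iff, not_and_or]
  exact Or.inl (mul_ne_zero (neg_ne_zero.mpr Complex.I_ne_zero) h0)

/-- The product of the three conjugates of `devi` under the modular group. -/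
def deviProd (k : ℕ) (G : ℂ → ℂ) (τ : ℂ) : ℂ :=
  devi k G τ * devi k G (τ + 1) * devi k G (-1 / τ + 1)

/-- The points τ, Tτ and TSτ correspond to the three cosets of the theta group, generated by T² and
S. Translation exchanges the first two factors and fixes the third. -/
lemma deviProd_T (hT : ∀ z ∈ Hset, G (z + 1) = G z)
    (hW : ∀ z ∈ Hset, G (-1 / (4 * z)) = (-2 * Complex.I * z) ^ ((k : ℂ) / 2) * G z) {τ : ℂ}
    (hτ : τ ∈ Hset) : deviProd k G (τ + 1) = deviProd k G τ := by
  have h0 := ne_zero_of_Hset hτ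
  have h10 := ne_zero_of_Hset (add_one_mem hτ)
  have e1 : devi k G (τ + 1 + 1) = devi k G τ := by
    rw [← devi_add_two hT hτ]; congr 1; ring
  set σ := -1 / τ + (-1) with hσ
  have hσm : σ ∈ Hset := by
    have := neg_inv_mem hτ
    rw [hσ]; simpa using this
  have e2 : -1 / (τ + 1) + 1 = -1 / σ := by
    have : σ = -(τ + 1) / τ := by rw [hσ]; field_simp; ring
    rw [this]; field_simp; ring
  have e3 : devi k G (-1 / τ + 1) = devi k G σ := by
    rw [← devi_add_two hT hσm]; congr 1; rw [hσ]; ring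
  unfold deviProd
  rw [e1, e2, devi_S hW hσm, e3]
  ring

lemma deviProd_S
    (hW : ∀ z ∈ Hset, G (-1 / (4 * z)) = (-2 * Complex.I * z) ^ ((k : ℂ) / 2) * G z) {τ : ℂ}
    (hτ : τ ∈ Hset) : deviProd k G (-1 / τ) = deviProd k G τ := by
  have h0 := ne_zero_of_Hset hτ
  unfold deviProd
  rw [devi_S hW hτ, show -1 / (-1 / τ) + 1 = τ + 1 by field_simp]
  ring

lemma deviProd_differentiableOn (hol : DifferentiableOn ℂ G Hset) :
    DifferentiableOn ℂ (deviProd k G) Hset := by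
  have h := devi_differentiableOn (k := k) hol
  refine (h.mul (h.comp (by fun_prop) fun z hz => add_one_mem hz)).mul
    (h.comp (DifferentiableOn.add_const _ ?_) fun z hz => add_one_mem (neg_inv_mem hz))
  exact (differentiableOn_const _).div differentiableOn_id fun z hz => ne_zero_of_Hset hz

/-- In z = τ/2 the deviation has period 1 and tends to 0 at i∞, so it is O(e^{-2π Im z}), that is
O(e^{-π Im τ}). -/
lemma devi_decay (hol : DifferentiableOn ℂ G Hset) (hT : ∀ z ∈ Hset, G (z + 1) = G z)
    (hinf : Tendsto G imInf (𝓝 1)) :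
    ∃ C M : ℝ, 0 < C ∧ ∀ τ : ℂ, M ≤ τ.im → ‖devi k G τ‖ ≤ C * Real.exp (-Real.pi * τ.im) := by
  classical
  -- Extension by 0 makes the function periodic on all of ℂ.
  let f : ℂ → ℂ := fun z => if z ∈ Hset then devi k G (2 * z) else 0
  have hper : Function.Periodic f 1 := fun z => by
    have : z + 1 ∈ Hset ↔ z ∈ Hset := by simp
    simp only [f, this]
    split_ifs with h
    · rw [← devi_add_two hT (τ := 2 * z) (by simpa using h)]
      congr 1; ring
    · rfl
  have hhol : ∀ᶠ z in imInf, DifferentiableAt ℂ f z := by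
    filter_upwards [eventually_Hset] with z hz
    have h1 : DifferentiableAt ℂ (fun z => devi k G (2 * z)) z :=
      DifferentiableAt.comp z (f := fun z : ℂ => 2 * z)
        ((devi_differentiableOn hol).differentiableAt
          (isOpen_Hset.mem_nhds (by simpa using hz))) (by fun_prop)
    refine h1.congr_of_eventuallyEq ?_
    filter_upwards [isOpen_Hset.mem_nhds hz] with w hw
    exact if_pos hw
  have hz : ZeroAtFilter imInf f := by
    have h2 : Tendsto (fun z : ℂ => 2 * z) imInf imInf := by
      rw [tendsto_comap_iff]
      have := (tendsto_comap (f := Complex.im) (x := atTop)).const_mul_atTop (two_pos : (0:ℝ) < 2)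
      exact this.congr fun z => by simp
    have h3 := (hinf.div ((jacobiTheta_tendsto.comp h2).pow k) (by simp)).sub_const 1
    rw [one_pow, div_one, sub_self] at h3
    refine h3.congr' ?_
    filter_upwards [eventually_Hset] with z hz
    simp [f, devi, show 0 < z.im from hz]
  have hO := Function.Periodic.exp_decay_of_zero_at_inf one_pos (by simpa using hper) hhol hz
  obtain ⟨C, hC, hO⟩ := hO.exists_pos
  rw [Asymptotics.isBigOWith_iff] at hO
  obtain ⟨t, ht, hsub⟩ := mem_comap.1 (hO.and eventually_Hset)
  obtain ⟨M, hM⟩ := mem_atTop_sets.1 ht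
  refine ⟨C, 2 * M, hC, fun τ hτ => ?_⟩
  have : τ / 2 ∈ {z | ‖f z‖ ≤ C * ‖Real.exp (-2 * Real.pi * z.im / 1)‖ ∧ z ∈ Hset} :=
    hsub (hM _ (by simp; linarith))
  obtain ⟨h1, h2⟩ := this
  simp only [f, if_pos h2] at h1
  rw [show 2 * (τ / 2) = τ by ring] at h1
  convert h1 using 2
  rw [Real.norm_of_nonneg (Real.exp_pos _).le]
  congr 1
  simp
  ring

/-- In the strip the point (1 - 1/τ)/2 has height between 1/(4 Im τ) and 1, so G is bounded there by
a power of Im τ. The exponential comes from dividing by θ^k, where theta at 1 - 1/τ has absolute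
value at least e^{-π Im τ/4}. -/
lemma devi_cusp_growth {C B : ℝ} (hB : 0 ≤ B)
    (hgrow : ∀ z ∈ Hset, z.im ≤ 1 → ‖G z‖ ≤ C * z.im ^ (-B)) :
    ∃ M : ℝ, ∀ τ : ℂ, M ≤ τ.im → |τ.re| ≤ 1 → ‖devi k G (-1 / τ + 1)‖ ≤
      1 + |C| * (4 * τ.im) ^ B * Real.exp (Real.pi * k * τ.im / 4) := by
  have hJ : ∀ᶠ z in imInf, 1 ≤ ‖J2 z‖ :=
    (J2_tendsto.norm.eventually (Ioi_mem_nhds (by norm_num : (1 : ℝ) < ‖(2 : ℂ)‖))).mono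
      fun z hz => le_of_lt hz
  obtain ⟨t, ht, hsub⟩ := mem_comap.1 hJ
  obtain ⟨M, hM⟩ := mem_atTop_sets.1 ht
  refine ⟨max M 1, fun τ hτ hre => ?_⟩
  have hM' : M ≤ τ.im := (le_max_left _ _).trans hτ
  have h1 : 1 ≤ τ.im := (le_max_right _ _).trans hτ
  have hJ1 : 1 ≤ ‖J2 τ‖ := hsub (hM _ hM')
  have hmem : τ ∈ Hset := show 0 < τ.im by linarith
  have hmem2 : -1 / τ + 1 ∈ Hset := add_one_mem (neg_inv_mem hmem)
  have h0 := ne_zero_of_Hset hmem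
  have him : ((-1 / τ + 1) / 2).im = τ.im / (2 * normSq τ) := by
    have := (normSq_pos.2 h0).ne'
    rw [div_ofNat_im, add_im, neg_div, neg_im, one_div, inv_im]
    simp; field_simp
  have hns : normSq τ ≤ 2 * τ.im ^ 2 := by
    rw [normSq_apply]
    have := abs_le.1 hre
    nlinarith
  have hns' : τ.im ^ 2 ≤ normSq τ := by rw [normSq_apply]; nlinarith [sq_nonneg τ.re]
  have hnp := normSq_pos.2 h0
  have hlow : (4 * τ.im)⁻¹ ≤ ((-1 / τ + 1) / 2).im := by
    rw [him, inv_eq_one_div, div_le_div_iff₀ (by linarith) (by linarith)]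
    nlinarith
  have hup : ((-1 / τ + 1) / 2).im ≤ 1 := by
    rw [him, div_le_one (by linarith)]
    nlinarith
  have hG := hgrow _ (half_mem hmem2) hup
  have hG2 : ‖G ((-1 / τ + 1) / 2)‖ ≤ |C| * (4 * τ.im) ^ B := by
    refine hG.trans ?_
    have hp : ((-1 / τ + 1) / 2).im ^ (-B) ≤ (4 * τ.im) ^ B := by
      rw [show (4 * τ.im) ^ B = ((4 * τ.im)⁻¹) ^ (-B) by
        rw [Real.inv_rpow (by linarith), Real.rpow_neg (by linarith), inv_inv]]
      exact Real.rpow_le_rpow_of_nonpos (by positivity) hlow (by linarith)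
    have : 0 ≤ ((-1 / τ + 1) / 2).im ^ (-B) := Real.rpow_nonneg (half_mem hmem2).le _
    exact mul_le_mul (le_abs_self C) hp this (abs_nonneg C)
  have hth : Real.exp (-(Real.pi * k * τ.im / 4)) ≤ ‖jacobiTheta (-1 / τ + 1) ^ k‖ := by
    rw [jacobiTheta_one_sub_inv hmem, norm_pow, norm_mul, norm_mul, Complex.norm_exp,
      show (Real.pi * Complex.I * τ / 4).re = -(Real.pi * τ.im / 4) by simp [neg_div]]
    have e : Real.exp (-(Real.pi * k * τ.im / 4)) = Real.exp (-(Real.pi * τ.im / 4)) ^ k := by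
      rw [← Real.exp_nat_mul]; congr 1; ring
    rw [e]
    refine pow_le_pow_left₀ (Real.exp_pos _).le ?_ k
    have hhalf : 1 ≤ ‖(-Complex.I * τ) ^ (1 / 2 : ℂ)‖ := by
      rw [show (1 / 2 : ℂ) = ((1 / 2 : ℝ) : ℂ) by push_cast; rfl,
        norm_cpow_of_ne_zero (mul_ne_zero (neg_ne_zero.2 Complex.I_ne_zero) h0)]
      simp only [ofReal_re, ofReal_im, mul_zero, Real.exp_zero, div_one, norm_mul, norm_neg,
        norm_I, one_mul]
      refine Real.one_le_rpow ?_ (by norm_num)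
      exact h1.trans ((le_abs_self _).trans (abs_im_le_norm τ))
    have he := (Real.exp_pos (-(Real.pi * τ.im / 4))).le
    calc Real.exp (-(Real.pi * τ.im / 4))
        = 1 * Real.exp (-(Real.pi * τ.im / 4)) * 1 := by ring
      _ ≤ _ := by gcongr
  unfold devi
  refine (norm_sub_le _ _).trans ?_
  rw [norm_div, norm_one, add_comm]
  gcongr
  rw [div_le_iff₀ ((Real.exp_pos _).trans_le hth)]
  refine hG2.trans ?_
  have hexp : 1 ≤ Real.exp (Real.pi * k * τ.im / 4) * ‖jacobiTheta (-1 / τ + 1) ^ k‖ := by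
    calc (1 : ℝ) = Real.exp (Real.pi * k * τ.im / 4) * Real.exp (-(Real.pi * k * τ.im / 4)) := by
          rw [← Real.exp_add]; simp
      _ ≤ _ := by gcongr
  have : 0 ≤ |C| * (4 * τ.im) ^ B := by positivity
  rw [mul_assoc]
  exact le_mul_of_one_le_right this hexp

/-- The product of the three conjugates is bounded, hence constant, and its limit at i∞ is 0. By the
identity theorem one factor vanishes identically, and each factor is the deviation composed with an
automorphism of the half-plane. -/
theorem eq_th_pow (hk : k < 8) (hol : DifferentiableOn ℂ G Hset)
    (hT : ∀ z ∈ Hset, G (z + 1) = G z)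
    (hW : ∀ z ∈ Hset, G (-1 / (4 * z)) = (-2 * Complex.I * z) ^ ((k : ℂ) / 2) * G z)
    (hinf : Tendsto G imInf (𝓝 1)) {C B : ℝ} (hB : 0 ≤ B)
    (hgrow : ∀ z ∈ Hset, z.im ≤ 1 → ‖G z‖ ≤ C * z.im ^ (-B)) :
    ∀ z ∈ Hset, G z = th z ^ k := by
  obtain ⟨C₁, M₁, hC₁, h₁⟩ := devi_decay (k := k) hol hT hinf
  obtain ⟨M₂, h₂⟩ := devi_cusp_growth (k := k) hB hgrow
  -- The two decaying factors give e^{-2πy}, against y^B e^{πky/4} from the third. The bound tends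
  -- to 0 because k < 8.
  set g : ℝ → ℝ := fun y => C₁ ^ 2 * Real.exp (-2 * Real.pi * y) + C₁ ^ 2 * |C| * 4 ^ B *
    (y ^ B * Real.exp (-(2 * Real.pi - Real.pi * k / 4) * y)) with hg
  have hg0 : Tendsto g atTop (𝓝 0) := by
    have a1 : Tendsto (fun y : ℝ => Real.exp (-2 * Real.pi * y)) atTop (𝓝 0) := by
      refine Real.tendsto_exp_atBot.comp ?_
      exact tendsto_id.const_mul_atTop_of_neg (by linarith [Real.pi_pos])
    have a2 := tendsto_rpow_mul_exp_neg_mul_atTop_nhds_zero B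
      (2 * Real.pi - Real.pi * k / 4) (by
        have : (k : ℝ) < 8 := by exact_mod_cast hk
        nlinarith [Real.pi_pos])
    simpa [hg] using (a1.const_mul (C₁ ^ 2)).add (a2.const_mul (C₁ ^ 2 * |C| * 4 ^ B))
  set M := max (max M₁ M₂) 1 with hM
  have bound : ∀ τ : ℂ, M ≤ τ.im → |τ.re| ≤ 1 → ‖deviProd k G τ‖ ≤ g τ.im := by
    intro τ hτ hre
    have b1 := h₁ τ (le_trans (by simp [hM]) hτ)
    have b2 := h₁ (τ + 1) (by rw [im_add_one]; exact le_trans (by simp [hM]) hτ)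
    have b3 := h₂ τ (le_trans (by simp [hM]) hτ) hre
    have hy : 1 ≤ τ.im := le_trans (by simp [hM]) hτ
    rw [im_add_one] at b2
    rw [deviProd, norm_mul, norm_mul]
    calc _ ≤ C₁ * Real.exp (-Real.pi * τ.im) * (C₁ * Real.exp (-Real.pi * τ.im)) *
          (1 + |C| * (4 * τ.im) ^ B * Real.exp (Real.pi * k * τ.im / 4)) := by gcongr
      _ = g τ.im := by
        rw [hg, Real.mul_rpow (by norm_num) (by linarith)]
        have e1 : Real.exp (-2 * Real.pi * τ.im) =
            Real.exp (-Real.pi * τ.im) * Real.exp (-Real.pi * τ.im) := by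
          rw [← Real.exp_add]; congr 1; ring
        have e2 : Real.exp (-(2 * Real.pi - Real.pi * k / 4) * τ.im) =
            Real.exp (-Real.pi * τ.im) * Real.exp (-Real.pi * τ.im) *
              Real.exp (Real.pi * k * τ.im / 4) := by
          rw [← Real.exp_add, ← Real.exp_add]; congr 1; ring
        simp only [e1, e2]
        ring
  have hperN : ∀ n : ℕ, ∀ τ ∈ Hset, deviProd k G (τ + n) = deviProd k G τ := by
    intro n
    induction n with
    | zero => simp
    | succ n ih =>
      intro τ hτ
      have h1 : τ + n ∈ Hset := by
        have : 0 < τ.im := hτ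
        simpa using this
      rw [← ih τ hτ, ← deviProd_T hT hW h1]
      congr 1
      push_cast
      ring
  -- The bound holds for |Re τ| ≤ 1 only; integral translations carry it to the whole half-plane.
  have hper : ∀ τ ∈ Hset, ∃ σ : ℂ, |σ.re| ≤ 1 ∧ σ.im = τ.im ∧
      deviProd k G σ = deviProd k G τ := by
    intro τ hτ
    have hpos : 0 < τ.im := hτ
    set n := ⌊τ.re⌋ with hn
    refine ⟨τ - n, ?_, by simp, ?_⟩
    · simp only [sub_re, intCast_re]
      have := Int.fract_nonneg τ.re
      have := Int.fract_lt_one τ.re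
      rw [Int.fract, ← hn] at *
      rw [abs_le]; constructor <;> linarith
    · obtain ⟨m, hm | hm⟩ := Int.eq_nat_or_neg n
      · have := hperN m (τ - n) (by rw [Set.mem_ofPred_eq]; simpa using hpos)
        rw [← this, hm]; congr 1; push_cast; ring
      · have := hperN m τ hτ
        rw [← this, hm]; congr 1; push_cast; ring
  obtain ⟨c, hc⟩ := level_one_const (deviProd_differentiableOn (k := k) hol)
    (fun z hz => deviProd_T hT hW hz) (fun z hz => deviProd_S hW hz) (by
      obtain ⟨M', hM'⟩ := mem_atTop_sets.1 (hg0.eventually (Iio_mem_nhds one_pos))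
      refine Asymptotics.IsBigO.of_bound 1 ?_
      filter_upwards [preimage_mem_comap (Ici_mem_atTop (max M M'))] with τ hτ
      have hτ' : max M M' ≤ τ.im := hτ
      have hτm : τ ∈ Hset := show 0 < τ.im from
        lt_of_lt_of_le (by simp [hM]) ((le_max_left _ _).trans hτ')
      obtain ⟨σ, s1, s2, s3⟩ := hper τ hτm
      rw [← s3]
      have := bound σ (by rw [s2]; exact (le_max_left _ _).trans hτ') s1
      have h3 : g σ.im < 1 := hM' _ (by rw [s2]; exact (le_max_right _ _).trans hτ')
      simp only [Pi.one_apply, CStarRing.norm_one, mul_one]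
      linarith)
  have hc0 : c = 0 := by
    have : ‖c‖ ≤ 0 := by
      refine ge_of_tendsto hg0 ?_
      filter_upwards [Ici_mem_atTop M] with y hy
      have hy' : M ≤ y := hy
      have hmem : (y * Complex.I : ℂ) ∈ Hset := by
        rw [Set.mem_ofPred_eq]; simp; exact lt_of_lt_of_le (by simp [hM]) hy'
      have := bound (y * Complex.I) (by simpa using hy') (by simp)
      rw [hc _ hmem] at this
      simpa using this
    simpa using this
  have hconn : IsPreconnected Hset := (convex_halfSpace_im_gt 0).isPreconnected
  have hD := (devi_differentiableOn (k := k) hol)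
  have an1 := hD.analyticOnNhd isOpen_Hset
  have an2 := (hD.comp (f := fun z : ℂ => z + 1) (by fun_prop)
    fun z hz => add_one_mem hz).analyticOnNhd isOpen_Hset
  have an3 := (hD.comp (f := fun z : ℂ => -1 / z + 1) (DifferentiableOn.add_const _
    ((differentiableOn_const _).div differentiableOn_id fun z hz => ne_zero_of_Hset hz))
    fun z hz => add_one_mem (neg_inv_mem hz)).analyticOnNhd isOpen_Hset
  have hzero : ∀ τ ∈ Hset, devi k G τ = 0 := by
    rcases (an1.mul an2).eq_zero_or_eq_zero_of_mul_eq_zero an3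
      (fun z hz => by rw [← hc0, ← hc z hz]; rfl) hconn with h | h
    · rcases an1.eq_zero_or_eq_zero_of_mul_eq_zero an2 h hconn with h | h
      · exact h
      · intro τ hτ
        have := h (τ - 1) (by have : 0 < τ.im := hτ; simpa using this)
        simpa using this
    · intro τ hτ
      have h1 : τ - 1 ∈ Hset := by have : 0 < τ.im := hτ; simpa using this
      have := h _ (neg_inv_mem h1)
      have h0 := ne_zero_of_Hset h1
      simp only [Function.comp_apply] at this
      rwa [show -1 / (-1 / (τ - 1)) + 1 = τ by field_simp; ring] at this
  intro z hz
  have h2 : 2 * z ∈ Hset := by have : 0 < z.im := hz; simpa using this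
  have := hzero _ h2
  rw [devi, sub_eq_zero, div_eq_one_iff_eq (pow_ne_zero _ (jacobiTheta_ne_zero h2)),
    mul_div_cancel_left₀ _ two_ne_zero] at this
  exact this

end

end ThetaEisenstein
end

/-! ### Eisenstein series with Hecke's factor and their transformation laws. -/

noncomputable section
namespace ThetaEisenstein
open Complex Filter Topology

open Classical in
/-- The coefficient `ν̄` of the row `(c, d)` in the Eisenstein series at `∞`, extended by zero to
all pairs of integers. -/
def rowCoeff (k : ℕ) (c d : ℤ) : ℂ :=
  if 4 ∣ c ∧ IsCoprime c d then (quadSymbol c d : ℂ) * eps d ^ k else 0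

lemma odd_of_isCoprime {c d : ℤ} (hc : 4 ∣ c) (h : IsCoprime c d) : Odd d := by
  rw [← Int.not_even_iff_odd]
  intro he
  have h2 : IsCoprime (2 : ℤ) 2 :=
    h.of_isCoprime_of_dvd_left (Dvd.dvd.trans (by decide) hc) |>.of_isCoprime_of_dvd_right he.two_dvd
  exact absurd h2 (by rw [isCoprime_self]; decide)

lemma eps_ne_zero (d : ℤ) : eps d ≠ 0 := by unfold eps; split_ifs <;> simp

lemma norm_eps (d : ℤ) : ‖eps d‖ = 1 := by unfold eps; split_ifs <;> simp

lemma quadSymbol_sq {c d : ℤ} (h : IsCoprime c d) : (quadSymbol c d) ^ 2 = 1 := by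
  have hJ := jacobiSym.sq_one (a := c) (b := d.natAbs) (by
    rw [Int.isCoprime_iff_gcd_eq_one] at h
    change Nat.gcd c.natAbs ((d.natAbs : ℤ)).natAbs = 1
    rwa [Int.natAbs_natCast])
  unfold quadSymbol
  split_ifs
  · rw [neg_sq, hJ]
  · exact hJ

lemma norm_rowCoeff_le (k : ℕ) (c d : ℤ) : ‖rowCoeff k c d‖ ≤ 1 := by
  unfold rowCoeff
  split_ifs with h
  · rw [norm_mul, norm_pow, norm_eps, one_pow, mul_one]
    rcases mul_self_eq_one_iff.1 ((sq _).symm.trans (quadSymbol_sq h.2)) with h | h <;> simp [h]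
  · simp

variable {k : ℕ}

/-- The summand of a row is θ(z)^k/θ(γz)^k. Since theta has no zeros, identities between summands
reduce to identities between points γz, with no further choice of branches. Oddness of k enters
through (c/d)^{k+1} = 1. -/
lemma th_pow_mul_rowCoeff (hk : Odd k) {a b c d : ℤ} (hab : a * d - b * c = 1) (hc : 4 ∣ c) {z : ℂ}
    (hz : z ∈ Hset) : th ((a * z + b) / (c * z + d)) ^ k *
      (rowCoeff k c d * (c * z + d) ^ (-((k : ℂ) / 2))) = th z ^ k := by
  have hcd : IsCoprime c d := ⟨-b, a, by rw [← hab]; ring⟩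
  have hne : (c : ℂ) * z + d ≠ 0 := row_ne_zero (by
    by_contra! h; rw [h.1, h.2] at hab; simp at hab) hz
  rw [rowLaw_quadSymbol (odd_of_isCoprime hc hcd) hc hcd a b hab z hz, rowCoeff,
    if_pos ⟨hc, hcd⟩, mul_pow, mul_pow, mul_pow, cpow_half_pow, cpow_neg, inv_pow]
  have h1 : ((c : ℂ) * z + d) ^ ((k : ℂ) / 2) ≠ 0 := by simp [cpow_eq_zero_iff, hne]
  have h2 := pow_ne_zero k (eps_ne_zero d)
  have h3 : (quadSymbol c d : ℂ) ^ k * quadSymbol c d = 1 := by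
    rw [← pow_succ]
    obtain ⟨m, hm⟩ := hk
    rw [hm, show 2 * m + 1 + 1 = 2 * (m + 1) by ring, pow_mul]
    have := quadSymbol_sq hcd
    rw [show (quadSymbol c d : ℂ) ^ 2 = 1 by exact_mod_cast this, one_pow]
  field_simp
  linear_combination (th z ^ k) * h3

lemma moebius_im {a b c d : ℤ} (hab : a * d - b * c = 1) (z : ℂ) :
    (((a : ℂ) * z + b) / (c * z + d)).im = z.im / normSq (c * z + d) := by
  rw [div_im]
  have h1 : ((a : ℝ) * d - b * c) = 1 := by exact_mod_cast hab
  rw [← sub_div]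
  congr 1
  simp
  linear_combination z.im * h1

lemma moebius_mem {a b c d : ℤ} (hab : a * d - b * c = 1) {z : ℂ} (hz : z ∈ Hset) :
    ((a : ℂ) * z + b) / (c * z + d) ∈ Hset := by
  have hne : (c : ℂ) * z + d ≠ 0 := row_ne_zero (by
    by_contra! h; rw [h.1, h.2] at hab; simp at hab) hz
  have hns := normSq_pos.2 hne
  rw [Set.mem_ofPred_eq, moebius_im hab]
  have : 0 < z.im := hz
  positivity

/-- The matrices γ at i + 1 and γT at i lead to the same point and have the same automorphy factor,
so comparing the theta quotients leaves equal coefficients. -/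
lemma rowCoeff_add (hk : Odd k) (c d : ℤ) : rowCoeff k c (d + c) = rowCoeff k c d := by
  by_cases h : 4 ∣ c ∧ IsCoprime c d
  · obtain ⟨hc, u, v, huv⟩ := h
    have hI : Complex.I ∈ Hset := by simp
    have h1 := th_pow_mul_rowCoeff hk (a := v) (b := v - u) (c := c) (d := d + c)
      (by linear_combination huv) hc hI
    have h2 := th_pow_mul_rowCoeff hk (a := v) (b := -u) (c := c) (d := d)
      (by linear_combination huv) hc (add_one_mem hI)
    rw [th_add_one, ← h1] at h2
    rw [Int.cast_neg, show (v : ℂ) * (Complex.I + 1) + -u = v * Complex.I + (v - u) by ring,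
      show (c : ℂ) * (Complex.I + 1) + d = c * Complex.I + (d + c) by ring] at h2
    push_cast at h2
    have hm := moebius_mem (a := v) (b := v - u) (c := c) (d := d + c)
      (by linear_combination huv) hI
    push_cast at hm
    have h3 := mul_left_cancel₀ (pow_ne_zero k (th_ne_zero hm)) h2
    have hne : (c : ℂ) * Complex.I + (d + c : ℤ) ≠ 0 := row_ne_zero (by
      by_contra! h; obtain ⟨rfl, h⟩ := h; obtain rfl : d = 0 := by omega
      simp at huv) hI
    push_cast at hne
    exact (mul_right_cancel₀ (by simp [cpow_eq_zero_iff, hne]) h3).symm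
  · have h' : ¬ (4 ∣ c ∧ IsCoprime c (d + c)) := fun ⟨x, y⟩ => h ⟨x, by
      have := y.add_mul_left_right (-1); simpa using this⟩
    rw [rowCoeff, rowCoeff, if_neg h, if_neg h']

lemma V_mem {z : ℂ} (hz : z ∈ Hset) : z / (4 * z + 1) ∈ Hset := by
  have := moebius_mem (a := 1) (b := 0) (c := 4) (d := 1) (by norm_num) hz
  simpa using this

lemma four_mul_add_one_ne_zero {z : ℂ} (hz : z ∈ Hset) : 4 * z + 1 ≠ 0 := by
  have := row_ne_zero (c := 4) (d := 1) (by simp) hz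
  simpa using this

lemma row_V (c d : ℤ) {z : ℂ} (hz : z ∈ Hset) :
    (c : ℂ) * (z / (4 * z + 1)) + d = ((c + 4 * d : ℤ) * z + d) / (4 * z + 1) := by
  have := four_mul_add_one_ne_zero hz
  rw [eq_div_iff this]
  push_cast
  have hx : z / (4 * z + 1) * (4 * z + 1) = z := div_mul_cancel₀ _ this
  linear_combination (c : ℂ) * hx

/-- The same comparison for (1 0; 4 1), whose own automorphy factor is kept as a quotient of powers
of theta. -/
lemma rowCoeff_V (hk : Odd k) (c d : ℤ) {z : ℂ} (hz : z ∈ Hset) :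
    rowCoeff k c d * (c * (z / (4 * z + 1)) + d) ^ (-((k : ℂ) / 2)) * th z ^ k =
      rowCoeff k (c + 4 * d) d * ((c + 4 * d : ℤ) * z + d) ^ (-((k : ℂ) / 2)) *
        th (z / (4 * z + 1)) ^ k := by
  by_cases h : 4 ∣ c ∧ IsCoprime c d
  · obtain ⟨hc, u, v, huv⟩ := h
    have hdet : (v + 4 * (-u)) * d - (-u) * (c + 4 * d) = 1 := by linear_combination huv
    have h1 := th_pow_mul_rowCoeff hk hdet (dvd_add hc (dvd_mul_right 4 d)) hz
    have h2 := th_pow_mul_rowCoeff hk (a := v) (b := -u) (c := c) (d := d)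
      (by linear_combination huv) hc (V_mem hz)
    have hm := moebius_mem hdet hz
    have e : ((v : ℂ) * (z / (4 * z + 1)) + (-u : ℤ)) / (c * (z / (4 * z + 1)) + d) =
        (((v + 4 * (-u) : ℤ) : ℂ) * z + (-u : ℤ)) / ((c + 4 * d : ℤ) * z + d) := by
      rw [row_V v (-u) hz, row_V c d hz, div_div_div_cancel_right₀ (four_mul_add_one_ne_zero hz)]
    rw [e] at h2
    have hne := pow_ne_zero k (th_ne_zero hm)
    apply mul_left_cancel₀ hne
    linear_combination th z ^ k * h2 - th (z / (4 * z + 1)) ^ k * h1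
  · have h' : ¬ (4 ∣ c + 4 * d ∧ IsCoprime (c + 4 * d) d) := fun ⟨x, y⟩ =>
      h ⟨(Int.dvd_add_left (dvd_mul_right 4 d)).1 x, by
        have := y.add_mul_right_left (-4)
        rwa [show c + 4 * d + -4 * d = c by ring] at this⟩
    rw [rowCoeff, rowCoeff, if_neg h, if_neg h']
    simp

/-- The term of the row `(c, d)` in the Eisenstein series with Hecke's convergence factor. -/
def rowTerm (k : ℕ) (s : ℂ) (z : ℂ) (p : ℤ × ℤ) : ℂ :=
  rowCoeff k p.1 p.2 * (p.1 * z + p.2) ^ (-((k : ℂ) / 2)) * (‖p.1 * z + p.2‖ : ℂ) ^ (-2 * s)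

/-- The Eisenstein series at `∞` with Hecke's convergence factor. -/
def Es (k : ℕ) (s : ℂ) (z : ℂ) : ℂ := (1 / 2) * ∑' p : ℤ × ℤ, rowTerm k s z p

/-- The automorphy factor of `W`. -/
def uW (k : ℕ) (z : ℂ) : ℂ := (-2 * Complex.I * z) ^ ((k : ℂ) / 2)

/-- The transform of `Es` under `W`, which is the Eisenstein series at the cusp `0`. -/
def EsW (k : ℕ) (s : ℂ) (z : ℂ) : ℂ :=
  (uW k z)⁻¹ * (‖2 * z‖ : ℂ) ^ (-2 * s) * Es k s (-1 / (4 * z))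

/-- The sum of the Eisenstein series at both cusps. -/
def Gs (k : ℕ) (s : ℂ) (z : ℂ) : ℂ := Es k s z + EsW k s z

lemma Es_add_one (hk : Odd k) (s z : ℂ) : Es k s (z + 1) = Es k s z := by
  unfold Es
  congr 1
  let e : ℤ × ℤ ≃ ℤ × ℤ :=
    { toFun := fun p => (p.1, p.2 + p.1)
      invFun := fun p => (p.1, p.2 - p.1)
      left_inv := fun p => by simp
      right_inv := fun p => by simp }
  rw [← e.tsum_eq (rowTerm k s z)]
  refine tsum_congr fun p => ?_
  have : ((p.1 : ℂ) * (z + 1) + p.2) = p.1 * z + ((p.2 + p.1 : ℤ) : ℂ) := by push_cast; ring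
  simp only [rowTerm, e, Equiv.coe_fn_mk, rowCoeff_add hk, this]

lemma ofReal_div_cpow {x y : ℝ} (hx : 0 ≤ x) (hy : 0 < y) (s : ℂ) :
    ((x / y : ℝ) : ℂ) ^ (-s) = (x : ℂ) ^ (-s) * (y : ℂ) ^ s := by
  rw [div_eq_mul_inv, ofReal_mul, mul_cpow_ofReal_nonneg hx (inv_nonneg.2 hy.le), ofReal_inv,
    inv_cpow, cpow_neg _ s, cpow_neg _ s, inv_inv]
  rw [arg_ofReal_of_nonneg hy.le]
  exact Real.pi_ne_zero.symm

lemma Es_V (hk : Odd k) (s : ℂ) {z : ℂ} (hz : z ∈ Hset) :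
    Es k s (z / (4 * z + 1)) * th z ^ k =
      (‖4 * z + 1‖ : ℂ) ^ (2 * s) * Es k s z * th (z / (4 * z + 1)) ^ k := by
  unfold Es
  let e : ℤ × ℤ ≃ ℤ × ℤ :=
    { toFun := fun p => (p.1 + 4 * p.2, p.2)
      invFun := fun p => (p.1 - 4 * p.2, p.2)
      left_inv := fun p => by simp
      right_inv := fun p => by simp }
  rw [← e.tsum_eq (rowTerm k s z)]
  rw [mul_assoc, mul_left_comm _ (1 / 2 : ℂ), mul_assoc (1 / 2 : ℂ)]
  congr 1
  rw [← tsum_mul_right, ← tsum_mul_left, ← tsum_mul_right]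
  refine tsum_congr fun p => ?_
  have h1 := rowCoeff_V hk p.1 p.2 hz
  have h2 : (‖(p.1 : ℂ) * (z / (4 * z + 1)) + p.2‖ : ℂ) ^ (-2 * s) =
      (‖((p.1 + 4 * p.2 : ℤ) : ℂ) * z + p.2‖ : ℂ) ^ (-2 * s) * (‖4 * z + 1‖ : ℂ) ^ (2 * s) := by
    rw [row_V _ _ hz, norm_div, neg_mul, ofReal_div_cpow (norm_nonneg _)
      (norm_pos_iff.2 (four_mul_add_one_ne_zero hz))]
  simp only [rowTerm, e, Equiv.coe_fn_mk]
  rw [h2]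
  linear_combination (‖((p.1 + 4 * p.2 : ℤ) : ℂ) * z + p.2‖ : ℂ) ^ (-2 * s) *
    (‖4 * z + 1‖ : ℂ) ^ (2 * s) * h1

lemma uW_ne_zero (k : ℕ) {z : ℂ} (hz : z ∈ Hset) : uW k z ≠ 0 := by
  simp [uW, cpow_eq_zero_iff, ne_zero_of_Hset hz]

lemma W_mem {z : ℂ} (hz : z ∈ Hset) : -1 / (4 * z) ∈ Hset := im_neg_inv_pos hz

lemma W_W {z : ℂ} (hz : z ∈ Hset) : -1 / (4 * (-1 / (4 * z))) = z := by
  have := ne_zero_of_Hset hz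
  field_simp

lemma th_W_pow (k : ℕ) {z : ℂ} (hz : z ∈ Hset) : th (-1 / (4 * z)) ^ k = uW k z * th z ^ k := by
  rw [th_W hz, mul_pow, cpow_half_pow, uW]

lemma uW_W (k : ℕ) {z : ℂ} (hz : z ∈ Hset) : uW k (-1 / (4 * z)) = (uW k z)⁻¹ := by
  have h1 := th_W_pow k (W_mem hz)
  rw [W_W hz, th_W_pow k hz] at h1
  have := pow_ne_zero k (th_ne_zero hz)
  apply eq_inv_of_mul_eq_one_left
  apply mul_right_cancel₀ this
  rw [one_mul, mul_assoc, ← h1]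

lemma norm_two_mul_W {z : ℂ} (hz : z ∈ Hset) : ‖2 * (-1 / (4 * z))‖ = ‖2 * z‖⁻¹ := by
  have := ne_zero_of_Hset hz
  rw [← norm_inv, ← norm_neg]
  congr 1
  field_simp
  norm_num

lemma ofReal_inv_cpow {x : ℝ} (hx : 0 ≤ x) (s : ℂ) : ((x⁻¹ : ℝ) : ℂ) ^ s = ((x : ℂ) ^ s)⁻¹ := by
  rw [ofReal_inv, inv_cpow]
  rw [arg_ofReal_of_nonneg hx]
  exact Real.pi_ne_zero.symm

lemma EsW_W (s : ℂ) {z : ℂ} (hz : z ∈ Hset) :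
    EsW k s (-1 / (4 * z)) = uW k z * (‖2 * z‖ : ℂ) ^ (2 * s) * Es k s z := by
  rw [EsW, W_W hz, uW_W k hz, inv_inv, norm_two_mul_W hz, ofReal_inv_cpow (norm_nonneg _),
    neg_mul, cpow_neg, inv_inv]

lemma Es_W (s : ℂ) {z : ℂ} (hz : z ∈ Hset) :
    Es k s (-1 / (4 * z)) = uW k z * (‖2 * z‖ : ℂ) ^ (2 * s) * EsW k s z := by
  have h1 := uW_ne_zero k hz
  have h2 : (‖2 * z‖ : ℂ) ^ (2 * s) ≠ 0 := by
    simp [cpow_eq_zero_iff, ne_zero_of_Hset hz]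
  rw [EsW, neg_mul, cpow_neg]
  generalize (‖2 * z‖ : ℂ) ^ (2 * s) = x at *
  field_simp

/-- W interchanges the two cusps and thereby the two summands. -/
lemma Gs_W (s : ℂ) {z : ℂ} (hz : z ∈ Hset) :
    Gs k s (-1 / (4 * z)) = uW k z * (‖2 * z‖ : ℂ) ^ (2 * s) * Gs k s z := by
  rw [Gs, Es_W s hz, EsW_W s hz, Gs]
  ring

/-- Conjugation by W turns a translation into z ↦ z/(4z + 1): for w = -1/(4(z + 1)) one has w/(4w +
1) = -1/(4z), so `Es_V` applies. -/
lemma EsW_add_one (hk : Odd k) (s : ℂ) {z : ℂ} (hz : z ∈ Hset) :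
    EsW k s (z + 1) = EsW k s z := by
  have hz1 := add_one_mem hz
  have h0 := ne_zero_of_Hset hz
  have h10 := ne_zero_of_Hset hz1
  set w := -1 / (4 * (z + 1)) with hw
  have hwm : w ∈ Hset := W_mem hz1
  have e1 : 4 * w + 1 = z / (z + 1) := by rw [hw]; field_simp; ring
  have e2 : w / (4 * w + 1) = -1 / (4 * z) := by rw [e1, hw]; field_simp
  have h := Es_V hk s hwm
  rw [e2, th_W_pow k hz1, th_W_pow k hz, th_add_one, e1, norm_div] at h
  have h2 : (((‖z‖ / ‖z + 1‖ : ℝ)) : ℂ) ^ (2 * s) =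
      (‖2 * (z + 1)‖ : ℂ) ^ (-2 * s) * ((‖2 * z‖ : ℂ) ^ (-2 * s))⁻¹ := by
    rw [neg_mul, ← cpow_neg, neg_neg, ← ofReal_div_cpow (norm_nonneg _)
      (by rw [norm_pos_iff]; simpa using h0), ← neg_neg (2 * s), neg_neg (2 * s), cpow_neg,
      ← ofReal_inv_cpow (by positivity)]
    congr 2
    rw [norm_mul, norm_mul]
    have := norm_pos_iff.2 h0
    have := norm_pos_iff.2 h10
    field_simp
  rw [h2] at h
  have h3 := pow_ne_zero k (th_ne_zero hz)
  have h4 : (‖2 * z‖ : ℂ) ^ (-2 * s) ≠ 0 := by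
    simp [cpow_eq_zero_iff, h0]
  have h5 := uW_ne_zero k hz
  have h6 := uW_ne_zero k hz1
  unfold EsW
  rw [← hw]
  generalize (‖2 * z‖ : ℂ) ^ (-2 * s) = x at *
  generalize (‖2 * (z + 1)‖ : ℂ) ^ (-2 * s) = y at *
  field_simp at h ⊢
  linear_combination -h

lemma Gs_add_one (hk : Odd k) (s : ℂ) {z : ℂ} (hz : z ∈ Hset) : Gs k s (z + 1) = Gs k s z := by
  rw [Gs, Es_add_one hk, EsW_add_one hk s hz, Gs]

end ThetaEisenstein
end

noncomputable section
namespace ThetaEisenstein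
open Complex Filter Topology

/-! ### Sums over rows with positive first entry -/

/-- The term `(cz + d)^(-κ) |cz + d|^(-2s)`. -/
def heckeTerm (κ s z : ℂ) : ℂ := z ^ (-κ) * (‖z‖ : ℂ) ^ (-2 * s)

/-- The row `(c + 1, d)` at `z`. -/
def posRow (z : ℂ) (p : ℕ × ℤ) : ℂ := (p.1 + 1 : ℕ) * z + p.2

/-- The sum `∑_{c ≥ 1, d} B(c, d) (cz + d)^(-κ) |cz + d|^(-2s)`. -/
def rowSum (B : ℕ → ℤ → ℂ) (κ s z : ℂ) : ℂ :=
  ∑' p : ℕ × ℤ, B (p.1 + 1) p.2 * heckeTerm κ s (posRow z p)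

/-- The vector of a row. -/
def posVec (p : ℕ × ℤ) : Fin 2 → ℤ := ![(p.1 + 1 : ℕ), p.2]

lemma posVec_injective : Function.Injective posVec := by
  intro p q h
  have h0 := congrFun h 0
  have h1 := congrFun h 1
  simp [posVec] at h0 h1
  exact Prod.ext h0 h1

lemma posRow_im {z : ℂ} (p : ℕ × ℤ) : (posRow z p).im = (p.1 + 1) * z.im := by
  simp [posRow]

lemma posRow_mem {z : ℂ} (hz : z ∈ Hset) (p : ℕ × ℤ) : posRow z p ∈ Hset := by
  rw [Set.mem_ofPred_eq, posRow_im]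
  have : 0 < z.im := hz
  positivity

lemma norm_heckeTerm (κ : ℝ) (s : ℂ) {z : ℂ} (hz : z ≠ 0) :
    ‖heckeTerm κ s z‖ = ‖z‖ ^ (-(κ + 2 * s.re)) := by
  rw [heckeTerm, norm_mul, ← ofReal_neg, norm_cpow_of_ne_zero hz, ofReal_re, ofReal_im, mul_zero,
    Real.exp_zero, div_one, norm_cpow_eq_rpow_re_of_pos (norm_pos_iff.2 hz),
    ← Real.rpow_add (norm_pos_iff.2 hz)]
  congr 1
  simp
  ring

lemma norm_heckeTerm_posRow_le {κ : ℝ} {s : ℂ} (h : 0 ≤ κ + 2 * s.re) {z : ℂ} (hz : z ∈ Hset)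
    (p : ℕ × ℤ) : ‖heckeTerm κ s (posRow z p)‖ ≤
      EisensteinSeries.r ⟨z, hz⟩ ^ (-(κ + 2 * s.re)) * ‖posVec p‖ ^ (-(κ + 2 * s.re)) := by
  rw [norm_heckeTerm _ _ (ne_zero_of_Hset (posRow_mem hz p))]
  have := EisensteinSeries.summand_bound ⟨z, hz⟩ h (posVec p)
  simpa [posVec, posRow] using this

lemma summable_posVec {κ : ℝ} (h : 2 < κ) : Summable fun p : ℕ × ℤ => ‖posVec p‖ ^ (-κ) :=
  (EisensteinSeries.summable_one_div_norm_rpow h).comp_injective posVec_injective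

variable {B : ℕ → ℤ → ℂ}

lemma norm_rowSum_term_le (hB : ∀ c d, ‖B c d‖ ≤ 1) {κ : ℝ} {s : ℂ} (h : 0 ≤ κ + 2 * s.re) {z : ℂ}
    (hz : z ∈ Hset) (p : ℕ × ℤ) : ‖B (p.1 + 1) p.2 * heckeTerm κ s (posRow z p)‖ ≤
      EisensteinSeries.r ⟨z, hz⟩ ^ (-(κ + 2 * s.re)) * ‖posVec p‖ ^ (-(κ + 2 * s.re)) := by
  rw [norm_mul]
  exact (mul_le_of_le_one_left (norm_nonneg _) (hB _ _)).trans (norm_heckeTerm_posRow_le h hz p)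

lemma summable_rowSum (hB : ∀ c d, ‖B c d‖ ≤ 1) {κ : ℝ} {s : ℂ} (h : 2 < κ + 2 * s.re) {z : ℂ}
    (hz : z ∈ Hset) : Summable fun p : ℕ × ℤ => B (p.1 + 1) p.2 * heckeTerm κ s (posRow z p) :=
  Summable.of_norm_bounded ((summable_posVec h).mul_left _)
    fun p => norm_rowSum_term_le hB (by linarith) hz p

/-- An explicit value for the constant in |cz + d| ≥ r max(|c|, |d|), uniform in the strip. It
yields both the polynomial growth as Im z → 0 and a majorant near i∞. -/
lemma r_ge_of_strip {z : ℂ} (hz : z ∈ Hset) (hre : |z.re| ≤ 1) :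
    min z.im 1 / 2 ≤ EisensteinSeries.r ⟨z, hz⟩ := by
  have hy : 0 < z.im := hz
  have hm : 0 < min z.im 1 := lt_min hy one_pos
  unfold EisensteinSeries.r
  refine le_min ?_ ?_
  · have := min_le_left z.im 1
    simp only [UpperHalfPlane.im]
    linarith
  · apply Real.le_sqrt_of_sq_le
    rw [EisensteinSeries.r1_eq]
    have e1 : (⟨z, hz⟩ : UpperHalfPlane).re = z.re := rfl
    have e2 : (⟨z, hz⟩ : UpperHalfPlane).im = z.im := rfl
    have e3 : 1 / ((z.re / z.im) ^ 2 + 1) = z.im ^ 2 / (z.re ^ 2 + z.im ^ 2) := by field_simp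
    rw [e1, e2, e3, div_pow, div_le_div_iff₀ (by norm_num) (by positivity)]
    have h1 : z.re ^ 2 ≤ 1 := by
      rw [← sq_abs]; exact pow_le_one₀ (abs_nonneg _) hre
    have h2 : min z.im 1 ^ 2 ≤ 1 := pow_le_one₀ hm.le (min_le_right _ _)
    have h3 : min z.im 1 ^ 2 ≤ z.im ^ 2 := pow_le_pow_left₀ hm.le (min_le_left _ _) 2
    nlinarith [sq_nonneg z.im]

lemma norm_rowSum_le (hB : ∀ c d, ‖B c d‖ ≤ 1) {κ : ℝ} (h : 2 < κ) {z : ℂ}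
    (hz : z ∈ Hset) (hre : |z.re| ≤ 1) (him : z.im ≤ 1) :
    ‖rowSum B κ 0 z‖ ≤ (2 ^ κ * ∑' p, ‖posVec p‖ ^ (-κ)) * z.im ^ (-κ) := by
  have hy : 0 < z.im := hz
  have hb := fun p => norm_rowSum_term_le (s := 0) hB (by simp; linarith : 0 ≤ κ + 2 * (0 : ℂ).re) hz p
  have hs := (summable_posVec h)
  simp only [zero_re, mul_zero, add_zero] at hb
  refine (tsum_of_norm_bounded (hs.mul_left _).hasSum hb).trans ?_
  rw [tsum_mul_left]
  have hr := r_ge_of_strip hz hre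
  rw [min_eq_left him] at hr
  have : EisensteinSeries.r ⟨z, hz⟩ ^ (-κ) ≤ (z.im / 2) ^ (-κ) :=
    Real.rpow_le_rpow_of_nonpos (by positivity) hr (by linarith)
  rw [Real.div_rpow hy.le two_pos.le, Real.rpow_neg two_pos.le, div_inv_eq_mul] at this
  have h0 : 0 ≤ ∑' p, ‖posVec p‖ ^ (-κ) := tsum_nonneg fun p => by positivity
  calc _ ≤ (z.im ^ (-κ) * 2 ^ κ) * ∑' p, ‖posVec p‖ ^ (-κ) := by gcongr
    _ = _ := by ring

lemma rowSum_differentiableOn (hB : ∀ c d, ‖B c d‖ ≤ 1) {κ : ℝ} (h : 2 < κ) :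
    DifferentiableOn ℂ (rowSum B κ 0) Hset := by
  intro z hz
  have hz' : 0 < z.im := hz
  have hopen : IsOpen ({w : ℂ | z.im / 2 < w.im} ∩ {w : ℂ | |w.re| < |z.re| + 1}) :=
    (isOpen_lt continuous_const continuous_im).inter
      (isOpen_lt (continuous_abs.comp continuous_re) continuous_const)
  have key : DifferentiableOn ℂ (rowSum B κ 0)
      ({w : ℂ | z.im / 2 < w.im} ∩ {w : ℂ | |w.re| < |z.re| + 1}) := by
    refine differentiableOn_tsum_of_summable_norm
      ((summable_posVec h).mul_left (EisensteinSeries.r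
        ⟨⟨|z.re| + 1, z.im / 2⟩, show 0 < z.im / 2 by linarith⟩ ^ (-κ))) (fun p => ?_) hopen
        (fun p w hw => ?_)
    · intro w hw
      have hwm : w ∈ Hset := lt_trans (by linarith : 0 < z.im / 2) hw.1
      have := posRow_mem hwm p
      simp only [heckeTerm, mul_zero, cpow_zero, mul_one]
      apply DifferentiableAt.differentiableWithinAt
      have hd : DifferentiableAt ℂ (fun w => posRow w p) w := by unfold posRow; fun_prop
      exact (hd.cpow (differentiableAt_const _) (Or.inr (ne_of_gt this))).const_mul _
    · have hwm : w ∈ Hset := lt_trans (by linarith : 0 < z.im / 2) hw.1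
      rw [norm_mul]
      refine (mul_le_of_le_one_left (norm_nonneg _) (hB _ _)).trans ?_
      rw [norm_heckeTerm _ _ (ne_zero_of_Hset (posRow_mem hwm p))]
      have := EisensteinSeries.summand_bound_of_mem_verticalStrip (z := ⟨w, hwm⟩)
        (by linarith : 0 ≤ κ) (posVec p) (A := |z.re| + 1) (B := z.im / 2) (by linarith)
        ⟨hw.2.le, hw.1.le⟩
      simpa [posVec, posRow] using this
  exact (key.differentiableAt (hopen.mem_nhds ⟨show z.im / 2 < z.im by linarith,
    show |z.re| < |z.re| + 1 by linarith⟩)).differentiableWithinAt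

/-- The majorant is uniform only in vertical strips, so z is first moved by the integer part of its
real part. Each term is then at most y^{-κ}. -/
lemma tendsto_rowSum (hB : ∀ c d, ‖B c d‖ ≤ 1) {κ : ℝ} (h : 2 < κ)
    (hper : ∀ z ∈ Hset, rowSum B κ 0 (z + 1) = rowSum B κ 0 z) :
    Tendsto (rowSum B κ 0) imInf (𝓝 0) := by
  have hperZ : ∀ n : ℤ, ∀ z ∈ Hset, rowSum B κ 0 (z + n) = rowSum B κ 0 z := by
    intro n
    have hm : ∀ (m : ℤ), ∀ z ∈ Hset, z + m ∈ Hset := fun m z hz => by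
      have : 0 < z.im := hz
      rw [Set.mem_ofPred_eq]; simpa using this
    induction n using Int.induction_on with
    | zero => simp
    | succ n ih =>
      intro z hz
      rw [← ih z hz, ← hper _ (hm n z hz)]
      congr 1; push_cast; ring
    | pred n ih =>
      intro z hz
      rw [← ih z hz, ← hper _ (hm _ _ hz)]
      congr 1; push_cast; ring
  have hz' : ∀ z ∈ Hset, z - (⌊z.re⌋ : ℤ) ∈ Hset := fun z hz => by
    have : 0 < z.im := hz
    rw [Set.mem_ofPred_eq]; simpa using this
  have hlim : Tendsto (fun z => rowSum B κ 0 (z - (⌊z.re⌋ : ℤ))) imInf (𝓝 (∑' _ : ℕ × ℤ, (0 : ℂ))) := by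
    unfold rowSum
    refine tendsto_tsum_of_dominated_convergence
      (bound := fun p => (1 / 2 : ℝ) ^ (-κ) * ‖posVec p‖ ^ (-κ))
      ((summable_posVec h).mul_left _) (fun p => ?_) ?_
    · rw [tendsto_zero_iff_norm_tendsto_zero]
      have h1 : Tendsto (fun z : ℂ => z.im ^ (-κ)) imInf (𝓝 0) :=
        (tendsto_rpow_neg_atTop (by linarith)).comp tendsto_comap
      refine squeeze_zero' (Eventually.of_forall fun z => norm_nonneg _) ?_ h1
      filter_upwards [eventually_Hset] with z hz
      have hy : 0 < z.im := hz
      rw [norm_mul]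
      refine (mul_le_of_le_one_left (norm_nonneg _) (hB _ _)).trans ?_
      rw [norm_heckeTerm _ _ (ne_zero_of_Hset (posRow_mem (hz' z hz) p))]
      simp only [zero_re, mul_zero, add_zero]
      refine Real.rpow_le_rpow_of_nonpos hy ?_ (by linarith)
      refine le_trans ?_ (abs_im_le_norm _)
      rw [posRow_im, sub_im, intCast_im, sub_zero]
      refine le_trans ?_ (le_abs_self _)
      have : (0 : ℝ) ≤ p.1 := Nat.cast_nonneg _
      nlinarith
    · filter_upwards [preimage_mem_comap (Ici_mem_atTop 1)] with z hz p
      have hz : 1 ≤ z.im := hz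
      have hzm : z ∈ Hset := lt_of_lt_of_le one_pos hz
      have hb := norm_rowSum_term_le (s := 0) hB (by simp; linarith : 0 ≤ κ + 2 * (0 : ℂ).re)
        (hz' z hzm) p
      simp only [zero_re, mul_zero, add_zero] at hb
      refine hb.trans ?_
      have hre : |(z - (⌊z.re⌋ : ℤ)).re| ≤ 1 := by
        simp only [sub_re, intCast_re]
        have := Int.fract_nonneg z.re
        have := Int.fract_lt_one z.re
        rw [Int.fract] at *
        rw [abs_le]; constructor <;> linarith
      have hr := r_ge_of_strip (hz' z hzm) hre
      rw [sub_im, intCast_im, sub_zero, min_eq_right hz] at hr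
      gcongr ?_ * _
      exact Real.rpow_le_rpow_of_nonpos (by norm_num) hr (by linarith)
  rw [tsum_zero] at hlim
  refine hlim.congr' ?_
  filter_upwards [eventually_Hset] with z hz
  have := hperZ (-⌊z.re⌋) z hz
  rw [← this]
  congr 1
  push_cast
  ring

end ThetaEisenstein
end

noncomputable section
namespace ThetaEisenstein
open Complex Filter Topology

/-! ### The Eisenstein series as sums over normalized rows -/

variable {k : ℕ}

/-- Rows (c, d) and (-c, -d) contribute equally; those with c ≠ 0 are represented by c > 0, which
uses up the factor 1/2. -/
lemma tsum_half_of_even {f : ℤ × ℤ → ℂ} (hs : Summable f) (he : ∀ p, f (-p) = f p) :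
    (1 / 2) * ∑' p, f p = (1 / 2) * ∑' d : ℤ, f (0, d) + ∑' p : ℕ × ℤ, f ((p.1 + 1 : ℕ), p.2) := by
  set g : ℤ → ℂ := fun c => ∑' d, f (c, d) with hg
  have hgs : Summable g := hs.prod
  have hge : ∀ c, g (-c) = g c := fun c => by
    rw [hg]
    simp only
    rw [← (Equiv.neg ℤ).tsum_eq]
    refine tsum_congr fun d => ?_
    exact he (c, d)
  have h1 : Summable fun n : ℕ => g (n + 1 : ℕ) :=
    hgs.comp_injective fun a b h => by simpa using h
  have h2 := HasSum.of_add_one_of_neg_add_one (f := g) (m := ∑' n : ℕ, g (n + 1 : ℕ))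
    (m' := ∑' n : ℕ, g (n + 1 : ℕ)) (by simpa using h1.hasSum) (by
      have := h1.hasSum
      simp_rw [hge]
      simpa using this)
  have h3 : ∑' p : ℕ × ℤ, f ((p.1 + 1 : ℕ), p.2) = ∑' n : ℕ, g (n + 1 : ℕ) :=
    Summable.tsum_prod (f := fun p : ℕ × ℤ => f ((p.1 + 1 : ℕ), p.2)) (hs.comp_injective (i := fun p : ℕ × ℤ => (((p.1 + 1 : ℕ) : ℤ), p.2)) fun p q h => by
      simp at h; exact Prod.ext h.1 h.2)
  rw [hs.tsum_prod, h3]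
  change 1 / 2 * ∑' c, g c = 1 / 2 * g 0 + _
  rw [h2.tsum_eq]
  ring

lemma rowTerm_eq (k : ℕ) (s z : ℂ) (p : ℤ × ℤ) :
    rowTerm k s z p = rowCoeff k p.1 p.2 * heckeTerm ((k : ℝ) / 2 : ℝ) s (p.1 * z + p.2) := by
  rw [rowTerm, heckeTerm, mul_assoc]
  push_cast
  rfl

lemma rowCoeff_zero_zero (k : ℕ) : rowCoeff k 0 0 = 0 := by
  rw [rowCoeff, if_neg]
  rintro ⟨-, h⟩
  simp [isCoprime_zero_left] at h

lemma norm_rowTerm_le {s : ℂ} (h : 0 ≤ (k : ℝ) / 2 + 2 * s.re) {z : ℂ} (hz : z ∈ Hset)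
    (p : ℤ × ℤ) : ‖rowTerm k s z p‖ ≤
      EisensteinSeries.r ⟨z, hz⟩ ^ (-((k : ℝ) / 2 + 2 * s.re)) *
        ‖(![p.1, p.2] : Fin 2 → ℤ)‖ ^ (-((k : ℝ) / 2 + 2 * s.re)) := by
  by_cases hp : p.1 ≠ 0 ∨ p.2 ≠ 0
  · rw [rowTerm_eq, norm_mul]
    refine (mul_le_of_le_one_left (norm_nonneg _) (norm_rowCoeff_le _ _ _)).trans ?_
    rw [norm_heckeTerm _ _ (row_ne_zero hp hz)]
    have := EisensteinSeries.summand_bound ⟨z, hz⟩ h ![p.1, p.2]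
    simpa using this
  · push Not at hp
    rw [rowTerm, hp.1, hp.2, rowCoeff_zero_zero]
    simp only [zero_mul, norm_zero]
    have := EisensteinSeries.r_pos ⟨z, hz⟩
    positivity

lemma summable_rowTerm {s : ℂ} (h : 2 < (k : ℝ) / 2 + 2 * s.re) {z : ℂ} (hz : z ∈ Hset) :
    Summable (rowTerm k s z) := by
  refine Summable.of_norm_bounded (Summable.mul_left _ ?_)
    fun p => norm_rowTerm_le (by linarith) hz p
  exact (EisensteinSeries.summable_one_div_norm_rpow h).comp_injective
    (i := fun p : ℤ × ℤ => (![p.1, p.2] : Fin 2 → ℤ)) fun p q hpq => by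
      have h0 := congrFun hpq 0
      have h1 := congrFun hpq 1
      simp at h0 h1
      exact Prod.ext h0 h1

/-- The matrices γ and -γ act alike, so their theta quotients coincide. -/
lemma rowTerm_neg (hk : Odd k) (s : ℂ) {z : ℂ} (hz : z ∈ Hset) (p : ℤ × ℤ) :
    rowTerm k s z (-p) = rowTerm k s z p := by
  obtain ⟨c, d⟩ := p
  simp only [rowTerm, Prod.neg_mk]
  by_cases h : 4 ∣ c ∧ IsCoprime c d
  · obtain ⟨hc, u, v, huv⟩ := h
    have hab : v * d - (-u) * c = 1 := by linear_combination huv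
    have h1 := th_pow_mul_rowCoeff hk hab hc hz
    have h2 := th_pow_mul_rowCoeff hk (a := -v) (b := u) (c := -c) (d := -d)
      (by linear_combination huv) ((dvd_neg).2 hc) hz
    have e0 : ((-c : ℤ) : ℂ) * z + (-d : ℤ) = -(c * z + d) := by push_cast; ring
    have e : (((-v : ℤ) : ℂ) * z + u) / ((-c : ℤ) * z + (-d : ℤ)) =
        (v * z + (-u : ℤ)) / (c * z + d) := by
      rw [e0, ← neg_div_neg_eq, neg_neg]
      congr 1
      push_cast; ring
    rw [e] at h2
    have := mul_left_cancel₀ (pow_ne_zero k (th_ne_zero (moebius_mem hab hz))) (h2.trans h1.symm)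
    rw [this, e0, norm_neg]
  · have h' : ¬ (4 ∣ -c ∧ IsCoprime (-c) (-d)) := by
      rwa [dvd_neg, IsCoprime.neg_neg_iff]
    rw [rowCoeff, rowCoeff, if_neg h, if_neg h']
    simp

lemma rowCoeff_zero_left (k : ℕ) {d : ℤ} (hd : d ≠ 1) (hd' : d ≠ -1) : rowCoeff k 0 d = 0 := by
  rw [rowCoeff, if_neg]
  rintro ⟨-, h⟩
  rw [isCoprime_zero_left, Int.isUnit_iff] at h
  tauto

lemma rowCoeff_zero_one (k : ℕ) : rowCoeff k 0 1 = 1 := by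
  rw [rowCoeff, if_pos ⟨by simp, isCoprime_one_right⟩]
  simp [quadSymbol, eps]

lemma tsum_rowTerm_zero (hk : Odd k) (s : ℂ) {z : ℂ} (hz : z ∈ Hset) :
    ∑' d : ℤ, rowTerm k s z (0, d) = 2 := by
  have h1 : rowTerm k s z (0, 1) = 1 := by simp [rowTerm, rowCoeff_zero_one]
  have h2 := rowTerm_neg hk s hz (0, 1)
  rw [h1] at h2
  rw [tsum_eq_sum (s := {1, -1}) (fun d hd => ?_), Finset.sum_pair (by decide), h1]
  · change 1 + rowTerm k s z (-0, -1) = 2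
    rw [← Prod.neg_mk, h2]
    norm_num
  · simp only [Finset.mem_insert, Finset.mem_singleton, not_or] at hd
    simp [rowTerm, rowCoeff_zero_left k hd.1 hd.2]

/-- The Eisenstein series at `∞` as a sum over rows with `c > 0`. -/
lemma Es_eq (hk : Odd k) {s : ℂ} (h : 2 < (k : ℝ) / 2 + 2 * s.re) {z : ℂ} (hz : z ∈ Hset) :
    Es k s z = 1 + rowSum (fun c d => rowCoeff k c d) ((k : ℝ) / 2 : ℝ) s z := by
  rw [Es, tsum_half_of_even (summable_rowTerm h hz) (rowTerm_neg hk s hz),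
    tsum_rowTerm_zero hk s hz, rowSum]
  congr 1
  · norm_num
  · refine tsum_congr fun p => ?_
    rw [rowTerm_eq]
    simp [posRow]

/-- Neither multiplication of a point of the upper half-plane by -2i nor the passage from u/z to u
leads out of the principal range of the argument. -/
lemma cpow_div_of_Hset {u z : ℂ} (hu : u ∈ Hset) (hz : z ∈ Hset) (s : ℂ) :
    (-2 * Complex.I * z) ^ s * (u / z) ^ s = (-2 * Complex.I) ^ s * u ^ s := by
  have hu0 := ne_zero_of_Hset hu
  have hz0 := ne_zero_of_Hset hz
  have hu' : 0 < u.im := hu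
  have hz' : 0 < z.im := hz
  have key : ∀ v : ℂ, v ∈ Hset → (-2 * Complex.I * v) ^ s = (-2 * Complex.I) ^ s * v ^ s := by
    intro v hv
    have hv' : 0 < v.im := hv
    refine mul_cpow_of_arg (by simp) (ne_zero_of_Hset hv) (arg_add_of_opposite ?_ ?_ hv) _
    · simp
    · simp
  have h2 : (u / z * z) ^ s = (u / z) ^ s * z ^ s := by
    refine mul_cpow_of_arg (div_ne_zero hu0 hz0) hz0 ?_ s
    by_cases h : 0 < (u / z).im
    · exact arg_add_of_im_pos h hz (by rwa [div_mul_cancel₀ _ hz0])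
    · refine arg_add_of_opposite (not_lt.1 h) (fun h0 => ?_) hz
      have h3 : u / z = ((u / z).re : ℂ) := by
        apply Complex.ext <;> simp [h0]
      have h4 : u.im = (u / z).re * z.im := by
        conv_lhs => rw [← div_mul_cancel₀ u hz0, h3]
        simp
      rw [h4] at hu'
      exact pos_of_mul_pos_left hu' hz'.le
  rw [div_mul_cancel₀ _ hz0] at h2
  rw [key z hz, h2]
  ring

/-- The coefficients of the rows in the Eisenstein series at the cusp `0`. -/
def rowCoeffZero (k : ℕ) (a : ℕ) (b : ℤ) : ℂ := rowCoeff k (-4 * b) a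

lemma norm_rowCoeffZero_le (k a : ℕ) (b : ℤ) : ‖rowCoeffZero k a b‖ ≤ 1 := norm_rowCoeff_le _ _ _

/-- At -1/(4z) the row (-4b, a) takes the value (az + b)/z, and the denominator z is absorbed by the
automorphy factor of W. -/
lemma rowTerm_W (s : ℂ) {z : ℂ} (hz : z ∈ Hset) (p : ℕ × ℤ) :
    (uW k z)⁻¹ * (‖2 * z‖ : ℂ) ^ (-2 * s) * rowTerm k s (-1 / (4 * z)) (-4 * p.2, (p.1 + 1 : ℕ)) =
      ((-2 * Complex.I) ^ ((k : ℂ) / 2))⁻¹ * 2 ^ (-2 * s) *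
        (rowCoeffZero k (p.1 + 1) p.2 * heckeTerm ((k : ℝ) / 2 : ℝ) s (posRow z p)) := by
  have hz0 := ne_zero_of_Hset hz
  have hr := posRow_mem hz p
  have e : ((-4 * p.2 : ℤ) : ℂ) * (-1 / (4 * z)) + ((p.1 + 1 : ℕ) : ℤ) = posRow z p / z := by
    rw [posRow]; field_simp; push_cast; ring
  simp only [rowTerm, heckeTerm, rowCoeffZero, e]
  have h1 := cpow_div_of_Hset hr hz ((k : ℂ) / 2)
  have h2 : (‖2 * z‖ : ℂ) ^ (-2 * s) * (‖posRow z p / z‖ : ℂ) ^ (-2 * s) =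
      2 ^ (-2 * s) * (‖posRow z p‖ : ℂ) ^ (-2 * s) := by
    have : (2 : ℂ) = ((2 : ℝ) : ℂ) := by simp
    rw [this, ← mul_cpow_ofReal_nonneg (norm_nonneg _) (norm_nonneg _),
      ← mul_cpow_ofReal_nonneg two_pos.le (norm_nonneg _), ← ofReal_mul, ← ofReal_mul, ← norm_mul]
    congr 2
    rw [show ((2 : ℝ) : ℂ) * z * (posRow z p / z) = ((2 : ℝ) : ℂ) * posRow z p by field_simp,
      norm_mul]
    simp
  have h3 := uW_ne_zero k hz
  rw [← uW] at h1
  push_cast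
  rw [cpow_neg, cpow_neg]
  have h4 : (posRow z p / z) ^ ((k : ℂ) / 2) ≠ 0 := by
    simp [cpow_eq_zero_iff, ne_zero_of_Hset hr, hz0]
  have h5 : (posRow z p) ^ ((k : ℂ) / 2) ≠ 0 := by
    simp [cpow_eq_zero_iff, ne_zero_of_Hset hr]
  have h6 : (-2 * Complex.I) ^ ((k : ℂ) / 2) ≠ 0 := by
    simp [cpow_eq_zero_iff]
  generalize (posRow z p / z) ^ ((k : ℂ) / 2) = x1 at *
  generalize (posRow z p) ^ ((k : ℂ) / 2) = x2 at *
  generalize (-2 * Complex.I) ^ ((k : ℂ) / 2) = x3 at *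
  generalize uW k z = x4 at *
  have h7 : x4⁻¹ * x1⁻¹ = x3⁻¹ * x2⁻¹ := by rw [← mul_inv, h1, mul_inv]
  linear_combination (rowCoeff k (-4 * p.2) (p.1 + 1)) * x3⁻¹ * x2⁻¹ * h2 +
    (rowCoeff k (-4 * p.2) (p.1 + 1)) * (‖2 * z‖ : ℂ) ^ (-2 * s) *
      (‖posRow z p / z‖ : ℂ) ^ (-2 * s) * h7

lemma rowCoeff_of_not_dvd (k : ℕ) {c : ℤ} (d : ℤ) (hc : ¬ 4 ∣ c) : rowCoeff k c d = 0 := by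
  rw [rowCoeff, if_neg (fun h => hc h.1)]

lemma rowCoeff_zero_right (k : ℕ) (c : ℤ) : rowCoeff k c 0 = 0 := by
  rw [rowCoeff, if_neg]
  rintro ⟨hc, h⟩
  exact absurd (odd_of_isCoprime hc h) (by decide)

/-- The Eisenstein series at `0` as a sum over rows with positive first entry. -/
lemma EsW_eq (hk : Odd k) {s : ℂ} (h : 2 < (k : ℝ) / 2 + 2 * s.re) {z : ℂ} (hz : z ∈ Hset) :
    EsW k s z = ((-2 * Complex.I) ^ ((k : ℂ) / 2))⁻¹ * 2 ^ (-2 * s) *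
      rowSum (rowCoeffZero k) ((k : ℝ) / 2 : ℝ) s z := by
  have hw := W_mem hz
  have hs := summable_rowTerm h hw
  -- The coordinates are exchanged so that the sign is normalised by the second entry, which is odd
  -- and hence nonzero whenever the coefficient is.
  let e : ℤ × ℤ ≃ ℤ × ℤ := Equiv.prodComm ℤ ℤ
  have h1 := tsum_half_of_even (f := fun p => rowTerm k s (-1 / (4 * z)) (e p))
    (e.summable_iff.2 hs) fun p => rowTerm_neg hk s hw (e p)
  rw [e.tsum_eq] at h1
  have h0 : ∑' d : ℤ, rowTerm k s (-1 / (4 * z)) (e (0, d)) = 0 := by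
    rw [← tsum_zero (α := ℂ) (β := ℤ)]
    refine tsum_congr fun d => ?_
    simp [e, rowTerm, rowCoeff_zero_right]
  -- Only first entries divisible by 4 carry a nonzero coefficient; they are written as -4b.
  have h2 : ∑' p : ℕ × ℤ, rowTerm k s (-1 / (4 * z)) (e ((p.1 + 1 : ℕ), p.2)) =
      ∑' p : ℕ × ℤ, rowTerm k s (-1 / (4 * z)) (-4 * p.2, (p.1 + 1 : ℕ)) := by
    have hi : Function.Injective fun p : ℕ × ℤ => (p.1, -4 * p.2) := fun p q hpq => by
      simp at hpq; exact Prod.ext hpq.1 hpq.2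
    rw [← hi.tsum_eq (f := fun p : ℕ × ℤ => rowTerm k s (-1 / (4 * z)) (e ((p.1 + 1 : ℕ), p.2)))]
    · rfl
    · intro p hp
      by_contra hn
      apply hp
      have : ¬ (4 : ℤ) ∣ p.2 := fun ⟨m, hm⟩ => hn ⟨(p.1, -m), by ext <;> simp [hm]⟩
      simp [e, rowTerm, rowCoeff_of_not_dvd k _ this]
  rw [EsW, Es, h1, h0, h2, mul_zero, zero_add, rowSum, ← tsum_mul_left, ← tsum_mul_left]
  exact tsum_congr fun p => rowTerm_W s hz p

end ThetaEisenstein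
end

noncomputable section
namespace ThetaEisenstein
open Complex Filter Topology CongruenceSubgroup

/-! ### The series over cosets -/

variable {k : ℕ}

lemma toReal_apply (γ : SL(2, ℤ)) (i l : Fin 2) : toReal γ i l = (γ i l : ℝ) := rfl

lemma toReal_injective : Function.Injective toReal := by
  intro a b h
  ext i l
  have := congrArg (fun g : SL(2, ℝ) => g i l) h
  simpa [toReal_apply] using this

lemma mem_Gamma0_four {γ : SL(2, ℤ)} : γ ∈ Gamma0 4 ↔ (4 : ℤ) ∣ γ 1 0 := by
  rw [Gamma0_mem, ZMod.intCast_zmod_eq_zero_iff_dvd]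
  rfl

lemma det_eq (γ : SL(2, ℤ)) : γ 0 0 * γ 1 1 - γ 0 1 * γ 1 0 = 1 := by
  have := γ.2
  rwa [Matrix.det_fin_two] at this

lemma coe_mem_Hset (z : UpperHalfPlane) : (z : ℂ) ∈ Hset := z.im_pos

lemma j_toReal (γ : SL(2, ℤ)) (z : UpperHalfPlane) : j (toReal γ) z = γ 1 0 * z + γ 1 1 := by
  simp [j, toReal_apply]

lemma j_toReal_ne_zero (γ : SL(2, ℤ)) (z : UpperHalfPlane) : j (toReal γ) z ≠ 0 := by
  rw [j_toReal]
  refine row_ne_zero ?_ (coe_mem_Hset z)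
  by_contra! h
  have := det_eq γ
  rw [h.1, h.2] at this
  simp at this

lemma coe_toReal_smul (γ : SL(2, ℤ)) (z : UpperHalfPlane) :
    ((toReal γ • z : UpperHalfPlane) : ℂ) = (γ 0 0 * z + γ 0 1) / (γ 1 0 * z + γ 1 1) := by
  rw [UpperHalfPlane.coe_specialLinearGroup_apply]
  simp [toReal_apply]

lemma star_Psi (k : ℕ) (γ : SL(2, ℤ)) :
    star (Psi k γ) = (quadSymbol (γ 1 0) (γ 1 1) : ℂ) * eps (γ 1 1) ^ k := by
  have h : star (eps (γ 1 1))⁻¹ = eps (γ 1 1) := by unfold eps; split_ifs <;> simp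
  rw [Psi, star_mul', star_pow, h]
  congr 1
  exact map_intCast (starRingEnd ℂ) _

lemma star_Psi_eq_rowCoeff {γ : SL(2, ℤ)} (hγ : γ ∈ Gamma0 4) :
    star (Psi k γ) = rowCoeff k (γ 1 0) (γ 1 1) := by
  have h : IsCoprime (γ 1 0) (γ 1 1) := ⟨-γ 0 1, γ 0 0, by linear_combination det_eq γ⟩
  rw [star_Psi, rowCoeff, if_pos ⟨mem_Gamma0_four.1 hγ, h⟩]

lemma w_one (κ : ℝ) (γ : SL(2, ℤ)) (z : UpperHalfPlane) : w κ 1 (toReal γ) z = 1 := by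
  have hj := j_toReal_ne_zero γ z
  rw [w, one_mul, cpow_neg]
  have h1 : j 1 (toReal γ • z) = 1 := by simp [j]
  rw [h1, one_cpow, one_mul, mul_inv_cancel₀]
  rw [Ne, cpow_eq_zero_iff]
  tauto

lemma eisTerm_one {γ : SL(2, ℤ)} (hγ : γ ∈ Gamma0 4) (z : UpperHalfPlane) :
    eisTerm ((k : ℝ) / 2) (Psi k) 1 z γ = rowTerm k 0 z (γ 1 0, γ 1 1) := by
  rw [eisTerm, inv_one, w_one, star_Psi_eq_rowCoeff hγ, one_mul, j_toReal, rowTerm]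
  simp

lemma coe_sigmaZero_inv : ((sigmaZero⁻¹ : SL(2, ℝ)) : Matrix (Fin 2) (Fin 2) ℝ) = !![0, 1 / 2; -2, 0] := by
  rw [Matrix.SpecialLinearGroup.coe_inv, Matrix.adjugate_fin_two]
  ext i l
  fin_cases i <;> fin_cases l <;> simp [sigmaZero]
  norm_num

lemma j_sigmaZero_inv (z : UpperHalfPlane) : j sigmaZero⁻¹ z = -2 * z := by
  rw [j, coe_sigmaZero_inv]
  simp

lemma sigmaZero_inv_mul_apply (γ : SL(2, ℤ)) :
    (sigmaZero⁻¹ * toReal γ) 1 0 = -2 * (γ 0 0 : ℝ) ∧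
      (sigmaZero⁻¹ * toReal γ) 1 1 = -2 * (γ 0 1 : ℝ) := by
  rw [Matrix.SpecialLinearGroup.coe_mul, coe_sigmaZero_inv]
  constructor <;> simp [Matrix.mul_apply, Fin.sum_univ_two, toReal_apply]

lemma j_sigmaZero_inv_mul (γ : SL(2, ℤ)) (z : UpperHalfPlane) :
    j (sigmaZero⁻¹ * toReal γ) z = -2 * (γ 0 0 * z + γ 0 1) := by
  rw [j, (sigmaZero_inv_mul_apply γ).1, (sigmaZero_inv_mul_apply γ).2]
  push_cast
  ring

lemma I_cpow_half : Complex.I ^ (1 / 2 : ℂ) = (1 + Complex.I) / (Real.sqrt 2 : ℂ) := by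
  have h : (Complex.I : ℂ) ^ (1 / 2 : ℂ) = exp ((Real.pi / 4 : ℝ) * Complex.I) := by
    rw [cpow_def_of_ne_zero I_ne_zero, log_I]
    congr 1
    push_cast
    ring
  have hs : (Real.sqrt 2 : ℂ) ^ 2 = 2 := by exact_mod_cast Real.sq_sqrt two_pos.le
  have hs0 : (Real.sqrt 2 : ℂ) ≠ 0 := by
    intro h0; rw [h0] at hs; norm_num at hs
  rw [h, exp_mul_I, ← ofReal_cos, ← ofReal_sin, Real.cos_pi_div_four, Real.sin_pi_div_four,
    eq_div_iff hs0]
  push_cast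
  linear_combination ((1 + Complex.I) / 2) * hs

/-- The constant of the theorem is i^{-k/2}. It mediates between the factor (-2iz)^{k/2} of θ^k
under W and the power (-2z)^{k/2} of j(σ₀⁻¹, z). -/
lemma one_sub_I_pow_mul (k : ℕ) :
    ((1 - Complex.I) / (Real.sqrt 2 : ℂ)) ^ k * Complex.I ^ ((k : ℂ) / 2) = 1 := by
  have hs : (Real.sqrt 2 : ℂ) ^ 2 = 2 := by exact_mod_cast Real.sq_sqrt two_pos.le
  have hs0 : (Real.sqrt 2 : ℂ) ≠ 0 := by
    intro h0; rw [h0] at hs; norm_num at hs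
  rw [← cpow_half_pow, I_cpow_half, ← mul_pow]
  convert one_pow k
  field_simp
  linear_combination -hs - I_sq

lemma uW_eq (k : ℕ) {z : ℂ} (hz : z ∈ Hset) :
    uW k z = Complex.I ^ ((k : ℂ) / 2) * (-2 * z) ^ ((k : ℂ) / 2) := by
  rw [uW, show -2 * Complex.I * z = (-2 * z) * Complex.I by ring, mul_comm (Complex.I ^ _)]
  have hz' : 0 < z.im := hz
  refine mul_cpow_of_arg (by simpa using ne_zero_of_Hset hz) I_ne_zero
    (arg_add_of_opposite ?_ ?_ (by simp)) _
  · simp; linarith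
  · intro h; simp at h; linarith

/-- The factor w has absolute value 1, so its conjugate is its inverse, which cancels the power of
j(σ₀⁻¹γ, z) and leaves the powers of the two factors separately. -/
lemma star_w_mul (κ : ℝ) (γ : SL(2, ℤ)) (z : UpperHalfPlane) :
    star (w κ sigmaZero⁻¹ (toReal γ) z) * j (sigmaZero⁻¹ * toReal γ) z ^ (-(κ : ℂ)) =
      (-2 * ((toReal γ • z : UpperHalfPlane) : ℂ)) ^ (-(κ : ℂ)) * j (toReal γ) z ^ (-(κ : ℂ)) := by
  have h1 := j_toReal_ne_zero γ z
  have h2 : -2 * ((toReal γ • z : UpperHalfPlane) : ℂ) ≠ 0 := by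
    simpa using ne_zero_of_Hset (coe_mem_Hset (toReal γ • z))
  have h3 : j (sigmaZero⁻¹ * toReal γ) z =
      -2 * ((toReal γ • z : UpperHalfPlane) : ℂ) * j (toReal γ) z := by
    have h1' := h1
    rw [j_toReal] at h1'
    rw [j_sigmaZero_inv_mul, coe_toReal_smul, j_toReal, mul_assoc, div_mul_cancel₀ _ h1']
  have h4 : j (sigmaZero⁻¹ * toReal γ) z ≠ 0 := h3 ▸ mul_ne_zero h2 h1
  have hn : ‖w κ sigmaZero⁻¹ (toReal γ) z‖ = 1 := by
    rw [w, norm_mul, norm_mul, ← ofReal_neg, norm_cpow_real, norm_cpow_real, norm_cpow_real,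
      j_sigmaZero_inv, ← Real.mul_rpow (norm_nonneg _) (norm_nonneg _), ← norm_mul, ← h3,
      ← Real.rpow_add (norm_pos_iff.2 h4), add_neg_cancel, Real.rpow_zero]
  have hsw : star (w κ sigmaZero⁻¹ (toReal γ) z) = (w κ sigmaZero⁻¹ (toReal γ) z)⁻¹ := by
    rw [inv_def, normSq_eq_norm_sq, hn]
    simp
  rw [hsw, w, j_sigmaZero_inv, cpow_neg, cpow_neg, cpow_neg, mul_inv, inv_inv, mul_inv, mul_assoc,
    mul_inv_cancel₀, mul_one]
  rw [Ne, cpow_eq_zero_iff]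
  tauto

lemma isCoprime_upper {γ : SL(2, ℤ)} (hγ : γ ∈ Gamma0 4) : IsCoprime (-4 * γ 0 1) (γ 0 0) := by
  obtain ⟨m, hm⟩ := mem_Gamma0_four.1 hγ
  have := det_eq γ
  rw [hm] at this
  exact ⟨m, γ 1 1, by linear_combination this⟩

/-- Both sides are compared through theta: γ carries z to γz, while the conjugate of γ by W, with
lower row (-4b, a), carries -1/(4z) to -1/(4γz). -/
lemma eisTerm_sigmaZero (hk : Odd k) {γ : SL(2, ℤ)} (hγ : γ ∈ Gamma0 4) (z : UpperHalfPlane) :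
    ((1 - Complex.I) / (Real.sqrt 2 : ℂ)) ^ k * eisTerm ((k : ℝ) / 2) (Psi k) sigmaZero z γ =
      (uW k z)⁻¹ * rowTerm k 0 (-1 / (4 * z)) (-4 * γ 0 1, γ 0 0) := by
  obtain ⟨m, hm⟩ := mem_Gamma0_four.1 hγ
  have hz := coe_mem_Hset z
  have hz' := coe_mem_Hset (toReal γ • z)
  have hz0 := ne_zero_of_Hset hz
  have hz0' := ne_zero_of_Hset hz'
  have hdet := det_eq γ
  have h1 := th_pow_mul_rowCoeff hk hdet (mem_Gamma0_four.1 hγ) hz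
  rw [← coe_toReal_smul] at h1
  have hdet' : γ 1 1 * γ 0 0 - (-m) * (-4 * γ 0 1) = 1 := by
    rw [hm] at hdet
    linear_combination hdet
  have h2 := th_pow_mul_rowCoeff hk hdet' ⟨-γ 0 1, by ring⟩ (W_mem hz)
  have hmob := coe_toReal_smul γ z
  have hj := j_toReal_ne_zero γ z
  rw [j_toReal] at hj
  have hup : (γ 0 0 : ℂ) * z + γ 0 1 ≠ 0 := by
    intro h; rw [h, zero_div] at hmob; exact hz0' hmob
  have e : ((γ 1 1 : ℂ) * (-1 / (4 * z)) + (-m : ℤ)) / ((-4 * γ 0 1 : ℤ) * (-1 / (4 * z)) + γ 0 0) =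
      -1 / (4 * ((toReal γ • z : UpperHalfPlane) : ℂ)) := by
    have e1 : ((-4 * γ 0 1 : ℤ) : ℂ) * (-1 / (4 * z)) + γ 0 0 = ((γ 0 0 : ℂ) * z + γ 0 1) / z := by
      field_simp; push_cast; ring
    have e2 : (γ 1 1 : ℂ) * (-1 / (4 * z)) + (-m : ℤ) = -((γ 1 0 : ℂ) * z + γ 1 1) / (4 * z) := by
      have hm' : (γ 1 0 : ℂ) = 4 * m := by exact_mod_cast hm
      rw [hm']; field_simp; push_cast; ring
    rw [e1, e2, hmob]
    generalize (γ 1 0 : ℂ) * z + γ 1 1 = D at *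
    generalize (γ 0 0 : ℂ) * z + γ 0 1 = U at *
    field_simp
  rw [e, th_W_pow k hz', th_W_pow k hz] at h2
  have hth := pow_ne_zero k (th_ne_zero hz')
  have hu := uW_ne_zero k hz
  have hu' := uW_ne_zero k hz'
  have h3 := one_sub_I_pow_mul k
  have h4 : ((1 - Complex.I) / (Real.sqrt 2 : ℂ)) ^ k *
      (-2 * ((toReal γ • z : UpperHalfPlane) : ℂ)) ^ (-((k : ℂ) / 2)) =
        (uW k ((toReal γ • z : UpperHalfPlane) : ℂ))⁻¹ := by
    rw [uW_eq k hz', cpow_neg, mul_inv, eq_inv_of_mul_eq_one_left h3]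
  have hs := star_w_mul ((k : ℝ) / 2) γ z
  rw [eisTerm, mul_assoc, hs, star_Psi_eq_rowCoeff hγ, j_toReal, rowTerm]
  push_cast at *
  simp only [mul_zero, cpow_zero, mul_one]
  generalize (uW k ((toReal γ • z : UpperHalfPlane) : ℂ)) = u' at *
  generalize uW k z = u at *
  generalize ((1 - Complex.I) / (Real.sqrt 2 : ℂ)) ^ k = t at *
  generalize th ((toReal γ • z : UpperHalfPlane) : ℂ) ^ k = θ' at *
  generalize (-2 * ((toReal γ • z : UpperHalfPlane) : ℂ)) ^ (-((k : ℂ) / 2)) = y at *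
  rw [← h1] at h2
  generalize ((γ 1 0 : ℂ) * z + γ 1 1) ^ (-((k : ℂ) / 2)) = x at *
  generalize (-4 * (γ 0 1 : ℂ) * (-1 / (4 * z)) + γ 0 0) ^ (-((k : ℂ) / 2)) = x2 at *
  generalize rowCoeff k (-4 * γ 0 1) (γ 0 0) = r2 at *
  generalize rowCoeff k (γ 1 0) (γ 1 1) = r1 at *
  have h5 : u' * (r2 * x2) = u * (r1 * x) := by
    apply mul_left_cancel₀ hth
    linear_combination h2
  have h6 : t * (r1 * (y * x)) = u'⁻¹ * (r1 * x) := by rw [← h4]; ring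
  rw [h6]
  field_simp
  linear_combination -h5

end ThetaEisenstein
end

/-! ### Cosets as coprime rows up to sign, and the identity for weight greater than 2. -/

noncomputable section
namespace ThetaEisenstein
open Complex Filter Topology CongruenceSubgroup

variable {k : ℕ}

lemma mul_inv_apply (g g' : SL(2, ℤ)) :
    (g' * g⁻¹) 1 0 = g' 1 0 * g 1 1 - g' 1 1 * g 1 0 ∧
      (g' * g⁻¹) 0 1 = g' 0 1 * g 0 0 - g' 0 0 * g 0 1 := by
  rw [Matrix.SpecialLinearGroup.coe_mul, Matrix.SpecialLinearGroup.coe_inv, Matrix.adjugate_fin_two]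
  constructor <;> simp [Matrix.mul_apply, Fin.sum_univ_two] <;> ring

lemma toReal_mem_map_stabInfty {γ : SL(2, ℤ)} :
    toReal γ ∈ stabInfty.map toReal ↔ γ 1 0 = 0 := by
  rw [Subgroup.mem_map]
  constructor
  · rintro ⟨g, hg, h⟩
    rw [← toReal_injective h]
    exact hg
  · intro h
    exact ⟨γ, h, rfl⟩

lemma mem_cuspStab_one {γ : Gamma0 4} : γ ∈ cuspStab (Gamma0 4) 1 ↔ (γ : SL(2, ℤ)) 1 0 = 0 := by
  rw [← toReal_mem_map_stabInfty, cuspStab]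
  simp [Subgroup.mem_comap]

/-- Conjugation by σ₀ turns (a b; c d) into the integral matrix (d -c/4; -4b a), which fixes ∞
exactly when b = 0. -/
lemma mem_cuspStab_sigmaZero {γ : Gamma0 4} :
    γ ∈ cuspStab (Gamma0 4) sigmaZero ↔ (γ : SL(2, ℤ)) 0 1 = 0 := by
  have key : ∀ g : SL(2, ℤ), sigmaZero⁻¹ * toReal γ * sigmaZero = toReal g ↔
      (g 0 0 = γ.1 1 1 ∧ -4 * g 0 1 = γ.1 1 0 ∧ g 1 0 = -4 * γ.1 0 1 ∧ g 1 1 = γ.1 0 0) := by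
    intro g
    have hm : ((sigmaZero⁻¹ * toReal γ * sigmaZero : SL(2, ℝ)) : Matrix (Fin 2) (Fin 2) ℝ) =
        !![(γ.1 1 1 : ℝ), -(γ.1 1 0 : ℝ) / 4; -4 * (γ.1 0 1 : ℝ), (γ.1 0 0 : ℝ)] := by
      rw [Matrix.SpecialLinearGroup.coe_mul, Matrix.SpecialLinearGroup.coe_mul, coe_sigmaZero_inv]
      ext i l
      fin_cases i <;> fin_cases l <;>
        simp [sigmaZero, Matrix.mul_apply, Fin.sum_univ_two, toReal_apply, Matrix.vecMul,
          dotProduct] <;> ring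
    refine (Matrix.SpecialLinearGroup.ext_iff _ _).trans ?_
    rw [hm]
    simp only [Fin.forall_fin_two, toReal_apply]
    simp
    constructor
    · rintro ⟨⟨h1, h2⟩, h3, h4⟩
      refine ⟨by exact_mod_cast h1.symm, ?_, by exact_mod_cast h3.symm, by exact_mod_cast h4.symm⟩
      have : -(4 * (g 0 1 : ℝ)) = γ.1 1 0 := by rw [← h2]; ring
      exact_mod_cast this
    · rintro ⟨h1, h2, h3, h4⟩
      refine ⟨⟨by exact_mod_cast h1.symm, ?_⟩, by exact_mod_cast h3.symm, by exact_mod_cast h4.symm⟩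
      rw [← h2]
      push_cast
      ring
  have hmem : γ ∈ cuspStab (Gamma0 4) sigmaZero ↔
      ∃ g : SL(2, ℤ), g 1 0 = 0 ∧ sigmaZero⁻¹ * toReal γ * sigmaZero = toReal g := by
    rw [cuspStab, Subgroup.mem_comap, Subgroup.mem_map]
    constructor
    · rintro ⟨x, hx, h⟩
      obtain ⟨g, hg, rfl⟩ := hx
      refine ⟨g, hg, ?_⟩
      simp at h
      rw [← h]
      group
    · rintro ⟨g, hg, h⟩
      refine ⟨toReal g, ⟨g, hg, rfl⟩, ?_⟩
      simp
      rw [← h]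
      group
  rw [hmem]
  constructor
  · rintro ⟨g, hg, h⟩
    have := ((key g).1 h).2.2.1
    omega
  · intro h
    obtain ⟨m, hm⟩ := mem_Gamma0_four.1 γ.2
    have hd := det_eq γ.1
    rw [h] at hd
    exact ⟨⟨!![γ.1 1 1, -m; 0, γ.1 0 0], by rw [Matrix.det_fin_two]; simp; linear_combination hd⟩, by simp, (key _).2
      ⟨by simp, by simp [hm], by simp [h], by simp⟩⟩

/-- Normalization of a row by the sign of its second entry. -/
def rowNorm (p : ℤ × ℤ) : ℤ × ℕ := (p.2.sign * p.1, p.2.natAbs - 1)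

lemma rowNorm_spec {p : ℤ × ℤ} (hp : p.2 ≠ 0) :
    ((rowNorm p).1, (((rowNorm p).2 + 1 : ℕ) : ℤ)) = p ∨
      ((rowNorm p).1, (((rowNorm p).2 + 1 : ℕ) : ℤ)) = -p := by
  obtain ⟨c, d⟩ := p
  simp only [rowNorm] at *
  rcases lt_or_gt_of_ne hp with h | h
  · right
    ext
    · simp [Int.sign_eq_neg_one_of_neg h]
    · simp; omega
  · left
    ext
    · simp [Int.sign_eq_one_of_pos h]
    · simp; omega

/-- The sum over cosets of a function of the row attached to a coset. -/
lemma tsum_cosets (σ : SL(2, ℝ)) (r : Gamma0 4 → ℤ × ℤ)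
    (hr : ∀ γ γ', γ' * γ⁻¹ ∈ cuspStab (Gamma0 4) σ ↔ (r γ').1 * (r γ).2 = (r γ).1 * (r γ').2)
    (hcop : ∀ γ, IsCoprime (r γ).1 (r γ).2) (hne : ∀ γ, (r γ).2 ≠ 0)
    (hsurj : ∀ c d, 4 ∣ c → IsCoprime c d → ∃ γ, r γ = (c, d)) {f : ℤ × ℤ → ℂ}
    (hf : Summable f) (he : ∀ p, f (-p) = f p)
    (hsupp : ∀ p : ℤ × ℤ, f p ≠ 0 → 4 ∣ p.1 ∧ IsCoprime p.1 p.2) (h0 : ∀ c, f (c, 0) = 0) :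
    Summable (fun q : Cosets (Gamma0 4) σ => f (r q.out)) ∧
      ∑' q : Cosets (Gamma0 4) σ, f (r q.out) = (1 / 2) * ∑' p, f p := by
  -- Rows normalised to a positive second entry; the shift by one lets that entry be indexed by all
  -- of ℕ.
  set F : ℤ × ℕ → ℂ := fun p => f (p.1, (p.2 + 1 : ℕ)) with hF
  have hFs : Summable F := hf.comp_injective fun p q h => by
    simp at h; exact Prod.ext h.1 h.2
  have hval : ∀ γ, f (r γ) = F (rowNorm (r γ)) := fun γ => by
    rcases rowNorm_spec (hne γ) with h | h
    · simp only [hF, h]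
    · simp only [hF, h, he]
  -- Proportional coprime rows differ by a sign only, so the normalised row of a coset does not
  -- depend on the representative.
  have hprop : ∀ x y x' y' : ℤ, IsCoprime x y → IsCoprime x' y' → x' * y = x * y' → y ≠ 0 →
      y' ≠ 0 → rowNorm (x, y) = rowNorm (x', y') := by
    intro x y x' y' h h' he hy hy'
    have h1 : y ∣ y' := h.symm.dvd_of_dvd_mul_left ⟨x', by linear_combination -he⟩
    have h2 : y' ∣ y := h'.symm.dvd_of_dvd_mul_left ⟨x, by linear_combination he⟩
    rcases Int.natAbs_eq_natAbs_iff.1 (Nat.dvd_antisymm (Int.natAbs_dvd_natAbs.2 h1)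
      (Int.natAbs_dvd_natAbs.2 h2)) with h3 | h3
    · subst h3
      rw [mul_right_cancel₀ hy he]
    · subst h3
      have : x = -x' := mul_right_cancel₀ hy' (by linear_combination -he)
      subst this
      simp [rowNorm]
  have hinj : Function.Injective fun q : Cosets (Gamma0 4) σ => rowNorm (r q.out) := by
    intro q q' hq
    rw [← q.out_eq, ← q'.out_eq]
    apply Quotient.sound
    apply QuotientGroup.rightRel_apply.2
    rw [hr]
    have hq : rowNorm (r q.out) = rowNorm (r q'.out) := hq
    have h1 := rowNorm_spec (hne q.out)
    have h2 := rowNorm_spec (hne q'.out)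
    rw [hq] at h1
    rcases h1 with h1 | h1 <;> rcases h2 with h2 | h2 <;> rw [h1] at h2
    · rw [h2]
    · rw [h2]; simp
    · rw [← h2]; simp
    · rw [neg_inj] at h2; rw [h2]
  have hrange : Function.support F ⊆ Set.range fun q : Cosets (Gamma0 4) σ => rowNorm (r q.out) := by
    intro p hp
    obtain ⟨h4, hc⟩ := hsupp _ hp
    obtain ⟨γ, hγ⟩ := hsurj _ _ h4 hc
    refine ⟨Quotient.mk _ γ, ?_⟩
    have h1 : QuotientGroup.rightRel (cuspStab (Gamma0 4) σ)
      (Quotient.mk (QuotientGroup.rightRel (cuspStab (Gamma0 4) σ)) γ).out γ :=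
        Quotient.exact (Quotient.out_eq _)
    rw [QuotientGroup.rightRel_apply, hr] at h1
    have h2 := hprop _ _ _ _ (hcop _) (hcop _) h1 (hne _) (hne _)
    change rowNorm (r (Quotient.mk (QuotientGroup.rightRel (cuspStab (Gamma0 4) σ)) γ).out) = p
    rw [← Prod.mk.eta (p := r (Quotient.out _)), h2, Prod.mk.eta, hγ]
    simp only [rowNorm]
    ext
    · simp only
      rw [Int.sign_eq_one_of_pos (by positivity), one_mul]
    · simp
      omega
  have hsq : Summable (fun q : Cosets (Gamma0 4) σ => f (r q.out)) := by
    simp_rw [hval]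
    exact hFs.comp_injective hinj
  refine ⟨hsq, ?_⟩
  simp_rw [hval]
  rw [hinj.tsum_eq (f := F) hrange]
  let e : ℤ × ℤ ≃ ℤ × ℤ := Equiv.prodComm ℤ ℤ
  have h1 := tsum_half_of_even (f := fun p => f (e p)) (e.summable_iff.2 hf) fun p => he (e p)
  rw [e.tsum_eq] at h1
  have h2 : ∑' d : ℤ, f (e (0, d)) = 0 := by
    rw [← tsum_zero (α := ℂ) (β := ℤ)]
    exact tsum_congr fun d => h0 d
  rw [h1, h2, mul_zero, zero_add, ← (Equiv.prodComm ℕ ℤ).tsum_eq]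
  rfl

lemma support_rowTerm (s z : ℂ) {p : ℤ × ℤ} (h : rowTerm k s z p ≠ 0) :
    4 ∣ p.1 ∧ IsCoprime p.1 p.2 := by
  by_contra hn
  apply h
  rw [rowTerm, rowCoeff, if_neg hn]
  simp

lemma exists_Gamma0_of_lower {c d : ℤ} (hc : 4 ∣ c) (h : IsCoprime c d) :
    ∃ γ : Gamma0 4, (γ : SL(2, ℤ)) 1 0 = c ∧ (γ : SL(2, ℤ)) 1 1 = d := by
  obtain ⟨u, v, huv⟩ := h
  exact ⟨⟨⟨!![v, -u; c, d], by rw [Matrix.det_fin_two]; simp; linear_combination huv⟩,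
    mem_Gamma0_four.2 (by simpa using hc)⟩, by simp, by simp⟩

lemma exists_Gamma0_of_upper {a b : ℤ} (h : IsCoprime (-4 * b) a) :
    ∃ γ : Gamma0 4, (γ : SL(2, ℤ)) 0 0 = a ∧ (γ : SL(2, ℤ)) 0 1 = b := by
  obtain ⟨u, v, huv⟩ := h
  exact ⟨⟨⟨!![a, b; 4 * u, v], by rw [Matrix.det_fin_two]; simp; linear_combination huv⟩,
    mem_Gamma0_four.2 (by simp)⟩, by simp, by simp⟩

lemma tsum_cosets_one (hk : Odd k) {s : ℂ} (hs : 2 < (k : ℝ) / 2 + 2 * s.re) {z : ℂ}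
    (hz : z ∈ Hset) :
    Summable (fun q : Cosets (Gamma0 4) 1 =>
      rowTerm k s z ((q.out : SL(2, ℤ)) 1 0, (q.out : SL(2, ℤ)) 1 1)) ∧
    ∑' q : Cosets (Gamma0 4) 1, rowTerm k s z ((q.out : SL(2, ℤ)) 1 0, (q.out : SL(2, ℤ)) 1 1) =
      Es k s z := by
  have hcop : ∀ γ : Gamma0 4, IsCoprime ((γ : SL(2, ℤ)) 1 0) ((γ : SL(2, ℤ)) 1 1) := fun γ =>
    ⟨-γ.1 0 1, γ.1 0 0, by linear_combination det_eq γ.1⟩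
  refine tsum_cosets 1 (fun γ => ((γ : SL(2, ℤ)) 1 0, (γ : SL(2, ℤ)) 1 1)) ?_ hcop ?_ ?_
    (summable_rowTerm hs hz) (rowTerm_neg hk s hz) (fun p hp => support_rowTerm s z hp) ?_
  · intro γ γ'
    rw [mem_cuspStab_one, Subgroup.coe_mul, Subgroup.coe_inv, (mul_inv_apply _ _).1]
    constructor <;> intro h <;> linarith
  · intro γ h
    have := odd_of_isCoprime (mem_Gamma0_four.1 γ.2) (hcop γ)
    simp only at h
    rw [h] at this
    exact absurd this (by decide)
  · intro c d hc h
    obtain ⟨γ, h1, h2⟩ := exists_Gamma0_of_lower hc h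
    exact ⟨γ, by simp only [h1, h2]⟩
  · intro c
    simp [rowTerm, rowCoeff_zero_right]

lemma tsum_cosets_sigmaZero (hk : Odd k) {s : ℂ} (hs : 2 < (k : ℝ) / 2 + 2 * s.re) {z : ℂ}
    (hz : z ∈ Hset) :
    Summable (fun q : Cosets (Gamma0 4) sigmaZero =>
      rowTerm k s z (-4 * (q.out : SL(2, ℤ)) 0 1, (q.out : SL(2, ℤ)) 0 0)) ∧
    ∑' q : Cosets (Gamma0 4) sigmaZero,
      rowTerm k s z (-4 * (q.out : SL(2, ℤ)) 0 1, (q.out : SL(2, ℤ)) 0 0) = Es k s z := by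
  refine tsum_cosets sigmaZero (fun γ => (-4 * (γ : SL(2, ℤ)) 0 1, (γ : SL(2, ℤ)) 0 0)) ?_
    (fun γ => isCoprime_upper γ.2) ?_ ?_
    (summable_rowTerm hs hz) (rowTerm_neg hk s hz) (fun p hp => support_rowTerm s z hp) ?_
  · intro γ γ'
    rw [mem_cuspStab_sigmaZero, Subgroup.coe_mul, Subgroup.coe_inv, (mul_inv_apply _ _).2]
    constructor <;> intro h <;> simp only at * <;> linarith
  · intro γ h
    have := odd_of_isCoprime ⟨-γ.1 0 1, by ring⟩ (isCoprime_upper γ.2)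
    simp only at h
    rw [h] at this
    exact absurd this (by decide)
  · rintro c d ⟨b, rfl⟩ h
    obtain ⟨γ, h1, h2⟩ := exists_Gamma0_of_upper (a := d) (b := -b) (by simpa using h)
    exact ⟨γ, by simp only [h1, h2]; simp⟩
  · intro c
    simp [rowTerm, rowCoeff_zero_right]

lemma one_sub_I_pow_ne_zero (k : ℕ) : ((1 - Complex.I) / (Real.sqrt 2 : ℂ)) ^ k ≠ 0 :=
  left_ne_zero_of_mul_eq_one (one_sub_I_pow_mul k)

lemma wellDefined_of_two_lt (hk : Odd k) (h : 2 < (k : ℝ) / 2) :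
    EisensteinWellDefined ((k : ℝ) / 2) (Gamma0 4) (Psi k) 1 ∧
      EisensteinWellDefined ((k : ℝ) / 2) (Gamma0 4) (Psi k) sigmaZero := by
  have h0 : 2 < (k : ℝ) / 2 + 2 * (0 : ℂ).re := by simpa using h
  rw [EisensteinWellDefined, EisensteinWellDefined, if_pos h, if_pos h]
  constructor <;> intro z
  · exact (tsum_cosets_one hk h0 (coe_mem_Hset z)).1.congr fun q => (eisTerm_one q.out.2 z).symm
  · have := (tsum_cosets_sigmaZero hk h0 (W_mem (coe_mem_Hset z))).1.mul_left (uW k z)⁻¹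
    rw [← summable_mul_left_iff (one_sub_I_pow_ne_zero k)]
    exact this.congr fun q => (eisTerm_sigmaZero hk q.out.2 z).symm

lemma E_eq_Es (hk : Odd k) (h : 2 < (k : ℝ) / 2) (z : UpperHalfPlane) : E k z = Es k 0 z := by
  have h0 : 2 < (k : ℝ) / 2 + 2 * (0 : ℂ).re := by simpa using h
  rw [E, eisenstein, if_pos h, eisSeries, ← (tsum_cosets_one hk h0 (coe_mem_Hset z)).2]
  exact tsum_congr fun q => eisTerm_one q.out.2 z

lemma F_eq_EsW (hk : Odd k) (h : 2 < (k : ℝ) / 2) (z : UpperHalfPlane) :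
    ((1 - Complex.I) / (Real.sqrt 2 : ℂ)) ^ k * F k z = EsW k 0 z := by
  have h0 : 2 < (k : ℝ) / 2 + 2 * (0 : ℂ).re := by simpa using h
  rw [F, eisenstein, if_pos h, eisSeries, EsW,
    ← (tsum_cosets_sigmaZero hk h0 (W_mem (coe_mem_Hset z))).2, ← tsum_mul_left, ← tsum_mul_left]
  refine tsum_congr fun q => ?_
  rw [eisTerm_sigmaZero hk q.out.2 z]
  simp

lemma Gs_zero_eq (hk : Odd k) (h : 2 < (k : ℝ) / 2) {z : ℂ} (hz : z ∈ Hset) :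
    Gs k 0 z = 1 + rowSum (fun c d => rowCoeff k c d) ((k : ℝ) / 2 : ℝ) 0 z +
      ((-2 * Complex.I) ^ ((k : ℂ) / 2))⁻¹ * rowSum (rowCoeffZero k) ((k : ℝ) / 2 : ℝ) 0 z := by
  have h0 : 2 < (k : ℝ) / 2 + 2 * (0 : ℂ).re := by simpa using h
  rw [Gs, Es_eq hk h0 hz, EsW_eq hk h0 hz]
  simp

/-- The identity between theta powers and Eisenstein series in the range of absolute convergence. -/
theorem th_pow_eq_of_two_lt (hk : Odd k) (h : 2 < (k : ℝ) / 2) (hk8 : k < 8) {z : ℂ}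
    (hz : z ∈ Hset) : Gs k 0 z = th z ^ k := by
  have hB1 : ∀ (c : ℕ) (d : ℤ), ‖rowCoeff k c d‖ ≤ 1 := fun c d => norm_rowCoeff_le _ _ _
  have hB2 := norm_rowCoeffZero_le k
  have h0 : 2 < (k : ℝ) / 2 + 2 * (0 : ℂ).re := by simpa using h
  have hc : ((-2 * Complex.I) ^ ((k : ℂ) / 2))⁻¹ ≠ 0 := by simp [cpow_eq_zero_iff]
  have hp1 : ∀ z ∈ Hset, rowSum (fun c d => rowCoeff k c d) ((k : ℝ) / 2 : ℝ) 0 (z + 1) =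
      rowSum (fun c d => rowCoeff k c d) ((k : ℝ) / 2 : ℝ) 0 z := fun z hz => by
    have := Es_add_one hk 0 z
    rwa [Es_eq hk h0 hz, Es_eq hk h0 (add_one_mem hz), add_right_inj] at this
  have hp2 : ∀ z ∈ Hset, rowSum (rowCoeffZero k) ((k : ℝ) / 2 : ℝ) 0 (z + 1) =
      rowSum (rowCoeffZero k) ((k : ℝ) / 2 : ℝ) 0 z := fun z hz => by
    have := EsW_add_one hk 0 hz
    rw [EsW_eq hk h0 hz, EsW_eq hk h0 (add_one_mem hz), mul_zero, cpow_zero, mul_one] at this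
    exact mul_left_cancel₀ hc this
  have hd : DifferentiableOn ℂ (Gs k 0) Hset :=
    (((rowSum_differentiableOn hB1 h).const_add 1).add
      ((rowSum_differentiableOn hB2 h).const_mul _)).congr fun z hz => Gs_zero_eq hk h hz
  have hinf : Tendsto (Gs k 0) imInf (𝓝 1) := by
    have := (tendsto_const_nhds (x := (1 : ℂ))).add (tendsto_rowSum hB1 h hp1) |>.add
      ((tendsto_rowSum hB2 h hp2).const_mul ((-2 * Complex.I) ^ ((k : ℂ) / 2))⁻¹)
    simp only [add_zero, mul_zero] at this
    refine this.congr' ?_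
    filter_upwards [eventually_Hset] with z hz
    exact (Gs_zero_eq hk h hz).symm
  set T := 2 ^ ((k : ℝ) / 2) * ∑' p, ‖posVec p‖ ^ (-((k : ℝ) / 2)) with hT
  have hper : ∀ z ∈ Hset, ∀ n : ℤ, Gs k 0 (z + n) = Gs k 0 z := by
    intro z hz n
    have hm : ∀ m : ℤ, z + m ∈ Hset := fun m => by
      have : 0 < z.im := hz
      rw [Set.mem_ofPred_eq]; simpa using this
    induction n using Int.induction_on with
    | zero => simp
    | succ n ih =>
      rw [← ih, ← Gs_add_one hk 0 (hm n)]
      congr 1; push_cast; ring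
    | pred n ih =>
      rw [← ih, ← Gs_add_one hk 0 (hm _)]
      congr 1; push_cast; ring
  have hgrow : ∀ z ∈ Hset, z.im ≤ 1 → ‖Gs k 0 z‖ ≤
      (1 + T + ‖((-2 * Complex.I) ^ ((k : ℂ) / 2))⁻¹‖ * T) * z.im ^ (-((k : ℝ) / 2)) := by
    intro z hz him
    set y := z + (-⌊z.re⌋ : ℤ) with hy
    have hyi : y.im = z.im := by simp [hy]
    have hym : y ∈ Hset := by rw [Set.mem_ofPred_eq, hyi]; exact hz
    have hre : |y.re| ≤ 1 := by
      have h1 := Int.floor_le z.re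
      have h2 := Int.lt_floor_add_one z.re
      rw [hy, abs_le]
      simp
      constructor <;> linarith
    have n1 := norm_rowSum_le hB1 h hym hre (hyi ▸ him)
    have n2 := norm_rowSum_le hB2 h hym hre (hyi ▸ him)
    rw [← hT, hyi] at n1 n2
    have n3 : 1 ≤ z.im ^ (-((k : ℝ) / 2)) :=
      Real.one_le_rpow_of_pos_of_le_one_of_nonpos hz him (by linarith)
    rw [← hper z hz (-⌊z.re⌋), ← hy, Gs_zero_eq hk h hym]
    refine (norm_add_le _ _).trans ((add_le_add_left (norm_add_le _ _) _).trans ?_)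
    rw [norm_mul, norm_one]
    have := mul_le_mul_of_nonneg_left n2 (norm_nonneg (((-2 * Complex.I) ^ ((k : ℂ) / 2))⁻¹))
    linarith
  refine eq_th_pow hk8 hd (fun z hz => Gs_add_one hk 0 hz) (fun z hz => ?_) hinf
    (by linarith : 0 ≤ (k : ℝ) / 2) hgrow z hz
  rw [Gs_W 0 hz, uW]
  simp

end ThetaEisenstein
end

noncomputable section
namespace ThetaEisenstein
open Complex Filter Topology MeasureTheory
open scoped FourierTransform

/-! ### The Fourier transform of `(x + iy)^(-α) (x - iy)^(-β)` -/

/-- The function `(x + iy)^(-α) (x - iy)^(-β)`. -/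
def wav (y : ℝ) (α β : ℂ) (x : ℝ) : ℂ := (x + y * Complex.I) ^ (-α) * (x - y * Complex.I) ^ (-β)

/-- The majorant `|x + iy|^(-5/4)`. -/
def maj (y : ℝ) (x : ℝ) : ℝ := ‖(x : ℂ) + y * Complex.I‖ ^ (-(5 / 4) : ℝ)

variable {y : ℝ}

lemma add_mul_I_ne_zero (hy : 0 < y) (x : ℝ) : (x : ℂ) + y * Complex.I ≠ 0 := by
  intro h
  have := congrArg Complex.im h
  simp at this
  exact hy.ne' this

lemma sub_mul_I_ne_zero (hy : 0 < y) (x : ℝ) : (x : ℂ) - y * Complex.I ≠ 0 := by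
  intro h
  have := congrArg Complex.im h
  simp at this
  exact hy.ne' this

lemma norm_sub_mul_I (x y : ℝ) : ‖(x : ℂ) - y * Complex.I‖ = ‖(x : ℂ) + y * Complex.I‖ := by
  rw [← norm_conj]
  congr 1
  simp

lemma le_norm_add_mul_I (hy : 0 < y) (x : ℝ) : y ≤ ‖(x : ℂ) + y * Complex.I‖ := by
  have := abs_im_le_norm ((x : ℂ) + y * Complex.I)
  simpa [abs_of_pos hy] using this

lemma abs_le_norm_add_mul_I (x y : ℝ) : |x| ≤ ‖(x : ℂ) + y * Complex.I‖ := by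
  have := abs_re_le_norm ((x : ℂ) + y * Complex.I)
  simpa using this

lemma continuous_wav (hy : 0 < y) (α β : ℂ) : Continuous (wav y α β) := by
  unfold wav
  refine Continuous.mul ?_ ?_
  · exact Continuous.cpow (by fun_prop) continuous_const fun x => Or.inr (by simp [hy.ne'])
  · exact Continuous.cpow (by fun_prop) continuous_const fun x => Or.inr (by simp [hy.ne'])

lemma continuous_maj (hy : 0 < y) : Continuous (maj y) := by
  unfold maj
  exact Continuous.rpow_const (by fun_prop) fun x => Or.inl (norm_ne_zero_iff.2 (add_mul_I_ne_zero hy x))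

lemma integrable_maj (hy : 0 < y) : Integrable (maj y) := by
  have h := integrable_rpow_neg_one_add_norm_sq (E := ℝ) (μ := volume) (r := 5 / 4) (by simp; norm_num)
  refine (h.const_mul ((min 1 y) ^ (-(5 / 4) : ℝ))).mono' (continuous_maj hy).aestronglyMeasurable
    (Eventually.of_forall fun x => ?_)
  have hm : 0 < min 1 y := lt_min one_pos hy
  have hn : ‖(x : ℂ) + y * Complex.I‖ = (x ^ 2 + y ^ 2) ^ (1 / 2 : ℝ) := by
    rw [Complex.norm_def, normSq_add_mul_I, Real.sqrt_eq_rpow]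
  rw [Real.norm_of_nonneg (by unfold maj; positivity), maj, hn, ← Real.rpow_mul (by positivity)]
  have e : (min 1 y) ^ (-(5 / 4) : ℝ) = ((min 1 y) ^ 2) ^ (-(5 / 4) / 2 : ℝ) := by
    rw [← Real.rpow_natCast, ← Real.rpow_mul hm.le]
    norm_num
  rw [e, ← Real.mul_rpow (by positivity) (by positivity)]
  rw [show (1 / 2 * -(5 / 4) : ℝ) = -(5 / 4) / 2 by norm_num]
  refine Real.rpow_le_rpow_of_nonpos (by positivity) ?_ (by norm_num)
  rw [Real.norm_eq_abs, sq_abs]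
  have h1 : min 1 y ^ 2 ≤ 1 := pow_le_one₀ hm.le (min_le_left _ _)
  have h2 : min 1 y ^ 2 ≤ y ^ 2 := pow_le_pow_left₀ hm.le (min_le_right _ _) 2
  nlinarith [sq_nonneg x]

/-- The constant in the bound of `wav` by `maj`. -/
def majConst (y R : ℝ) : ℝ := Real.exp (2 * Real.pi * R) * (max 1 y⁻¹) ^ (2 * R)

lemma majConst_nonneg (y R : ℝ) : 0 ≤ majConst y R := by
  unfold majConst
  have : 0 ≤ max 1 y⁻¹ := le_max_of_le_left zero_le_one
  positivity

lemma norm_cpow_neg_le {z : ℂ} (hz : z ≠ 0) {α : ℂ} {R : ℝ} (hα : ‖α‖ ≤ R) :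
    ‖z ^ (-α)‖ ≤ Real.exp (Real.pi * R) * ‖z‖ ^ (-α.re) := by
  rw [norm_cpow_of_ne_zero hz, neg_re, neg_im, div_eq_mul_inv, ← Real.exp_neg, mul_comm]
  gcongr
  refine (le_abs_self _).trans ?_
  rw [mul_neg, neg_neg, abs_mul]
  exact mul_le_mul (abs_arg_le_pi z) ((abs_im_le_norm α).trans hα) (abs_nonneg _) Real.pi_pos.le

/-- The surplus of Re(α + β) over 5/4 is estimated with |x + iy| ≥ y, and the imaginary parts of the
two exponents cost at most e^{πR} each, as |arg| ≤ π. -/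
lemma norm_wav_le (hy : 0 < y) {α β : ℂ} {R : ℝ} (hα : ‖α‖ ≤ R) (hβ : ‖β‖ ≤ R)
    (h : 5 / 4 ≤ α.re + β.re) (x : ℝ) : ‖wav y α β x‖ ≤ majConst y R * maj y x := by
  have hz := add_mul_I_ne_zero hy x
  have hp := norm_pos_iff.2 hz
  have h1 := norm_cpow_neg_le hz hα
  have h2 := norm_cpow_neg_le (sub_mul_I_ne_zero hy x) hβ
  rw [norm_sub_mul_I] at h2
  rw [wav, norm_mul]
  refine (mul_le_mul h1 h2 (norm_nonneg _) (by positivity)).trans ?_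
  have hM : (1 : ℝ) ≤ max 1 y⁻¹ := le_max_left _ _
  have h3 : ‖(x : ℂ) + y * Complex.I‖ ^ (-(α.re + β.re - 5 / 4)) ≤ (max 1 y⁻¹) ^ (2 * R) := by
    calc _ ≤ y ^ (-(α.re + β.re - 5 / 4)) :=
          Real.rpow_le_rpow_of_nonpos hy (le_norm_add_mul_I hy x) (by linarith)
      _ = (y⁻¹) ^ (α.re + β.re - 5 / 4) := by rw [Real.rpow_neg hy.le, Real.inv_rpow hy.le]
      _ ≤ (max 1 y⁻¹) ^ (α.re + β.re - 5 / 4) :=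
          Real.rpow_le_rpow (inv_nonneg.2 hy.le) (le_max_right _ _) (by linarith)
      _ ≤ _ := Real.rpow_le_rpow_of_exponent_le hM (by
          have := (le_abs_self _).trans ((abs_re_le_norm α).trans hα)
          have := (le_abs_self _).trans ((abs_re_le_norm β).trans hβ)
          linarith)
  calc _ = (Real.exp (Real.pi * R) * Real.exp (Real.pi * R)) *
        (‖(x : ℂ) + y * Complex.I‖ ^ (-(α.re + β.re - 5 / 4)) * maj y x) := by
        rw [maj, ← Real.rpow_add hp, mul_mul_mul_comm, ← Real.rpow_add hp]
        congr 2
        ring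
    _ ≤ (Real.exp (Real.pi * R) * Real.exp (Real.pi * R)) * ((max 1 y⁻¹) ^ (2 * R) * maj y x) := by
        have : 0 ≤ maj y x := by unfold maj; positivity
        gcongr
    _ = _ := by
        rw [majConst, ← Real.exp_add, mul_assoc]
        congr 2
        ring

lemma integrable_wav (hy : 0 < y) {α β : ℂ} (h : 5 / 4 ≤ α.re + β.re) : Integrable (wav y α β) :=
  ((integrable_maj hy).const_mul _).mono' (continuous_wav hy α β).aestronglyMeasurable
    (Eventually.of_forall fun x => norm_wav_le hy (le_max_left ‖α‖ ‖β‖) (le_max_right _ _) h x)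

lemma hasDerivAt_wav (hy : 0 < y) (α β : ℂ) (x : ℝ) :
    HasDerivAt (wav y α β) (-α * wav y (α + 1) β x + -β * wav y α (β + 1) x) x := by
  have h1 : HasDerivAt (fun t : ℂ => t + y * Complex.I) 1 x := (hasDerivAt_id _).add_const _
  have h2 : HasDerivAt (fun t : ℂ => t - y * Complex.I) 1 x := (hasDerivAt_id _).sub_const _
  have s1 : (x : ℂ) + y * Complex.I ∈ slitPlane := Or.inr (by simp [hy.ne'])
  have s2 : (x : ℂ) - y * Complex.I ∈ slitPlane := Or.inr (by simp [hy.ne'])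
  have := ((h1.cpow_const (c := -α) s1).mul (h2.cpow_const (c := -β) s2)).comp_ofReal
  refine this.congr_deriv ?_
  simp only [wav]
  rw [show -(α + 1) = -α - 1 by ring, show -(β + 1) = -β - 1 by ring]
  ring

lemma integrable_fourierChar_smul {f : ℝ → ℂ} (hf : Integrable f) (ξ : ℝ) :
    Integrable fun x : ℝ => Real.fourierChar (-(x * ξ)) • f x := by
  have := (Real.fourierIntegral_convergent_iff (μ := volume) (f := f) ξ).2 hf
  simpa [mul_comm] using this

lemma norm_fourier_wav_le (hy : 0 < y) {α β : ℂ} {R : ℝ} (hα : ‖α‖ ≤ R) (hβ : ‖β‖ ≤ R)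
    (h : 5 / 4 ≤ α.re + β.re) (ξ : ℝ) :
    ‖𝓕 (wav y α β) ξ‖ ≤ majConst y R * ∫ x, maj y x := by
  rw [Real.fourier_real_eq, ← integral_const_mul]
  refine norm_integral_le_of_norm_le ((integrable_maj hy).const_mul _) (Eventually.of_forall fun x => ?_)
  rw [Circle.norm_smul]
  exact norm_wav_le hy hα hβ h x

/-- Integration by parts raises α or β by one, which stays within the range of the uniform bound;
iteration therefore gives any polynomial decay. -/
lemma fourier_wav_rec (hy : 0 < y) {α β : ℂ} (h : 5 / 4 ≤ α.re + β.re) (ξ : ℝ) :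
    2 * Real.pi * Complex.I * ξ * 𝓕 (wav y α β) ξ =
      -α * 𝓕 (wav y (α + 1) β) ξ + -β * 𝓕 (wav y α (β + 1)) ξ := by
  have i1 : Integrable (wav y (α + 1) β) := integrable_wav hy (by simp; linarith)
  have i2 : Integrable (wav y α (β + 1)) := integrable_wav hy (by simp; linarith)
  have hd : deriv (wav y α β) = fun x => -α * wav y (α + 1) β x + -β * wav y α (β + 1) x :=
    funext fun x => (hasDerivAt_wav hy α β x).deriv
  have := congrFun (Real.fourier_deriv (integrable_wav hy h)
    (fun x => (hasDerivAt_wav hy α β x).differentiableAt)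
    (hd ▸ (i1.const_mul _).add (i2.const_mul _))) ξ
  rw [smul_eq_mul] at this
  rw [← this, hd, Real.fourier_real_eq, Real.fourier_real_eq, Real.fourier_real_eq,
    ← integral_const_mul, ← integral_const_mul, ← integral_add]
  · refine integral_congr_ae (Eventually.of_forall fun x => ?_)
    simp only [Circle.smul_def, smul_eq_mul]
    ring
  · exact (integrable_fourierChar_smul i1 ξ).const_mul _
  · exact (integrable_fourierChar_smul i2 ξ).const_mul _

/-- Rapid decay of the Fourier transform, uniformly in bounded parameters. -/
lemma fourier_wav_decay (hy : 0 < y) (N : ℕ) : ∀ R : ℝ, ∃ C : ℝ, 0 ≤ C ∧ ∀ α β : ℂ, ‖α‖ ≤ R → ‖β‖ ≤ R →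
    5 / 4 ≤ α.re + β.re → ∀ ξ : ℝ, |2 * Real.pi * ξ| ^ N * ‖𝓕 (wav y α β) ξ‖ ≤ C := by
  induction N with
  | zero =>
    intro R
    have hm : 0 ≤ ∫ x, maj y x := integral_nonneg fun x => by unfold maj; positivity
    refine ⟨majConst y R * ∫ x, maj y x, mul_nonneg (majConst_nonneg _ _) hm,
      fun α β hα hβ h ξ => ?_⟩
    rw [pow_zero, one_mul]
    exact norm_fourier_wav_le hy hα hβ h ξ
  | succ N ih =>
    intro R
    obtain ⟨C, hC, hb⟩ := ih (R + 1)
    refine ⟨(|R| + |R|) * C, by positivity, fun α β hα hβ h ξ => ?_⟩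
    have h1 := hb (α + 1) β ((norm_add_le _ _).trans (by simpa using hα)) (by linarith)
      (by simp; linarith) ξ
    have h2 := hb α (β + 1) (by linarith) ((norm_add_le _ _).trans (by simpa using hβ))
      (by simp; linarith) ξ
    have hr := congrArg norm (fourier_wav_rec hy h ξ)
    have hl : ‖2 * Real.pi * Complex.I * ξ * 𝓕 (wav y α β) ξ‖ =
        |2 * Real.pi * ξ| * ‖𝓕 (wav y α β) ξ‖ := by
      simp [abs_mul, abs_of_pos Real.pi_pos]
    rw [pow_succ, mul_assoc, ← hl, hr]
    have hR := le_abs_self R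
    calc _ ≤ |2 * Real.pi * ξ| ^ N * (|R| * ‖𝓕 (wav y (α + 1) β) ξ‖ + |R| * ‖𝓕 (wav y α (β + 1)) ξ‖) := by
          gcongr
          refine (norm_add_le _ _).trans ?_
          rw [norm_mul, norm_mul, norm_neg, norm_neg]
          gcongr <;> linarith
      _ = |R| * (|2 * Real.pi * ξ| ^ N * ‖𝓕 (wav y (α + 1) β) ξ‖) +
          |R| * (|2 * Real.pi * ξ| ^ N * ‖𝓕 (wav y α (β + 1)) ξ‖) := by ring
      _ ≤ |R| * C + |R| * C := by gcongr
      _ = _ := by ring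

/-- Differentiation under the integral sign for holomorphic families with a common majorant. -/
lemma differentiableOn_integral_of_bound {F : ℂ → ℝ → ℂ} {U : Set ℂ} (hU : IsOpen U) {b : ℝ → ℝ}
    (hb : Integrable b) (hF : ∀ s ∈ U, Continuous (F s)) (hd : ∀ x, DifferentiableOn ℂ (F · x) U)
    (hle : ∀ s ∈ U, ∀ x, ‖F s x‖ ≤ b x) : DifferentiableOn ℂ (fun s => ∫ x, F s x) U := by
  intro s hs
  obtain ⟨r, hr, hball⟩ := Metric.isOpen_iff.1 hU s hs
  have hsub : ∀ w ∈ Metric.ball s (r / 2), Metric.closedBall w (r / 4) ⊆ U := fun w hw v hv =>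
    hball (by
      rw [Metric.mem_ball] at *
      rw [Metric.mem_closedBall] at hv
      linarith [dist_triangle v w s])
  have hdat : ∀ x, ∀ w ∈ Metric.ball s (r / 2), HasDerivAt (F · x) (deriv (F · x) w) w :=
    fun x w hw => ((hd x).differentiableAt (hU.mem_nhds (hsub w hw
      (Metric.mem_closedBall_self (by linarith))))).hasDerivAt
  -- The derivative in the parameter is a pointwise limit of continuous difference quotients. Its
  -- majorant b/(r/4) below is Cauchy's estimate.
  have hmeas : AEStronglyMeasurable (fun x => deriv (F · x) s) volume := by
    obtain ⟨u, hu0, hut⟩ := exists_seq_tendsto (𝓝[≠] (0 : ℂ))|>.imp fun u hu =>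
      (⟨fun _ => trivial, hu⟩ : (ℕ → True) ∧ _)
    have hev : ∀ᶠ n in atTop, s + u n ∈ U := by
      have : Tendsto (fun n => s + u n) atTop (𝓝 (s + 0)) :=
        tendsto_const_nhds.add (hut.mono_right nhdsWithin_le_nhds)
      rw [add_zero] at this
      exact this.eventually (hU.mem_nhds hs)
    obtain ⟨N, hN⟩ := eventually_atTop.1 hev
    refine aestronglyMeasurable_of_tendsto_ae atTop
      (f := fun n x => (u (n + N))⁻¹ * (F (s + u (n + N)) x - F s x)) (fun n => ?_)
      (Eventually.of_forall fun x => ?_)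
    · exact (continuous_const.mul ((hF _ (hN _ (by omega))).sub (hF _ hs))).aestronglyMeasurable
    · have := (hdat x s (Metric.mem_ball_self (by linarith))).tendsto_slope_zero
      exact this.comp (hut.comp (tendsto_add_atTop_nat N))
  have := (hasDerivAt_integral_of_dominated_loc_of_deriv_le (μ := volume) (F := F)
    (F' := fun s x => deriv (F · x) s) (x₀ := s) (bound := fun x => b x / (r / 4))
    (Metric.ball_mem_nhds s (half_pos hr))
    (by filter_upwards [hU.mem_nhds hs] with w hw using (hF w hw).aestronglyMeasurable)
    (hb.mono' (hF s hs).aestronglyMeasurable (Eventually.of_forall (hle s hs))) hmeas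
    (Eventually.of_forall fun x w hw => norm_deriv_le_of_forall_mem_sphere_norm_le (by linarith)
      (DifferentiableOn.diffContOnCl (((hd x).mono ((closure_minimal Metric.ball_subset_closedBall
        Metric.isClosed_closedBall).trans (hsub w hw)))))
      fun v hv => hle v (hsub w hw (Metric.sphere_subset_closedBall hv)) x)
    (hb.div_const _) (Eventually.of_forall fun x w hw => hdat x w hw)).2
  exact this.differentiableAt.differentiableWithinAt

/-- The Fourier coefficient of the Hecke term as a function of `s`. -/
def hw (y : ℝ) (n : ℤ) (s : ℂ) : ℂ := 𝓕 (wav y (3 / 2 + s) s) n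

/-- The half-plane in which the Fourier coefficients are considered. -/
def sHalf : Set ℂ := {s | -(1 / 8) < s.re}

lemma isOpen_sHalf : IsOpen sHalf := isOpen_lt continuous_const continuous_re

/-- The bound -1/8 in `sHalf` is the one that keeps 3/2 + 2 Re s above 5/4, hence above 1 with room
to spare. -/
lemma wav_exponents {s : ℂ} (hs : s ∈ sHalf) : 5 / 4 ≤ (3 / 2 + s).re + s.re := by
  have : -(1 / 8) < s.re := hs
  have h : (3 / 2 : ℂ).re = 3 / 2 := by norm_num
  rw [add_re, h]
  linarith

lemma norm_three_half_add_le (s : ℂ) : ‖3 / 2 + s‖ ≤ 2 + ‖s‖ := by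
  refine (norm_add_le _ _).trans ?_
  have : ‖(3 / 2 : ℂ)‖ = 3 / 2 := by norm_num
  linarith

lemma hw_differentiableOn (hy : 0 < y) (n : ℤ) : DifferentiableOn ℂ (hw y n) sHalf := by
  have key : ∀ R : ℝ, DifferentiableOn ℂ (hw y n) (sHalf ∩ Metric.ball 0 R) := by
    intro R
    unfold hw
    simp_rw [Real.fourier_real_eq]
    refine differentiableOn_integral_of_bound (isOpen_sHalf.inter Metric.isOpen_ball)
      ((integrable_maj hy).const_mul (majConst y (2 + R))) (fun s hs => ?_) (fun x => ?_)
      (fun s hs x => ?_)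
    · simp only [Circle.smul_def, Real.fourierChar_apply]
      have h1 : Continuous fun v : ℝ => cexp (↑(2 * Real.pi * -(v * (n : ℝ))) * Complex.I) := by
        fun_prop
      exact h1.smul (continuous_wav hy _ _)
    · simp only [Circle.smul_def, smul_eq_mul, wav]
      refine DifferentiableOn.const_mul (DifferentiableOn.mul ?_ ?_) _
      · exact (DifferentiableOn.const_cpow (by fun_prop) (Or.inl (add_mul_I_ne_zero hy x)))
      · exact (DifferentiableOn.const_cpow (by fun_prop) (Or.inl (sub_mul_I_ne_zero hy x)))
    · rw [Circle.norm_smul]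
      have h1 : ‖s‖ < R := by simpa using hs.2
      exact norm_wav_le hy (by linarith [norm_three_half_add_le s]) (by linarith)
        (wav_exponents hs.1) x
  intro s hs
  have hR : s ∈ sHalf ∩ Metric.ball 0 (‖s‖ + 1) := ⟨hs, by simp⟩
  exact ((key (‖s‖ + 1)).differentiableAt
    ((isOpen_sHalf.inter Metric.isOpen_ball).mem_nhds hR)).differentiableWithinAt

lemma hw_decay (hy : 0 < y) (N : ℕ) (R : ℝ) : ∃ C : ℝ, 0 ≤ C ∧ ∀ s ∈ sHalf, ‖s‖ ≤ R → ∀ n : ℤ,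
    (1 + |(n : ℝ)|) ^ N * ‖hw y n s‖ ≤ C := by
  obtain ⟨C0, hC0, h0⟩ := fourier_wav_decay hy 0 (2 + R)
  obtain ⟨C1, hC1, h1⟩ := fourier_wav_decay hy N (2 + R)
  refine ⟨C0 + 2 ^ N * C1, by positivity, fun s hs hsR n => ?_⟩
  have a0 := h0 (3 / 2 + s) s (by linarith [norm_three_half_add_le s]) (by linarith)
    (wav_exponents hs) n
  have a1 := h1 (3 / 2 + s) s (by linarith [norm_three_half_add_le s]) (by linarith)
    (wav_exponents hs) n
  rw [← hw] at a0 a1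
  rcases eq_or_ne n 0 with rfl | hn
  · simp only [Int.cast_zero, abs_zero, add_zero, one_pow, one_mul]
    simp at a0
    have : 0 ≤ 2 ^ N * C1 := by positivity
    linarith
  · have hn1 : (1 : ℝ) ≤ |(n : ℝ)| := by exact_mod_cast Int.one_le_abs hn
    have h2 : (1 + |(n : ℝ)|) ^ N ≤ 2 ^ N * |2 * Real.pi * n| ^ N := by
      rw [← mul_pow]
      gcongr
      rw [abs_mul, abs_of_pos (by positivity : 0 < 2 * Real.pi)]
      have := Real.pi_gt_three
      nlinarith
    calc _ ≤ (2 ^ N * |2 * Real.pi * n| ^ N) * ‖hw y n s‖ := by gcongr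
      _ = 2 ^ N * (|2 * Real.pi * n| ^ N * ‖hw y n s‖) := by ring
      _ ≤ 2 ^ N * C1 := by gcongr
      _ ≤ _ := by linarith

end ThetaEisenstein
end

noncomputable section
namespace ThetaEisenstein
open Complex Filter Topology MeasureTheory
open scoped FourierTransform

variable {y : ℝ}

/-! ### The Fourier coefficients at `s = 0` -/

/-- The function `√t e^(-2πyt)` on the positive half-line. -/
def gam (y t : ℝ) : ℂ := ((Real.sqrt t * Real.exp (-2 * Real.pi * y * t) : ℝ) : ℂ)

lemma continuous_gam (y : ℝ) : Continuous (gam y) := by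
  unfold gam
  fun_prop

lemma gam_of_nonpos {t : ℝ} (ht : t ≤ 0) : gam y t = 0 := by
  simp [gam, Real.sqrt_eq_zero_of_nonpos ht]

lemma integrable_gam (hy : 0 < y) : Integrable (gam y) := by
  have h : IntegrableOn (gam y) (Set.Ioi 0) := by
    have h1 := integrableOn_rpow_mul_exp_neg_mul_rpow (p := 1) (s := 1 / 2) (b := 2 * Real.pi * y)
      (by norm_num) one_pos (by positivity)
    have h2 : IntegrableOn (fun t : ℝ => ((t ^ (1 / 2 : ℝ) * Real.exp (-(2 * Real.pi * y) * t ^ (1 : ℝ)) : ℝ) : ℂ))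
      (Set.Ioi 0) := Integrable.ofReal h1
    refine h2.congr_fun (fun t ht => ?_) measurableSet_Ioi
    simp only [gam, Real.sqrt_eq_rpow, Real.rpow_one]
    congr 3
    ring
  rw [← integrableOn_univ, ← Set.Iic_union_Ioi (a := (0 : ℝ))]
  refine IntegrableOn.union ?_ h
  refine (integrableOn_zero).congr_fun (fun t ht => ?_) measurableSet_Iic
  exact (gam_of_nonpos ht).symm

/-- For real r this is the Gamma integral; both sides are holomorphic for Re r > 0, and the identity
theorem does the rest. -/
lemma integral_sqrt_mul_exp {r : ℂ} (hr : 0 < r.re) :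
    ∫ t : ℝ, (Real.sqrt t : ℂ) * cexp (-(r * t)) = (1 / r) ^ (3 / 2 : ℂ) * Complex.Gamma (3 / 2) := by
  have hU : IsOpen {r : ℂ | 0 < r.re} := isOpen_lt continuous_const continuous_re
  have hL : DifferentiableOn ℂ (fun r : ℂ => ∫ t : ℝ, (Real.sqrt t : ℂ) * cexp (-(r * t)))
      {r : ℂ | 0 < r.re} := by
    intro r hr
    have hr : 0 < r.re := hr
    have hV : IsOpen {w : ℂ | r.re / 2 < w.re} := isOpen_lt continuous_const continuous_re
    refine ((differentiableOn_integral_of_bound hV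
      (integrable_gam (y := r.re / 2 / (2 * Real.pi)) (by positivity)).norm (fun w _ => by fun_prop)
      (fun x => by fun_prop) (fun w hw x => ?_)).differentiableAt
      (hV.mem_nhds (show r.re / 2 < r.re by linarith))).differentiableWithinAt
    have hw : r.re / 2 < w.re := hw
    rcases le_or_gt x 0 with hx | hx
    · simp [Real.sqrt_eq_zero_of_nonpos hx]
    · rw [gam, ofReal_mul, norm_mul, norm_mul, Complex.norm_exp, norm_real (Real.exp _),
        Real.norm_of_nonneg (Real.exp_pos _).le]
      gcongr
      have e : -2 * Real.pi * (r.re / 2 / (2 * Real.pi)) * x = -(r.re / 2 * x) := by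
        field_simp
      rw [e]
      simp
      gcongr
  have hR : DifferentiableOn ℂ (fun r : ℂ => (1 / r) ^ (3 / 2 : ℂ) * Complex.Gamma (3 / 2))
      {r : ℂ | 0 < r.re} := by
    intro r hr
    have hr : 0 < r.re := hr
    have h0 : r ≠ 0 := fun h => by simp [h] at hr
    refine (DifferentiableAt.mul_const (DifferentiableAt.cpow_const ?_ ?_) _).differentiableWithinAt
    · exact (differentiableAt_const _).div differentiableAt_id h0
    · left
      rw [one_div, inv_re]
      exact div_pos hr (normSq_pos.2 h0)
  have hconn : IsPreconnected {r : ℂ | 0 < r.re} := (convex_halfSpace_re_gt 0).isPreconnected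
  refine (hL.analyticOnNhd hU).eqOn_of_preconnected_of_frequently_eq (hR.analyticOnNhd hU) hconn
    (z₀ := 1) (by simp) ?_ hr
  have ht : Tendsto (fun t : ℝ => (t : ℂ)) (𝓝[>] 1) (𝓝[≠] 1) := by
    refine tendsto_nhdsWithin_iff.2 ⟨?_, ?_⟩
    · exact (continuous_ofReal.tendsto' 1 1 (by simp)).mono_left nhdsWithin_le_nhds
    · filter_upwards [self_mem_nhdsWithin] with t ht
      have ht : 1 < t := ht
      simp only [Set.mem_compl_iff, Set.mem_singleton_iff]
      exact_mod_cast ht.ne'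
  refine ht.frequently (Eventually.frequently ?_)
  filter_upwards [self_mem_nhdsWithin] with r hr
  have hr : 0 < r := zero_lt_one.trans hr
  rw [← integral_cpow_mul_exp_neg_mul_Ioi (by norm_num) hr, ← integral_indicator measurableSet_Ioi]
  refine integral_congr_ae (Eventually.of_forall fun t => ?_)
  simp only
  by_cases ht : 0 < t
  · rw [Set.indicator_of_mem (Set.mem_Ioi.2 ht), Real.sqrt_eq_rpow, ofReal_cpow ht.le]
    congr 2
    push_cast; norm_num
  · rw [Set.indicator_of_notMem (s := Set.Ioi (0 : ℝ)) ht, Real.sqrt_eq_zero_of_nonpos (not_lt.1 ht)]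
    simp

lemma fourier_gam (hy : 0 < y) (ξ : ℝ) : 𝓕 (gam y) ξ =
    (1 / (2 * Real.pi * (y + Complex.I * ξ))) ^ (3 / 2 : ℂ) * Complex.Gamma (3 / 2) := by
  have hre : 0 < (2 * Real.pi * (y + Complex.I * ξ) : ℂ).re := by
    rw [show (2 * Real.pi * (y + Complex.I * ξ) : ℂ) = ((2 * Real.pi : ℝ) : ℂ) * (y + Complex.I * ξ) by
      push_cast; ring, re_ofReal_mul]
    simp
    positivity
  rw [Real.fourier_real_eq, ← integral_sqrt_mul_exp hre]
  refine integral_congr_ae (Eventually.of_forall fun t => ?_)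
  simp only
  rw [gam, Circle.smul_def, Real.fourierChar_apply, smul_eq_mul, ofReal_mul (Real.sqrt t), ofReal_exp,
    mul_left_comm, ← Complex.exp_add]
  congr 2
  push_cast; ring

lemma mul_I_cpow {w : ℂ} (hw : 0 < w.re) (s : ℂ) : (w * Complex.I) ^ s = w ^ s * Complex.I ^ s := by
  have hw0 : w ≠ 0 := fun h => by simp [h] at hw
  refine mul_cpow_of_arg hw0 I_ne_zero ?_ s
  rcases lt_or_ge 0 w.im with h | h
  · exact arg_add_of_im_pos h (by simp) (by simpa using hw)
  · exact arg_add_of_opposite h (fun _ => hw) (by simp)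

lemma ofReal_mul_cpow {r : ℝ} (hr : 0 < r) {w : ℂ} (hw : w ≠ 0) (s : ℂ) :
    ((r : ℂ) * w) ^ s = (r : ℂ) ^ s * w ^ s := by
  refine mul_cpow_of_arg (by exact_mod_cast hr.ne') hw ?_ s
  rw [arg_ofReal_of_nonneg hr.le, zero_add]
  exact ⟨neg_pi_lt_arg _, arg_le_pi _⟩

lemma two_pi_div_I_cpow :
    (2 * Real.pi / Complex.I) ^ (3 / 2 : ℂ) * Complex.I ^ (3 / 2 : ℂ) = (2 * Real.pi : ℂ) ^ (3 / 2 : ℂ) := by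
  have h : ((2 * Real.pi : ℝ) : ℂ) ≠ 0 := by exact_mod_cast (by positivity)
  rw [div_eq_mul_inv, show (2 * Real.pi : ℂ) = ((2 * Real.pi : ℝ) : ℂ) by push_cast; ring,
    ofReal_mul_cpow (by positivity) (by simp), inv_cpow _ _ (by rw [arg_I]; linarith [Real.pi_pos]),
    mul_assoc, inv_mul_cancel₀, mul_one]
  simp [cpow_eq_zero_iff]

lemma fourier_gam_eq_wav (hy : 0 < y) (ξ : ℝ) : 𝓕 (gam y) ξ =
    ((2 * Real.pi / Complex.I) ^ (3 / 2 : ℂ))⁻¹ * Complex.Gamma (3 / 2) * wav y (3 / 2) 0 (-ξ) := by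
  have hre : 0 < ((y : ℂ) + Complex.I * ξ).re := by simpa using hy
  have h0 : (y : ℂ) + Complex.I * ξ ≠ 0 := fun h => by rw [h] at hre; simp at hre
  have h2 : (2 * Real.pi : ℂ) = ((2 * Real.pi : ℝ) : ℂ) := by push_cast; ring
  have e : (((-ξ : ℝ) : ℂ) + y * Complex.I) = (y + Complex.I * ξ) * Complex.I := by
    push_cast
    linear_combination -(ξ : ℂ) * I_sq
  have hpi := two_pi_div_I_cpow
  have harg : ((2 * Real.pi : ℝ) : ℂ) * (y + Complex.I * ξ) ∈ slitPlane := by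
    left
    rw [re_ofReal_mul]
    positivity
  rw [fourier_gam hy, wav, neg_zero, cpow_zero, mul_one, e, mul_I_cpow hre, one_div, cpow_neg,
    cpow_neg, h2, inv_cpow _ _ (slitPlane_arg_ne_pi harg), ofReal_mul_cpow (by positivity) h0, ← h2,
    ← hpi, mul_inv, mul_inv]
  ring

lemma two_pi_div_I_cpow_ne_zero : (2 * Real.pi / Complex.I) ^ (3 / 2 : ℂ) ≠ 0 := by
  simp [cpow_eq_zero_iff, Real.pi_ne_zero]

/-- Fourier inversion applied to the transform of `gam`. The result is zero for t ≤ 0, which is why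
the central value of the Eisenstein series has no terms with n ≤ 0 apart from its constant 1. -/
lemma fourier_wav_zero (hy : 0 < y) (t : ℝ) : 𝓕 (wav y (3 / 2) 0) t =
    (2 * Real.pi / Complex.I) ^ (3 / 2 : ℂ) / Complex.Gamma (3 / 2) * gam y t := by
  have hG : Complex.Gamma (3 / 2) ≠ 0 := Complex.Gamma_ne_zero_of_re_pos (by norm_num)
  have hc := two_pi_div_I_cpow_ne_zero
  set c := ((2 * Real.pi / Complex.I) ^ (3 / 2 : ℂ))⁻¹ * Complex.Gamma (3 / 2) with hcdef
  have hF : 𝓕 (gam y) = fun ξ => c * wav y (3 / 2) 0 (-ξ) := funext fun ξ => fourier_gam_eq_wav hy ξ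
  have hi : Integrable (wav y (3 / 2) 0) := integrable_wav hy (by simp; norm_num)
  have h := (continuous_gam y).fourierInv_fourier_eq (integrable_gam hy)
    (hF ▸ (hi.comp_neg).const_mul c)
  have ht := congrFun h t
  rw [hF, Real.fourierInv_eq_fourier_comp_neg] at ht
  simp only [neg_neg] at ht
  have ht : 𝓕 (fun x => c * wav y (3 / 2) 0 x) t = gam y t := ht
  rw [← ht, Real.fourier_real_eq (wav _ _ _), Real.fourier_real_eq]
  have : ∀ v : ℝ, Real.fourierChar (-(v * t)) • (c * wav y (3 / 2) 0 v) =
      c * (Real.fourierChar (-(v * t)) • wav y (3 / 2) 0 v) := fun v => by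
    simp only [Circle.smul_def, smul_eq_mul]; ring
  simp_rw [this]
  have hcc : (2 * Real.pi / Complex.I) ^ (3 / 2 : ℂ) / Complex.Gamma (3 / 2) * c = 1 := by
    rw [hcdef]
    field_simp
  rw [integral_const_mul, ← mul_assoc, hcc, one_mul]

lemma hw_zero (hy : 0 < y) (n : ℤ) : hw y n 0 =
    (2 * Real.pi / Complex.I) ^ (3 / 2 : ℂ) / Complex.Gamma (3 / 2) * gam y n := by
  rw [hw, add_zero, fourier_wav_zero hy]

/-! ### The Fourier expansion of row sums -/

/-- The factor |w|^{-2s} splits as w^{-s} w̄^{-s}, since arg w̄ = -arg w off the negative axis. -/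
lemma heckeTerm_eq_wav (hy : 0 < y) (s : ℂ) (x : ℝ) :
    heckeTerm (3 / 2) s (x + y * Complex.I) = wav y (3 / 2 + s) s x := by
  have h0 := add_mul_I_ne_zero hy x
  have hc : (x : ℂ) - y * Complex.I = (starRingEnd ℂ) (x + y * Complex.I) := by
    simp [sub_eq_add_neg]
  have him : 0 < ((x : ℂ) + y * Complex.I).im := by simpa using hy
  have harg : arg ((starRingEnd ℂ) ((x : ℂ) + y * Complex.I)) = -arg (x + y * Complex.I) := by
    rw [arg_conj, if_neg]
    intro h
    rw [arg_eq_pi_iff] at h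
    linarith [h.2]
  rw [wav, hc, neg_add, cpow_add _ _ h0, heckeTerm, mul_assoc]
  congr 1
  rw [← mul_cpow_of_arg h0 ((map_ne_zero _).2 h0) (by rw [harg, add_neg_cancel]; constructor <;> linarith [Real.pi_pos]),
    mul_conj, normSq_eq_norm_sq, sq, ofReal_mul, mul_cpow_ofReal_nonneg (norm_nonneg _) (norm_nonneg _),
    ← cpow_add _ _ (by simpa using h0)]
  congr 1
  ring

lemma heckeTerm_natCast_mul {c : ℕ} (hc : 0 < c) (κ s : ℂ) {w : ℂ} (hw : w ≠ 0) :
    heckeTerm κ s (c * w) = (c : ℂ) ^ (-(κ + 2 * s)) * heckeTerm κ s w := by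
  have hc' : (0 : ℝ) < c := by exact_mod_cast hc
  have hc0 : (c : ℂ) ≠ 0 := by exact_mod_cast hc.ne'
  have h1 := ofReal_mul_cpow hc' hw (-κ)
  rw [ofReal_natCast] at h1
  rw [heckeTerm, h1, norm_mul, norm_natCast, ofReal_mul,
    mul_cpow_ofReal_nonneg hc'.le (norm_nonneg _), heckeTerm, ofReal_natCast, neg_add, cpow_add _ _ hc0]
  ring_nf

lemma summable_hw (hy : 0 < y) {s : ℂ} (hs : s ∈ sHalf) : Summable fun n : ℤ => ‖hw y n s‖ := by
  obtain ⟨C, hC, h⟩ := hw_decay hy 2 ‖s‖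
  refine Summable.of_nonneg_of_le (fun n => norm_nonneg _) (fun n => ?_)
    ((Real.summable_one_div_int_add_rpow (1 / 2) 2 |>.2 (by norm_num)).mul_left C)
  have := h s hs le_rfl n
  have h2 : |(n : ℝ) + 1 / 2| ^ (2 : ℝ) ≤ (1 + |(n : ℝ)|) ^ 2 := by
    rw [Real.rpow_two]
    refine pow_le_pow_left₀ (abs_nonneg _) ((abs_add_le _ _).trans ?_) 2
    rw [abs_of_pos (by norm_num : (0 : ℝ) < 1 / 2)]
    linarith
  have hpos : 0 < |(n : ℝ) + 1 / 2| ^ (2 : ℝ) := by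
    apply Real.rpow_pos_of_pos
    rw [abs_pos]
    intro h0
    have : (2 * n + 1 : ℝ) = 0 := by linarith
    have : (2 * n + 1 : ℤ) = 0 := by exact_mod_cast this
    omega
  rw [mul_one_div, le_div_iff₀ hpos]
  calc _ ≤ ‖hw y n s‖ * (1 + |(n : ℝ)|) ^ 2 := by gcongr
    _ ≤ C := by linarith

/-- The exponential `e(t) = e^(2πit)`. -/
def ef (t : ℂ) : ℂ := cexp (2 * Real.pi * Complex.I * t)

lemma ef_add (a b : ℂ) : ef (a + b) = ef a * ef b := by
  rw [ef, ef, ef, ← Complex.exp_add]; ring_nf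

lemma ef_int (n : ℤ) : ef n = 1 := by
  rw [ef, mul_comm]
  exact exp_int_mul_two_pi_mul_I n

lemma norm_ef_ofReal (t : ℝ) : ‖ef t‖ = 1 := by
  rw [ef, show 2 * Real.pi * Complex.I * (t : ℂ) = ((2 * Real.pi * t : ℝ) : ℂ) * Complex.I by
    push_cast; ring, norm_exp_ofReal_mul_I]

lemma poisson_wav (hy : 0 < y) {s : ℂ} (hs : s ∈ sHalf) (x : ℝ) :
    ∑' l : ℤ, wav y (3 / 2 + s) s (x + l) = ∑' n : ℤ, hw y n s * ef (n * x) := by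
  have h := Real.tsum_eq_tsum_fourier_of_rpow_decay_of_summable
    (continuous_wav hy (3 / 2 + s) s) (b := 5 / 4) (by norm_num) ?_ (summable_hw hy hs).of_norm x
  · rw [h]
    refine tsum_congr fun n => ?_
    rw [fourier_coe_apply, hw, ef]
    congr 2
    push_cast
    ring
  · refine Asymptotics.IsBigO.of_bound (majConst y (2 + ‖s‖)) ?_
    have h0 : ∀ᶠ t : ℝ in cocompact ℝ, t ≠ 0 := by
      have := (isCompact_singleton (x := (0 : ℝ))).compl_mem_cocompact
      filter_upwards [this] with t ht using ht
    filter_upwards [h0] with t ht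
    refine (norm_wav_le hy (norm_three_half_add_le s) (by linarith) (wav_exponents hs) t).trans ?_
    refine mul_le_mul_of_nonneg_left ?_ (majConst_nonneg _ _)
    rw [Real.norm_of_nonneg (by positivity), maj]
    exact Real.rpow_le_rpow_of_nonpos (abs_pos.2 ht) (abs_le_norm_add_mul_I t y) (by norm_num)

/-- The sum `∑_{r mod c} B(c, r) e(nr/c)`. -/
def klSum (B : ℕ → ℤ → ℂ) (n : ℤ) (c : ℕ) : ℂ := ∑ r ∈ Finset.range c, B c r * ef (n * r / c)

variable {B : ℕ → ℤ → ℂ}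

lemma norm_klSum_le (hB : ∀ c d, ‖B c d‖ ≤ 1) (n : ℤ) (c : ℕ) : ‖klSum B n c‖ ≤ c := by
  refine (norm_sum_le _ _).trans ?_
  calc _ ≤ ∑ r ∈ Finset.range c, (1 : ℝ) := Finset.sum_le_sum fun r _ => by
        rw [norm_mul, show (n * r / c : ℂ) = ((n * r / c : ℝ) : ℂ) by push_cast; ring, norm_ef_ofReal,
          mul_one]
        exact hB _ _
    _ = c := by simp

lemma tsum_int_residues {f : ℤ → ℂ} (hf : Summable f) {c : ℕ} (hc : 0 < c) :
    ∑' d, f d = ∑ r ∈ Finset.range c, ∑' l : ℤ, f (r + c * l) := by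
  have : NeZero c := ⟨hc.ne'⟩
  have hs := ((Equiv.prodComm _ _).trans (Int.divModEquiv c).symm).summable_iff.2 hf
  rw [← ((Equiv.prodComm _ _).trans (Int.divModEquiv c).symm).tsum_eq]
  refine (Summable.tsum_prod hs).trans ?_
  rw [tsum_fintype, ← Fin.sum_univ_eq_sum_range (fun r => ∑' l : ℤ, f (r + c * l))]
  refine Finset.sum_congr rfl fun r _ => tsum_congr fun l => ?_
  simp [Int.divModEquiv, add_comm, mul_comm]

/-- The sum over d is split into residues r modulo c and Poisson summation is applied at each x +
r/c; the phases e(nr/c) assemble the Kloosterman sum. -/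
lemma tsum_row (hper : ∀ c d, B c (d + c) = B c d) {z : ℂ} (hz : z ∈ Hset) {s : ℂ} (hs : s ∈ sHalf)
    {c : ℕ} (hc : 0 < c) (hsum : Summable fun d : ℤ => B c d * heckeTerm (3 / 2) s (c * z + d)) :
    ∑' d : ℤ, B c d * heckeTerm (3 / 2) s (c * z + d) =
      ∑' n : ℤ, (c : ℂ) ^ (-(3 / 2 + 2 * s)) * klSum B n c * (hw z.im n s * ef (n * z.re)) := by
  have hc0 : (c : ℂ) ≠ 0 := by exact_mod_cast hc.ne'
  have hy : 0 < z.im := hz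
  have hperl : ∀ (r l : ℤ), B c (r + c * l) = B c r := by
    intro r l
    induction l using Int.induction_on with
    | zero => simp
    | succ l ih => rw [← ih, ← hper c (r + c * l)]; congr 1; ring
    | pred l ih => rw [← ih, ← hper c (r + c * (-l - 1))]; congr 1; ring
  rw [tsum_int_residues hsum hc]
  have h1 : ∀ r : ℕ, ∑' l : ℤ, B c (r + c * l) * heckeTerm (3 / 2) s (c * z + ((r + c * l : ℤ) : ℂ)) =
      ∑' n : ℤ, (c : ℂ) ^ (-(3 / 2 + 2 * s)) * (B c r * ef (n * r / c)) *
        (hw z.im n s * ef (n * z.re)) := by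
    intro r
    have h2 : ∀ l : ℤ, B c (r + c * l) * heckeTerm (3 / 2) s (c * z + ((r + c * l : ℤ) : ℂ)) =
        (B c r * (c : ℂ) ^ (-(3 / 2 + 2 * s))) * wav z.im (3 / 2 + s) s ((z.re + r / c : ℝ) + l) := by
      intro l
      have e : (c : ℂ) * z + ((r + c * l : ℤ) : ℂ) =
          c * ((((z.re + r / c : ℝ) + l : ℝ) : ℂ) + z.im * Complex.I) := by
        conv_lhs => rw [← re_add_im z]
        push_cast
        field_simp
        ring
      rw [hperl, e, heckeTerm_natCast_mul hc _ _ (add_mul_I_ne_zero hy _), heckeTerm_eq_wav hy]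
      ring
    rw [tsum_congr h2, tsum_mul_left, poisson_wav hy hs, ← tsum_mul_left]
    refine tsum_congr fun n => ?_
    have e2 : (n : ℂ) * ((z.re + r / c : ℝ) : ℂ) = n * z.re + n * r / c := by push_cast; ring
    rw [e2, ef_add]
    ring
  have hsm : ∀ r : ℕ, Summable fun n : ℤ => (c : ℂ) ^ (-(3 / 2 + 2 * s)) * (B c r * ef (n * r / c)) *
        (hw z.im n s * ef (n * z.re)) := by
    intro r
    refine Summable.of_norm_bounded
      ((summable_hw hy hs).mul_left (‖(c : ℂ) ^ (-(3 / 2 + 2 * s))‖ * ‖B c r‖)) fun n => ?_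
    rw [norm_mul, norm_mul, norm_mul, norm_mul,
      show (n * r / c : ℂ) = ((n * r / c : ℝ) : ℂ) by push_cast; ring,
      show (n * z.re : ℂ) = ((n * z.re : ℝ) : ℂ) by push_cast; ring, norm_ef_ofReal, norm_ef_ofReal]
    simp
  rw [Finset.sum_congr rfl fun r _ => h1 r, ← Summable.tsum_finsetSum fun r _ => hsm r]
  refine tsum_congr fun n => ?_
  rw [klSum, Finset.mul_sum, Finset.sum_mul]

/-- The Dirichlet series of the sums `klSum B n c`. -/
def klZeta (B : ℕ → ℤ → ℂ) (n : ℤ) (s : ℂ) : ℂ :=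
  ∑' c : ℕ, ((c + 1 : ℕ) : ℂ) ^ (-(3 / 2 + 2 * s)) * klSum B n (c + 1)

lemma norm_klZeta_term_le (hB : ∀ c d, ‖B c d‖ ≤ 1) (n : ℤ) (s : ℂ) (c : ℕ) :
    ‖((c + 1 : ℕ) : ℂ) ^ (-(3 / 2 + 2 * s)) * klSum B n (c + 1)‖ ≤
      ((c + 1 : ℕ) : ℝ) ^ (-(1 / 2 + 2 * s.re)) := by
  have hc : (0 : ℝ) < ((c + 1 : ℕ) : ℝ) := by positivity
  rw [norm_mul, norm_natCast_cpow_of_pos (by omega)]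
  refine (mul_le_mul_of_nonneg_left (norm_klSum_le hB n (c + 1)) (by positivity)).trans_eq ?_
  conv_lhs => rw [← Real.rpow_one (((c + 1 : ℕ) : ℝ))]
  rw [Real.rpow_one, ← Real.rpow_add_one hc.ne']
  congr 1
  simp
  ring

lemma summable_klZeta_majorant {σ : ℝ} (h : 1 / 4 < σ) :
    Summable fun c : ℕ => ((c + 1 : ℕ) : ℝ) ^ (-(1 / 2 + 2 * σ)) :=
  (summable_nat_add_iff 1).2 (Real.summable_nat_rpow.2 (by linarith))

lemma summable_klZeta (hB : ∀ c d, ‖B c d‖ ≤ 1) (n : ℤ) {s : ℂ} (h : 1 / 4 < s.re) :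
    Summable fun c : ℕ => ((c + 1 : ℕ) : ℂ) ^ (-(3 / 2 + 2 * s)) * klSum B n (c + 1) :=
  Summable.of_norm_bounded (summable_klZeta_majorant h) fun c => norm_klZeta_term_le hB n s c

lemma summable_klZeta_term (hB : ∀ c d, ‖B c d‖ ≤ 1) (hy : 0 < y) (x : ℝ) {s : ℂ}
    (h : 1 / 4 < s.re) : Summable fun p : ℕ × ℤ => (((p.1 + 1 : ℕ) : ℂ) ^ (-(3 / 2 + 2 * s)) *
      klSum B p.2 (p.1 + 1)) * (hw y p.2 s * ef (p.2 * x)) := by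
  have hs : s ∈ sHalf := show -(1 / 8) < s.re by linarith
  refine Summable.of_norm_bounded ((summable_klZeta_majorant h).mul_of_nonneg (summable_hw hy hs)
    (fun c => by positivity) (fun n => norm_nonneg _)) fun p => ?_
  rw [norm_mul]
  refine mul_le_mul (norm_klZeta_term_le hB _ s _) ?_ (norm_nonneg _) (by positivity)
  rw [norm_mul, show (p.2 * x : ℂ) = ((p.2 * x : ℝ) : ℂ) by push_cast; ring, norm_ef_ofReal,
    mul_one]

/-- The Fourier expansion of a row sum in the region of absolute convergence. -/
lemma rowSum_eq_tsum (hB : ∀ c d, ‖B c d‖ ≤ 1) (hper : ∀ c d, B c (d + c) = B c d) {z : ℂ}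
    (hz : z ∈ Hset) {s : ℂ} (h : 1 / 4 < s.re) :
    rowSum B (3 / 2) s z = ∑' n : ℤ, klZeta B n s * (hw z.im n s * ef (n * z.re)) := by
  have hs : s ∈ sHalf := show -(1 / 8) < s.re by linarith
  have hsum : Summable fun p : ℕ × ℤ => B (p.1 + 1) p.2 * heckeTerm (3 / 2) s (posRow z p) := by
    have := summable_rowSum hB (κ := 3 / 2) (s := s) (by linarith) hz
    rwa [show (((3 / 2 : ℝ)) : ℂ) = 3 / 2 by push_cast; rfl] at this
  have h1 : ∀ c : ℕ, ∑' d : ℤ, B (c + 1) d * heckeTerm (3 / 2) s (posRow z (c, d)) =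
      ∑' n : ℤ, (((c + 1 : ℕ) : ℂ) ^ (-(3 / 2 + 2 * s)) * klSum B n (c + 1)) *
        (hw z.im n s * ef (n * z.re)) := fun c => by
    have hf := hsum.prod_factor c
    simp only [posRow] at hf ⊢
    exact tsum_row (c := c + 1) hper hz hs (Nat.succ_pos c) hf
  have hS := summable_klZeta_term hB (show 0 < z.im from hz) z.re h
  rw [rowSum, hsum.tsum_prod, tsum_congr h1]
  refine (hS.tsum_comm (f := fun c n => (((c + 1 : ℕ) : ℂ) ^ (-(3 / 2 + 2 * s)) *
      klSum B n (c + 1)) * (hw z.im n s * ef (n * z.re)))).symm.trans ?_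
  exact tsum_congr fun n => by rw [tsum_mul_right, klZeta]

end ThetaEisenstein
end

noncomputable section
namespace ThetaEisenstein
open Complex Filter Topology HurwitzZeta

/-! ### Theta asymptotics at rational points and quadratic Gauss sums -/

/-- The quadratic Gauss sum `∑_{x mod q} e(r x² / q)`. -/
def qGauss (r : ℤ) (q : ℕ) : ℂ := ∑ x ∈ Finset.range q, ef (r * x ^ 2 / q)

lemma cosKernel_tendsto (a : UnitAddCircle) : Tendsto (cosKernel a) atTop (𝓝 1) := by
  obtain ⟨p, hp, h⟩ := isBigO_atTop_cosKernel_sub a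
  have h1 : Tendsto (fun x => Real.exp (-p * x)) atTop (𝓝 0) :=
    Real.tendsto_exp_atBot.comp (tendsto_id.const_mul_atTop_of_neg (by linarith))
  have := (h.trans_tendsto h1).add_const 1
  simpa using this

/-- A point approaching the rational number `r / q` vertically. -/
def vpt (r : ℤ) (q : ℕ) (T : ℝ) : ℂ := r / q + Complex.I / (2 * q ^ 2 * T)

lemma vpt_im {r : ℤ} {q : ℕ} {T : ℝ} : (vpt r q T).im = 1 / (2 * q ^ 2 * T) := by
  have h1 : ((r : ℂ) / q) = ((r / q : ℝ) : ℂ) := by push_cast; rfl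
  have h2 : Complex.I / (2 * (q : ℂ) ^ 2 * T) = ((1 / (2 * q ^ 2 * T) : ℝ) : ℂ) * Complex.I := by
    push_cast; ring
  rw [vpt, h1, h2, add_im, ofReal_im, im_ofReal_mul, I_im, mul_one, zero_add]

lemma vpt_mem (r : ℤ) {q : ℕ} (hq : 0 < q) {T : ℝ} (hT : 0 < T) : vpt r q T ∈ Hset := by
  have hq' : (0 : ℝ) < q := by exact_mod_cast hq
  rw [Set.mem_ofPred_eq, vpt_im]
  positivity

/-- The height 1/(2q²T) makes n = x + ql contribute e(rx²/q) e^{-π(l + x/q)²/T}. For each x the sum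
over l is a theta kernel, inverted by its functional equation. -/
lemma th_vpt (r : ℤ) {q : ℕ} (hq : 0 < q) {T : ℝ} (hT : 0 < T) : th (vpt r q T) / Real.sqrt T =
    ∑ x ∈ Finset.range q, ef (r * x ^ 2 / q) * cosKernel ((x / q : ℝ) : UnitAddCircle) T := by
  have hq' : (0 : ℝ) < q := by exact_mod_cast hq
  have hqc : (q : ℂ) ≠ 0 := by exact_mod_cast hq.ne'
  have hTc : (T : ℂ) ≠ 0 := by exact_mod_cast hT.ne'
  have hsum : Summable fun n : ℤ => cexp (Real.pi * Complex.I * n ^ 2 * (2 * vpt r q T)) := by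
    have hτ : 0 < (2 * vpt r q T).im := by
      have : 0 < (vpt r q T).im := vpt_mem r hq hT
      simpa using this
    have := (hasSum_jacobiTheta₂_term 0 hτ).summable
    simpa [jacobiTheta₂_term] using this
  have hterm : ∀ (x : ℕ) (l : ℤ), cexp (Real.pi * Complex.I * ((x + q * l : ℤ) : ℂ) ^ 2 * (2 * vpt r q T)) =
      ef (r * x ^ 2 / q) * (Real.exp (-Real.pi * (l + x / q) ^ 2 * (1 / T)) : ℝ) := by
    intro x l
    rw [← mul_one (ef _), ← ef_int (r * (2 * x * l + q * l ^ 2)), ← ef_add, ef, ofReal_exp,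
      ← Complex.exp_add]
    congr 1
    rw [vpt]
    push_cast
    field_simp
    linear_combination ((x + q * l : ℂ) ^ 2) * I_sq
  have hT2 : (1 / T) ^ (1 / 2 : ℝ) = 1 / Real.sqrt T := by
    rw [← Real.sqrt_eq_rpow, Real.sqrt_div zero_le_one, Real.sqrt_one]
  have hs0 : (Real.sqrt T : ℂ) ≠ 0 := by exact_mod_cast (Real.sqrt_pos.2 hT).ne'
  rw [th, jacobiTheta, tsum_int_residues hsum hq, Finset.sum_div]
  refine Finset.sum_congr rfl fun x _ => ?_
  have h1 := (hasSum_ofReal.2 (hasSum_int_evenKernel (x / q : ℝ) (one_div_pos.2 hT))).mul_left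
    (ef (r * x ^ 2 / q))
  rw [tsum_congr (hterm x), h1.tsum_eq, evenKernel_functional_equation, one_div_one_div, hT2]
  push_cast
  field_simp

lemma th_vpt_tendsto (r : ℤ) {q : ℕ} (hq : 0 < q) :
    Tendsto (fun T : ℝ => th (vpt r q T) / Real.sqrt T) atTop (𝓝 (qGauss r q)) := by
  have h : Tendsto (fun T : ℝ => ∑ x ∈ Finset.range q,
      ef (r * x ^ 2 / q) * cosKernel ((x / q : ℝ) : UnitAddCircle) T) atTop
      (𝓝 (∑ x ∈ Finset.range q, ef (r * x ^ 2 / q) * ((1 : ℝ) : ℂ))) :=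
    tendsto_finsetSum _ fun x _ => tendsto_const_nhds.mul
      ((continuous_ofReal.tendsto _).comp (cosKernel_tendsto _))
  simp only [ofReal_one, mul_one] at h
  refine h.congr' ?_
  filter_upwards [eventually_gt_atTop 0] with T hT
  exact (th_vpt r hq hT).symm

lemma th_tendsto : Tendsto th imInf (𝓝 1) := by
  refine jacobiTheta_tendsto.comp (tendsto_comap_iff.2 ?_)
  have : (Complex.im ∘ fun z : ℂ => 2 * z) = fun z => 2 * z.im := by ext z; simp
  rw [this]
  exact tendsto_comap.const_mul_atTop two_pos

lemma conj_ef (t : ℝ) : (starRingEnd ℂ) (ef t) = ef (-t) := by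
  rw [ef, ef, ← exp_conj]
  congr 1
  simp [map_ofNat (starRingEnd ℂ) 2]

lemma conj_qGauss (r : ℤ) (q : ℕ) : (starRingEnd ℂ) (qGauss r q) = qGauss (-r) q := by
  rw [qGauss, map_sum, qGauss]
  refine Finset.sum_congr rfl fun x _ => ?_
  rw [show (r * x ^ 2 / q : ℂ) = ((r * x ^ 2 / q : ℝ) : ℂ) by push_cast; ring, conj_ef]
  congr 1
  push_cast
  ring

/-- Since ε_d⁴ = 1, conjugation takes ε_d to ε_d³; Gauss sums found from the law of θ itself thus
give the multipliers for k = 3. -/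
lemma conj_rowCoeff_one (c d : ℤ) : (starRingEnd ℂ) (rowCoeff 1 c d) = rowCoeff 3 c d := by
  unfold rowCoeff
  split_ifs
  · rw [map_mul, map_intCast, pow_one]
    congr 1
    unfold eps
    split_ifs <;> simp
  · simp

lemma conj_I_cpow_half_mul : (starRingEnd ℂ) (Complex.I ^ (1 / 2 : ℂ)) * Complex.I ^ (1 / 2 : ℂ) = 1 := by
  have hs : (Real.sqrt 2 : ℂ) ^ 2 = 2 := by exact_mod_cast Real.sq_sqrt two_pos.le
  have hs0 : (Real.sqrt 2 : ℂ) ≠ 0 := by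
    intro h0; rw [h0] at hs; norm_num at hs
  rw [I_cpow_half]
  simp
  field_simp
  linear_combination -hs - I_sq

/-- Theta is evaluated in two ways as z descends to -d/c. Directly, its size is governed by the
Gauss sum; by the transformation law, γz has height 2T and theta at γz tends to 1. -/
lemma qGauss_neg_infty {c : ℕ} {d : ℤ} (hc : 0 < c) (h4 : (4 : ℤ) ∣ c) (hcd : IsCoprime (c : ℤ) d) :
    qGauss (-d) c = rowCoeff 1 c d * Real.sqrt (2 * c) * (Complex.I ^ (1 / 2 : ℂ))⁻¹ := by
  have hc' : (0 : ℝ) < c := by exact_mod_cast hc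
  have hcc : (c : ℂ) ≠ 0 := by exact_mod_cast hc.ne'
  obtain ⟨u, v, huv⟩ := hcd
  have hab : v * d - (-u) * (c : ℤ) = 1 := by linear_combination huv
  refine tendsto_nhds_unique (th_vpt_tendsto (-d) hc) ?_
  have hrow : ∀ T : ℝ, 0 < T → ((c : ℤ) : ℂ) * vpt (-d) c T + d = ((1 / (2 * c * T) : ℝ) : ℂ) * Complex.I := by
    intro T hT
    have : (T : ℂ) ≠ 0 := by exact_mod_cast hT.ne'
    rw [vpt]
    push_cast
    field_simp
    ring
  have hlim : Tendsto (fun T : ℝ => th (((v : ℂ) * vpt (-d) c T + (-u : ℤ)) / (((c : ℤ) : ℂ) * vpt (-d) c T + d)))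
      atTop (𝓝 1) := by
    refine th_tendsto.comp (tendsto_comap_iff.2 ?_)
    have h2 : Tendsto (fun T : ℝ => 2 * T) atTop atTop := tendsto_id.const_mul_atTop two_pos
    refine h2.congr' ?_
    filter_upwards [eventually_gt_atTop 0] with T hT
    simp only [Function.comp_apply]
    rw [moebius_im hab, hrow T hT, vpt_im, map_mul, normSq_ofReal, normSq_I]
    field_simp
  have := (hlim.mul_const (rowCoeff 1 c d * Real.sqrt (2 * c) * (Complex.I ^ (1 / 2 : ℂ))⁻¹))
  rw [one_mul] at this
  refine this.congr' ?_
  filter_upwards [eventually_gt_atTop 0] with T hT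
  have hth := th_pow_mul_rowCoeff (k := 1) odd_one hab h4 (vpt_mem (-d) hc hT)
  rw [pow_one, pow_one, hrow T hT, ofReal_mul_cpow (by positivity) I_ne_zero] at hth
  rw [← hth, hrow T hT]
  have e1 : (((1 / (2 * c * T) : ℝ)) : ℂ) ^ (-(((1 : ℕ) : ℂ) / 2)) = Real.sqrt (2 * c) * Real.sqrt T := by
    rw [show (-(((1 : ℕ) : ℂ) / 2)) = ((-(1 / 2) : ℝ) : ℂ) by push_cast; ring, ← ofReal_cpow (by positivity),
      one_div, Real.inv_rpow (by positivity), ← Real.rpow_neg (by positivity), neg_neg,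
      ← Real.sqrt_eq_rpow, Real.sqrt_mul (by positivity), ofReal_mul]
  have e2 : Complex.I ^ (-(((1 : ℕ) : ℂ) / 2)) = (Complex.I ^ (1 / 2 : ℂ))⁻¹ := by
    rw [← cpow_neg]; push_cast; rfl
  have hs0 : (Real.sqrt T : ℂ) ≠ 0 := by exact_mod_cast (Real.sqrt_pos.2 hT).ne'
  rw [e1, e2]
  field_simp

lemma W_im (z : ℂ) : (-1 / (4 * z)).im = z.im / (4 * normSq z) := by
  rw [neg_div, neg_im, one_div, inv_im, map_mul]
  rw [show (4 * z).im = 4 * z.im by simp, show normSq 4 = 16 by simp; norm_num]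
  ring

/-- The same comparison at -b/a, now after applying W, which reaches the odd denominators. The
transformed point has height T/2. -/
lemma qGauss_neg_zero {a : ℕ} {b : ℤ} (ha : 0 < a) (hab : IsCoprime (-4 * b) (a : ℤ)) :
    qGauss (-b) a = rowCoeff 1 (-4 * b) a * Real.sqrt a := by
  have ha' : (0 : ℝ) < a := by exact_mod_cast ha
  have hac : (a : ℂ) ≠ 0 := by exact_mod_cast ha.ne'
  obtain ⟨u, v, huv⟩ := hab
  have hdet : v * (a : ℤ) - (-u) * (-4 * b) = 1 := by linear_combination huv
  refine tendsto_nhds_unique (th_vpt_tendsto (-b) ha) ?_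
  have hup : ∀ T : ℝ, 0 < T → (a : ℂ) * vpt (-b) a T + b = ((1 / (2 * a * T) : ℝ) : ℂ) * Complex.I := by
    intro T hT
    have : (T : ℂ) ≠ 0 := by exact_mod_cast hT.ne'
    rw [vpt]
    push_cast
    field_simp
    ring
  have hrow : ∀ T : ℝ, 0 < T → ((-4 * b : ℤ) : ℂ) * (-1 / (4 * vpt (-b) a T)) + (a : ℤ) =
      ((1 / (2 * a * T) : ℝ) : ℂ) * Complex.I / vpt (-b) a T := by
    intro T hT
    have h0 := ne_zero_of_Hset (vpt_mem (-b) ha hT)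
    rw [← hup T hT]
    field_simp
    push_cast
    ring
  have hlim : Tendsto (fun T : ℝ => th (((v : ℂ) * (-1 / (4 * vpt (-b) a T)) + (-u : ℤ)) /
      (((-4 * b : ℤ) : ℂ) * (-1 / (4 * vpt (-b) a T)) + (a : ℤ)))) atTop (𝓝 1) := by
    refine th_tendsto.comp (tendsto_comap_iff.2 ?_)
    have h2 : Tendsto (fun T : ℝ => 1 / 2 * T) atTop atTop := tendsto_id.const_mul_atTop (by norm_num)
    refine h2.congr' ?_
    filter_upwards [eventually_gt_atTop 0] with T hT
    have h0 := normSq_pos.2 (ne_zero_of_Hset (vpt_mem (-b) ha hT))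
    simp only [Function.comp_apply]
    rw [moebius_im hdet, hrow T hT, map_div₀, map_mul, normSq_ofReal, normSq_I, W_im, vpt_im]
    field_simp
    norm_num
  have := (hlim.mul_const (rowCoeff 1 (-4 * b) a * Real.sqrt a))
  rw [one_mul] at this
  refine this.congr' ?_
  filter_upwards [eventually_gt_atTop 0] with T hT
  have hz := vpt_mem (-b) ha hT
  have hth := th_pow_mul_rowCoeff (k := 1) odd_one hdet ⟨-b, by ring⟩ (W_mem hz)
  rw [th_W_pow 1 hz, pow_one, pow_one, hrow T hT] at hth
  rw [hrow T hT]
  have huI : ((1 / (2 * a * T) : ℝ) : ℂ) * Complex.I ∈ Hset := by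
    rw [Set.mem_ofPred_eq, im_ofReal_mul, I_im]
    positivity
  have h1 := cpow_div_of_Hset huI hz (((1 : ℕ) : ℂ) / 2)
  rw [← uW] at h1
  have h2 : (-2 * Complex.I) ^ (((1 : ℕ) : ℂ) / 2) *
      (((1 / (2 * a * T) : ℝ) : ℂ) * Complex.I) ^ (((1 : ℕ) : ℂ) / 2) =
        (Real.sqrt a : ℂ)⁻¹ * (Real.sqrt T : ℂ)⁻¹ := by
    rw [← mul_cpow_of_arg (by simp) (ne_zero_of_Hset huI)
      (arg_add_of_opposite (by simp) (by simp) huI),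
      show (-2 * Complex.I) * (((1 / (2 * a * T) : ℝ) : ℂ) * Complex.I) = ((1 / (a * T) : ℝ) : ℂ) by
        push_cast; field_simp; linear_combination -(T : ℂ)⁻¹ * I_sq,
      show ((((1 : ℕ) : ℂ) / 2)) = ((1 / 2 : ℝ) : ℂ) by push_cast; ring, ← ofReal_cpow (by positivity),
      ← Real.sqrt_eq_rpow, one_div, Real.sqrt_inv, Real.sqrt_mul (by positivity), mul_inv]
    push_cast
    rfl
  rw [h2] at h1
  have hs0 : (Real.sqrt T : ℂ) ≠ 0 := by exact_mod_cast (Real.sqrt_pos.2 hT).ne'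
  have hs1 : (Real.sqrt a : ℂ) ≠ 0 := by exact_mod_cast (Real.sqrt_pos.2 ha').ne'
  have hu := uW_ne_zero 1 hz
  rw [cpow_neg] at hth
  have h3 : ((((1 / (2 * a * T) : ℝ) : ℂ) * Complex.I) / vpt (-b) a T) ^ (((1 : ℕ) : ℂ) / 2) ≠ 0 := by
    intro h; rw [h, mul_zero] at h1
    exact mul_ne_zero (inv_ne_zero hs1) (inv_ne_zero hs0) h1.symm
  generalize ((((1 / (2 * a * T) : ℝ) : ℂ) * Complex.I) / vpt (-b) a T) ^ (((1 : ℕ) : ℂ) / 2) = x at *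
  generalize uW 1 (vpt (-b) a T) = U at *
  generalize th (((v : ℂ) * (-1 / (4 * vpt (-b) a T)) + (-u : ℤ)) / _) = t at *
  generalize th (vpt (-b) a T) = t' at *
  generalize (Real.sqrt a : ℂ) = sa at *
  generalize (Real.sqrt T : ℂ) = sT at *
  rw [eq_div_iff hs0]
  apply mul_left_cancel₀ hu
  rw [← hth]
  have h4 : U * x * sa * sT = 1 := by rw [h1]; field_simp
  have h5 : x⁻¹ = U * sa * sT := inv_eq_of_mul_eq_one_right (by linear_combination h4)
  rw [h5]
  ring

/-- The row coefficients at `∞` are normalized quadratic Gauss sums. -/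
lemma qGauss_infty {c : ℕ} {d : ℤ} (hc : 0 < c) (h4 : (4 : ℤ) ∣ c) (hcd : IsCoprime (c : ℤ) d) :
    qGauss d c = rowCoeff 3 c d * Real.sqrt (2 * c) * Complex.I ^ (1 / 2 : ℂ) := by
  have h := congrArg (starRingEnd ℂ) (qGauss_neg_infty hc h4 hcd)
  have hI := conj_I_cpow_half_mul
  rw [conj_qGauss, neg_neg, map_mul, map_mul, conj_rowCoeff_one, map_inv₀, conj_ofReal,
    eq_inv_of_mul_eq_one_left hI, inv_inv] at h
  exact h

/-- The row coefficients at `0` are normalized quadratic Gauss sums. -/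
lemma qGauss_zero {a : ℕ} {b : ℤ} (ha : 0 < a) (hab : IsCoprime (-4 * b) (a : ℤ)) :
    qGauss b a = rowCoeffZero 3 a b * Real.sqrt a := by
  have h := congrArg (starRingEnd ℂ) (qGauss_neg_zero ha hab)
  rw [conj_qGauss, neg_neg, map_mul, conj_rowCoeff_one, conj_ofReal] at h
  exact h

end ThetaEisenstein
end

noncomputable section
namespace ThetaEisenstein
open Complex

/-! ### Kloosterman sums and counts of square roots -/

/-- The number of `x mod d` with `x² ≡ -n mod d`. -/
def cntSq (n : ℤ) (d : ℕ) : ℕ :=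
  ((Finset.range d).filter fun x : ℕ => (d : ℤ) ∣ (x : ℤ) ^ 2 + n).card

/-- The counting function as an arithmetic function. -/
def cnt (n : ℤ) : ArithmeticFunction ℤ := ⟨fun d => cntSq n d, by simp [cntSq]⟩

/-- The Möbius transform of the counting function. -/
def beta (n : ℤ) : ArithmeticFunction ℤ := ArithmeticFunction.moebius * cnt n

lemma ef_eq_one_iff {m : ℤ} {c : ℕ} (hc : 0 < c) : ef (m / c) = 1 ↔ (c : ℤ) ∣ m := by
  have hcc : (c : ℂ) ≠ 0 := by exact_mod_cast hc.ne'
  have hpi : (2 * Real.pi * Complex.I : ℂ) ≠ 0 := by simp [Real.pi_ne_zero]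
  rw [ef, exp_eq_one_iff]
  constructor
  · rintro ⟨k, hk⟩
    refine ⟨k, ?_⟩
    rw [mul_comm (k : ℂ)] at hk
    have := mul_left_cancel₀ hpi hk
    rw [div_eq_iff hcc] at this
    have h : ((m : ℤ) : ℂ) = ((c * k : ℤ) : ℂ) := by rw [this]; push_cast; ring
    exact_mod_cast h
  · rintro ⟨k, rfl⟩
    refine ⟨k, ?_⟩
    push_cast
    field_simp

lemma ef_nat_mul (d : ℕ) (t : ℂ) : ef (d * t) = ef t ^ d := by
  rw [ef, ef, ← Complex.exp_nat_mul]
  ring_nf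

lemma ef_add_int (t : ℂ) (n : ℤ) : ef (t + n) = ef t := by rw [ef_add, ef_int, mul_one]

lemma sum_ef (m : ℤ) {c : ℕ} (hc : 0 < c) :
    ∑ d ∈ Finset.range c, ef (d * m / c) = if (c : ℤ) ∣ m then (c : ℂ) else 0 := by
  have h1 : ∀ d : ℕ, ef (d * m / c) = ef (m / c) ^ d := fun d => by
    rw [← ef_nat_mul, mul_div_assoc]
  simp_rw [h1]
  split_ifs with h
  · rw [(ef_eq_one_iff hc).2 h]
    simp
  · have hne : ef (m / c) ≠ 1 := fun h' => h ((ef_eq_one_iff hc).1 h')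
    have hcc : (c : ℂ) ≠ 0 := by exact_mod_cast hc.ne'
    rw [geom_sum_eq hne, ← ef_nat_mul, mul_div_cancel₀ _ hcc, ef_int]
    simp

/-- Sums over residues of functions of the reduced fraction. -/
lemma sum_range_eq_sum_divisors {f : ℕ → ℕ → ℂ} (hf : ∀ g d c, 0 < g → f (g * d) (g * c) = f d c)
    {c : ℕ} (hc : 0 < c) : ∑ d ∈ Finset.range c, f d c =
      ∑ e ∈ c.divisors, ∑ d ∈ Finset.range e with d.Coprime e, f d e := by
  rw [← Finset.sum_fiberwise_of_maps_to (t := c.divisors) (g := fun d => c / c.gcd d)]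
  · refine Finset.sum_congr rfl fun e he => ?_
    obtain ⟨⟨g, rfl⟩, -⟩ := Nat.mem_divisors.1 he
    have he0 : 0 < e := Nat.pos_of_mul_pos_right hc |> fun h => by
      rcases Nat.eq_zero_or_pos e with rfl | h'
      · simp at hc
      · exact h'
    have hg0 : 0 < g := by
      rcases Nat.eq_zero_or_pos g with rfl | h'
      · simp at hc
      · exact h'
    symm
    refine Finset.sum_nbij' (fun d => g * d) (fun d => d / g) ?_ ?_ ?_ ?_ ?_
    · intro d hd
      simp only [Finset.mem_filter, Finset.mem_range] at hd ⊢
      refine ⟨by rw [mul_comm e]; exact Nat.mul_lt_mul_of_pos_left hd.1 hg0, ?_⟩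
      rw [mul_comm e, Nat.gcd_mul_left, (Nat.Coprime.symm hd.2 : Nat.gcd e d = 1), mul_one,
        Nat.mul_div_cancel_left _ hg0]
    · intro d hd
      simp only [Finset.mem_filter, Finset.mem_range] at hd ⊢
      have hgcd : (e * g).gcd d = g := by
        have h1 := Nat.div_mul_cancel (Nat.gcd_dvd_left (e * g) d)
        rw [hd.2] at h1
        exact Nat.eq_of_mul_eq_mul_left he0 h1
      obtain ⟨d', rfl⟩ : g ∣ d := hgcd ▸ Nat.gcd_dvd_right (e * g) d
      rw [Nat.mul_div_cancel_left _ hg0]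
      rw [mul_comm e, Nat.gcd_mul_left] at hgcd
      refine ⟨?_, ?_⟩
      · rw [mul_comm e] at hd
        exact Nat.lt_of_mul_lt_mul_left hd.1
      · have := Nat.eq_of_mul_eq_mul_left hg0 (hgcd.trans (mul_one g).symm)
        exact Nat.Coprime.symm this
    · intro d _
      exact Nat.mul_div_cancel_left _ hg0
    · intro d hd
      simp only [Finset.mem_filter, Finset.mem_range] at hd ⊢
      have hgcd : (e * g).gcd d = g := by
        have h1 := Nat.div_mul_cancel (Nat.gcd_dvd_left (e * g) d)
        rw [hd.2] at h1
        exact Nat.eq_of_mul_eq_mul_left he0 h1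
      exact Nat.mul_div_cancel' (hgcd ▸ Nat.gcd_dvd_right (e * g) d)
    · intro d _
      rw [mul_comm e, hf _ _ _ hg0]
  · intro d _
    exact Nat.mem_divisors.2 ⟨Nat.div_dvd_of_dvd (Nat.gcd_dvd_left _ _), hc.ne'⟩

lemma sum_range_mul_periodic {f : ℕ → ℂ} {c : ℕ} (hf : ∀ x, f (x + c) = f x) (g : ℕ) :
    ∑ x ∈ Finset.range (g * c), f x = g * ∑ x ∈ Finset.range c, f x := by
  induction g with
  | zero => simp
  | succ g ih =>
    have h : ∀ m x, f (m * c + x) = f x := by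
      intro m x
      induction m with
      | zero => simp
      | succ m ihm => rw [← ihm, ← hf (m * c + x)]; congr 1; ring
    rw [Nat.succ_mul, Finset.sum_range_add, ih]
    simp_rw [h]
    push_cast
    ring

/-- The sum `∑_{x mod c} e(d(x² + n)/c)`. -/
def qSum (n : ℤ) (d c : ℕ) : ℂ := ∑ x ∈ Finset.range c, ef (d * (x ^ 2 + n) / c)

lemma qSum_mul (n : ℤ) {g : ℕ} (hg : 0 < g) (d c : ℕ) : qSum n (g * d) (g * c) = g * qSum n d c := by
  rcases Nat.eq_zero_or_pos c with rfl | hc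
  · simp [qSum]
  have hcc : (c : ℂ) ≠ 0 := by exact_mod_cast hc.ne'
  have hgc : (g : ℂ) ≠ 0 := by exact_mod_cast hg.ne'
  rw [qSum, qSum, ← sum_range_mul_periodic]
  · refine Finset.sum_congr rfl fun x _ => ?_
    congr 1
    push_cast
    field_simp
  · intro x
    rw [← ef_add_int (d * ((x : ℂ) ^ 2 + n) / c) (d * (2 * x + c))]
    congr 1
    push_cast
    field_simp
    ring

lemma sum_qSum (n : ℤ) {c : ℕ} (hc : 0 < c) :
    ∑ d ∈ Finset.range c, qSum n d c = c * cntSq n c := by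
  unfold qSum
  rw [Finset.sum_comm]
  have : ∀ x : ℕ, ∑ d ∈ Finset.range c, ef (d * (x ^ 2 + n) / c) =
      if (c : ℤ) ∣ (x : ℤ) ^ 2 + n then (c : ℂ) else 0 := fun x => by
    rw [← sum_ef _ hc]; push_cast; rfl
  simp_rw [this]
  rw [← Finset.sum_filter, Finset.sum_const, nsmul_eq_mul, cntSq, mul_comm]

/-- By orthogonality the sum over all d is c times the number of roots of x² ≡ -n. As `qSum`/c
depends only on the fraction d/c, grouping by reduced denominators writes that number as a divisor
sum, and Möbius inversion isolates the coprime d. -/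
lemma sum_qSum_coprime (n : ℤ) {c : ℕ} (hc : 0 < c) :
    ∑ d ∈ Finset.range c with d.Coprime c, qSum n d c = c * beta n c := by
  have hcc : (c : ℂ) ≠ 0 := by exact_mod_cast hc.ne'
  have key := (ArithmeticFunction.sum_eq_iff_sum_mul_moebius_eq (R := ℂ)
    (f := fun c => ∑ d ∈ Finset.range c with d.Coprime c, qSum n d c / c)
    (g := fun c => cntSq n c)).1 (fun c hc => by
      rw [← sum_range_eq_sum_divisors (f := fun d c => qSum n d c / c) _ hc]
      · have hcc : (c : ℂ) ≠ 0 := by exact_mod_cast hc.ne'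
        rw [← Finset.sum_div, sum_qSum n hc, mul_div_cancel_left₀ _ hcc]
      · intro g d c hg
        have hgc : (g : ℂ) ≠ 0 := by exact_mod_cast hg.ne'
        rw [qSum_mul n hg]
        push_cast
        rw [mul_div_mul_left _ _ hgc]) c hc
  rw [← Finset.sum_div] at key
  rw [eq_div_iff hcc] at key
  rw [← key, beta, ArithmeticFunction.mul_apply]
  push_cast
  rw [mul_comm]
  rfl

lemma qSum_eq (n : ℤ) (d c : ℕ) : qSum n d c = qGauss d c * ef (n * d / c) := by
  rw [qSum, qGauss, Finset.sum_mul]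
  refine Finset.sum_congr rfl fun x _ => ?_
  rw [← ef_add]
  congr 1
  push_cast
  ring

/-- The Kloosterman sums at `∞`. -/
lemma klSum_infty (n : ℤ) {c : ℕ} (hc : 0 < c) (h4 : 4 ∣ c) :
    klSum (fun c d => rowCoeff 3 c d) n c = (Complex.I ^ (1 / 2 : ℂ) * Real.sqrt 2)⁻¹ *
      (Real.sqrt c * beta n c) := by
  have h4' : (4 : ℤ) ∣ (c : ℤ) := by exact_mod_cast h4
  have hs : (Real.sqrt c : ℂ) * Real.sqrt c = c := by
    exact_mod_cast Real.mul_self_sqrt (Nat.cast_nonneg c)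
  have hc0 : (Real.sqrt c : ℂ) ≠ 0 := by
    exact_mod_cast (Real.sqrt_pos.2 (by exact_mod_cast hc)).ne'
  have hI : Complex.I ^ (1 / 2 : ℂ) ≠ 0 := by simp [cpow_eq_zero_iff]
  have h2 : (Real.sqrt 2 : ℂ) ≠ 0 := by exact_mod_cast (Real.sqrt_pos.2 two_pos).ne'
  -- With the constant of `qGauss_infty`, each coefficient at r prime to c becomes a Gauss sum; all
  -- other coefficients are zero.
  have key : (Complex.I ^ (1 / 2 : ℂ) * Real.sqrt 2 * Real.sqrt c) *
      klSum (fun c d => rowCoeff 3 c d) n c = c * beta n c := by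
    rw [← sum_qSum_coprime n hc, klSum, Finset.mul_sum, Finset.sum_filter]
    refine Finset.sum_congr rfl fun r _ => ?_
    split_ifs with h
    · rw [qSum_eq, qGauss_infty hc h4' (Nat.isCoprime_iff_coprime.2 h.symm),
        Real.sqrt_mul two_pos.le]
      push_cast
      ring
    · rw [rowCoeff, if_neg]
      · simp
      · rintro ⟨-, h'⟩
        exact h (Nat.isCoprime_iff_coprime.1 h').symm
  rw [← hs] at key
  have h3 : Complex.I ^ (1 / 2 : ℂ) * Real.sqrt 2 ≠ 0 := mul_ne_zero hI h2
  rw [eq_inv_mul_iff_mul_eq₀ h3]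
  apply mul_left_cancel₀ hc0
  linear_combination key

lemma klSum_infty_of_not_dvd (n : ℤ) {c : ℕ} (h4 : ¬ 4 ∣ c) :
    klSum (fun c d => rowCoeff 3 c d) n c = 0 := by
  refine Finset.sum_eq_zero fun r _ => ?_
  show rowCoeff 3 c r * _ = 0
  rw [rowCoeff_of_not_dvd, zero_mul]
  exact fun h => h4 (by exact_mod_cast h)

lemma isCoprime_neg_four_mul {a : ℕ} {b : ℤ} (ha : Odd a) :
    IsCoprime (-4 * b) (a : ℤ) ↔ IsCoprime b (a : ℤ) := by
  have h4 : IsCoprime (-4 : ℤ) (a : ℤ) := by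
    have : IsCoprime (((4 : ℕ) : ℤ)) (a : ℤ) := Nat.isCoprime_iff_coprime.2
      (Nat.Coprime.pow_left 2 (Nat.coprime_two_left.2 ha))
    exact this.neg_left
  exact ⟨fun h => h.of_mul_left_right, fun h => h4.mul_left h⟩

/-- The Kloosterman sums at `0`. -/
lemma klSum_zero (n : ℤ) {a : ℕ} (ha : Odd a) :
    klSum (rowCoeffZero 3) n a = Real.sqrt a * beta n a := by
  have hc := ha.pos
  have hs : (Real.sqrt a : ℂ) * Real.sqrt a = a := by
    exact_mod_cast Real.mul_self_sqrt (Nat.cast_nonneg a)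
  have hc0 : (Real.sqrt a : ℂ) ≠ 0 := by
    exact_mod_cast (Real.sqrt_pos.2 (by exact_mod_cast hc)).ne'
  have key : Real.sqrt a * klSum (rowCoeffZero 3) n a = a * beta n a := by
    rw [← sum_qSum_coprime n hc, klSum, Finset.mul_sum, Finset.sum_filter]
    refine Finset.sum_congr rfl fun r _ => ?_
    split_ifs with h
    · rw [qSum_eq, qGauss_zero hc ((isCoprime_neg_four_mul ha).2 (Nat.isCoprime_iff_coprime.2 h))]
      ring
    · rw [rowCoeffZero, rowCoeff, if_neg]
      · simp
      · rintro ⟨-, h'⟩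
        exact h (Nat.isCoprime_iff_coprime.1 ((isCoprime_neg_four_mul ha).1 h'))
  apply mul_left_cancel₀ hc0
  rw [key, ← mul_assoc, hs]

lemma klSum_zero_of_even (n : ℤ) {a : ℕ} (ha : ¬ Odd a) : klSum (rowCoeffZero 3) n a = 0 := by
  refine Finset.sum_eq_zero fun r _ => ?_
  rw [rowCoeffZero, rowCoeff, if_neg, zero_mul]
  rintro ⟨h4, h⟩
  exact ha (by exact_mod_cast odd_of_isCoprime h4 h)

end ThetaEisenstein
end

noncomputable section
namespace ThetaEisenstein
open Complex ArithmeticFunction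

/-! ### Multiplicative functions -/

lemma mul_prime_pow (f g : ArithmeticFunction ℤ) {p : ℕ} (hp : p.Prime) (k : ℕ) :
    (f * g) (p ^ k) = ∑ i ∈ Finset.range (k + 1), f (p ^ i) * g (p ^ (k - i)) := by
  rw [mul_apply, Nat.sum_divisorsAntidiagonal fun a b => f a * g b, Nat.sum_divisors_prime_pow hp]
  refine Finset.sum_congr rfl fun i hi => ?_
  rw [Nat.pow_div (by simpa [Nat.lt_succ_iff] using hi) hp.pos]

lemma mul_prime_pow_of_left (f g : ArithmeticFunction ℤ) {p : ℕ} (hp : p.Prime) (h1 : f 1 = 1)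
    (hf : ∀ i, f (p ^ (i + 1)) = 0) (k : ℕ) : (f * g) (p ^ k) = g (p ^ k) := by
  rw [mul_prime_pow f g hp, Finset.sum_range_succ']
  simp [hf, h1]

open Classical in
/-- The restriction of `f` to the numbers all of whose prime divisors satisfy `Q`. -/
def restr (Q : ℕ → Prop) (f : ArithmeticFunction ℤ) : ArithmeticFunction ℤ :=
  ⟨fun c => if ∀ p, p.Prime → p ∣ c → Q p then f c else 0, by simp⟩

open Classical in
lemma restr_apply (Q : ℕ → Prop) (f : ArithmeticFunction ℤ) (c : ℕ) :
    restr Q f c = if ∀ p, p.Prime → p ∣ c → Q p then f c else 0 := rfl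

lemma restr_of_forall {Q : ℕ → Prop} (f : ArithmeticFunction ℤ) {c : ℕ}
    (h : ∀ p, p.Prime → p ∣ c → Q p) : restr Q f c = f c := by rw [restr_apply, if_pos h]

lemma restr_of_not {Q : ℕ → Prop} (f : ArithmeticFunction ℤ) {c p : ℕ} (hp : p.Prime) (hpc : p ∣ c)
    (h : ¬ Q p) : restr Q f c = 0 := by rw [restr_apply, if_neg fun h' => h (h' p hp hpc)]

lemma abs_restr_le (Q : ℕ → Prop) (f : ArithmeticFunction ℤ) (c : ℕ) : |restr Q f c| ≤ |f c| := by
  rw [restr_apply]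
  split_ifs <;> simp

lemma restr_one (Q : ℕ → Prop) (f : ArithmeticFunction ℤ) : restr Q f 1 = f 1 :=
  restr_of_forall f fun _ hp h => absurd (Nat.dvd_one.1 h) hp.ne_one

lemma restr_prime_pow {Q : ℕ → Prop} (f : ArithmeticFunction ℤ) {p : ℕ} (hp : p.Prime) (hQ : Q p)
    (k : ℕ) : restr Q f (p ^ k) = f (p ^ k) :=
  restr_of_forall f fun q hq h => by
    rwa [(Nat.prime_dvd_prime_iff_eq hq hp).1 (hq.dvd_of_dvd_pow h)]

lemma restr_prime_pow_succ {Q : ℕ → Prop} (f : ArithmeticFunction ℤ) {p : ℕ} (hp : p.Prime)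
    (hQ : ¬ Q p) (k : ℕ) : restr Q f (p ^ (k + 1)) = 0 :=
  restr_of_not f hp (dvd_pow_self p k.succ_ne_zero) hQ

lemma isMultiplicative_restr (Q : ℕ → Prop) {f : ArithmeticFunction ℤ} (hf : f.IsMultiplicative) :
    (restr Q f).IsMultiplicative := by
  refine ⟨by rw [restr_one, hf.map_one], fun {m n} h => ?_⟩
  rw [restr_apply, restr_apply, restr_apply, hf.map_mul_of_coprime h]
  have : (∀ p, p.Prime → p ∣ m * n → Q p) ↔
      (∀ p, p.Prime → p ∣ m → Q p) ∧ (∀ p, p.Prime → p ∣ n → Q p) :=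
    ⟨fun H => ⟨fun p hp hd => H p hp (hd.mul_right n), fun p hp hd => H p hp (hd.mul_left m)⟩,
      fun H p hp hd => ((Nat.Prime.dvd_mul hp).1 hd).elim (H.1 p hp) (H.2 p hp)⟩
  rw [this]
  split_ifs <;> simp_all

/-- An Euler product splits along a partition of the primes. -/
lemma restr_mul_restr (Q : ℕ → Prop) {f : ArithmeticFunction ℤ} (hf : f.IsMultiplicative) :
    restr Q f * restr (fun p => ¬ Q p) f = f := by
  have h1 := isMultiplicative_restr Q hf
  have h2 := isMultiplicative_restr (fun p => ¬ Q p) hf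
  refine ((h1.mul h2).eq_iff_eq_on_prime_powers _ _ hf).2 fun p k hp => ?_
  by_cases hQ : Q p
  · rw [mul_comm, mul_prime_pow_of_left _ _ hp h2.map_one, restr_prime_pow f hp hQ]
    exact restr_prime_pow_succ f hp (by simpa using hQ)
  · rw [mul_prime_pow_of_left _ _ hp h1.map_one, restr_prime_pow f hp hQ]
    exact restr_prime_pow_succ f hp hQ

open Classical in
/-- The function supported on the squares with value `f d` at `d ^ 2`. -/
def sqr (f : ArithmeticFunction ℤ) : ArithmeticFunction ℤ :=
  ⟨fun c => if IsSquare c then f c.sqrt else 0, by simp⟩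

open Classical in
lemma sqr_apply (f : ArithmeticFunction ℤ) (c : ℕ) :
    sqr f c = if IsSquare c then f c.sqrt else 0 := rfl

lemma sqr_sq (f : ArithmeticFunction ℤ) (d : ℕ) : sqr f (d ^ 2) = f d := by
  rw [sqr_apply, if_pos (IsSquare.sq d), Nat.sqrt_eq']

lemma sqr_of_not (f : ArithmeticFunction ℤ) {c : ℕ} (h : ¬ IsSquare c) : sqr f c = 0 := by
  rw [sqr_apply, if_neg h]

lemma isMultiplicative_sqr {f : ArithmeticFunction ℤ} (hf : f.IsMultiplicative) :
    (sqr f).IsMultiplicative := by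
  refine ⟨by simpa [hf.map_one] using sqr_sq f 1, fun {m n} h => ?_⟩
  by_cases hs : IsSquare (m * n)
  · have aux : ∀ {m n : ℕ}, m.Coprime n → IsSquare (m * n) → IsSquare m := fun {m n} h ⟨r, hr⟩ => by
      obtain ⟨d, hd⟩ := exists_associated_pow_of_mul_eq_pow (a := m) (b := n) (c := r) (k := 2)
        (by rw [Nat.isUnit_iff]; exact h) (by rw [hr, sq])
      rw [associated_iff_eq] at hd
      exact ⟨d, by rw [← hd, sq]⟩
    obtain ⟨a, ha⟩ := aux h hs
    obtain ⟨b, hb⟩ := aux h.symm (by rwa [mul_comm])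
    rw [← sq] at ha hb
    subst ha hb
    rw [← mul_pow, sqr_sq, sqr_sq, sqr_sq, hf.map_mul_of_coprime]
    exact Nat.Coprime.of_dvd (dvd_pow_self a two_ne_zero) (dvd_pow_self b two_ne_zero) h
  · rw [sqr_of_not f hs]
    by_cases hm : IsSquare m
    · rw [sqr_of_not f fun hn => hs (hm.mul hn), mul_zero]
    · rw [sqr_of_not f hm, zero_mul]

lemma sqr_prime_pow_two_mul (f : ArithmeticFunction ℤ) (p k : ℕ) :
    sqr f (p ^ (2 * k)) = f (p ^ k) := by rw [mul_comm, pow_mul, sqr_sq]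

lemma sqr_prime_pow_two_mul_add_one (f : ArithmeticFunction ℤ) {p : ℕ} (hp : p.Prime) (k : ℕ) :
    sqr f (p ^ (2 * k + 1)) = 0 := by
  refine sqr_of_not f ?_
  rintro ⟨r, hr⟩
  have h1 := congrArg (fun n => n.factorization p) (hr.trans (sq r).symm)
  simp only [Nat.factorization_pow, hp.factorization_self, Finsupp.smul_apply, smul_eq_mul] at h1
  omega

/-! ### The multiplicative function `beta` -/

lemma cntSq_eq (n : ℤ) {d : ℕ} (hd : d ≠ 0) :
    cntSq n d = Nat.card {x : ZMod d // x ^ 2 = ((-n : ℤ) : ZMod d)} := by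
  have : NeZero d := ⟨hd⟩
  rw [Nat.card_eq_fintype_card, Fintype.card_subtype, cntSq]
  refine Finset.card_bij' (fun x _ => (x : ZMod d)) (fun x _ => x.val) ?_ ?_ ?_ ?_
  · intro x hx
    simp only [Finset.mem_filter, Finset.mem_range, Finset.mem_univ, true_and] at hx ⊢
    have := (ZMod.intCast_zmod_eq_zero_iff_dvd _ _).2 hx.2
    push_cast at this ⊢
    exact eq_neg_of_add_eq_zero_left this
  · intro x hx
    simp only [Finset.mem_filter, Finset.mem_range, Finset.mem_univ, true_and] at hx ⊢
    refine ⟨x.val_lt, (ZMod.intCast_zmod_eq_zero_iff_dvd _ _).1 ?_⟩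
    push_cast at hx ⊢
    rw [ZMod.natCast_zmod_val, hx, neg_add_cancel]
  · intro x hx
    simp only [Finset.mem_filter, Finset.mem_range] at hx
    exact ZMod.val_cast_of_lt hx.1
  · intro x hx
    exact ZMod.natCast_zmod_val x

lemma isMultiplicative_cnt (n : ℤ) : (cnt n).IsMultiplicative := by
  refine IsMultiplicative.iff_ne_zero.2 ⟨?_, fun {a b} ha hb h => ?_⟩
  · show ((cntSq n 1 : ℕ) : ℤ) = 1
    simp [cntSq]
  · show ((cntSq n (a * b) : ℕ) : ℤ) = (cntSq n a : ℕ) * (cntSq n b : ℕ)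
    rw [cntSq_eq n ha, cntSq_eq n hb, cntSq_eq n (mul_ne_zero ha hb), ← Nat.cast_mul,
      ← Nat.card_prod]
    congr 1
    refine Nat.card_congr (((ZMod.chineseRemainder h).toEquiv.subtypeEquiv fun x => ?_).trans
      (Equiv.subtypeProdEquivProd (p := fun x => x ^ 2 = ((-n : ℤ) : ZMod a))
        (q := fun x => x ^ 2 = ((-n : ℤ) : ZMod b))))
    rw [← (ZMod.chineseRemainder h).injective.eq_iff, map_pow, map_intCast, Prod.ext_iff]
    rfl

lemma isMultiplicative_beta (n : ℤ) : (beta n).IsMultiplicative :=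
  isMultiplicative_moebius.mul (isMultiplicative_cnt n)

lemma beta_prime_pow_succ (n : ℤ) {p : ℕ} (hp : p.Prime) (k : ℕ) :
    beta n (p ^ (k + 1)) = cntSq n (p ^ (k + 1)) - cntSq n (p ^ k) := by
  have h : ∀ m, cnt n m = ∑ d ∈ m.divisors, beta n d := fun m => by
    rw [← coe_zeta_mul_apply, beta, ← mul_assoc, coe_zeta_mul_moebius, one_mul]
  have h1 := h (p ^ (k + 1))
  rw [Nat.sum_divisors_prime_pow hp, Finset.sum_range_succ, ← Nat.sum_divisors_prime_pow hp, ← h]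
    at h1
  exact eq_sub_of_add_eq' h1.symm

lemma beta_one (n : ℤ) : beta n 1 = 1 := (isMultiplicative_beta n).map_one

lemma cntSq_one (n : ℤ) : cntSq n 1 = 1 := by simp [cntSq]

lemma beta_prime (n : ℤ) {p : ℕ} (hp : p.Prime) (h2 : p ≠ 2) : beta n p = jacobiSym (-n) p := by
  have : Fact p.Prime := ⟨hp⟩
  have h := beta_prime_pow_succ n hp 0
  rw [zero_add, pow_one, pow_zero, cntSq_one, cntSq_eq n hp.ne_zero] at h
  have h3 := legendreSym.card_sqrts p h2 (-n)
  rw [h, ← jacobiSym.legendreSym.to_jacobiSym, Nat.card_eq_fintype_card, Fintype.card_subtype,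
    sub_eq_iff_eq_add, Nat.cast_one, ← h3]
  congr 2
  ext x
  simp

/-- Crude, but sufficient for a polynomial bound on the ramified factor. -/
lemma abs_beta_le (n : ℤ) (c : ℕ) : |beta n c| ≤ c ^ 2 := by
  have h1 : ∀ d : ℕ, (cntSq n d : ℤ) ≤ d := fun d => by
    have := Finset.card_filter_le (Finset.range d) fun x : ℕ => (d : ℤ) ∣ (x : ℤ) ^ 2 + n
    rw [Finset.card_range] at this
    exact_mod_cast this
  rw [beta, mul_apply, Nat.sum_divisorsAntidiagonal' fun a b => moebius a * cnt n b]
  calc _ ≤ ∑ d ∈ c.divisors, (c : ℤ) := by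
        refine (Finset.abs_sum_le_sum_abs _ _).trans (Finset.sum_le_sum fun d hd => ?_)
        rw [abs_mul]
        have h2 : |cnt n d| ≤ d := by
          show |((cntSq n d : ℕ) : ℤ)| ≤ d
          rw [Nat.abs_cast]
          exact h1 d
        have h3 : (d : ℤ) ≤ c := by exact_mod_cast Nat.divisor_le hd
        nlinarith [abs_moebius_le_one (n := c / d), abs_nonneg (cnt n d)]
    _ ≤ c ^ 2 := by
        rw [Finset.sum_const, nsmul_eq_mul, sq]
        gcongr
        exact_mod_cast Nat.card_divisors_le_self c

end ThetaEisenstein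
end

noncomputable section
namespace ThetaEisenstein
open Complex ArithmeticFunction

/-! ### Vanishing of `beta` on high prime powers -/

lemma sum_range_add_of_periodic {F : ℕ → ℂ} {c : ℕ} (hF : ∀ r, F (r + c) = F r) (m : ℕ) :
    ∑ r ∈ Finset.range c, F (r + m) = ∑ r ∈ Finset.range c, F r := by
  induction m with
  | zero => rfl
  | succ m ih =>
    have h1 := Finset.sum_range_succ (fun r => F (r + m)) c
    have h2 := Finset.sum_range_succ' (fun r => F (r + m)) c
    simp only [zero_add, add_comm c m, hF] at h1 h2
    rw [h1] at h2
    rw [← ih, add_right_cancel h2]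
    exact Finset.sum_congr rfl fun r _ => by rw [add_right_comm, add_assoc]

/-- If the coefficients have period m, a shift by m shows that the sum is unchanged under
multiplication by e(nm/c), which is not 1. It is applied to prime powers, where the multiplier
depends on the residue modulo p or modulo 8 only. -/
lemma klSum_eq_zero {B : ℕ → ℤ → ℂ} {n : ℤ} {c m : ℕ} (hc : 0 < c)
    (hper : ∀ d, B c (d + c) = B c d) (hm : ∀ r : ℕ, B c (r + m) = B c r)
    (hn : ¬ (c : ℤ) ∣ n * m) : klSum B n c = 0 := by
  have hcc : (c : ℂ) ≠ 0 := by exact_mod_cast hc.ne'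
  have h := sum_range_add_of_periodic (F := fun r : ℕ => B c r * ef (n * r / c)) (c := c)
    (fun r => by
      push_cast
      rw [hper, ← ef_add_int (n * (r : ℂ) / c) n]
      congr 2
      field_simp) m
  have h2 : klSum B n c * ef ((n * m : ℤ) / c) = klSum B n c := by
    conv_rhs => rw [klSum, ← h]
    rw [klSum, Finset.sum_mul]
    refine Finset.sum_congr rfl fun r _ => ?_
    push_cast
    rw [hm, mul_assoc, ← ef_add]
    congr 2
    ring
  have h3 : ef ((n * m : ℤ) / c) ≠ 1 := fun h' => hn ((ef_eq_one_iff hc).1 h')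
  have h4 : klSum B n c * (ef ((n * m : ℤ) / c) - 1) = 0 := by rw [mul_sub, h2, mul_one, sub_self]
  exact (mul_eq_zero.1 h4).resolve_right (sub_ne_zero.2 h3)

lemma quadSymbol_natCast (c : ℤ) (d : ℕ) : quadSymbol c d = jacobiSym c d := by
  rw [quadSymbol, if_neg (by omega), Int.natAbs_natCast]

lemma rowCoeffZero_congr {a m : ℕ} {b : ℤ}
    (h1 : IsCoprime (-4 * (b + m)) (a : ℤ) ↔ IsCoprime (-4 * b) (a : ℤ))
    (h3 : jacobiSym (-4 * (b + m)) a = jacobiSym (-4 * b) a) :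
    rowCoeffZero 3 a (b + m) = rowCoeffZero 3 a b := by
  have h2 : (4 : ℤ) ∣ -4 * (b + m) ↔ (4 : ℤ) ∣ -4 * b := by omega
  simp only [rowCoeffZero, rowCoeff, h1, h2, quadSymbol_natCast, h3]

lemma rowCoeffZero_add (a : ℕ) (b : ℤ) : rowCoeffZero 3 a (b + a) = rowCoeffZero 3 a b := by
  refine rowCoeffZero_congr ?_ (jacobiSym.mod_left' ?_)
  · rw [mul_add, IsCoprime.add_mul_right_left_iff]
  · rw [mul_add, Int.add_mul_emod_self_right]

lemma rowCoeffZero_prime_pow {p : ℕ} (k : ℕ) (b : ℤ) :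
    rowCoeffZero 3 (p ^ (k + 1)) (b + p) = rowCoeffZero 3 (p ^ (k + 1)) b := by
  refine rowCoeffZero_congr ?_ ?_
  · push_cast
    rw [IsCoprime.pow_right_iff k.succ_pos, IsCoprime.pow_right_iff k.succ_pos, mul_add,
      IsCoprime.add_mul_right_left_iff]
  · rw [jacobiSym.pow_right, jacobiSym.pow_right,
      jacobiSym.mod_left' (a₁ := -4 * (b + p)) (a₂ := -4 * b)]
    rw [mul_add, Int.add_mul_emod_self_right]

/-- The multipliers at modulus p^{k+1} have period p, so the Kloosterman sum vanishes unless p^k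
divides n. -/
lemma beta_odd_prime_pow (n : ℤ) {p : ℕ} (hp : p.Prime) (h2 : p ≠ 2) (k : ℕ)
    (hk : ¬ (p : ℤ) ^ k ∣ n) : beta n (p ^ (k + 1)) = 0 := by
  have hodd : Odd (p ^ (k + 1)) := (hp.odd_of_ne_two h2).pow
  have hpos : 0 < p ^ (k + 1) := pow_pos hp.pos _
  have h := klSum_zero n hodd
  rw [klSum_eq_zero (m := p) hpos (rowCoeffZero_add _)
    (fun r => rowCoeffZero_prime_pow k r)] at h
  · have hs : (Real.sqrt (p ^ (k + 1) : ℕ) : ℂ) ≠ 0 := by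
      exact_mod_cast (Real.sqrt_pos.2 (by exact_mod_cast hpos)).ne'
    exact_mod_cast (mul_eq_zero.1 h.symm).resolve_left hs
  · push_cast
    rw [pow_succ]
    intro h'
    exact hk (Int.dvd_of_mul_dvd_mul_right (by exact_mod_cast hp.ne_zero) h')

/-- For a power of two only ε_r and powers of (2/r) occur, and these depend on r modulo 8. -/
lemma rowCoeff_two_pow (a r : ℕ) : rowCoeff 3 ((2 ^ (a + 1) : ℕ) : ℤ) ((r : ℤ) + (8 : ℕ)) =
    rowCoeff 3 ((2 ^ (a + 1) : ℕ) : ℤ) r := by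
  have hc : ∀ r : ℕ, IsCoprime ((2 ^ (a + 1) : ℕ) : ℤ) (r : ℤ) ↔ Odd r := fun r => by
    rw [Nat.isCoprime_iff_coprime, Nat.coprime_pow_left_iff a.succ_pos, Nat.coprime_two_left]
  have h1 : Odd (r + 8) ↔ Odd r := by simp only [Nat.odd_iff]; omega
  rw [← Nat.cast_add]
  simp only [rowCoeff, hc, h1]
  by_cases hr : Odd r
  · have h3 : eps ((r + 8 : ℕ) : ℤ) = eps r := by
      have : ((r + 8 : ℕ) : ℤ) % 4 = (r : ℤ) % 4 := by push_cast; omega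
      rw [eps, eps, this]
    have h4 : jacobiSym 2 (r + 8) = jacobiSym 2 r := by
      rw [jacobiSym.at_two hr, jacobiSym.at_two (h1.2 hr)]
      congr 1
      push_cast
      rw [show (8 : ZMod 8) = 0 from rfl, add_zero]
    rw [h3, quadSymbol_natCast, quadSymbol_natCast]
    push_cast
    rw [jacobiSym.pow_left, jacobiSym.pow_left, h4]
  · simp [hr]

lemma beta_two_pow (n : ℤ) (k : ℕ) (hk : ¬ (2 : ℤ) ^ k ∣ n) : beta n (2 ^ (k + 3)) = 0 := by
  have hpos : 0 < 2 ^ (k + 3) := pow_pos two_pos _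
  have h := klSum_infty n hpos (Dvd.intro_left (2 ^ (k + 1)) (by ring))
  rw [klSum_eq_zero (m := 8) hpos (fun d => rowCoeff_add (by decide) _ d)
    (fun r => rowCoeff_two_pow (k + 2) r)] at h
  · have hs : (Real.sqrt (2 ^ (k + 3) : ℕ) : ℂ) ≠ 0 := by
      exact_mod_cast (Real.sqrt_pos.2 (by exact_mod_cast hpos)).ne'
    have h2 : (Real.sqrt 2 : ℂ) ≠ 0 := by exact_mod_cast (Real.sqrt_pos.2 two_pos).ne'
    have hI : Complex.I ^ (1 / 2 : ℂ) ≠ 0 := by simp [cpow_eq_zero_iff]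
    have := (mul_eq_zero.1 h.symm).resolve_left (inv_ne_zero (mul_ne_zero hI h2))
    exact_mod_cast (mul_eq_zero.1 this).resolve_left hs
  · push_cast
    rw [pow_add]
    norm_num
    intro h'
    exact hk (Int.dvd_of_mul_dvd_mul_right (by norm_num) h')

lemma beta_two (n : ℤ) : beta n 2 = 0 := by
  have h := beta_prime_pow_succ n Nat.prime_two 0
  rw [zero_add, pow_one, pow_zero, cntSq_one] at h
  rw [h, sub_eq_zero]
  have : cntSq n 2 = 1 := by
    simp only [cntSq, Finset.card_filter, Finset.sum_range_succ, Finset.range_zero,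
      Finset.sum_empty]
    push_cast
    split_ifs <;> omega
  rw [this]

/-! ### Factorisation of `beta` -/

/-- The Jacobi symbol `(-n/e)`, extended by zero to `e = 0`. -/
def jac (n : ℤ) : ArithmeticFunction ℤ := ⟨fun e => if e = 0 then 0 else jacobiSym (-n) e, by simp⟩

/-- The Jacobi symbol `(-n/e)` for odd `e`, extended by zero. -/
def psi (n : ℤ) : ArithmeticFunction ℤ := restr (· ≠ 2) (jac n)

lemma psi_of_odd (n : ℤ) {e : ℕ} (he : Odd e) : psi n e = jacobiSym (-n) e := by
  rw [psi, restr_of_forall _ (fun p _ hpe h2 => by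
    subst h2
    exact Nat.not_even_iff_odd.2 he (even_iff_two_dvd.2 hpe))]
  exact if_neg he.pos.ne'

lemma psi_of_even (n : ℤ) {e : ℕ} (he : ¬ Odd e) : psi n e = 0 :=
  restr_of_not _ Nat.prime_two (even_iff_two_dvd.1 (Nat.not_odd_iff_even.1 he)) (by simp)

lemma isMultiplicative_psi (n : ℤ) : (psi n).IsMultiplicative := by
  refine isMultiplicative_restr _ (IsMultiplicative.iff_ne_zero.2 ⟨by simp [jac], fun {a b} ha hb _ => ?_⟩)
  simp [jac, ha, hb, jacobiSym.mul_right' (-n) ha hb]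

/-- The part of `beta` supported on powers of two. -/
def betaTwo (n : ℤ) : ArithmeticFunction ℤ := restr (· = 2) (beta n)

/-- The part of `beta` supported on odd numbers. -/
def betaOdd (n : ℤ) : ArithmeticFunction ℤ := restr (· ≠ 2) (beta n)

/-- The part of `beta` supported on odd numbers composed of the primes dividing `n`. -/
def betaRam (n : ℤ) : ArithmeticFunction ℤ := restr (fun p => p ≠ 2 ∧ (p : ℤ) ∣ n) (beta n)

/-- The inverse of the series of squares of odd numbers prime to `n`. -/
def kappaSq (n : ℤ) : ArithmeticFunction ℤ :=
  sqr (restr (fun p => p ≠ 2 ∧ ¬ (p : ℤ) ∣ n) moebius)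

lemma betaTwo_mul_betaOdd (n : ℤ) : betaTwo n * betaOdd n = beta n :=
  restr_mul_restr (· = 2) (isMultiplicative_beta n)

lemma isMultiplicative_kappaSq (n : ℤ) : (kappaSq n).IsMultiplicative :=
  isMultiplicative_sqr (isMultiplicative_restr _ isMultiplicative_moebius)

/-- With χ = (-n/p) = ±1 the local series of β is 1 + χX, because higher powers of p contribute
nothing, and 1 + χX = (1 - X²)/(1 - χX). -/
lemma kappaSq_mul_psi_prime_pow (n : ℤ) {p : ℕ} (hp : p.Prime) (h2 : p ≠ 2) (hn : ¬ (p : ℤ) ∣ n)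
    (k : ℕ) : (kappaSq n * psi n) (p ^ k) = beta n (p ^ k) := by
  have hψ : ∀ i, psi n (p ^ i) = jacobiSym (-n) p ^ i := fun i => by
    rw [psi_of_odd n (hp.odd_of_ne_two h2).pow, jacobiSym.pow_right]
  have hgcd : (-n).gcd p = 1 := by
    rw [← Int.isCoprime_iff_gcd_eq_one]
    refine ((Nat.prime_iff_prime_int.1 hp).coprime_iff_not_dvd.2 ?_).symm
    simpa using hn
  have hsq := jacobiSym.sq_one hgcd
  have hr : ∀ i, kappaSq n (p ^ (2 * i)) = moebius (p ^ i) := fun i => by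
    rw [kappaSq, sqr_prime_pow_two_mul]
    exact restr_prime_pow _ hp ⟨h2, hn⟩ i
  have k0 : kappaSq n 1 = 1 := (isMultiplicative_kappaSq n).map_one
  have k1 : kappaSq n p = 0 := by
    have h := sqr_prime_pow_two_mul_add_one
      (restr (fun p => p ≠ 2 ∧ ¬ (p : ℤ) ∣ n) moebius) hp 0
    rwa [mul_zero, zero_add, pow_one] at h
  have k2 : kappaSq n (p ^ 2) = -1 := by simpa [moebius_apply_prime hp] using hr 1
  have k3 : ∀ i, kappaSq n (p ^ (i + 3)) = 0 := fun i => by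
    obtain ⟨j, hj⟩ := Nat.even_or_odd' (i + 3)
    rcases hj with hj | hj
    · rw [hj, hr, moebius_apply_prime_pow hp (by omega), if_neg (by omega)]
    · rw [hj, kappaSq, sqr_prime_pow_two_mul_add_one _ hp]
  rw [mul_prime_pow _ _ hp]
  match k with
  | 0 => simp [k0, beta_one, (isMultiplicative_psi n).map_one]
  | 1 => simp [Finset.sum_range_succ, k0, k1, hψ, beta_prime n hp h2]
  | m + 2 =>
    rw [Finset.sum_range_succ', Finset.sum_range_succ', Finset.sum_range_succ',
      beta_odd_prime_pow n hp h2 (m + 1)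
        fun h => hn ((dvd_pow_self _ m.succ_ne_zero).trans h)]
    simp only [add_assoc, Nat.reduceAdd, zero_add, pow_zero, pow_one, k0, k1, k2, k3, hψ]
    simp [pow_add, hsq]

/-- Checked prime by prime: odd primes dividing n enter through `betaRam` alone, the other odd
primes through `kappaSq` and `psi`. For n ≠ 0 the first factor will turn out to be a finite sum. -/
lemma betaOdd_eq (n : ℤ) : betaOdd n = betaRam n * (kappaSq n * psi n) := by
  have hR : (betaRam n).IsMultiplicative := isMultiplicative_restr _ (isMultiplicative_beta n)
  have hK := isMultiplicative_kappaSq n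
  have hKP := hK.mul (isMultiplicative_psi n)
  refine (((isMultiplicative_restr _ (isMultiplicative_beta n)).eq_iff_eq_on_prime_powers _ _
    (hR.mul hKP))).2 fun p k hp => ?_
  have trivK : (¬ (p ≠ 2 ∧ ¬ (p : ℤ) ∣ n)) → ∀ i, kappaSq n (p ^ (i + 1)) = 0 := fun h i => by
    obtain ⟨j, hj⟩ := Nat.even_or_odd' (i + 1)
    rcases hj with hj | hj
    · obtain ⟨j, rfl⟩ : ∃ j', j = j' + 1 := ⟨j - 1, by omega⟩
      rw [hj, kappaSq, sqr_prime_pow_two_mul, restr_prime_pow_succ _ hp h]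
    · rw [hj, kappaSq, sqr_prime_pow_two_mul_add_one _ hp]
  have trivP : (¬ (p ≠ 2 ∧ ¬ (p : ℤ) ∣ n)) → ∀ i, psi n (p ^ (i + 1)) = 0 := fun h i => by
    by_cases h2 : p = 2
    · exact restr_prime_pow_succ _ hp (by simp [h2]) i
    · have hpn : (p : ℤ) ∣ n := by tauto
      rw [psi_of_odd n (hp.odd_of_ne_two h2).pow, jacobiSym.pow_right, jacobiSym.eq_zero_iff.2,
        zero_pow i.succ_ne_zero]
      refine ⟨hp.ne_zero, fun h1 => hp.one_lt.ne' ?_⟩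
      have : (p : ℤ) ∣ ((-n).gcd p : ℤ) := Int.dvd_coe_gcd (by simpa using hpn) dvd_rfl
      rw [h1] at this
      exact Nat.dvd_one.1 (by exact_mod_cast this)
  by_cases h : p ≠ 2 ∧ ¬ (p : ℤ) ∣ n
  · show betaOdd n (p ^ k) = _
    rw [betaOdd, restr_prime_pow _ hp h.1, mul_prime_pow_of_left _ _ hp hR.map_one,
      kappaSq_mul_psi_prime_pow n hp h.1 h.2]
    exact restr_prime_pow_succ _ hp (by tauto)
  · show betaOdd n (p ^ k) = _
    rw [mul_comm, mul_prime_pow_of_left _ _ hp hKP.map_one]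
    · by_cases h2 : p = 2
      · cases k with
        | zero => simp [betaOdd, betaRam, restr_one]
        | succ k =>
          rw [betaOdd, betaRam, restr_prime_pow_succ _ hp (by simp [h2]),
            restr_prime_pow_succ _ hp (by simp [h2])]
      · rw [betaOdd, betaRam, restr_prime_pow _ hp h2, restr_prime_pow _ hp ⟨h2, by tauto⟩]
    · intro i
      rw [mul_prime_pow_of_left _ _ hp hK.map_one (trivK h), trivP h]

end ThetaEisenstein
end

noncomputable section
namespace ThetaEisenstein
open Complex ArithmeticFunction

/-! ### Vanishing of the residues -/

/-- Every root is even, x = 2y, and y runs modulo 2^{a+1} under a condition modulo 2^a; hence the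
factor 2. -/
lemma cntSq_four_mul (n : ℤ) (a : ℕ) : cntSq (4 * n) (2 ^ (a + 2)) = 2 * cntSq n (2 ^ a) := by
  have h1 : cntSq (4 * n) (2 ^ (a + 2)) =
      ((Finset.range (2 * 2 ^ a)).filter fun y : ℕ => ((2 ^ a : ℕ) : ℤ) ∣ (y : ℤ) ^ 2 + n).card := by
    refine Finset.card_nbij' (fun x => x / 2) (fun y => 2 * y) ?_ ?_ ?_ ?_
    all_goals intro x hx
    all_goals simp only [Finset.coe_filter, Finset.mem_range, Set.mem_ofPred_eq] at hx ⊢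
    · obtain ⟨hx, hd⟩ := hx
      have he : Even x := by
        have h2 : (2 : ℤ) ∣ (x : ℤ) ^ 2 + 4 * n :=
          (Dvd.intro_left (2 ^ (a + 1)) (by push_cast; ring)).trans hd
        have h3 : (2 : ℤ) ∣ (x : ℤ) ^ 2 := by omega
        exact even_iff_two_dvd.2 (by exact_mod_cast Int.prime_two.dvd_of_dvd_pow h3)
      obtain ⟨y, rfl⟩ := he.two_dvd
      rw [Nat.mul_div_cancel_left _ two_pos]
      refine ⟨by rw [pow_add] at hx; omega, ?_⟩
      have h4 : ((4 : ℤ) * (2 ^ a : ℕ)) ∣ 4 * ((y : ℤ) ^ 2 + n) := by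
        convert hd using 1 <;> push_cast <;> ring
      exact Int.dvd_of_mul_dvd_mul_left (by norm_num) h4
    · refine ⟨by rw [pow_add]; omega, ?_⟩
      have h4 := mul_dvd_mul_left (4 : ℤ) hx.2
      have e1 : ((2 ^ (a + 2) : ℕ) : ℤ) = 4 * (2 ^ a : ℕ) := by push_cast; ring
      have e2 : ((2 * x : ℕ) : ℤ) ^ 2 + 4 * n = 4 * ((x : ℤ) ^ 2 + n) := by push_cast; ring
      rwa [e1, e2]
    · obtain ⟨hx, hd⟩ := hx
      have h2 : (2 : ℤ) ∣ (x : ℤ) ^ 2 + 4 * n :=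
        (Dvd.intro_left (2 ^ (a + 1)) (by push_cast; ring)).trans hd
      have h3 : (2 : ℤ) ∣ (x : ℤ) ^ 2 := by omega
      have : 2 ∣ x := by exact_mod_cast Int.prime_two.dvd_of_dvd_pow h3
      omega
    · omega
  have h2 := sum_range_mul_periodic (c := 2 ^ a)
    (f := fun y : ℕ => if ((2 ^ a : ℕ) : ℤ) ∣ (y : ℤ) ^ 2 + n then (1 : ℂ) else 0) (fun x => by
      have : ((2 ^ a : ℕ) : ℤ) ∣ ((x + 2 ^ a : ℕ) : ℤ) ^ 2 + n ↔
          ((2 ^ a : ℕ) : ℤ) ∣ (x : ℤ) ^ 2 + n := by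
        rw [show ((x + 2 ^ a : ℕ) : ℤ) ^ 2 + n =
          (x : ℤ) ^ 2 + n + ((2 ^ a : ℕ) : ℤ) * (2 * x + (2 ^ a : ℕ)) by push_cast; ring]
        exact (Int.dvd_add_left (dvd_mul_right _ _))
      simp only [this]) 2
  rw [h1, cntSq]
  simp only [Finset.sum_boole] at h2
  exact_mod_cast h2

/-- The `2`-part of the singular series at the central point. -/
def twoTerm (n : ℤ) (a : ℕ) : ℝ := beta n (2 ^ (a + 1)) / 2 ^ (a + 1)

lemma cntSq_four (n : ℤ) : cntSq n 4 = if n % 4 = 0 ∨ n % 4 = 3 then 2 else 0 := by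
  simp only [cntSq, Finset.card_filter, Finset.sum_range_succ, Finset.range_zero,
    Finset.sum_empty]
  push_cast
  split_ifs <;> omega

lemma cntSq_eight {n : ℤ} (hn : n % 8 = 7) : cntSq n 8 = 4 := by
  simp only [cntSq, Finset.card_filter, Finset.sum_range_succ, Finset.range_zero,
    Finset.sum_empty]
  push_cast
  split_ifs <;> omega

lemma cntSq_two (n : ℤ) : cntSq n 2 = 1 := by
  have h := beta_prime_pow_succ n Nat.prime_two 0
  rw [zero_add, pow_one, pow_zero, cntSq_one, beta_two] at h
  omega

lemma twoTerm_zero (n : ℤ) : twoTerm n 0 = 0 := by simp [twoTerm, beta_two]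

lemma twoTerm_one {n : ℤ} (h : n % 4 = 0 ∨ n % 4 = 3) : twoTerm n 1 = 1 / 4 := by
  have h1 := beta_prime_pow_succ n Nat.prime_two 1
  rw [pow_one, cntSq_two, show 2 ^ (1 + 1) = 4 from rfl, cntSq_four, if_pos h] at h1
  rw [twoTerm, show 2 ^ (1 + 1) = 4 from rfl, h1]
  norm_num

/-- The powers 2, 4 and 8 contribute 0, 1/4 and 1/4. Nothing follows, by `beta_two_pow`, because n
is odd. -/
lemma hasSum_twoTerm_of_emod_eight {n : ℤ} (hn : n % 8 = 7) : HasSum (twoTerm n) (1 / 2) := by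
  have h2 : twoTerm n 2 = 1 / 4 := by
    have h1 := beta_prime_pow_succ n Nat.prime_two 2
    rw [show 2 ^ (2 + 1) = 8 from rfl, show 2 ^ 2 = 4 from rfl, cntSq_four, if_pos (by omega),
      cntSq_eight hn] at h1
    rw [twoTerm, show 2 ^ (2 + 1) = 8 from rfl, h1]
    norm_num
  have h3 : ∀ a, twoTerm n (a + 3) = 0 := fun a => by
    rw [twoTerm, show a + 3 + 1 = (a + 1) + 3 by ring, beta_two_pow]
    · simp
    · intro h
      have := (dvd_pow_self (2 : ℤ) a.succ_ne_zero).trans h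
      omega
  have h4 : HasSum (twoTerm n) (∑ a ∈ Finset.range 3, twoTerm n a) :=
    hasSum_sum_of_ne_finset_zero fun b hb => by
      obtain ⟨c, rfl⟩ := Nat.exists_eq_add_of_le (not_lt.1 fun h => hb (Finset.mem_range.2 h))
      rw [add_comm, h3]
  rw [Finset.sum_range_succ, Finset.sum_range_succ, Finset.sum_range_one, twoTerm_zero,
    twoTerm_one (by omega), h2] at h4
  norm_num at h4
  simpa using h4

/-- Passing from n to 4n shifts the terms by two places and halves them, so t becomes t/2 + 1/4,
with fixed point 1/2. This is the value that makes the factor at two in `bothPart_eq` vanish at s =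
0. -/
lemma hasSum_twoTerm_four_mul' {n : ℤ} {t : ℝ} (h : HasSum (twoTerm n) t) :
    HasSum (twoTerm (4 * n)) (t / 2 + 1 / 4) := by
  have h1 : ∀ a, twoTerm (4 * n) (a + 2) = twoTerm n a * (1 / 2) := fun a => by
    have e1 := beta_prime_pow_succ (4 * n) Nat.prime_two (a + 2)
    have e2 := beta_prime_pow_succ n Nat.prime_two a
    rw [show a + 2 + 1 = (a + 1) + 2 by ring, cntSq_four_mul, cntSq_four_mul] at e1
    rw [twoTerm, twoTerm, e2, show a + 2 + 1 = (a + 1) + 2 by ring, e1]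
    push_cast
    field_simp
    ring
  have h2 : HasSum (fun a => twoTerm (4 * n) (a + 2)) (t * (1 / 2)) := by
    simp_rw [h1]
    exact h.mul_right _
  rw [hasSum_nat_add_iff, Finset.sum_range_succ, Finset.sum_range_one, twoTerm_zero,
    twoTerm_one (by omega)] at h2
  rwa [show t * (1 / 2) + (0 + 1 / 4) = t / 2 + 1 / 4 by ring] at h2

lemma hasSum_twoTerm_four_mul {n : ℤ} (h : HasSum (twoTerm n) (1 / 2)) :
    HasSum (twoTerm (4 * n)) (1 / 2) := by
  have := hasSum_twoTerm_four_mul' h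
  rwa [show (1 / 2 : ℝ) / 2 + 1 / 4 = 1 / 2 by norm_num] at this

lemma exists_odd_jacobiSym_eq_neg_one {m : ℕ} (hm : Odd m) {r : ℕ} (hr : Odd r) :
    ∃ e : ℕ, e % 8 = r % 8 ∧ e % m = 1 % m ∧ Odd e := by
  have hco : Nat.Coprime 8 m := by
    rw [show 8 = 2 ^ 3 by rfl]
    exact Nat.Coprime.pow_left 3 (Nat.coprime_two_left.2 hm)
  obtain ⟨e, h1, h2⟩ := Nat.chineseRemainder hco r 1
  refine ⟨e, h1, h2, ?_⟩
  have : e % 8 = r % 8 := h1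
  rw [Nat.odd_iff] at hr ⊢
  omega

/-- A nontrivial value of the quadratic character, or an exceptional value of the `2`-part. -/
lemma exists_jacobiSym_or (D : ℕ) (hD : 0 < D) :
    (∃ e : ℕ, Odd e ∧ jacobiSym D e = -1) ∨ HasSum (twoTerm (-D)) (1 / 2) := by
  induction D using Nat.strong_induction_on with
  | _ D ih =>
  have h8 : D % 8 = 1 ∨ D % 8 = 5 ∨ D % 4 = 2 ∨ D % 4 = 3 ∨ D % 4 = 0 := by omega
  rcases h8 with h | h | h | h | h
  -- This class contains the odd squares, for which no e with symbol -1 exists.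
  · exact Or.inr (hasSum_twoTerm_of_emod_eight (by omega))
  -- For D ≡ 5 mod 8 put e = (D + 1)/2: then e ≡ 3 mod 4 and D ≡ -1 modulo e.
  · left
    have he : (D + 1) / 2 % 4 = 3 := by omega
    have hodd : Odd ((D + 1) / 2) := by rw [Nat.odd_iff]; omega
    refine ⟨(D + 1) / 2, hodd, ?_⟩
    rw [jacobiSym.mod_left' (a₂ := -1), jacobiSym.at_neg_one hodd,
      ZMod.χ₄_nat_three_mod_four he]
    refine Int.ModEq.symm (Int.modEq_iff_dvd.2 ⟨2, by omega⟩)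
  -- For D = 2m with m odd, take e ≡ 5 mod 8 and e ≡ 1 mod m: then (2/e) = -1 and (m/e) = (e/m) = 1.
  · left
    obtain ⟨m, rfl⟩ : ∃ m, D = 2 * m := ⟨D / 2, by omega⟩
    have hm : Odd m := by rw [Nat.odd_iff]; omega
    obtain ⟨e, h1, h2, h3⟩ := exists_odd_jacobiSym_eq_neg_one hm (r := 5) (by decide)
    refine ⟨e, h3, ?_⟩
    push_cast
    rw [jacobiSym.mul_left, jacobiSym.at_two h3,
      jacobiSym.quadratic_reciprocity_one_mod_four' hm (by omega),
      jacobiSym.mod_left' (a₂ := 1) (by exact_mod_cast h2), jacobiSym.one_left, mul_one,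
      ZMod.χ₈_nat_eq_if_mod_eight, if_neg (by omega), if_neg (by omega)]
  -- For D ≡ 3 mod 4, take e ≡ 3 mod 8 and e ≡ 1 mod D; reciprocity supplies the sign.
  · left
    have hm : Odd D := by rw [Nat.odd_iff]; omega
    obtain ⟨e, h1, h2, h3⟩ := exists_odd_jacobiSym_eq_neg_one hm (r := 3) (by decide)
    refine ⟨e, h3, ?_⟩
    rw [jacobiSym.quadratic_reciprocity_three_mod_four h (by omega),
      jacobiSym.mod_left' (a₂ := 1) (by exact_mod_cast h2), jacobiSym.one_left]
  -- Both alternatives pass from m to 4m.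
  · obtain ⟨m, rfl⟩ : ∃ m, D = 4 * m := ⟨D / 4, by omega⟩
    rcases ih m (by omega) (by omega) with ⟨e, he, h1⟩ | h1
    · left
      refine ⟨e, he, ?_⟩
      push_cast
      rw [jacobiSym.mul_left, jacobiSym.at_four he, h1, one_mul]
    · right
      have := hasSum_twoTerm_four_mul h1
      convert this using 2
      push_cast
      ring

/-- With e = 4n - 1 one has (-n/e) = (-4n/e) = (-1/e) = -1. So for n > 0 the symbol is never trivial
and each cusp is regular by itself. -/
lemma jacobiSym_neg_four_mul_sub_one {n : ℕ} (hn : 0 < n) :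
    Odd (4 * n - 1) ∧ jacobiSym (-n) (4 * n - 1) = -1 := by
  have hodd : Odd (4 * n - 1) := by rw [Nat.odd_iff]; omega
  refine ⟨hodd, ?_⟩
  have h1 := jacobiSym.mul_left 4 (-n) (4 * n - 1)
  rw [jacobiSym.at_four hodd, one_mul] at h1
  rw [← h1, jacobiSym.mod_left' (a₂ := -1), jacobiSym.at_neg_one hodd,
    ZMod.χ₄_nat_three_mod_four (by omega)]
  refine Int.ModEq.symm ((Int.modEq_iff_dvd).2 ⟨-1, ?_⟩)
  rw [Nat.cast_sub (by omega)]
  push_cast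
  ring

/-- The mean value of the periodic function `psi n`. -/
def psiMean (n : ℤ) : ℂ := (∑ e ∈ Finset.range (4 * n.natAbs), (psi n e : ℂ)) / (4 * n.natAbs : ℕ)

lemma psi_add (n : ℤ) (e : ℕ) : psi n (e + 4 * n.natAbs) = psi n e := by
  by_cases he : Odd e
  · have he' : Odd (e + 4 * n.natAbs) := by rw [Nat.odd_iff] at he ⊢; omega
    rw [psi_of_odd n he, psi_of_odd n he', jacobiSym.mod_right _ he, jacobiSym.mod_right _ he',
      Int.natAbs_neg, Nat.add_mod_right]
  · have he' : ¬ Odd (e + 4 * n.natAbs) := by rw [Nat.odd_iff] at he ⊢; omega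
    rw [psi_of_even n he, psi_of_even n he']

lemma psi_mod (n : ℤ) (e : ℕ) : psi n (e % (4 * n.natAbs)) = psi n e := by
  have h : ∀ q r, psi n (r + 4 * n.natAbs * q) = psi n r := fun q r => by
    induction q with
    | zero => simp
    | succ q ih => rw [mul_add, mul_one, ← add_assoc, psi_add, ih]
  conv_rhs => rw [← Nat.mod_add_div e (4 * n.natAbs), h]

lemma psi_mul (n : ℤ) {a b : ℕ} (ha : Odd a) : psi n (a * b) = psi n a * psi n b := by
  by_cases hb : Odd b
  · rw [psi_of_odd n ha, psi_of_odd n hb, psi_of_odd n (ha.mul hb),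
      jacobiSym.mul_right' _ ha.pos.ne' hb.pos.ne']
  · rw [psi_of_even n hb, psi_of_even n (fun h => hb (Nat.Odd.of_mul_right h)), mul_zero]

lemma abs_psi_le (n : ℤ) (e : ℕ) : |psi n e| ≤ 1 := by
  by_cases he : Odd e
  · rw [psi_of_odd n he]
    rcases jacobiSym.trichotomy (-n) e with h | h | h <;> rw [h] <;> simp
  · rw [psi_of_even n he]; simp

/-- Multiplication by e permutes the residues modulo 4|n| and reverses the sign of ψ. -/
lemma psiMean_eq_zero {n : ℤ} (hn : n ≠ 0) {e : ℕ} (he : Odd e) (h : jacobiSym (-n) e = -1) :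
    psiMean n = 0 := by
  have hP : 0 < 4 * n.natAbs := by positivity
  have : NeZero (4 * n.natAbs) := ⟨hP.ne'⟩
  have hco : e.Coprime (4 * n.natAbs) := by
    rw [Nat.coprime_mul_iff_right]
    refine ⟨?_, ?_⟩
    · rw [show 4 = 2 ^ 2 by rfl]
      exact Nat.Coprime.pow_right 2 (Nat.coprime_two_right.2 he)
    · by_contra h1
      have := jacobiSym.eq_zero_iff (a := -n) (b := e)
      rw [h] at this
      refine absurd (this.2 ⟨he.pos.ne', ?_⟩) (by norm_num)
      rw [Int.neg_gcd]
      intro h2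
      exact h1 (by rw [Nat.coprime_comm]; simpa [Int.gcd] using h2)
  have key : ∑ x ∈ Finset.range (4 * n.natAbs), (psi n x : ℂ) =
      ∑ x ∈ Finset.range (4 * n.natAbs), (psi n (e * x % (4 * n.natAbs)) : ℂ) := by
    symm
    refine Finset.sum_nbij (fun x => e * x % (4 * n.natAbs)) ?_ ?_ ?_ (fun _ _ => rfl)
    · intro x _
      exact Finset.mem_range.2 (Nat.mod_lt _ hP)
    · intro x hx y hy hxy
      simp only [Finset.coe_range, Set.mem_Iio] at hx hy
      have : e * x ≡ e * y [MOD (4 * n.natAbs)] := hxy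
      have := Nat.ModEq.cancel_left_of_coprime (by rwa [Nat.gcd_comm]) this
      rwa [Nat.ModEq, Nat.mod_eq_of_lt hx, Nat.mod_eq_of_lt hy] at this
    · refine Finset.surjOn_of_injOn_of_card_le _ ?_ ?_ le_rfl
      · intro x _
        simpa using Nat.mod_lt _ hP
      · intro x hx y hy hxy
        simp only [Finset.coe_range, Set.mem_Iio] at hx hy
        have : e * x ≡ e * y [MOD (4 * n.natAbs)] := hxy
        have := Nat.ModEq.cancel_left_of_coprime (by rwa [Nat.gcd_comm]) this
        rwa [Nat.ModEq, Nat.mod_eq_of_lt hx, Nat.mod_eq_of_lt hy] at this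
  have h2 : ∀ x, (psi n (e * x % (4 * n.natAbs)) : ℂ) = - psi n x := fun x => by
    rw [psi_mod, psi_mul n he, psi_of_odd n he, h]
    push_cast
    ring
  simp_rw [h2, Finset.sum_neg_distrib] at key
  rw [psiMean, self_eq_neg.1 key, zero_div]

lemma psiMean_of_pos {n : ℤ} (hn : 0 < n) : psiMean n = 0 := by
  lift n to ℕ using hn.le
  obtain ⟨h1, h2⟩ := jacobiSym_neg_four_mul_sub_one (n := n) (by omega)
  exact psiMean_eq_zero hn.ne' h1 h2

lemma psiMean_or_hasSum {n : ℤ} (hn : n ≠ 0) : psiMean n = 0 ∨ HasSum (twoTerm n) (1 / 2) := by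
  rcases lt_or_gt_of_ne hn with h | h
  · obtain ⟨D, rfl⟩ : ∃ D : ℕ, n = -D := ⟨n.natAbs, by omega⟩
    rcases exists_jacobiSym_or D (by omega) with ⟨e, he, h1⟩ | h1
    · exact Or.inl (psiMean_eq_zero hn he (by rwa [neg_neg]))
    · exact Or.inr h1
  · exact Or.inl (psiMean_of_pos h)

end ThetaEisenstein
end

noncomputable section
namespace ThetaEisenstein
open Complex Filter Topology

/-! ### Continuation of Dirichlet series with periodic coefficients -/

lemma norm_cpow_sub_cpow_le {x : ℝ} (hx : 0 < x) {u : ℂ} (hu : 0 < u.re) :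
    ‖(x : ℂ) ^ (-u) - ((x + 1 : ℝ) : ℂ) ^ (-u)‖ ≤ ‖u‖ * x ^ (-u.re - 1) := by
  have hu0 : u ≠ 0 := fun h => by simp [h] at hu
  have hd : ∀ t ∈ Set.Icc x (x + 1), HasDerivWithinAt (fun t : ℝ => (t : ℂ) ^ (-u))
      (-u * (t : ℂ) ^ (-u - 1)) (Set.Icc x (x + 1)) t := fun t ht => by
    have ht0 : 0 < t := hx.trans_le ht.1
    have h1 : HasDerivAt (fun w : ℂ => w ^ (-u)) (-u * (t : ℂ) ^ (-u - 1) * 1) (t : ℂ) :=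
      (hasDerivAt_id (t : ℂ)).cpow_const (Or.inl (by simpa using ht0))
    rw [mul_one] at h1
    exact h1.comp_ofReal.hasDerivWithinAt
  have hb : ∀ t ∈ Set.Icc x (x + 1), ‖-u * (t : ℂ) ^ (-u - 1)‖ ≤ ‖u‖ * x ^ (-u.re - 1) :=
    fun t ht => by
    have ht0 : 0 < t := hx.trans_le ht.1
    rw [norm_mul, norm_neg, norm_cpow_eq_rpow_re_of_pos ht0]
    refine mul_le_mul_of_nonneg_left ?_ (norm_nonneg _)
    simp only [sub_re, neg_re, one_re]
    exact Real.rpow_le_rpow_of_nonpos hx ht.1 (by linarith)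
  have := (convex_Icc x (x + 1)).norm_image_sub_le_of_norm_hasDerivWithin_le hd hb
    (Set.right_mem_Icc.2 (by linarith)) (Set.left_mem_Icc.2 (by linarith))
  simpa using this

/-- The terms of a Dirichlet series after summation by parts. -/
def abelTerm (S : ℕ → ℂ) (u : ℂ) (N : ℕ) : ℂ :=
  S (N + 1) * (((N + 1 : ℕ) : ℂ) ^ (-u) - ((N + 2 : ℕ) : ℂ) ^ (-u))

/-- A Dirichlet series after summation by parts. -/
def abelSum (S : ℕ → ℂ) (u : ℂ) : ℂ := ∑' N, abelTerm S u N

variable {S : ℕ → ℂ} {K r : ℝ}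

lemma norm_abelTerm_le (hS : ∀ N, ‖S N‖ ≤ K) (hr : 0 < r) {u : ℂ} (hu : r ≤ u.re) (N : ℕ) :
    ‖abelTerm S u N‖ ≤ K * ‖u‖ * ((N + 1 : ℕ) : ℝ) ^ (-r - 1) := by
  have hN : (1 : ℝ) ≤ (N + 1 : ℕ) := by norm_cast; omega
  have h1 := norm_cpow_sub_cpow_le (x := (N + 1 : ℕ)) (by positivity) (hr.trans_le hu)
  have e : ((((N + 1 : ℕ) : ℝ) + 1 : ℝ) : ℂ) = ((N + 2 : ℕ) : ℂ) := by push_cast; ring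
  rw [e, ofReal_natCast] at h1
  rw [abelTerm, norm_mul, mul_assoc]
  refine mul_le_mul (hS _) (h1.trans ?_) (norm_nonneg _) ((norm_nonneg _).trans (hS 0))
  exact mul_le_mul_of_nonneg_left (Real.rpow_le_rpow_of_exponent_le hN (by linarith))
    (norm_nonneg _)

lemma summable_rpow_neg_sub_one (hr : 0 < r) : Summable fun N : ℕ => ((N + 1 : ℕ) : ℝ) ^ (-r - 1) :=
  (summable_nat_add_iff 1).2 (Real.summable_nat_rpow.2 (by linarith))

lemma norm_abelSum_le (hS : ∀ N, ‖S N‖ ≤ K) (hr : 0 < r) {u : ℂ} (hu : r ≤ u.re) :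
    ‖abelSum S u‖ ≤ K * ‖u‖ * ∑' N : ℕ, ((N + 1 : ℕ) : ℝ) ^ (-r - 1) := by
  rw [← tsum_mul_left]
  exact tsum_of_norm_bounded ((summable_rpow_neg_sub_one hr).mul_left _).hasSum
    (norm_abelTerm_le hS hr hu)

lemma differentiableOn_abelSum (hS : ∀ N, ‖S N‖ ≤ K) :
    DifferentiableOn ℂ (abelSum S) {u | 0 < u.re} := by
  intro u hu
  have hu' : 0 < u.re := hu
  have hK : 0 ≤ K := (norm_nonneg _).trans (hS 0)
  have hopen : IsOpen ({v : ℂ | u.re / 2 < v.re} ∩ Metric.ball 0 (‖u‖ + 1)) :=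
    (isOpen_lt continuous_const continuous_re).inter Metric.isOpen_ball
  have hmem : u ∈ {v : ℂ | u.re / 2 < v.re} ∩ Metric.ball 0 (‖u‖ + 1) :=
    ⟨show u.re / 2 < u.re by linarith, by simp⟩
  have hr : 0 < u.re / 2 := by linarith
  have h := differentiableOn_tsum_of_summable_norm (F := fun N v => abelTerm S v N)
    (((summable_rpow_neg_sub_one hr).mul_left (K * (‖u‖ + 1)))) (fun N => ?_) hopen
    (fun N v hv => ?_)
  · exact (h.differentiableAt (hopen.mem_nhds hmem)).differentiableWithinAt
  · refine DifferentiableOn.const_mul (DifferentiableOn.sub ?_ ?_) _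
    · exact fun v _ => (differentiableAt_id.neg.const_cpow
        (Or.inl (Nat.cast_ne_zero.2 N.succ_ne_zero))).differentiableWithinAt
    · exact fun v _ => (differentiableAt_id.neg.const_cpow
        (Or.inl (Nat.cast_ne_zero.2 (N + 1).succ_ne_zero))).differentiableWithinAt
  · refine (norm_abelTerm_le hS hr (le_of_lt hv.1) N).trans ?_
    have : ‖v‖ ≤ ‖u‖ + 1 := by simpa using (Metric.mem_ball.1 hv.2).le
    gcongr

/-- Summation by parts. Boundedness of the partial sums makes the new series converge for all Re u >
0. -/
lemma LSeries_eq_abelSum {a : ℕ → ℂ} (hS : ∀ N, ‖S N‖ ≤ K)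
    (ha : ∀ N, S N = ∑ e ∈ Finset.range N, a (e + 1)) {u : ℂ} (hu : 0 < u.re)
    (h : LSeriesSummable a u) : LSeries a u = abelSum S u := by
  have h1 : Summable (abelTerm S u) :=
    Summable.of_norm_bounded ((summable_rpow_neg_sub_one hu).mul_left _)
      (norm_abelTerm_le hS hu le_rfl)
  have h2 : ∀ M : ℕ, ∑ e ∈ Finset.range M, LSeries.term a u (e + 1) =
      ∑ N ∈ Finset.range M, abelTerm S u N + S M * ((M + 1 : ℕ) : ℂ) ^ (-u) := fun M => by
    induction M with
    | zero => simp [ha]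
    | succ M ih =>
      have hSM : S (M + 1) = S M + a (M + 1) := by rw [ha, ha, Finset.sum_range_succ]
      rw [Finset.sum_range_succ, Finset.sum_range_succ, ih,
        LSeries.term_of_ne_zero M.succ_ne_zero, abelTerm, hSM, cpow_neg, cpow_neg]
      push_cast
      ring
  have h3 : Tendsto (fun M : ℕ => S M * ((M + 1 : ℕ) : ℂ) ^ (-u)) atTop (𝓝 0) := by
    refine squeeze_zero_norm (a := fun M : ℕ => K * ((M + 1 : ℕ) : ℝ) ^ (-u.re)) (fun M => ?_) ?_
    · rw [norm_mul, norm_natCast_cpow_of_pos M.succ_pos, neg_re]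
      exact mul_le_mul_of_nonneg_right (hS M) (by positivity)
    · rw [← mul_zero K]
      refine Tendsto.const_mul K ?_
      exact ((tendsto_rpow_neg_atTop hu).comp tendsto_natCast_atTop_atTop).comp
        (tendsto_add_atTop_nat 1)
  have h4 : Summable fun e => LSeries.term a u (e + 1) := (summable_nat_add_iff 1).2 h
  have h5 := h4.hasSum.tendsto_sum_nat
  simp_rw [h2] at h5
  have h6 := h1.hasSum.tendsto_sum_nat.add h3
  rw [add_zero] at h6
  rw [LSeries, h.tsum_eq_zero_add, LSeries.term_zero, zero_add]
  exact tendsto_nhds_unique h5 h6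

/-- The entire function `s ζ(1 + 2s)`. -/
def sZeta (s : ℂ) : ℂ := Function.update (fun s => s * riemannZeta (1 + 2 * s)) 0 (1 / 2) s

lemma sZeta_zero : sZeta 0 = 1 / 2 := by simp [sZeta]

lemma sZeta_of_ne_zero {s : ℂ} (hs : s ≠ 0) : sZeta s = s * riemannZeta (1 + 2 * s) := by
  simp [sZeta, hs]

/-- The factor s removes the pole of ζ(1 + 2s) at 0, whose residue in s is 1/2. -/
lemma differentiable_sZeta : Differentiable ℂ sZeta := by
  rw [← differentiableOn_univ]
  have h0 : (Set.univ : Set ℂ) ∈ 𝓝 (0 : ℂ) := univ_mem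
  rw [← differentiableOn_compl_singleton_and_continuousAt_iff h0]
  constructor
  · intro s hs
    have hs0 : s ≠ 0 := by simpa using hs
    have h1 : DifferentiableAt ℂ (fun s => s * riemannZeta (1 + 2 * s)) s := by
      refine differentiableAt_id.mul ?_
      exact DifferentiableAt.comp (g := riemannZeta) (f := fun s : ℂ => 1 + 2 * s) s
        (differentiableAt_riemannZeta (by simpa using hs0)) (by fun_prop)
    refine (h1.congr_of_eventuallyEq ?_).differentiableWithinAt
    filter_upwards [isOpen_ne.mem_nhds hs0] with w hw
    exact sZeta_of_ne_zero hw
  · rw [continuousAt_iff_punctured_nhds, sZeta_zero]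
    have h1 : Tendsto (fun s : ℂ => 1 + 2 * s) (𝓝[≠] 0) (𝓝[≠] 1) := by
      refine tendsto_nhdsWithin_iff.2 ⟨?_, ?_⟩
      · have : ContinuousAt (fun s : ℂ => 1 + 2 * s) 0 := by fun_prop
        simpa [ContinuousAt] using this.tendsto.mono_left nhdsWithin_le_nhds
      · filter_upwards [self_mem_nhdsWithin] with s hs
        simpa using hs
    have h2 := (riemannZeta_residue_one.comp h1).const_mul (1 / 2)
    rw [mul_one] at h2
    refine h2.congr' ?_
    filter_upwards [self_mem_nhdsWithin] with s hs
    rw [sZeta_of_ne_zero hs]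
    simp only [Function.comp]
    ring

variable {g : ℕ → ℂ} {P : ℕ}

/-- The mean value of a function with period `P`. -/
def perMean (g : ℕ → ℂ) (P : ℕ) : ℂ := (∑ e ∈ Finset.range P, g e) / P

/-- The partial sums of a periodic function minus its mean value. -/
def perRem (g : ℕ → ℂ) (P N : ℕ) : ℂ := ∑ e ∈ Finset.range N, (g (e + 1) - perMean g P)

/-- The function `s ∑ g(e) e^{-1-2s}`, continued. -/
def perL (g : ℕ → ℂ) (P : ℕ) (s : ℂ) : ℂ :=
  perMean g P * sZeta s + s * abelSum (perRem g P) (1 + 2 * s)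

lemma norm_perMean_le (hg : ∀ e, ‖g e‖ ≤ 1) : ‖perMean g P‖ ≤ 1 := by
  rw [perMean, norm_div, norm_natCast]
  refine div_le_one_of_le₀ ((norm_sum_le _ _).trans ?_) (Nat.cast_nonneg _)
  calc _ ≤ ∑ e ∈ Finset.range P, (1 : ℝ) := Finset.sum_le_sum fun e _ => hg e
    _ = P := by simp

/-- Once the mean is subtracted the sum over a period is zero, so the partial sums are periodic and
consist of fewer than P terms of size at most 2. -/
lemma norm_perRem_le (hP : 0 < P) (hper : ∀ e, g (e + P) = g e) (hg : ∀ e, ‖g e‖ ≤ 1) (N : ℕ) :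
    ‖perRem g P N‖ ≤ 2 * P := by
  have hPc : (P : ℂ) ≠ 0 := by exact_mod_cast hP.ne'
  have h0 : Function.Periodic (perRem g P) P := fun N => by
    have h1 := sum_range_add_of_periodic (F := fun e => g e - perMean g P) (c := P)
      (fun r => by rw [hper]) (N + 1)
    rw [Finset.sum_sub_distrib, Finset.sum_sub_distrib, Finset.sum_const, Finset.card_range,
      nsmul_eq_mul] at h1
    have h2 : (P : ℂ) * perMean g P = ∑ e ∈ Finset.range P, g e := by
      rw [perMean, mul_div_cancel₀ _ hPc]
    rw [perRem, Finset.sum_range_add, perRem, Finset.sum_sub_distrib (f := fun x => g (N + x + 1)),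
      Finset.sum_const, Finset.card_range, nsmul_eq_mul, h2]
    rw [h2, sub_self] at h1
    rw [add_eq_left, ← h1]
    congr 1
    exact Finset.sum_congr rfl fun x _ => by congr 1; ring
  rw [← h0.map_mod_nat N]
  have h3 : ((N % P : ℕ) : ℝ) ≤ P := by exact_mod_cast (Nat.mod_lt N hP).le
  calc _ ≤ ∑ e ∈ Finset.range (N % P), (2 : ℝ) := by
        refine (norm_sum_le _ _).trans (Finset.sum_le_sum fun e _ => ?_)
        have := norm_sub_le (g (e + 1)) (perMean g P)
        linarith [hg (e + 1), norm_perMean_le (P := P) hg]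
    _ = (N % P : ℕ) * 2 := by simp
    _ ≤ 2 * P := by linarith

lemma perL_zero (g : ℕ → ℂ) (P : ℕ) : perL g P 0 = perMean g P / 2 := by
  simp [perL, sZeta_zero]; ring

/-- The mean value contributes a multiple of ζ, which carries the only possible pole; the remainder
is regular after summation by parts. -/
lemma perL_eq (hP : 0 < P) (hper : ∀ e, g (e + P) = g e) (hg : ∀ e, ‖g e‖ ≤ 1) {s : ℂ}
    (hs : 0 < s.re) : perL g P s = s * LSeries g (1 + 2 * s) := by
  have hs0 : s ≠ 0 := fun h => by simp [h] at hs
  have hu : 1 < (1 + 2 * s).re := by simpa using hs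
  have h1 : LSeriesSummable g (1 + 2 * s) :=
    LSeriesSummable_of_bounded_of_one_lt_re (m := 1) (fun n _ => hg n) hu
  have h2 : LSeriesSummable (perMean g P • (1 : ℕ → ℂ)) (1 + 2 * s) :=
    (LSeriesSummable_one_iff.2 hu).smul _
  have h3 := LSeries_eq_abelSum (a := g - perMean g P • (1 : ℕ → ℂ)) (norm_perRem_le hP hper hg)
    (fun N => by simp [perRem]) (u := 1 + 2 * s) (by linarith) (h1.sub h2)
  rw [LSeries_sub h1 h2, LSeries_smul, LSeries_one_eq_riemannZeta hu] at h3
  rw [perL, ← h3, sZeta_of_ne_zero hs0]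
  ring

lemma differentiableOn_perL (hP : 0 < P) (hper : ∀ e, g (e + P) = g e) (hg : ∀ e, ‖g e‖ ≤ 1) :
    DifferentiableOn ℂ (perL g P) {s | -(1 / 2) < s.re} := by
  refine ((differentiable_sZeta.const_mul _).differentiableOn).add
    (differentiableOn_id.mul ?_)
  refine (differentiableOn_abelSum (norm_perRem_le hP hper hg)).comp
    (f := fun s : ℂ => 1 + 2 * s) (by fun_prop) fun s hs => ?_
  have hs' : -(1 / 2) < s.re := hs
  have : (1 + 2 * s).re = 1 + 2 * s.re := by simp
  show 0 < (1 + 2 * s).re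
  linarith

/-- The constant is uniform in g and the dependence on the period is linear; for P = 4|n| this is
polynomial control in n. -/
lemma exists_norm_perL_le : ∃ C : ℝ, 0 ≤ C ∧ ∀ (g : ℕ → ℂ) (P : ℕ), 0 < P →
    (∀ e, g (e + P) = g e) → (∀ e, ‖g e‖ ≤ 1) → ∀ s : ℂ, -(1 / 4) ≤ s.re → ‖s‖ ≤ 2 →
      ‖perL g P s‖ ≤ C * P := by
  obtain ⟨A, hA⟩ := (isCompact_closedBall (0 : ℂ) 2).exists_bound_of_continuousOn
    differentiable_sZeta.continuous.continuousOn
  have hA0 : 0 ≤ A := (norm_nonneg _).trans (hA 0 (by simp))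
  set T := ∑' N : ℕ, ((N + 1 : ℕ) : ℝ) ^ (-(1 / 2 : ℝ) - 1)
  have hT : 0 ≤ T := tsum_nonneg fun N => by positivity
  refine ⟨A + 2 * (2 * 5 * T), by positivity, fun g P hP hper hg s hs hs2 => ?_⟩
  have hP1 : (1 : ℝ) ≤ P := by exact_mod_cast hP
  have hu : (1 / 2 : ℝ) ≤ (1 + 2 * s).re := by
    have : (1 + 2 * s).re = 1 + 2 * s.re := by simp
    linarith
  have hu5 : ‖1 + 2 * s‖ ≤ 5 := by
    refine (norm_add_le _ _).trans ?_
    rw [norm_mul]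
    norm_num
    linarith
  have h1 := norm_abelSum_le (norm_perRem_le hP hper hg) (by norm_num : (0 : ℝ) < 1 / 2) hu
  have h2 : ‖abelSum (perRem g P) (1 + 2 * s)‖ ≤ 2 * P * 5 * T := h1.trans (by gcongr)
  calc ‖perL g P s‖ ≤ 1 * A + 2 * (2 * P * 5 * T) := by
        refine (norm_add_le _ _).trans (add_le_add ?_ ?_)
        · rw [norm_mul]
          exact mul_le_mul (norm_perMean_le hg) (hA s (by simpa using hs2)) (norm_nonneg _)
            zero_le_one
        · rw [norm_mul]
          exact mul_le_mul hs2 h2 (norm_nonneg _) zero_le_two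
    _ ≤ (A + 2 * (2 * 5 * T)) * P := by nlinarith

end ThetaEisenstein
end

noncomputable section
namespace ThetaEisenstein
open Complex Filter Topology ArithmeticFunction

/-! ### Dirichlet series of integral arithmetic functions -/

/-- The Dirichlet series of an arithmetic function. -/
def dser (f : ArithmeticFunction ℤ) (u : ℂ) : ℂ := LSeries (fun c => (f c : ℂ)) u

/-- Summability of the Dirichlet series of an arithmetic function. -/
def DSummable (f : ArithmeticFunction ℤ) (u : ℂ) : Prop := LSeriesSummable (fun c => (f c : ℂ)) u

lemma DSummable.mul {f g : ArithmeticFunction ℤ} {u : ℂ} (hf : DSummable f u) (hg : DSummable g u) :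
    DSummable (f * g) u ∧ dser (f * g) u = dser f u * dser g u := by
  have e : (fun c => ((f * g) c : ℂ)) =
      fun c => ((f : ArithmeticFunction ℂ) * (g : ArithmeticFunction ℂ)) c := by
    ext c
    rw [← intCoe_mul, intCoe_apply]
  have hf' : LSeriesSummable (fun c => (f : ArithmeticFunction ℂ) c) u := by
    simpa only [intCoe_apply, DSummable] using hf
  have hg' : LSeriesSummable (fun c => (g : ArithmeticFunction ℂ) c) u := by
    simpa only [intCoe_apply, DSummable] using hg
  unfold DSummable dser
  rw [e]
  refine ⟨LSeriesSummable_mul hf' hg', ?_⟩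
  rw [LSeries_mul' hf' hg']
  simp only [intCoe_apply]

section Bounded

variable {f : ArithmeticFunction ℤ}

lemma DSummable.of_abs_le_one (hf : ∀ c, |f c| ≤ 1) {u : ℂ} (hu : 1 < u.re) : DSummable f u :=
  LSeriesSummable_of_bounded_of_one_lt_re (m := 1) (fun c _ => by
    rw [norm_intCast]; exact_mod_cast hf c) hu

lemma differentiableOn_dser_of_abs_le_one (hf : ∀ c, |f c| ≤ 1) :
    DifferentiableOn ℂ (dser f) {u | 1 < u.re} := by
  refine (LSeries_differentiableOn _).mono fun u hu => ?_
  refine lt_of_le_of_lt (LSeries.abscissaOfAbsConv_le_of_le_const ⟨1, fun c _ => ?_⟩) ?_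
  · rw [norm_intCast]; exact_mod_cast hf c
  · exact_mod_cast hu

lemma norm_dser_le_of_abs_le_one (hf : ∀ c, |f c| ≤ 1) {u : ℂ} (hu : 3 / 2 ≤ u.re) :
    ‖dser f u‖ ≤ ∑' c : ℕ, (c : ℝ) ^ (-(3 / 2 : ℝ)) := by
  refine tsum_of_norm_bounded (Real.summable_nat_rpow.2 (by norm_num)).hasSum fun c => ?_
  rw [LSeries.norm_term_eq]
  split_ifs with h
  · positivity
  · have hc : (1 : ℝ) ≤ c := by exact_mod_cast Nat.one_le_iff_ne_zero.2 h
    have h1 : ‖(f c : ℂ)‖ ≤ 1 := by rw [norm_intCast]; exact_mod_cast hf c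
    calc _ ≤ 1 / (c : ℝ) ^ u.re := by gcongr
      _ = (c : ℝ) ^ (-u.re) := by rw [Real.rpow_neg (by positivity), one_div]
      _ ≤ _ := Real.rpow_le_rpow_of_exponent_le hc (by linarith)

end Bounded

section Finite

variable {f : ArithmeticFunction ℤ} {X : ℕ}

lemma dser_eq_sum (hf : ∀ c, X < c → f c = 0) (u : ℂ) :
    dser f u = ∑ c ∈ Finset.range (X + 1), LSeries.term (fun c => (f c : ℂ)) u c := by
  refine tsum_eq_sum fun c hc => ?_
  rw [LSeries.term_def, hf c (by simpa using hc)]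
  simp

lemma DSummable.of_finite (hf : ∀ c, X < c → f c = 0) (u : ℂ) : DSummable f u := by
  refine summable_of_ne_finset_zero (s := Finset.range (X + 1)) fun c hc => ?_
  rw [LSeries.term_def, hf c (by simpa using hc)]
  simp

lemma differentiable_dser_of_finite (hf : ∀ c, X < c → f c = 0) : Differentiable ℂ (dser f) := by
  rw [show dser f = fun u => _ from funext (dser_eq_sum hf)]
  exact Differentiable.fun_sum fun c _ u => (LSeries.hasDerivAt_term _ c u).differentiableAt

lemma norm_dser_le_of_finite (hf : ∀ c, X < c → f c = 0) {Y : ℝ} (hY : ∀ c ≤ X, |(f c : ℝ)| ≤ Y)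
    {u : ℂ} (hu : 0 ≤ u.re) : ‖dser f u‖ ≤ (X + 1) * Y := by
  rw [dser_eq_sum hf]
  calc _ ≤ ∑ c ∈ Finset.range (X + 1), Y := by
        refine (norm_sum_le _ _).trans (Finset.sum_le_sum fun c hc => ?_)
        have hcX : c ≤ X := by simpa [Nat.lt_succ_iff] using hc
        have h1 := hY c hcX
        rw [LSeries.norm_term_eq]
        split_ifs with h
        · exact (abs_nonneg _).trans h1
        · have hc : (1 : ℝ) ≤ c := by exact_mod_cast Nat.one_le_iff_ne_zero.2 h
          rw [norm_intCast]
          exact (div_le_self (abs_nonneg _) (Real.one_le_rpow hc hu)).trans h1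
    _ = (X + 1) * Y := by simp

end Finite

lemma term_sqr (f : ArithmeticFunction ℤ) (u : ℂ) (d : ℕ) :
    LSeries.term (fun c => (sqr f c : ℂ)) u (d ^ 2) =
      LSeries.term (fun c => (f c : ℂ)) (2 * u) d := by
  rcases eq_or_ne d 0 with rfl | hd
  · simp
  · have hdc : (d : ℂ) ≠ 0 := by exact_mod_cast hd
    rw [LSeries.term_of_ne_zero (pow_ne_zero 2 hd), LSeries.term_of_ne_zero hd, sqr_sq, sq,
      Nat.cast_mul, natCast_mul_natCast_cpow, two_mul, cpow_add _ _ hdc]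

lemma pow_two_injective : Function.Injective fun d : ℕ => d ^ 2 :=
  fun _ _ h => Nat.pow_left_injective two_ne_zero h

lemma term_sqr_of_notMem (f : ArithmeticFunction ℤ) (u : ℂ) {c : ℕ}
    (hc : c ∉ Set.range fun d : ℕ => d ^ 2) : LSeries.term (fun c => (sqr f c : ℂ)) u c = 0 := by
  rw [LSeries.term_def, sqr_of_not f]
  · simp
  · rintro ⟨r, rfl⟩
    exact hc ⟨r, sq r⟩

lemma dser_sqr (f : ArithmeticFunction ℤ) (u : ℂ) : dser (sqr f) u = dser f (2 * u) := by
  rw [dser, LSeries, ← pow_two_injective.tsum_eq, dser, LSeries]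
  · exact tsum_congr fun d => term_sqr f u d
  · intro c hc
    by_contra h
    exact hc (term_sqr_of_notMem f u h)

lemma DSummable.sqr {f : ArithmeticFunction ℤ} {u : ℂ} (h : DSummable f (2 * u)) :
    DSummable (sqr f) u := by
  refine (pow_two_injective.summable_iff fun c hc => term_sqr_of_notMem f u hc).1 ?_
  exact h.congr fun d => (term_sqr f u d).symm

/-! ### The part at two -/

/-- Read off from the Kloosterman sums: they are at most c, and they equal √c β(c) up to a constant
of absolute value 1 or 1/√2. This lets the series over powers of two converge beyond s = 0. -/
lemma abs_beta_le_sqrt (n : ℤ) (c : ℕ) : |(beta n c : ℝ)| ≤ Real.sqrt 2 * Real.sqrt c := by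
  rcases Nat.eq_zero_or_pos c with rfl | hc
  · simp
  have hs : 0 < Real.sqrt c := Real.sqrt_pos.2 (by exact_mod_cast hc)
  have h2 : 1 ≤ Real.sqrt 2 := Real.one_le_sqrt.2 (by norm_num)
  have hss := Real.mul_self_sqrt (Nat.cast_nonneg (α := ℝ) c)
  have hc4 : 4 ∣ c ∨ Odd c ∨ c % 4 = 2 := by
    rw [Nat.odd_iff]; omega
  rcases hc4 with h | h | h
  · have h1 := norm_klSum_le (B := fun c d => rowCoeff 3 c d) (fun _ _ => norm_rowCoeff_le _ _ _) n c
    have hI : ‖Complex.I ^ (1 / 2 : ℂ)‖ = 1 := by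
      rw [show (1 / 2 : ℂ) = ((1 / 2 : ℝ) : ℂ) by push_cast; rfl, norm_cpow_real]
      simp
    rw [klSum_infty n hc h, norm_mul, norm_inv, norm_mul, hI, one_mul, norm_mul, norm_real,
      norm_real, norm_intCast, Real.norm_of_nonneg (by positivity), Real.norm_of_nonneg hs.le,
      inv_mul_le_iff₀ (by positivity)] at h1
    have h3 : Real.sqrt c * |(beta n c : ℝ)| ≤ Real.sqrt c * (Real.sqrt 2 * Real.sqrt c) := by
      nlinarith
    exact le_of_mul_le_mul_left h3 hs
  · have h1 := norm_klSum_le (B := rowCoeffZero 3) (fun _ _ => norm_rowCoeffZero_le _ _ _) n c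
    rw [klSum_zero n h, norm_mul, norm_real, norm_intCast, Real.norm_of_nonneg hs.le] at h1
    have h3 : Real.sqrt c * |(beta n c : ℝ)| ≤ Real.sqrt c * Real.sqrt c := by rwa [hss]
    exact (le_of_mul_le_mul_left h3 hs).trans (le_mul_of_one_le_left hs.le h2)
  · obtain ⟨m, rfl⟩ : ∃ m, c = 2 * m := ⟨c / 2, by omega⟩
    have hm : Odd m := by rw [Nat.odd_iff]; omega
    rw [(isMultiplicative_beta n).map_mul_of_coprime (Nat.coprime_two_left.2 hm), beta_two]
    simp

/-- The part of the singular series at two, without its constant term. -/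
def twoPart (n : ℤ) (s : ℂ) : ℂ :=
  ∑' a : ℕ, (beta n (2 ^ (a + 1)) : ℂ) * ((2 ^ (a + 1) : ℕ) : ℂ) ^ (-(1 + 2 * s))

lemma norm_twoPart_term_le (n : ℤ) {s : ℂ} (hs : s ∈ sHalf) (a : ℕ) :
    ‖(beta n (2 ^ (a + 1)) : ℂ) * ((2 ^ (a + 1) : ℕ) : ℂ) ^ (-(1 + 2 * s))‖ ≤
      Real.sqrt 2 * ((2 : ℝ) ^ (-(1 / 4 : ℝ))) ^ (a + 1) := by
  have hs' : -(1 / 8) < s.re := hs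
  have h1 := abs_beta_le_sqrt n (2 ^ (a + 1))
  have hx : (1 : ℝ) ≤ ((2 ^ (a + 1) : ℕ) : ℝ) := by exact_mod_cast Nat.one_le_two_pow
  have hx0 : (0 : ℝ) < ((2 ^ (a + 1) : ℕ) : ℝ) := by linarith
  rw [norm_mul, norm_intCast, norm_natCast_cpow_of_pos (by positivity)]
  have h2 : ((2 ^ (a + 1) : ℕ) : ℝ) ^ (-(1 + 2 * s)).re ≤ ((2 ^ (a + 1) : ℕ) : ℝ) ^ (-(3 / 4 : ℝ)) := by
    refine Real.rpow_le_rpow_of_exponent_le hx ?_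
    have : (-(1 + 2 * s)).re = -1 - 2 * s.re := by simp; ring
    linarith
  calc _ ≤ (Real.sqrt 2 * Real.sqrt ((2 ^ (a + 1) : ℕ) : ℝ)) *
        ((2 ^ (a + 1) : ℕ) : ℝ) ^ (-(3 / 4 : ℝ)) := by gcongr
    _ = Real.sqrt 2 * ((2 ^ (a + 1) : ℕ) : ℝ) ^ (-(1 / 4 : ℝ)) := by
        rw [Real.sqrt_eq_rpow ((2 ^ (a + 1) : ℕ) : ℝ), mul_assoc, ← Real.rpow_add hx0]
        norm_num
    _ = _ := by
        rw [Nat.cast_pow, Nat.cast_two, ← Real.rpow_natCast, ← Real.rpow_natCast,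
          ← Real.rpow_mul two_pos.le, ← Real.rpow_mul two_pos.le, mul_comm (-(1 / 4 : ℝ))]

lemma summable_twoPart_bound :
    Summable fun a : ℕ => Real.sqrt 2 * ((2 : ℝ) ^ (-(1 / 4 : ℝ))) ^ (a + 1) := by
  refine ((summable_nat_add_iff 1).2 (summable_geometric_of_lt_one (by positivity) ?_)).mul_left _
  exact Real.rpow_lt_one_of_one_lt_of_neg one_lt_two (by norm_num)

lemma exists_norm_twoPart_le : ∃ C : ℝ, ∀ n : ℤ, ∀ s ∈ sHalf, ‖twoPart n s‖ ≤ C :=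
  ⟨_, fun n _ hs => tsum_of_norm_bounded summable_twoPart_bound.hasSum (norm_twoPart_term_le n hs)⟩

lemma differentiableOn_twoPart (n : ℤ) : DifferentiableOn ℂ (twoPart n) sHalf := by
  refine differentiableOn_tsum_of_summable_norm summable_twoPart_bound (fun a s _ => ?_)
    isOpen_sHalf fun a s hs => norm_twoPart_term_le n hs a
  refine (DifferentiableAt.const_mul ?_ _).differentiableWithinAt
  exact DifferentiableAt.const_cpow (by fun_prop) (Or.inl (Nat.cast_ne_zero.2 (by positivity)))

lemma zero_mem_sHalf : (0 : ℂ) ∈ sHalf := by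
  show -(1 / 8) < (0 : ℂ).re
  norm_num

lemma twoPart_zero_term (n : ℤ) (a : ℕ) :
    (beta n (2 ^ (a + 1)) : ℂ) * ((2 ^ (a + 1) : ℕ) : ℂ) ^ (-(1 + 2 * (0 : ℂ))) =
      (twoTerm n a : ℂ) := by
  rw [twoTerm, mul_zero, add_zero, cpow_neg_one]
  push_cast
  rw [div_eq_mul_inv]

lemma summable_twoTerm (n : ℤ) : Summable (twoTerm n) := by
  have h := Summable.of_norm_bounded summable_twoPart_bound (norm_twoPart_term_le n zero_mem_sHalf)
  simp_rw [twoPart_zero_term] at h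
  exact_mod_cast h

lemma twoPart_zero {n : ℤ} (h : HasSum (twoTerm n) (1 / 2)) : twoPart n 0 = 1 / 2 := by
  rw [twoPart]
  simp_rw [twoPart_zero_term]
  rw [← ofReal_tsum, h.tsum_eq]
  push_cast
  rfl

/-- As 4 · 0 = 0, the sum is the fixed point of t ↦ t/2 + 1/4. -/
lemma hasSum_twoTerm_zero : HasSum (twoTerm 0) (1 / 2) := by
  obtain ⟨t, ht⟩ := summable_twoTerm 0
  have h := hasSum_twoTerm_four_mul' ht
  rw [mul_zero] at h
  have := ht.unique h
  rwa [show t = 1 / 2 by linarith] at ht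

lemma two_pow_injective : Function.Injective fun a : ℕ => 2 ^ a := Nat.pow_right_injective le_rfl

lemma betaTwo_of_notMem (n : ℤ) {c : ℕ} (hc : c ∉ Set.range fun a : ℕ => 2 ^ a) :
    betaTwo n c = 0 := by
  rcases eq_or_ne c 0 with rfl | h0
  · simp
  · rw [betaTwo, restr_apply, if_neg]
    intro h
    exact hc ⟨_, (Nat.eq_prime_pow_of_unique_prime_dvd h0 fun {d} hd hdc => h d hd hdc).symm⟩

lemma DSummable_betaTwo (n : ℤ) {s : ℂ} (hs : s ∈ sHalf) : DSummable (betaTwo n) (1 + 2 * s) ∧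
    dser (betaTwo n) (1 + 2 * s) = 1 + twoPart n s := by
  have h0 : ∀ c ∉ Set.range fun a : ℕ => 2 ^ a,
      LSeries.term (fun c => (betaTwo n c : ℂ)) (1 + 2 * s) c = 0 := fun c hc => by
    rw [LSeries.term_def, betaTwo_of_notMem n hc]
    simp
  have h1 : ∀ a : ℕ, LSeries.term (fun c => (betaTwo n c : ℂ)) (1 + 2 * s) (2 ^ (a + 1)) =
      (beta n (2 ^ (a + 1)) : ℂ) * ((2 ^ (a + 1) : ℕ) : ℂ) ^ (-(1 + 2 * s)) := fun a => by
    rw [LSeries.term_of_ne_zero (by positivity), betaTwo, restr_prime_pow (Q := (· = 2)) _ Nat.prime_two rfl,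
      cpow_neg, div_eq_mul_inv]
  have h2 : Summable fun a : ℕ => LSeries.term (fun c => (betaTwo n c : ℂ)) (1 + 2 * s) (2 ^ a) := by
    rw [← summable_nat_add_iff 1]
    simp_rw [h1]
    exact Summable.of_norm_bounded summable_twoPart_bound (norm_twoPart_term_le n hs)
  refine ⟨(two_pow_injective.summable_iff h0).1 h2, ?_⟩
  rw [dser, LSeries, ← two_pow_injective.tsum_eq]
  · rw [h2.tsum_eq_zero_add]
    simp_rw [h1]
    rw [pow_zero, LSeries.term_of_ne_zero one_ne_zero, twoPart, betaTwo, restr_one, beta_one]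
    simp
  · intro c hc
    by_contra h
    exact hc (h0 c h)

end ThetaEisenstein
end

noncomputable section
namespace ThetaEisenstein
open Complex Filter Topology ArithmeticFunction

/-! ### The odd part -/

/-- If β(p^{k+1}) ≠ 0 for an odd prime p dividing n, then p^k ∣ n, and therefore p^{k+1} ∣ n². -/
lemma dvd_sq_of_betaRam_ne_zero {n : ℤ} (hn : n ≠ 0) {c : ℕ} (hc : betaRam n c ≠ 0) :
    c ∣ n.natAbs ^ 2 := by
  have hc0 : c ≠ 0 := by rintro rfl; simp at hc
  have hN : n.natAbs ^ 2 ≠ 0 := pow_ne_zero 2 (Int.natAbs_ne_zero.2 hn)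
  refine (Nat.factorization_prime_le_iff_dvd hc0 hN).1 fun p hp => ?_
  rcases Nat.eq_zero_or_pos (c.factorization p) with h0 | hpos
  · rw [h0]; exact Nat.zero_le _
  obtain ⟨k, hk⟩ : ∃ k, c.factorization p = k + 1 := ⟨c.factorization p - 1, by omega⟩
  have hmul := (isMultiplicative_restr (fun p => p ≠ 2 ∧ (p : ℤ) ∣ n)
    (isMultiplicative_beta n)).map_mul_of_coprime
      (Nat.Coprime.pow_left (c.factorization p) (Nat.coprime_ordCompl hp hc0))
  rw [Nat.ordProj_mul_ordCompl_eq_self] at hmul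
  have h1 : betaRam n (p ^ (k + 1)) ≠ 0 := by
    intro h
    refine hc (hmul.trans ?_)
    rw [hk]
    exact mul_eq_zero_of_left h _
  have hQ : p ≠ 2 ∧ (p : ℤ) ∣ n := by
    by_contra h
    exact h1 (restr_prime_pow_succ _ hp h k)
  rw [betaRam, restr_prime_pow _ hp hQ] at h1
  have h2 : (p : ℤ) ^ k ∣ n := by
    by_contra h
    exact h1 (beta_odd_prime_pow n hp hQ.1 k h)
  have h3 : p ^ k ∣ n.natAbs := Int.natCast_dvd.1 (by exact_mod_cast h2)
  have h4 : p ∣ n.natAbs := Int.natCast_dvd.1 hQ.2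
  rw [hk, ← hp.pow_dvd_iff_le_factorization hN, sq, pow_succ]
  exact mul_dvd_mul h3 h4

lemma betaRam_eq_zero {n : ℤ} (hn : n ≠ 0) (c : ℕ) (hc : n.natAbs ^ 2 < c) : betaRam n c = 0 := by
  by_contra h
  exact absurd (Nat.le_of_dvd (pow_pos (Int.natAbs_pos.2 hn) 2) (dvd_sq_of_betaRam_ne_zero hn h))
    (by omega)

lemma abs_restr_moebius_le (Q : ℕ → Prop) (c : ℕ) : |restr Q moebius c| ≤ 1 :=
  (abs_restr_le Q moebius c).trans abs_moebius_le_one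

lemma cntSq_zero_prime_pow {p : ℕ} (hp : p.Prime) {i j : ℕ} (hij : i ≤ 2 * j) (hij' : 2 * j ≤ i + 1)
    (hji : j ≤ i) : cntSq 0 (p ^ i) = p ^ (i - j) := by
  have h1 : ∀ x : ℕ, ((p ^ i : ℕ) : ℤ) ∣ (x : ℤ) ^ 2 + 0 ↔ p ^ j ∣ x := fun x => by
    rw [add_zero]
    norm_cast
    constructor
    · intro h
      rcases eq_or_ne x 0 with rfl | hx
      · simp
      · rw [hp.pow_dvd_iff_le_factorization (pow_ne_zero 2 hx), Nat.factorization_pow] at h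
        rw [hp.pow_dvd_iff_le_factorization hx]
        simp only [Finsupp.smul_apply, smul_eq_mul] at h
        omega
    · intro h
      refine (pow_dvd_pow p hij).trans ?_
      rw [mul_comm, pow_mul]
      exact pow_dvd_pow_of_dvd h 2
  have h2 : p ^ i = p ^ j * p ^ (i - j) := by rw [← pow_add]; congr 1; omega
  rw [cntSq]
  simp_rw [h1]
  conv_rhs => rw [← Finset.card_range (p ^ (i - j))]
  symm
  refine Finset.card_nbij' (fun y => p ^ j * y) (fun x => x / p ^ j) ?_ ?_ ?_ ?_
  all_goals intro x hx
  all_goals simp only [Finset.coe_filter, Finset.mem_range, Set.mem_ofPred_eq, Finset.coe_range,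
    Set.mem_Iio] at hx ⊢
  · exact ⟨by rw [h2]; exact Nat.mul_lt_mul_of_pos_left hx (pow_pos hp.pos j), dvd_mul_right _ _⟩
  · rw [h2] at hx
    exact Nat.div_lt_of_lt_mul hx.1
  · exact Nat.mul_div_cancel_left _ (pow_pos hp.pos j)
  · exact Nat.mul_div_cancel' hx.2

/-- The identity function as an integral arithmetic function. -/
def idZ : ArithmeticFunction ℤ := ⟨fun c => c, by simp⟩

lemma idZ_apply (c : ℕ) : idZ c = c := rfl

lemma isMultiplicative_idZ : idZ.IsMultiplicative := ⟨rfl, fun _ => Nat.cast_mul _ _⟩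

/-- For n = 0 there are p^{⌊i/2⌋} roots modulo p^i. So β vanishes at odd powers of p, and at p^{2j}
it is Euler's totient of p^j, that is, μ ∗ id. -/
lemma betaOdd_zero : betaOdd 0 = sqr (restr (· ≠ 2) moebius * restr (· ≠ 2) idZ) := by
  have hm := isMultiplicative_restr (· ≠ 2) isMultiplicative_moebius
  have hi := isMultiplicative_restr (· ≠ 2) isMultiplicative_idZ
  refine (((isMultiplicative_restr _ (isMultiplicative_beta 0)).eq_iff_eq_on_prime_powers _ _
    (isMultiplicative_sqr (hm.mul hi)))).2 fun p k hp => ?_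
  show betaOdd 0 (p ^ k) = _
  cases k with
  | zero =>
    rw [pow_zero, (isMultiplicative_sqr (hm.mul hi)).map_one, betaOdd, restr_one, beta_one]
  | succ k =>
    by_cases h2 : p = 2
    · have hQ : ¬ p ≠ 2 := by simpa using h2
      rw [betaOdd, restr_prime_pow_succ _ hp hQ]
      obtain ⟨j, hj⟩ := Nat.even_or_odd' (k + 1)
      rcases hj with hj | hj
      · obtain ⟨j, rfl⟩ : ∃ j', j = j' + 1 := ⟨j - 1, by omega⟩
        rw [hj, sqr_prime_pow_two_mul, mul_prime_pow_of_left _ _ hp hm.map_one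
          (restr_prime_pow_succ _ hp hQ), restr_prime_pow_succ _ hp hQ]
      · rw [hj, sqr_prime_pow_two_mul_add_one _ hp]
    · rw [betaOdd, restr_prime_pow _ hp h2]
      obtain ⟨j, hj⟩ := Nat.even_or_odd' (k + 1)
      rw [beta_prime_pow_succ 0 hp]
      rcases hj with hj | hj
      · obtain ⟨j, rfl⟩ : ∃ j', j = j' + 1 := ⟨j - 1, by omega⟩
        have hk : k = 2 * j + 1 := by omega
        have r1 : ∀ i, restr (· ≠ 2) moebius (p ^ i) = moebius (p ^ i) :=
          fun i => restr_prime_pow _ hp h2 i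
        have r2 : ∀ i, restr (· ≠ 2) idZ (p ^ i) = idZ (p ^ i) :=
          fun i => restr_prime_pow _ hp h2 i
        have r4 : restr (· ≠ 2) moebius 1 = 1 := hm.map_one
        have r5 : restr (· ≠ 2) moebius p = -1 := by
          simpa [moebius_apply_prime hp] using r1 1
        have r3 : ∀ i, moebius (p ^ (i + 2)) = 0 := fun i => by
          rw [moebius_apply_prime_pow hp (by omega), if_neg (by omega)]
        rw [hj, cntSq_zero_prime_pow hp (j := j + 1) (by omega) (by omega) (by omega), hk,
          cntSq_zero_prime_pow hp (j := j + 1) (by omega) (by omega) (by omega),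
          sqr_prime_pow_two_mul, mul_prime_pow _ _ hp, Finset.sum_range_succ',
          Finset.sum_range_succ']
        simp only [r1, r2, add_assoc, Nat.reduceAdd, r3, zero_mul, Finset.sum_const_zero, zero_add,
          pow_one, pow_zero, r4, r5, idZ_apply,
          Nat.add_sub_cancel, Nat.sub_zero]
        rw [show 2 * (j + 1) - (j + 1) = j + 1 by omega,
          show 2 * j + 1 - (j + 1) = j by omega]
        push_cast
        ring
      · have hk : k = 2 * j := by omega
        rw [hj, sqr_prime_pow_two_mul_add_one _ hp,
          cntSq_zero_prime_pow hp (j := j + 1) (by omega) (by omega) (by omega), hk,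
          cntSq_zero_prime_pow hp (j := j) (by omega) (by omega) (by omega),
          show 2 * j + 1 - (j + 1) = 2 * j - j by omega, sub_self]

/-- The indicator function of the odd numbers. -/
def oddInd (e : ℕ) : ℂ := if Odd e then 1 else 0

lemma restr_ne_two (f : ArithmeticFunction ℤ) (e : ℕ) :
    (restr (· ≠ 2) f e : ℂ) = oddInd e * f e := by
  by_cases h : Odd e
  · rw [restr_of_forall, oddInd, if_pos h, one_mul]
    rintro p - hpe rfl
    exact Nat.not_even_iff_odd.2 h (even_iff_two_dvd.2 hpe)
  · rw [oddInd, if_neg h, zero_mul,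
      restr_of_not f Nat.prime_two (even_iff_two_dvd.1 (Nat.not_odd_iff_even.1 h)) (by simp)]
    simp

lemma norm_oddInd_le (e : ℕ) : ‖oddInd e‖ ≤ 1 := by
  unfold oddInd
  split_ifs <;> simp

lemma oddInd_add (e : ℕ) : oddInd (e + 2) = oddInd e := by
  have : Odd (e + 2) ↔ Odd e := by simp only [Nat.odd_iff]; omega
  simp only [oddInd, this]

lemma dser_restr_idZ {v : ℂ} (hv : 2 < v.re) : DSummable (restr (· ≠ 2) idZ) v ∧
    dser (restr (· ≠ 2) idZ) v = LSeries oddInd (v - 1) := by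
  have h1 : ∀ e, LSeries.term (fun c => (restr (· ≠ 2) idZ c : ℂ)) v e =
      LSeries.term oddInd (v - 1) e := fun e => by
    rcases eq_or_ne e 0 with rfl | he
    · simp
    · have hec : (e : ℂ) ≠ 0 := by exact_mod_cast he
      rw [LSeries.term_of_ne_zero he, LSeries.term_of_ne_zero he, restr_ne_two, idZ_apply,
        cpow_sub _ _ hec, cpow_one]
      push_cast
      rw [div_div_eq_mul_div]
  have h2 : LSeriesSummable oddInd (v - 1) :=
    LSeriesSummable_of_bounded_of_one_lt_re (m := 1) (fun e _ => norm_oddInd_le e)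
      (by rw [sub_re, one_re]; linarith)
  exact ⟨h2.congr fun e => (h1 e).symm, tsum_congr h1⟩

/-- The function `s ∑_{c odd} β(c) c^{-1-2s}`, continued. -/
def oddPart (n : ℤ) (s : ℂ) : ℂ :=
  -- For n = 0 the L-series is taken at 1 + 4s, so `perL` at 2s carries the factor 2s instead of s;
  -- hence the division by 2.
  if n = 0 then dser (restr (· ≠ 2) moebius) (2 + 4 * s) * (perL oddInd 2 (2 * s) / 2)
  else dser (betaRam n) (1 + 2 * s) *
    (dser (restr (fun p => p ≠ 2 ∧ ¬ (p : ℤ) ∣ n) moebius) (2 + 4 * s) *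
      perL (fun e => (psi n e : ℂ)) (4 * n.natAbs) s)

lemma norm_psi_le (n : ℤ) (e : ℕ) : ‖(psi n e : ℂ)‖ ≤ 1 := by
  rw [norm_intCast]
  exact_mod_cast abs_psi_le n e

lemma oddPart_eq (n : ℤ) {s : ℂ} (hs : 0 < s.re) : DSummable (betaOdd n) (1 + 2 * s) ∧
    oddPart n s = s * dser (betaOdd n) (1 + 2 * s) := by
  have e2 : 2 * (1 + 2 * s) = 2 + 4 * s := by ring
  have hre : (1 + 2 * s).re = 1 + 2 * s.re := by simp
  have hre2 : (2 + 4 * s).re = 2 + 4 * s.re := by simp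
  by_cases hn : n = 0
  · subst hn
    have h1 := DSummable.of_abs_le_one (u := 2 + 4 * s) (abs_restr_moebius_le (· ≠ 2)) (by linarith)
    obtain ⟨h2, h3⟩ := dser_restr_idZ (v := 2 + 4 * s) (by linarith)
    obtain ⟨h4, h5⟩ := h1.mul h2
    rw [← e2] at h4
    rw [betaOdd_zero]
    refine ⟨h4.sqr, ?_⟩
    rw [dser_sqr, e2, h5, h3, oddPart, if_pos rfl,
      perL_eq two_pos oddInd_add norm_oddInd_le (by simpa using hs),
      show 1 + 2 * (2 * s) = 2 + 4 * s - 1 by ring]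
    ring
  · have hP : 0 < 4 * n.natAbs := by have := Int.natAbs_pos.2 hn; omega
    have h1 := DSummable.of_finite (betaRam_eq_zero hn) (1 + 2 * s)
    have h2 := DSummable.of_abs_le_one (u := 2 + 4 * s)
      (abs_restr_moebius_le (fun p => p ≠ 2 ∧ ¬ (p : ℤ) ∣ n)) (by linarith)
    rw [← e2] at h2
    have h2' : DSummable (kappaSq n) (1 + 2 * s) := h2.sqr
    have h3 := DSummable.of_abs_le_one (u := 1 + 2 * s) (abs_psi_le n) (by linarith)
    obtain ⟨h4, h5⟩ := h2'.mul h3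
    obtain ⟨h6, h7⟩ := h1.mul h4
    rw [betaOdd_eq]
    refine ⟨h6, ?_⟩
    rw [h7, h5, oddPart, if_neg hn, kappaSq, dser_sqr, e2,
      perL_eq hP (fun e => by rw [psi_add]) (norm_psi_le n) hs]
    simp only [dser]
    ring

lemma differentiableOn_oddPart (n : ℤ) : DifferentiableOn ℂ (oddPart n) sHalf := by
  have hd : ∀ Q : ℕ → Prop, DifferentiableOn ℂ
      (fun s => dser (restr Q moebius) (2 + 4 * s)) sHalf := fun Q => by
    refine (differentiableOn_dser_of_abs_le_one (abs_restr_moebius_le Q)).comp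
      (f := fun s : ℂ => 2 + 4 * s) (by fun_prop) fun s hs => ?_
    have hs' : -(1 / 8) < s.re := hs
    have hre2 : (2 + 4 * s).re = 2 + 4 * s.re := by simp
    show 1 < (2 + 4 * s).re
    linarith
  by_cases hn : n = 0
  · rw [show oddPart n = fun s => _ from funext fun s => by rw [oddPart, if_pos hn]]
    refine (hd _).mul (DifferentiableOn.div_const ?_ _)
    refine (differentiableOn_perL two_pos oddInd_add norm_oddInd_le).comp
      (f := fun s : ℂ => 2 * s) (by fun_prop) fun s hs => ?_
    have hs' : -(1 / 8) < s.re := hs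
    have hre2 : (2 * s).re = 2 * s.re := by simp
    show -(1 / 2) < (2 * s).re
    linarith
  · have hP : 0 < 4 * n.natAbs := by have := Int.natAbs_pos.2 hn; omega
    rw [show oddPart n = fun s => _ from funext fun s => by rw [oddPart, if_neg hn]]
    refine DifferentiableOn.mul ?_ ((hd _).mul ?_)
    · exact ((differentiable_dser_of_finite (betaRam_eq_zero hn)).comp
        (g := dser (betaRam n)) (f := fun s : ℂ => 1 + 2 * s) (by fun_prop)).differentiableOn
    · refine (differentiableOn_perL hP (fun e => by rw [psi_add]) (norm_psi_le n)).mono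
        fun s hs => ?_
      have hs' : -(1 / 8) < s.re := hs
      show -(1 / 2) < s.re
      linarith

/-- The exponent 7: the ramified factor has at most n² + 1 terms of size at most n⁴, and `perL`
contributes its period 4|n|. -/
lemma exists_norm_oddPart_le : ∃ C : ℝ, 0 ≤ C ∧ ∀ n : ℤ, ∀ s ∈ sHalf, ‖s‖ ≤ 1 →
    ‖oddPart n s‖ ≤ C * (1 + |(n : ℝ)|) ^ 7 := by
  obtain ⟨A, hA0, hA⟩ := exists_norm_perL_le
  set T := ∑' c : ℕ, (c : ℝ) ^ (-(3 / 2 : ℝ))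
  have hT0 : 0 ≤ T := tsum_nonneg fun c => by positivity
  have hT : ∀ (Q : ℕ → Prop), ∀ s ∈ sHalf, ‖dser (restr Q moebius) (2 + 4 * s)‖ ≤ T :=
    fun Q s hs => by
    refine norm_dser_le_of_abs_le_one (abs_restr_moebius_le Q) ?_
    have hs' : -(1 / 8) < s.re := hs
    have hre2 : (2 + 4 * s).re = 2 + 4 * s.re := by simp
    linarith
  refine ⟨2 * T * (A * 4), by positivity, fun n s hs hs1 => ?_⟩
  have hs' : -(1 / 8) < s.re := hs
  have h1 : 1 ≤ (1 + |(n : ℝ)|) ^ 7 := one_le_pow₀ (by linarith [abs_nonneg (n : ℝ)])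
  by_cases hn : n = 0
  · rw [oddPart, if_pos hn, norm_mul, norm_div]
    have h2 := hA oddInd 2 two_pos oddInd_add norm_oddInd_le (2 * s)
      (by have hre2 : (2 * s).re = 2 * s.re := by simp
          linarith) (by rw [norm_mul]; norm_num; linarith)
    have h3 : ‖perL oddInd 2 (2 * s)‖ / ‖(2 : ℂ)‖ ≤ A := by
      rw [div_le_iff₀ (by norm_num)]
      simpa using h2
    calc _ ≤ T * A := mul_le_mul (hT _ s hs) h3 (by positivity) hT0
      _ ≤ 2 * T * (A * 4) * 1 := by nlinarith [mul_nonneg hT0 hA0]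
      _ ≤ _ := by gcongr
  · have hP : 0 < 4 * n.natAbs := by have := Int.natAbs_pos.2 hn; omega
    have hm : ((n.natAbs : ℕ) : ℝ) = |(n : ℝ)| := by
      rw [Nat.cast_natAbs]; push_cast; rfl
    have hm1 : 1 ≤ |(n : ℝ)| := by rw [← hm]; exact_mod_cast Int.natAbs_pos.2 hn
    rw [oddPart, if_neg hn, norm_mul, norm_mul]
    have h2 := hA (fun e => (psi n e : ℂ)) (4 * n.natAbs) hP (fun e => by rw [psi_add])
      (norm_psi_le n) s (by linarith) (by linarith)
    have h3 := norm_dser_le_of_finite (betaRam_eq_zero hn) (Y := |(n : ℝ)| ^ 4) (u := 1 + 2 * s)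
      (fun c hc => by
        have e1 : |(betaRam n c : ℝ)| ≤ (c : ℝ) ^ 2 := by
          exact_mod_cast (abs_restr_le _ _ c).trans (abs_beta_le n c)
        have e2 : (c : ℝ) ≤ |(n : ℝ)| ^ 2 := by rw [← hm]; exact_mod_cast hc
        calc _ ≤ (c : ℝ) ^ 2 := e1
          _ ≤ (|(n : ℝ)| ^ 2) ^ 2 := by gcongr
          _ = _ := by ring)
      (by have hre2 : (1 + 2 * s).re = 1 + 2 * s.re := by simp
          linarith)
    push_cast at h2 h3
    rw [hm] at h2 h3
    set m := |(n : ℝ)|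
    have hm2 : 1 ≤ m ^ 2 := one_le_pow₀ hm1
    have h4 : (m ^ 2 + 1) * m ^ 4 ≤ 2 * m ^ 6 := by
      calc (m ^ 2 + 1) * m ^ 4 ≤ (m ^ 2 + m ^ 2) * m ^ 4 := by gcongr
        _ = 2 * m ^ 6 := by ring
    calc _ ≤ (2 * m ^ 6) * (T * (A * (4 * m))) :=
          mul_le_mul (h3.trans h4) (mul_le_mul (hT _ s hs) h2 (norm_nonneg _) hT0)
            (by positivity) (by positivity)
      _ = 2 * T * (A * 4) * m ^ 7 := by ring
      _ ≤ _ := by gcongr; linarith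

lemma oddPart_zero {n : ℤ} (hn : n ≠ 0) (h : psiMean n = 0) : oddPart n 0 = 0 := by
  have h1 : perMean (fun e => (psi n e : ℂ)) (4 * n.natAbs) = 0 := h
  rw [oddPart, if_neg hn, perL_zero, h1, zero_div, mul_zero (dser _ _), mul_zero]

end ThetaEisenstein
end

noncomputable section
namespace ThetaEisenstein
open Complex Filter Topology ArithmeticFunction

/-! ### The Kloosterman zeta functions -/

/-- `s` times the Kloosterman zeta function at `∞`, continued. -/
def inftyPart (n : ℤ) (s : ℂ) : ℂ :=
  (Complex.I ^ (1 / 2 : ℂ) * Real.sqrt 2)⁻¹ * (twoPart n s * oddPart n s)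

/-- `s` times the combination of Kloosterman zeta functions in the expansion of `Gs`, continued. -/
def bothPart (n : ℤ) (s : ℂ) : ℂ :=
  inftyPart n s + ((-2 * Complex.I) ^ (3 / 2 : ℂ))⁻¹ * 2 ^ (-2 * s) * oddPart n s

lemma term_eq_of_sqrt {c : ℕ} (hc : c ≠ 0) (s b : ℂ) :
    (c : ℂ) ^ (-(3 / 2 + 2 * s)) * (Real.sqrt c * b) = b / (c : ℂ) ^ (1 + 2 * s) := by
  have hcc : (c : ℂ) ≠ 0 := by exact_mod_cast hc
  have h1 : (Real.sqrt c : ℂ) = (c : ℂ) ^ (1 / 2 : ℂ) := by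
    rw [Real.sqrt_eq_rpow, ofReal_cpow (Nat.cast_nonneg c)]
    push_cast
    rfl
  have h2 : -(3 / 2 + 2 * s) + 1 / 2 = -(1 + 2 * s) := by ring
  rw [h1, ← mul_assoc, ← cpow_add _ _ hcc, h2, cpow_neg, mul_comm, div_eq_mul_inv]

lemma dser_eq_tsum_succ (f : ArithmeticFunction ℤ) (u : ℂ) :
    dser f u = ∑' c : ℕ, LSeries.term (fun c => (f c : ℂ)) u (c + 1) := by
  rw [dser, LSeries, ← Nat.succ_injective.tsum_eq]
  intro c hc
  rcases Nat.eq_zero_or_pos c with rfl | h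
  · simp at hc
  · exact ⟨c - 1, Nat.succ_pred_eq_of_pos h⟩

lemma betaOdd_of_odd (n : ℤ) {c : ℕ} (hc : Odd c) : betaOdd n c = beta n c :=
  restr_of_forall _ fun p _ hpc h2 => by
    subst h2
    exact Nat.not_even_iff_odd.2 hc (even_iff_two_dvd.2 hpc)

lemma betaOdd_of_even (n : ℤ) {c : ℕ} (hc : ¬ Odd c) : betaOdd n c = 0 :=
  restr_of_not _ Nat.prime_two (even_iff_two_dvd.1 (Nat.not_odd_iff_even.1 hc)) (by simp)

lemma klZeta_zero (n : ℤ) (s : ℂ) : klZeta (rowCoeffZero 3) n s = dser (betaOdd n) (1 + 2 * s) := by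
  rw [dser_eq_tsum_succ, klZeta]
  refine tsum_congr fun c => ?_
  rw [LSeries.term_of_ne_zero c.succ_ne_zero]
  by_cases h : Odd (c + 1)
  · rw [klSum_zero n h, term_eq_of_sqrt c.succ_ne_zero, betaOdd_of_odd n h]
  · rw [klSum_zero_of_even n h, betaOdd_of_even n h]
    simp

/-- As β(2) = 0, β vanishes at all c ≡ 2 mod 4; the even c that remain are the multiples of 4, the
lower entries occurring at ∞. -/
lemma beta_sub_betaOdd (n : ℤ) (c : ℕ) :
    beta n c - betaOdd n c = if 4 ∣ c then beta n c else 0 := by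
  have h : Odd c ∨ 4 ∣ c ∨ c % 4 = 2 := by rw [Nat.odd_iff]; omega
  rcases h with h | h | h
  · rw [betaOdd_of_odd n h, sub_self, if_neg]
    rw [Nat.odd_iff] at h
    omega
  · rw [if_pos h, betaOdd_of_even, sub_zero]
    rw [Nat.odd_iff]
    omega
  · obtain ⟨m, rfl⟩ : ∃ m, c = 2 * m := ⟨c / 2, by omega⟩
    have hm : Odd m := by rw [Nat.odd_iff]; omega
    rw [betaOdd_of_even n (by rw [Nat.odd_iff]; omega), if_neg (by omega),
      (isMultiplicative_beta n).map_mul_of_coprime (Nat.coprime_two_left.2 hm), beta_two]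
    simp

lemma mem_sHalf_of_pos {s : ℂ} (hs : 0 < s.re) : s ∈ sHalf := by
  show -(1 / 8) < s.re
  linarith

/-- The sum over 4 ∣ c is the full series minus its odd part, and the full series is (1 + `twoPart`)
times the odd part. -/
lemma klZeta_infty (n : ℤ) {s : ℂ} (hs : 0 < s.re) :
    klZeta (fun c d => rowCoeff 3 c d) n s = (Complex.I ^ (1 / 2 : ℂ) * Real.sqrt 2)⁻¹ *
      (twoPart n s * dser (betaOdd n) (1 + 2 * s)) := by
  obtain ⟨h1, h2⟩ := DSummable_betaTwo n (mem_sHalf_of_pos hs)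
  obtain ⟨h3, -⟩ := oddPart_eq n hs
  obtain ⟨h4, h5⟩ := h1.mul h3
  rw [betaTwo_mul_betaOdd] at h4 h5
  have h6 : twoPart n s * dser (betaOdd n) (1 + 2 * s) =
      dser (beta n) (1 + 2 * s) - dser (betaOdd n) (1 + 2 * s) := by rw [h5, h2]; ring
  have h4' : Summable fun c : ℕ => LSeries.term (fun c => (beta n c : ℂ)) (1 + 2 * s) (c + 1) :=
    (summable_nat_add_iff 1).2 h4
  have h3' : Summable fun c : ℕ => LSeries.term (fun c => (betaOdd n c : ℂ)) (1 + 2 * s) (c + 1) :=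
    (summable_nat_add_iff 1).2 h3
  rw [h6, dser_eq_tsum_succ, dser_eq_tsum_succ, ← h4'.tsum_sub h3', klZeta, ← tsum_mul_left]
  refine tsum_congr fun c => ?_
  rw [LSeries.term_of_ne_zero c.succ_ne_zero, LSeries.term_of_ne_zero c.succ_ne_zero, ← sub_div]
  have h7 := beta_sub_betaOdd n (c + 1)
  by_cases h : 4 ∣ c + 1
  · rw [if_pos h] at h7
    rw [klSum_infty n c.succ_pos h, mul_left_comm, term_eq_of_sqrt c.succ_ne_zero]
    congr 2
    exact_mod_cast h7.symm
  · rw [if_neg h] at h7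
    rw [klSum_infty_of_not_dvd n h]
    have : (beta n (c + 1) : ℂ) - betaOdd n (c + 1) = 0 := by exact_mod_cast h7
    simp [this]

lemma inftyPart_eq (n : ℤ) {s : ℂ} (hs : 0 < s.re) :
    inftyPart n s = s * klZeta (fun c d => rowCoeff 3 c d) n s := by
  rw [klZeta_infty n hs, inftyPart, (oddPart_eq n hs).2]
  ring

lemma oddPart_eq_klZeta (n : ℤ) {s : ℂ} (hs : 0 < s.re) :
    oddPart n s = s * klZeta (rowCoeffZero 3) n s := by
  rw [klZeta_zero n, (oddPart_eq n hs).2]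

lemma differentiableOn_inftyPart (n : ℤ) : DifferentiableOn ℂ (inftyPart n) sHalf :=
  ((differentiableOn_twoPart n).mul (differentiableOn_oddPart n)).const_mul _

lemma differentiableOn_bothPart (n : ℤ) : DifferentiableOn ℂ (bothPart n) sHalf := by
  refine (differentiableOn_inftyPart n).add (DifferentiableOn.mul ?_ (differentiableOn_oddPart n))
  exact ((Differentiable.const_cpow (by fun_prop) (Or.inl two_ne_zero)).const_mul _).differentiableOn

/-- The minus sign is decisive: it turns the sum over the two cusps into the difference in
`bothPart_eq`. -/
lemma neg_two_I_cpow : (-2 * Complex.I) ^ (3 / 2 : ℂ) =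
    -(2 * (Complex.I ^ (1 / 2 : ℂ) * Real.sqrt 2)) := by
  have h2 : (Real.sqrt 2 : ℂ) = (2 : ℂ) ^ (1 / 2 : ℂ) := by
    rw [Real.sqrt_eq_rpow, ofReal_cpow two_pos.le]
    push_cast
    rfl
  rw [show -2 * Complex.I = ((2 : ℝ) : ℂ) * (-Complex.I) by push_cast; ring,
    ofReal_mul_cpow two_pos (neg_ne_zero.2 I_ne_zero), h2,
    show (3 / 2 : ℂ) = 1 / 2 + 1 by norm_num, cpow_add _ _ (by norm_num), cpow_add _ _ (by simp),
    cpow_one, cpow_one, cpow_def_of_ne_zero (neg_ne_zero.2 I_ne_zero) (1 / 2),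
    cpow_def_of_ne_zero I_ne_zero (1 / 2), log_neg_I, log_I]
  have h3 : cexp (Real.pi / 2 * Complex.I * (1 / 2)) =
      cexp (-(Real.pi / 2) * Complex.I * (1 / 2)) * Complex.I := by
    rw [show (Real.pi / 2 * Complex.I * (1 / 2) : ℂ) =
      -(Real.pi / 2) * Complex.I * (1 / 2) + Real.pi / 2 * Complex.I by ring, Complex.exp_add,
      exp_pi_div_two_mul_I]
  rw [h3]
  push_cast
  ring

lemma bothPart_eq (n : ℤ) (s : ℂ) : bothPart n s = (Complex.I ^ (1 / 2 : ℂ) * Real.sqrt 2)⁻¹ *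
    ((twoPart n s - 2⁻¹ * 2 ^ (-2 * s)) * oddPart n s) := by
  rw [bothPart, inftyPart, neg_two_I_cpow, inv_neg, mul_inv 2]
  ring

/-- The crux in weight 3/2: in the combination of the two cusps there is no pole at s = 0. Either ψ
has mean zero and the odd part vanishes, or `twoPart` takes the value 1/2 and the difference in
`bothPart_eq` vanishes. -/
lemma bothPart_zero (n : ℤ) : bothPart n 0 = 0 := by
  rw [bothPart_eq]
  have h : oddPart n 0 = 0 ∨ HasSum (twoTerm n) (1 / 2) := by
    by_cases hn : n = 0
    · rw [hn]; exact Or.inr hasSum_twoTerm_zero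
    · exact (psiMean_or_hasSum hn).imp (oddPart_zero hn) id
  rcases h with h | h
  · rw [h]; simp
  · rw [twoPart_zero h]; simp

lemma exists_norm_bothPart_le : ∃ C : ℝ, 0 ≤ C ∧ ∀ n : ℤ, ∀ s ∈ sHalf, ‖s‖ ≤ 1 →
    ‖inftyPart n s‖ ≤ C * (1 + |(n : ℝ)|) ^ 7 ∧ ‖oddPart n s‖ ≤ C * (1 + |(n : ℝ)|) ^ 7 ∧
      ‖bothPart n s‖ ≤ C * (1 + |(n : ℝ)|) ^ 7 := by
  obtain ⟨A, hA⟩ := exists_norm_twoPart_le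
  obtain ⟨C, hC0, hC⟩ := exists_norm_oddPart_le
  have hA0 : 0 ≤ A := (norm_nonneg _).trans (hA 0 0 zero_mem_sHalf)
  set k := ‖(Complex.I ^ (1 / 2 : ℂ) * Real.sqrt 2)⁻¹‖
  have hk : 0 ≤ k := norm_nonneg _
  have hT : ∀ s : ℂ, ‖s‖ ≤ 1 → ‖(2⁻¹ : ℂ) * 2 ^ (-2 * s)‖ ≤ 2 := fun s hs => by
    have h1 : ‖(2 : ℂ) ^ (-2 * s)‖ = 2 ^ (-2 * s).re := by
      have := norm_cpow_eq_rpow_re_of_pos two_pos (-2 * s)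
      simpa using this
    have h2 : (-2 * s).re ≤ 2 := by
      have := neg_le_of_abs_le ((abs_re_le_norm s).trans hs)
      have h3 : (-2 * s).re = -2 * s.re := by simp
      linarith
    rw [norm_mul, h1]
    have h4 : (2 : ℝ) ^ (-2 * s).re ≤ 2 ^ (2 : ℝ) :=
      Real.rpow_le_rpow_of_exponent_le one_le_two h2
    norm_num at h4 ⊢
    linarith
  refine ⟨k * A * C + C + k * (A + 2) * C, by positivity, fun n s hs hs1 => ?_⟩
  have hM : 0 ≤ (1 + |(n : ℝ)|) ^ 7 := by positivity
  have ho := hC n s hs hs1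
  have e1 : 0 ≤ k * A * C * (1 + |(n : ℝ)|) ^ 7 := by positivity
  have e2 : 0 ≤ C * (1 + |(n : ℝ)|) ^ 7 := by positivity
  have e3 : 0 ≤ k * (A + 2) * C * (1 + |(n : ℝ)|) ^ 7 := by positivity
  refine ⟨?_, by linarith, ?_⟩
  · rw [inftyPart, norm_mul, norm_mul]
    calc _ ≤ k * (A * (C * (1 + |(n : ℝ)|) ^ 7)) :=
          mul_le_mul_of_nonneg_left (mul_le_mul (hA n s hs) ho (norm_nonneg _) hA0) hk
      _ ≤ _ := by linarith
  · rw [bothPart_eq, norm_mul, norm_mul]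
    have h1 : ‖twoPart n s - 2⁻¹ * 2 ^ (-2 * s)‖ ≤ A + 2 :=
      (norm_sub_le _ _).trans (add_le_add (hA n s hs) (hT s hs1))
    calc _ ≤ k * ((A + 2) * (C * (1 + |(n : ℝ)|) ^ 7)) :=
          mul_le_mul_of_nonneg_left (mul_le_mul h1 ho (norm_nonneg _) (by linarith)) hk
      _ ≤ _ := by linarith

/-- Cauchy's estimate on the circle of radius 1/16, which lies inside the half-plane. -/
lemma norm_deriv_zero_le {f : ℂ → ℂ} (hf : DifferentiableOn ℂ f sHalf) {M : ℝ}
    (hM : ∀ s ∈ sHalf, ‖s‖ ≤ 1 → ‖f s‖ ≤ M) : ‖deriv f 0‖ ≤ 16 * M := by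
  have hsub : Metric.closedBall (0 : ℂ) (1 / 16) ⊆ sHalf := fun s hs => by
    have h1 : ‖s‖ ≤ 1 / 16 := by simpa using hs
    have := neg_le_of_abs_le ((abs_re_le_norm s).trans h1)
    show -(1 / 8) < s.re
    linarith
  have hd : DiffContOnCl ℂ f (Metric.ball 0 (1 / 16)) :=
    (hf.mono (by rwa [closure_ball _ (by norm_num)])).diffContOnCl
  have := norm_deriv_le_of_forall_mem_sphere_norm_le (C := M) (by norm_num : (0 : ℝ) < 1 / 16) hd
    fun s hs => hM s (hsub (Metric.sphere_subset_closedBall hs)) (by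
      have : ‖s‖ = 1 / 16 := by simpa using hs
      rw [this]; norm_num)
  refine this.trans_eq ?_
  ring

end ThetaEisenstein
end

noncomputable section
namespace ThetaEisenstein
open Complex Filter Topology

/-! ### The value at the centre -/

/-- The region of continuation. -/
def sDisc : Set ℂ := sHalf ∩ Metric.ball 0 1

lemma isOpen_sDisc : IsOpen sDisc := isOpen_sHalf.inter Metric.isOpen_ball

lemma isPreconnected_sDisc : IsPreconnected sDisc :=
  ((convex_halfSpace_re_gt _).inter (convex_ball 0 1)).isPreconnected

lemma zero_mem_sDisc : (0 : ℂ) ∈ sDisc := ⟨zero_mem_sHalf, by simp⟩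

lemma norm_le_of_mem_sDisc {s : ℂ} (hs : s ∈ sDisc) : ‖s‖ ≤ 1 := by
  simpa using (Metric.mem_ball.1 hs.2).le

lemma summable_int_one_add_abs : Summable fun n : ℤ => ((1 + |(n : ℝ)|) ^ 2)⁻¹ := by
  refine summable_int_iff_summable_nat_and_neg.2 ⟨?_, ?_⟩
  all_goals
    have h := (summable_nat_add_iff 1).2 (Real.summable_nat_pow_inv.2 one_lt_two)
    refine h.congr fun n => ?_
    push_cast
    simp [add_comm]

/-- The Fourier terms of the continued Eisenstein series. -/
def centreTerm (z : ℂ) (n : ℤ) (s : ℂ) : ℂ := bothPart n s * (hw z.im n s * ef (n * z.re))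

lemma norm_ef_int_mul (n : ℤ) (x : ℝ) : ‖ef (n * x)‖ = 1 := by
  have := norm_ef_ofReal (n * x)
  push_cast at this
  exact this

/-- Nine powers of decay of `hw` are used: seven against the growth of `bothPart` and two for
summability. -/
lemma exists_norm_centreTerm_le {z : ℂ} (hz : z ∈ Hset) : ∃ C : ℝ, ∀ n : ℤ, ∀ s ∈ sDisc,
    ‖centreTerm z n s‖ ≤ C * ((1 + |(n : ℝ)|) ^ 2)⁻¹ := by
  obtain ⟨A, hA0, hA⟩ := exists_norm_bothPart_le
  obtain ⟨B, hB0, hB⟩ := hw_decay hz 9 1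
  refine ⟨A * B, fun n s hs => ?_⟩
  have h1 := (hA n s hs.1 (norm_le_of_mem_sDisc hs)).2.2
  have h2 := hB s hs.1 (norm_le_of_mem_sDisc hs) n
  have hm : 0 < 1 + |(n : ℝ)| := by positivity
  rw [centreTerm, norm_mul, norm_mul, norm_ef_int_mul, mul_one]
  calc _ ≤ A * (1 + |(n : ℝ)|) ^ 7 * ‖hw z.im n s‖ := by gcongr
    _ = A * ((1 + |(n : ℝ)|) ^ 9 * ‖hw z.im n s‖) * ((1 + |(n : ℝ)|) ^ 2)⁻¹ := by
        field_simp
    _ ≤ A * B * ((1 + |(n : ℝ)|) ^ 2)⁻¹ := by gcongr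

lemma differentiableOn_centreTerm {z : ℂ} (hz : z ∈ Hset) (n : ℤ) :
    DifferentiableOn ℂ (centreTerm z n) sDisc :=
  ((differentiableOn_bothPart n).mul ((hw_differentiableOn hz n).mul_const _)).mono
    Set.inter_subset_left

/-- The function `s Gs(s, z)`, continued. -/
def centre (z s : ℂ) : ℂ := s + ∑' n : ℤ, centreTerm z n s

lemma differentiableOn_centre {z : ℂ} (hz : z ∈ Hset) : DifferentiableOn ℂ (centre z) sDisc := by
  obtain ⟨C, hC⟩ := exists_norm_centreTerm_le hz
  exact differentiableOn_id.add (differentiableOn_tsum_of_summable_norm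
    (summable_int_one_add_abs.mul_left C) (fun n => differentiableOn_centreTerm hz n) isOpen_sDisc
    fun n s hs => hC n s hs)

lemma centre_eq {z : ℂ} (hz : z ∈ Hset) {s : ℂ} (hs : 1 / 4 < s.re) :
    centre z s = s * Gs 3 s z := by
  have hs0 : 0 < s.re := by linarith
  have hk : Odd 3 := by decide
  have h2 : 2 < ((3 : ℕ) : ℝ) / 2 + 2 * s.re := by push_cast; linarith
  have e1 : ((((3 : ℕ) : ℝ) / 2 : ℝ) : ℂ) = 3 / 2 := by push_cast; rfl
  have e2 : (((3 : ℕ) : ℂ) / 2) = 3 / 2 := by push_cast; rfl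
  have hB1 : ∀ c : ℕ, ∀ d : ℤ, ‖(fun c d => rowCoeff 3 c d : ℕ → ℤ → ℂ) c d‖ ≤ 1 :=
    fun _ _ => norm_rowCoeff_le _ _ _
  have hB2 := norm_rowCoeffZero_le 3
  rw [Gs, Es_eq hk h2 hz, EsW_eq hk h2 hz, e1, e2,
    rowSum_eq_tsum hB1 (fun c d => rowCoeff_add hk c d) hz hs,
    rowSum_eq_tsum hB2 rowCoeffZero_add hz hs, centre, add_assoc, mul_add, mul_one]
  congr 1
  have hsum : ∀ {B : ℕ → ℤ → ℂ}, (∀ c d, ‖B c d‖ ≤ 1) →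
      Summable fun n : ℤ => klZeta B n s * (hw z.im n s * ef (n * z.re)) := fun hB =>
    (summable_klZeta_term hB (show 0 < z.im from hz) z.re hs).prod_symm.prod.congr fun n => by
      simp only [Prod.swap_prod_mk, tsum_mul_right, klZeta]
  rw [← tsum_mul_left, ← (hsum hB1).tsum_add ((hsum hB2).mul_left _), ← tsum_mul_left]
  refine tsum_congr fun n => ?_
  rw [centreTerm, bothPart, inftyPart_eq n hs0, oddPart_eq_klZeta n hs0]
  ring

lemma half_mem_sDisc : (1 / 2 : ℂ) ∈ sDisc := by
  refine ⟨?_, ?_⟩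
  · show -(1 / 8) < (1 / 2 : ℂ).re
    norm_num
  · simp; norm_num

/-- The convex region contains a neighbourhood of 1/2 inside Re s > 1/4. The identity theorem thus
carries the transformation laws of `Gs` to s = 0. -/
lemma eqOn_sDisc {f g : ℂ → ℂ} (hf : DifferentiableOn ℂ f sDisc) (hg : DifferentiableOn ℂ g sDisc)
    (h : ∀ s : ℂ, 1 / 4 < s.re → f s = g s) : Set.EqOn f g sDisc := by
  refine (hf.analyticOnNhd isOpen_sDisc).eqOn_of_preconnected_of_eventuallyEq
    (hg.analyticOnNhd isOpen_sDisc) isPreconnected_sDisc half_mem_sDisc ?_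
  have : {s : ℂ | 1 / 4 < s.re} ∈ 𝓝 (1 / 2 : ℂ) :=
    (isOpen_lt continuous_const continuous_re).mem_nhds (show 1 / 4 < (1 / 2 : ℂ).re by norm_num)
  filter_upwards [this] with s hs using h s hs

lemma centre_add_one {z : ℂ} (hz : z ∈ Hset) : Set.EqOn (centre (z + 1)) (centre z) sDisc :=
  eqOn_sDisc (differentiableOn_centre (add_one_mem hz)) (differentiableOn_centre hz) fun s hs => by
    rw [centre_eq (add_one_mem hz) hs, centre_eq hz hs, Gs_add_one (by decide) s hz]

lemma centre_W {z : ℂ} (hz : z ∈ Hset) : Set.EqOn (centre (-1 / (4 * z)))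
    (fun s => uW 3 z * (‖2 * z‖ : ℂ) ^ (2 * s) * centre z s) sDisc := by
  have hz0 : (‖2 * z‖ : ℂ) ≠ 0 := by simpa using ne_zero_of_Hset hz
  refine eqOn_sDisc (differentiableOn_centre (W_mem hz)) ?_ fun s hs => ?_
  · refine DifferentiableOn.mul (DifferentiableOn.const_mul ?_ _) (differentiableOn_centre hz)
    exact (Differentiable.const_cpow (by fun_prop) (Or.inl hz0)).differentiableOn
  · rw [centre_eq (W_mem hz) hs, centre_eq hz hs, Gs_W s hz]
    ring

lemma centre_zero (z : ℂ) : centre z 0 = 0 := by simp [centre, centreTerm, bothPart_zero]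

/-- The central value of the Eisenstein series. -/
def centreVal (z : ℂ) : ℂ := deriv (centre z) 0

lemma centreVal_add_one {z : ℂ} (hz : z ∈ Hset) : centreVal (z + 1) = centreVal z :=
  ((centre_add_one hz).eventuallyEq_of_mem (isOpen_sDisc.mem_nhds zero_mem_sDisc)).deriv_eq

/-- As `centre` vanishes at s = 0, differentiating the product leaves only the derivative of that
factor, and |2z|^{2s} is 1 there. -/
lemma centreVal_W {z : ℂ} (hz : z ∈ Hset) : centreVal (-1 / (4 * z)) = uW 3 z * centreVal z := by
  have hz0 : (‖2 * z‖ : ℂ) ≠ 0 := by simpa using ne_zero_of_Hset hz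
  rw [centreVal, ((centre_W hz).eventuallyEq_of_mem
    (isOpen_sDisc.mem_nhds zero_mem_sDisc)).deriv_eq]
  have h1 : DifferentiableAt ℂ (centre z) 0 :=
    (differentiableOn_centre hz).differentiableAt (isOpen_sDisc.mem_nhds zero_mem_sDisc)
  have h2 : DifferentiableAt ℂ (fun s : ℂ => uW 3 z * (‖2 * z‖ : ℂ) ^ (2 * s)) 0 :=
    (DifferentiableAt.const_cpow (by fun_prop) (Or.inl hz0)).const_mul _
  rw [deriv_fun_mul h2 h1, centre_zero]
  simp [centreVal]

/-- Because `bothPart` vanishes at 0, the archimedean factor enters only through its value at s = 0,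
where it produces a multiple of q^n for n > 0 and zero for n ≤ 0. This makes the central value
holomorphic in z. -/
lemma deriv_centreTerm {z : ℂ} (hz : z ∈ Hset) (n : ℤ) : deriv (centreTerm z n) 0 =
    deriv (bothPart n) 0 * (hw z.im n 0 * ef (n * z.re)) := by
  have hmem := isOpen_sHalf.mem_nhds zero_mem_sHalf
  have h1 := (differentiableOn_bothPart n).differentiableAt hmem
  have h2 := ((hw_differentiableOn hz n).mul_const (ef (n * z.re))).differentiableAt hmem
  have := deriv_fun_mul h1 h2
  rw [bothPart_zero, zero_mul, add_zero] at this
  exact this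

lemma hasSum_centreVal {z : ℂ} (hz : z ∈ Hset) :
    HasSum (fun n : ℤ => deriv (bothPart n) 0 * (hw z.im n 0 * ef (n * z.re)))
      (centreVal z - 1) := by
  obtain ⟨C, hC⟩ := exists_norm_centreTerm_le hz
  have h1 := hasSum_deriv_of_summable_norm (summable_int_one_add_abs.mul_left C)
    (fun n => differentiableOn_centreTerm hz n) isOpen_sDisc (fun n s hs => hC n s hs)
    zero_mem_sDisc
  have h2 : DifferentiableAt ℂ (fun s => ∑' n, centreTerm z n s) 0 :=
    (differentiableOn_tsum_of_summable_norm (summable_int_one_add_abs.mul_left C)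
      (fun n => differentiableOn_centreTerm hz n) isOpen_sDisc
      fun n s hs => hC n s hs).differentiableAt (isOpen_sDisc.mem_nhds zero_mem_sDisc)
  have h3 : centreVal z - 1 = deriv (fun s => ∑' n, centreTerm z n s) 0 := by
    have := deriv_fun_add (differentiableAt_fun_id (x := (0 : ℂ)) (𝕜 := ℂ)) h2
    rw [deriv_id''] at this
    rw [centreVal, show centre z = fun s => s + ∑' n, centreTerm z n s from rfl, this]
    ring
  rw [h3]
  simpa only [deriv_centreTerm hz] using h1

/-- The Fourier coefficients of the central value. -/
def centreCoeff (n : ℕ) : ℂ :=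
  deriv (bothPart n) 0 * ((2 * Real.pi / Complex.I) ^ (3 / 2 : ℂ) / Complex.Gamma (3 / 2) * Real.sqrt n)

lemma hw_mul_ef {z : ℂ} (hz : z ∈ Hset) (n : ℕ) : hw z.im (n : ℤ) 0 * ef ((n : ℤ) * z.re) =
    (2 * Real.pi / Complex.I) ^ (3 / 2 : ℂ) / Complex.Gamma (3 / 2) * Real.sqrt n *
      cexp (2 * Real.pi * Complex.I * n * z) := by
  rw [hw_zero hz, gam, ef, ofReal_mul, ofReal_exp, mul_assoc, mul_assoc, ← Complex.exp_add,
    ← mul_assoc, Int.cast_natCast]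
  congr 2
  conv_rhs => rw [← re_add_im z]
  push_cast
  have := I_mul_I
  linear_combination (-(2 * Real.pi * n * z.im : ℂ)) * this

lemma hasSum_centreVal_nat {z : ℂ} (hz : z ∈ Hset) :
    HasSum (fun n : ℕ => centreCoeff (n + 1) * cexp (2 * Real.pi * Complex.I * (n + 1 : ℕ) * z))
      (centreVal z - 1) := by
  have hinj : Function.Injective fun n : ℕ => ((n + 1 : ℕ) : ℤ) := fun a b hab => by
    simpa using hab
  have e : ∀ n : ℕ, centreCoeff (n + 1) * cexp (2 * Real.pi * Complex.I * (n + 1 : ℕ) * z) =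
      ((fun n : ℤ => deriv (bothPart n) 0 * (hw z.im n 0 * ef (n * z.re))) ∘
        fun n : ℕ => ((n + 1 : ℕ) : ℤ)) n := fun n => by
    simp only [Function.comp]
    rw [hw_mul_ef hz (n + 1), centreCoeff]
    ring
  simp_rw [e]
  refine (hinj.hasSum_iff fun n hn => ?_).2 (hasSum_centreVal hz)
  have hn0 : n ≤ 0 := by
    by_contra hpos
    exact hn ⟨n.toNat - 1, by simp only; omega⟩
  rw [hw_zero hz, gam_of_nonpos (by exact_mod_cast hn0)]
  simp

/-! ### Fourier series with coefficients of polynomial growth -/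

/-- From e^{-x} ≤ 10!/x^{10}: eight powers absorb the growth of the coefficients and two remain for
summability. The price y^{-10} is the growth exponent in `centreVal_eq`. -/
lemma pow_mul_exp_neg_le {y : ℝ} (hy : 0 < y) (n : ℕ) :
    (1 + ((n + 1 : ℕ) : ℝ)) ^ 8 * Real.exp (-(2 * Real.pi * (n + 1 : ℕ) * y)) ≤
      2 ^ 8 * (Nat.factorial 10) * ((((n + 1 : ℕ) : ℝ) ^ 2)⁻¹ * (y ^ 10)⁻¹) := by
  set m : ℝ := ((n + 1 : ℕ) : ℝ) with hm
  have hm1 : 1 ≤ m := by rw [hm]; exact_mod_cast Nat.succ_pos n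
  have hm0 : 0 < m := by linarith
  have h1 := Real.pow_div_factorial_le_exp (2 * Real.pi * m * y) (by positivity) 10
  have h2 : (m * y) ^ 10 ≤ (2 * Real.pi * m * y) ^ 10 := by
    refine pow_le_pow_left₀ (by positivity) ?_ 10
    have : 1 ≤ 2 * Real.pi := by linarith [Real.pi_gt_three]
    nlinarith [mul_pos hm0 hy]
  have hf : (0 : ℝ) < Nat.factorial 10 := by positivity
  have h3 : Real.exp (-(2 * Real.pi * m * y)) ≤ Nat.factorial 10 * ((m * y) ^ 10)⁻¹ := by
    rw [Real.exp_neg, inv_le_comm₀ (Real.exp_pos _) (by positivity), mul_inv, inv_inv]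
    refine le_trans ?_ h1
    rw [div_eq_inv_mul]
    gcongr
  calc _ ≤ (2 * m) ^ 8 * (Nat.factorial 10 * ((m * y) ^ 10)⁻¹) := by gcongr; linarith
    _ = _ := by field_simp

lemma norm_exp_mul (n : ℕ) (z : ℂ) : ‖cexp (2 * Real.pi * Complex.I * (n + 1 : ℕ) * z)‖ =
    Real.exp (-(2 * Real.pi * (n + 1 : ℕ) * z.im)) := by
  rw [norm_exp]
  congr 1
  simp

lemma norm_fourier_term_le {a : ℂ} {C : ℝ} {n : ℕ} (ha : ‖a‖ ≤ C * (1 + ((n + 1 : ℕ) : ℝ)) ^ 8)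
    {z : ℂ} (hz : z ∈ Hset) : ‖a * cexp (2 * Real.pi * Complex.I * (n + 1 : ℕ) * z)‖ ≤
      C * (2 ^ 8 * (Nat.factorial 10)) * ((((n + 1 : ℕ) : ℝ) ^ 2)⁻¹ * (z.im ^ 10)⁻¹) := by
  have hC : 0 ≤ C := by
    by_contra h
    have := (norm_nonneg a).trans ha
    have h2 : 0 < (1 + ((n + 1 : ℕ) : ℝ)) ^ 8 := by positivity
    nlinarith
  rw [norm_mul, norm_exp_mul]
  calc _ ≤ C * (1 + ((n + 1 : ℕ) : ℝ)) ^ 8 * Real.exp (-(2 * Real.pi * (n + 1 : ℕ) * z.im)) := by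
        gcongr
    _ = C * ((1 + ((n + 1 : ℕ) : ℝ)) ^ 8 * Real.exp (-(2 * Real.pi * (n + 1 : ℕ) * z.im))) := by
        ring
    _ ≤ C * _ := mul_le_mul_of_nonneg_left (pow_mul_exp_neg_le hz n) hC
    _ = _ := by ring

lemma summable_succ_sq_inv : Summable fun n : ℕ => (((n + 1 : ℕ) : ℝ) ^ 2)⁻¹ :=
  (summable_nat_add_iff 1).2 (Real.summable_nat_pow_inv.2 one_lt_two)

/-- Seven powers come from `bothPart` through Cauchy's estimate, and one more bounds the square
root. -/
lemma exists_norm_centreCoeff_le : ∃ C : ℝ, ∀ n : ℕ,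
    ‖centreCoeff (n + 1)‖ ≤ C * (1 + ((n + 1 : ℕ) : ℝ)) ^ 8 := by
  obtain ⟨A, hA0, hA⟩ := exists_norm_bothPart_le
  set k := ‖(2 * Real.pi / Complex.I) ^ (3 / 2 : ℂ) / Complex.Gamma (3 / 2)‖
  refine ⟨16 * A * k, fun n => ?_⟩
  set m : ℝ := ((n + 1 : ℕ) : ℝ) with hm
  have hm1 : 1 ≤ m := by rw [hm]; exact_mod_cast Nat.succ_pos n
  have h1 := norm_deriv_zero_le (differentiableOn_bothPart (n + 1 : ℕ))
    fun s hs hs1 => (hA (n + 1 : ℕ) s hs hs1).2.2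
  have e : |(((n + 1 : ℕ) : ℤ) : ℝ)| = m := by
    rw [Int.cast_natCast, abs_of_nonneg (by positivity)]
  rw [e] at h1
  have h2 : ‖(Real.sqrt m : ℂ)‖ ≤ 1 + m := by
    rw [norm_real, Real.norm_of_nonneg (Real.sqrt_nonneg _)]
    refine (Real.sqrt_le_left (by linarith)).2 (by nlinarith)
  rw [centreCoeff, norm_mul, norm_mul]
  calc _ ≤ 16 * (A * (1 + m) ^ 7) * (k * (1 + m)) := by gcongr
    _ = _ := by ring

lemma norm_centreVal_term_le : ∃ C : ℝ, 0 ≤ C ∧ ∀ n : ℕ, ∀ z ∈ Hset,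
    ‖centreCoeff (n + 1) * cexp (2 * Real.pi * Complex.I * (n + 1 : ℕ) * z)‖ ≤
      C * ((((n + 1 : ℕ) : ℝ) ^ 2)⁻¹ * (z.im ^ 10)⁻¹) := by
  obtain ⟨C, hC⟩ := exists_norm_centreCoeff_le
  refine ⟨|C * (2 ^ 8 * (Nat.factorial 10))|, abs_nonneg _, fun n z hz => ?_⟩
  have hz' : 0 < z.im := hz
  exact (norm_fourier_term_le (hC n) hz).trans
    (mul_le_mul_of_nonneg_right (le_abs_self _) (by positivity))

lemma exists_norm_centreVal_sub_one_le : ∃ C : ℝ, 0 ≤ C ∧ ∀ z ∈ Hset,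
    ‖centreVal z - 1‖ ≤ C * (z.im ^ 10)⁻¹ := by
  obtain ⟨C, hC0, hC⟩ := norm_centreVal_term_le
  refine ⟨C * ∑' n : ℕ, (((n + 1 : ℕ) : ℝ) ^ 2)⁻¹, by positivity, fun z hz => ?_⟩
  rw [← (hasSum_centreVal_nat hz).tsum_eq]
  have h1 := ((summable_succ_sq_inv.hasSum.mul_right (z.im ^ 10)⁻¹).mul_left C)
  rw [← mul_assoc] at h1
  exact tsum_of_norm_bounded h1 fun n => hC n z hz

lemma differentiableOn_centreVal : DifferentiableOn ℂ centreVal Hset := by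
  obtain ⟨C, hC0, hC⟩ := norm_centreVal_term_le
  intro z hz
  have hz' : 0 < z.im := hz
  have hopen : IsOpen {w : ℂ | z.im / 2 < w.im} := isOpen_lt continuous_const continuous_im
  have h := differentiableOn_tsum_of_summable_norm
    (F := fun (n : ℕ) (w : ℂ) => centreCoeff (n + 1) * cexp (2 * Real.pi * Complex.I * (n + 1 : ℕ) * w))
    (((summable_succ_sq_inv.mul_right ((z.im / 2) ^ 10)⁻¹).mul_left C))
    (fun n => by fun_prop) hopen fun n w hw => by
      have hw' : z.im / 2 < w.im := hw
      have hw0 : w ∈ Hset := show 0 < w.im by linarith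
      refine (hC n w hw0).trans ?_
      gcongr
  have h1 := (h.const_add 1).differentiableAt (hopen.mem_nhds (show z.im / 2 < z.im by linarith))
  refine (h1.congr_of_eventuallyEq ?_).differentiableWithinAt
  filter_upwards [isOpen_Hset.mem_nhds hz] with w hw
  rw [(hasSum_centreVal_nat hw).tsum_eq]
  ring

lemma centreVal_eq {z : ℂ} (hz : z ∈ Hset) : centreVal z = th z ^ 3 := by
  obtain ⟨C, hC0, hC⟩ := exists_norm_centreVal_sub_one_le
  refine eq_th_pow (k := 3) (by norm_num) differentiableOn_centreVal
    (fun z hz => centreVal_add_one hz) (fun z hz => centreVal_W hz) ?_ (C := 1 + C) (B := 10)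
    (by norm_num) (fun z hz hz1 => ?_) z hz
  · rw [← tendsto_sub_nhds_zero_iff]
    refine squeeze_zero_norm' (a := fun z : ℂ => C * (z.im ^ 10)⁻¹) ?_ ?_
    · filter_upwards [eventually_Hset] with z hz using hC z hz
    · rw [← mul_zero C]
      refine Tendsto.const_mul C ?_
      exact (tendsto_inv_atTop_zero.comp (tendsto_pow_atTop (by norm_num))).comp tendsto_comap
  · have hz0 : 0 < z.im := hz
    have h1 : 1 ≤ (z.im ^ 10)⁻¹ := (one_le_inv₀ (by positivity)).2 (pow_le_one₀ hz0.le hz1)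
    have h2 : z.im ^ (-10 : ℝ) = (z.im ^ 10)⁻¹ := by
      rw [Real.rpow_neg hz0.le]
      norm_cast
    rw [h2]
    have h3 := norm_add_le (1 : ℂ) (centreVal z - 1)
    rw [add_sub_cancel, norm_one] at h3
    linarith [hC z hz]

end ThetaEisenstein
end

noncomputable section
namespace ThetaEisenstein
open Complex Filter Topology CongruenceSubgroup

/-! ### Kloosterman sums over double cosets -/

lemma trans_apply (n : ℤ) : trans n 0 0 = 1 ∧ trans n 0 1 = n ∧ trans n 1 0 = 0 ∧ trans n 1 1 = 1 := by
  simp only [trans, toReal_apply, ModularGroup.coe_T_zpow]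
  simp

lemma trans_mul_mul_trans (m n : ℤ) (g : SL(2, ℝ)) :
    (trans m * g * trans n) 1 0 = g 1 0 ∧ (trans m * g * trans n) 1 1 = g 1 0 * n + g 1 1 := by
  obtain ⟨-, -, h3, h4⟩ := trans_apply m
  obtain ⟨k1, k2, k3, k4⟩ := trans_apply n
  rw [Matrix.SpecialLinearGroup.coe_mul, Matrix.SpecialLinearGroup.coe_mul]
  simp only [Matrix.mul_apply, Fin.sum_univ_two, h3, h4, k1, k2, k3, k4]
  constructor <;> ring

/-- A description of the bottom rows of `σ⁻¹Γ₀(4)` by integers `C` and `D`, and of the multipliers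
by a periodic function `B`. -/
structure CuspData (σ : SL(2, ℝ)) (lam : ℝ) (C D : SL(2, ℤ) → ℤ) (B : ℕ → ℤ → ℂ) (K : ℂ) : Prop where
  pos : 0 < lam
  lower : ∀ γ, (σ⁻¹ * toReal γ) 1 0 = lam * C γ
  right : ∀ γ, (σ⁻¹ * toReal γ) 1 1 = lam * D γ
  unipotent : ∀ M ∈ Gamma0 4, (σ⁻¹ * toReal M * σ) 1 0 = 0 → (σ⁻¹ * toReal M * σ) 1 1 = 1 →
    ∃ m : ℤ, σ⁻¹ * toReal M * σ = trans m
  exists_row : ∀ c : ℕ, 0 < c → ∀ d : ℤ, B c d ≠ 0 →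
    ∃ γ : Gamma0 4, C (γ : SL(2, ℤ)) = c ∧ D (γ : SL(2, ℤ)) = d
  periodic : ∀ (c : ℕ) (d : ℤ), B c (d + c) = B c d
  norm_le : ∀ (c : ℕ) (d : ℤ), ‖B c d‖ ≤ 1
  multiplier : ∀ γ ∈ Gamma0 4, 0 < C γ →
    star (Psi 3 γ * w (((3 : ℕ) : ℝ) / 2) σ⁻¹ (toReal γ) UpperHalfPlane.I) = K * B (C γ).toNat (D γ)

namespace CuspData

variable {σ : SL(2, ℝ)} {lam : ℝ} {C D : SL(2, ℤ) → ℤ} {B : ℕ → ℤ → ℂ} {K : ℂ}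

lemma periodic_mul (h : CuspData σ lam C D B K) (c : ℕ) (d m : ℤ) : B c (d + m * c) = B c d := by
  induction m using Int.induction_on with
  | zero => simp
  | succ m ih => rw [← ih, ← h.periodic c (d + m * c)]; congr 1; ring
  | pred m ih => rw [← ih, ← h.periodic c (d + (-m - 1) * c)]; congr 1; ring

lemma periodic_emod (h : CuspData σ lam C D B K) (c : ℕ) (d : ℤ) : B c (d % c) = B c d := by
  conv_rhs => rw [← Int.emod_add_mul_ediv d c, mul_comm, h.periodic_mul]

lemma rep_lower (h : CuspData σ lam C D B K) (q : DoubleCosets (Gamma0 4) σ) :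
    q.rep 1 0 = lam * C (q.out.1 : SL(2, ℤ)) ∧ 0 < C (q.out.1 : SL(2, ℤ)) := by
  refine ⟨h.lower _, ?_⟩
  have := q.out.2
  rw [h.lower] at this
  exact_mod_cast pos_of_mul_pos_right this h.pos.le

/-- The element γ' T^{-n} γ⁻¹ of Γ, conjugated by σ, has lower row (0, 1), so it is an integral
translation. A double coset is thus determined by C and by D modulo C. -/
lemma rel (h : CuspData σ lam C D B K) {γ γ' : Gamma0 4} {n : ℤ}
    (hC : C (γ' : SL(2, ℤ)) = C (γ : SL(2, ℤ)))
    (hD : D (γ' : SL(2, ℤ)) = D (γ : SL(2, ℤ)) + n * C (γ : SL(2, ℤ))) :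
    ∃ m n : ℤ, σ⁻¹ * toReal γ' = trans m * (σ⁻¹ * toReal γ) * trans n := by
  set g := σ⁻¹ * toReal γ with hg
  set M : SL(2, ℤ) := γ' * ModularGroup.T ^ (-n) * (γ : SL(2, ℤ))⁻¹ with hM
  have hMmem : M ∈ Gamma0 4 := by
    refine mul_mem (mul_mem γ'.2 ?_) (inv_mem γ.2)
    rw [mem_Gamma0_four]
    simp [ModularGroup.coe_T_zpow]
  have e : σ⁻¹ * toReal M * σ = σ⁻¹ * toReal γ' * trans (-n) * g⁻¹ := by
    rw [hM, hg, map_mul, map_mul, map_inv, mul_inv_rev, inv_inv, trans]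
    simp only [mul_assoc]
  have e1 : ∀ x : SL(2, ℝ), (x * g⁻¹) 1 0 = x 1 0 * g 1 1 - x 1 1 * g 1 0 ∧
      (x * g⁻¹) 1 1 = x 1 1 * g 0 0 - x 1 0 * g 0 1 := fun x => by
    rw [Matrix.SpecialLinearGroup.coe_mul, Matrix.SpecialLinearGroup.coe_inv,
      Matrix.adjugate_fin_two]
    simp only [Matrix.mul_apply, Fin.sum_univ_two]
    constructor <;> simp <;> ring
  have h1 := trans_mul_mul_trans 0 (-n) (σ⁻¹ * toReal γ')
  rw [show trans 0 = 1 by simp [trans], one_mul, h.lower, h.right, hC, hD] at h1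
  have h2 : g 1 0 = lam * C (γ : SL(2, ℤ)) := h.lower _
  have h3 : g 1 1 = lam * D (γ : SL(2, ℤ)) := h.right _
  have hdet : g 0 0 * g 1 1 - g 0 1 * g 1 0 = 1 := by
    have := g.2
    rwa [Matrix.det_fin_two] at this
  have h4 : (σ⁻¹ * toReal γ' * trans (-n)) 1 1 = g 1 1 := by
    rw [h1.2, h3]; push_cast; ring
  have h5 : (σ⁻¹ * toReal γ' * trans (-n)) 1 0 = g 1 0 := by rw [h1.1, h2]
  obtain ⟨m, hm⟩ := h.unipotent M hMmem
    (by rw [e, (e1 _).1, h4, h5]; ring) (by rw [e, (e1 _).2, h4, h5]; linear_combination hdet)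
  refine ⟨m, n, ?_⟩
  rw [← hm, e]
  simp [trans, mul_assoc]

lemma out_of_row (h : CuspData σ lam C D B K) (γ : Gamma0 4) (hpos : 0 < C (γ : SL(2, ℤ))) :
    ∃ q : DoubleCosets (Gamma0 4) σ, C (q.out.1 : SL(2, ℤ)) = C (γ : SL(2, ℤ)) ∧
      ∃ n : ℤ, D (q.out.1 : SL(2, ℤ)) = D (γ : SL(2, ℤ)) + n * C (γ : SL(2, ℤ)) := by
  have hl := h.pos
  let p : PosLower (Gamma0 4) σ := ⟨γ, by
    rw [h.lower]; have : (0 : ℝ) < C (γ : SL(2, ℤ)) := by exact_mod_cast hpos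
    positivity⟩
  obtain ⟨m, n, hmn⟩ := (doubleCosetSetoid (Gamma0 4) σ).symm (Quotient.mk_out (s := doubleCosetSetoid (Gamma0 4) σ) p)
  have h1 := trans_mul_mul_trans m n (σ⁻¹ * toReal p.1)
  rw [← hmn, h.lower, h.lower, h.right, h.right] at h1
  have e1 := mul_left_cancel₀ hl.ne' h1.1
  have e2 : (D ((Quotient.mk (doubleCosetSetoid (Gamma0 4) σ) p).out.1 : SL(2, ℤ)) : ℝ) =
      D (γ : SL(2, ℤ)) + n * C (γ : SL(2, ℤ)) := by
    apply mul_left_cancel₀ hl.ne'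
    rw [h1.2]; ring
  exact ⟨Quotient.mk (doubleCosetSetoid (Gamma0 4) σ) p, by exact_mod_cast e1, n, by exact_mod_cast e2⟩

/-- Double cosets with C = c embed into the residues modulo c by means of D. Residues that are not
attained have coefficient zero, so the sum may run over all of them. -/
lemma kloosterman_eq (h : CuspData σ lam C D B K) (n : ℕ) {c : ℕ} (hc : 0 < c) :
    kloosterman (((3 : ℕ) : ℝ) / 2) (Gamma0 4) (Psi 3) σ n (lam * c) = K * klSum B n c := by
  have hl := h.pos
  have hcc : (c : ℂ) ≠ 0 := by exact_mod_cast hc.ne'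
  have hlc : (lam : ℂ) ≠ 0 := by exact_mod_cast hl.ne'
  set S : Set (DoubleCosets (Gamma0 4) σ) := {q | q.rep 1 0 = lam * c} with hS
  have hSC : ∀ q ∈ S, C (q.out.1 : SL(2, ℤ)) = c := fun q hq => by
    have hq' : q.rep 1 0 = lam * c := hq
    rw [(h.rep_lower q).1] at hq'
    exact_mod_cast mul_left_cancel₀ hl.ne' hq'
  set e : DoubleCosets (Gamma0 4) σ → ℕ := fun q => (D (q.out.1 : SL(2, ℤ)) % c).toNat with he
  have hec : ∀ q, ((e q : ℕ) : ℤ) = D (q.out.1 : SL(2, ℤ)) % c := fun q =>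
    Int.toNat_of_nonneg (Int.emod_nonneg _ (by omega))
  set g : ℕ → ℂ := fun r => K * (B c r * ef ((n : ℤ) * r / c)) with hg
  have hinj : Set.InjOn e S := fun q hq q' hq' hqq => by
    have h1 : D (q.out.1 : SL(2, ℤ)) % c = D (q'.out.1 : SL(2, ℤ)) % c := by
      rw [← hec, ← hec, hqq]
    obtain ⟨k, hk⟩ := (Int.modEq_iff_dvd).1 h1
    refine Quotient.out_equiv_out.1 ?_
    refine h.rel (n := k) (by rw [hSC q hq, hSC q' hq']) ?_
    rw [hSC q hq]
    linear_combination hk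
  have hterm : ∀ q ∈ S, star (Psi 3 q.out.1 * w (((3 : ℕ) : ℝ) / 2) σ⁻¹ (toReal q.out.1)
      UpperHalfPlane.I) * cexp (2 * Real.pi * Complex.I * (n : ℂ) * ((q.rep 1 1 : ℝ) : ℂ) /
        ((lam * c : ℝ) : ℂ)) = g (e q) := fun q hq => by
    rw [h.multiplier _ q.out.1.2 (h.rep_lower q).2, hSC q hq, hg]
    simp only
    rw [Int.toNat_natCast, hec, h.periodic_emod, mul_assoc]
    congr 2
    have h1 : q.rep 1 1 = lam * D (q.out.1 : SL(2, ℤ)) := h.right _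
    rw [← ef_add_int _ ((n : ℤ) * (D (q.out.1 : SL(2, ℤ)) / c)), ef, h1]
    congr 1
    have h2 : ((e q : ℕ) : ℂ) = D (q.out.1 : SL(2, ℤ)) - c * (D (q.out.1 : SL(2, ℤ)) / c : ℤ) := by
      have h3 := Int.emod_add_mul_ediv (D (q.out.1 : SL(2, ℤ))) c
      rw [← hec] at h3
      have h4 : (((e q : ℕ) : ℤ) : ℂ) = ((D (q.out.1 : SL(2, ℤ)) - c * (D (q.out.1 : SL(2, ℤ)) / c) : ℤ) : ℂ)  :=
        congrArg Int.cast (by linarith [h3])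
      push_cast at h4
      exact h4
    rw [h2]
    push_cast
    field_simp
    ring
  rw [kloosterman]
  have s1 : (∑ᶠ (q : DoubleCosets (Gamma0 4) σ) (_ : q.rep 1 0 = lam * c),
      star (Psi 3 q.out.1 * w (((3 : ℕ) : ℝ) / 2) σ⁻¹ (toReal q.out.1) UpperHalfPlane.I) *
        cexp (2 * Real.pi * Complex.I * (n : ℂ) * ((q.rep 1 1 : ℝ) : ℂ) / ((lam * c : ℝ) : ℂ))) =
      ∑ᶠ q ∈ S, g (e q) := finsum_mem_congr rfl hterm
  rw [s1, ← finsum_mem_image hinj, finsum_mem_eq_sum_of_inter_support_eq (t := Finset.range c)]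
  · rw [klSum, Finset.mul_sum]
  · ext r
    simp only [Set.mem_inter_iff, Finset.coe_range, Set.mem_Iio, Function.mem_support]
    refine and_congr_left fun hr => ⟨?_, fun hrc => ?_⟩
    · rintro ⟨q, -, rfl⟩
      have h1 : ((e q : ℕ) : ℤ) < c := by rw [hec]; exact Int.emod_lt_of_pos _ (by omega)
      exact_mod_cast h1
    · have hB : B c r ≠ 0 := fun h0 => hr (by simp [hg, h0])
      obtain ⟨γ, hγ1, hγ2⟩ := h.exists_row c hc r hB
      obtain ⟨q, hq1, k, hq2⟩ := h.out_of_row γ (by rw [hγ1]; exact_mod_cast hc)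
      refine ⟨q, ?_, ?_⟩
      · show q.rep 1 0 = lam * c
        rw [(h.rep_lower q).1, hq1, hγ1]
        simp
      · have h1 := hec q
        rw [hq2, hγ1, hγ2, Int.add_mul_emod_self_right, Int.emod_eq_of_lt (by omega) (by omega)] at h1
        exact_mod_cast h1

lemma kloosterman_eq_zero (h : CuspData σ lam C D B K) (n : ℕ) {x : ℝ}
    (hx : ∀ c : ℕ, 0 < c → x ≠ lam * c) :
    kloosterman (((3 : ℕ) : ℝ) / 2) (Gamma0 4) (Psi 3) σ n x = 0 := by
  rw [kloosterman]
  refine finsum_eq_zero_of_forall_eq_zero fun q => ?_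
  obtain ⟨h1, h2⟩ := h.rep_lower q
  suffices hne : ¬ q.rep 1 0 = x by simp [hne]
  intro hq
  refine absurd (hq.symm.trans h1) ?_
  have h3 : ((C (q.out.1 : SL(2, ℤ)) : ℤ) : ℝ) = ((C (q.out.1 : SL(2, ℤ))).toNat : ℝ) := by
    have := Int.toNat_of_nonneg h2.le
    exact_mod_cast this.symm
  rw [h3]
  exact hx _ (by omega)

lemma hasSum_kloosterman (h : CuspData σ lam C D B K) (n : ℕ) {s : ℂ} (hs : 1 / 4 < s.re) :
    HasSum (fun c : {c : ℝ // 0 < c} =>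
      kloosterman (((3 : ℕ) : ℝ) / 2) (Gamma0 4) (Psi 3) σ n c *
        ((c : ℝ) : ℂ) ^ (-(((((3 : ℕ) : ℝ) / 2 : ℝ) : ℂ) + 2 * s)))
      (K * (lam : ℂ) ^ (-(3 / 2 + 2 * s)) * klZeta B n s) := by
  have hl := h.pos
  have e1 : ((((3 : ℕ) : ℝ) / 2 : ℝ) : ℂ) = 3 / 2 := by push_cast; rfl
  rw [e1]
  let i : ℕ → {c : ℝ // 0 < c} := fun m => ⟨lam * (m + 1 : ℕ), by positivity⟩
  have hi : Function.Injective i := fun a b hab => by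
    have := mul_left_cancel₀ hl.ne' (congrArg Subtype.val hab)
    have : a + 1 = b + 1 := by exact_mod_cast this
    omega
  rw [← hi.hasSum_iff]
  · have h1 := (summable_klZeta h.norm_le n hs).hasSum.mul_left (K * (lam : ℂ) ^ (-(3 / 2 + 2 * s)))
    rw [klZeta]
    refine (congrArg (fun f : ℕ → ℂ => HasSum f _) (funext fun m => ?_)).mpr h1
    simp only [Function.comp, i]
    rw [h.kloosterman_eq n m.succ_pos, ofReal_mul, ofReal_natCast,
      ofReal_mul_cpow hl (Nat.cast_ne_zero.2 m.succ_ne_zero)]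
    ring
  · rintro ⟨x, hx⟩ hxi
    rw [h.kloosterman_eq_zero n, zero_mul]
    intro c hc hxc
    exact hxi ⟨c - 1, Subtype.ext (by simp only [i]; rw [Nat.sub_add_cancel hc]; exact hxc.symm)⟩

/-- Here f is s times the zeta function, so the continuation is f(s)/s, completed at 0 by f'(0)
because f(0) = 0. -/
lemma isKloostermanZetaValue (h : CuspData σ lam C D B K) (n : ℕ) {f : ℂ → ℂ}
    (hf : DifferentiableOn ℂ f sHalf) (h0 : f 0 = 0)
    (hfz : ∀ s : ℂ, 0 < s.re → f s = s * klZeta B n s) :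
    IsKloostermanZetaValue (((3 : ℕ) : ℝ) / 2) (Gamma0 4) (Psi 3) σ n
      (K * (lam : ℂ) ^ (-(3 / 2 : ℂ)) * deriv f 0) := by
  have hl : (lam : ℂ) ≠ 0 := by exact_mod_cast h.pos.ne'
  have hd : DifferentiableOn ℂ (fun s => K * (lam : ℂ) ^ (-(3 / 2 + 2 * s)) * dslope f 0 s) sHalf := by
    refine DifferentiableOn.mul (DifferentiableOn.const_mul ?_ _) ?_
    · exact (Differentiable.const_cpow (by fun_prop) (Or.inl hl)).differentiableOn
    · exact (differentiableOn_dslope (isOpen_sHalf.mem_nhds zero_mem_sHalf)).2 hf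
  have ha := hd.analyticOnNhd isOpen_sHalf
  refine ⟨1 / 8, fun s => K * (lam : ℂ) ^ (-(3 / 2 + 2 * s)) * dslope f 0 s, by norm_num,
    ha.meromorphicOn, ha 0 zero_mem_sHalf, fun s hs => ?_, ?_⟩
  · have hs' : 1 / 4 < s.re := by push_cast at hs; linarith
    have hs0 : s ≠ 0 := fun h => by rw [h] at hs'; norm_num at hs'
    have e : dslope f 0 s = klZeta B n s := by
      rw [dslope_of_ne _ hs0, slope_def_field, h0, hfz s (by linarith), sub_zero, sub_zero,
        mul_div_cancel_left₀ _ hs0]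
    show HasSum _ (K * (lam : ℂ) ^ (-(3 / 2 + 2 * s)) * dslope f 0 s)
    rw [e]
    exact h.hasSum_kloosterman n hs'
  · simp [dslope_same]

end CuspData

/-- The continued value is unique. -/
lemma IsKloostermanZetaValue.unique {κ : ℝ} {Γ : Subgroup SL(2, ℤ)} {ν : SL(2, ℤ) → ℂ}
    {σ : SL(2, ℝ)} {n : ℕ} {v v' : ℂ} (h : IsKloostermanZetaValue κ Γ ν σ n v)
    (h' : IsKloostermanZetaValue κ Γ ν σ n v') : v = v' := by
  obtain ⟨δ, G, hδ, hG, hG0, hGs, rfl⟩ := h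
  obtain ⟨δ', G', hδ', hG', hG0', hGs', rfl⟩ := h'
  set U : Set ℂ := {s | -(min δ δ') < s.re} with hU
  have hm : MeromorphicOn (G - G') U := fun s hs => by
    have hs' : -(min δ δ') < s.re := hs
    refine (hG s ?_).sub (hG' s ?_)
    · have := min_le_left δ δ'
      show -δ < s.re
      linarith
    · have := min_le_right δ δ'
      show -δ' < s.re
      linarith
  have hmin : 0 < min δ δ' := lt_min hδ hδ'
  have hpre : IsPreconnected U := (convex_halfSpace_re_gt _).isPreconnected
  -- A point in the region of convergence, whatever the sign of κ.
  set x : ℂ := ((|κ| + 2 : ℝ) : ℂ) with hx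
  have hxre : x.re = |κ| + 2 := ofReal_re _
  have hxU : x ∈ U := by
    show -(min δ δ') < x.re
    rw [hxre]
    linarith [abs_nonneg κ]
  have h0U : (0 : ℂ) ∈ U := by
    show -(min δ δ') < (0 : ℂ).re
    simpa using hmin
  have htop : meromorphicOrderAt (G - G') x = ⊤ := by
    rw [meromorphicOrderAt_eq_top_iff]
    refine Filter.Eventually.filter_mono nhdsWithin_le_nhds ?_
    have hopen : IsOpen {s : ℂ | 2 < κ + 2 * s.re} :=
      isOpen_lt continuous_const (by fun_prop)
    filter_upwards [hopen.mem_nhds (show 2 < κ + 2 * x.re by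
      rw [hxre]; linarith [neg_abs_le κ, abs_nonneg κ])] with s hs
    rw [Pi.sub_apply, (hGs s hs).unique (hGs' s hs), sub_self]
  -- Infinite order of vanishing propagates along the connected half-plane. It gives equality only
  -- near 0 and off 0, and analyticity at 0 then settles the value itself.
  have htop0 : meromorphicOrderAt (G - G') 0 = ⊤ := by
    by_contra hne
    exact hm.meromorphicOrderAt_ne_top_of_isPreconnected hpre h0U hxU hne htop
  rw [meromorphicOrderAt_eq_top_iff] at htop0
  have hc : ContinuousAt (G - G') 0 := (hG0.sub hG0').continuousAt
  have h1 : Tendsto (G - G') (𝓝[≠] 0) (𝓝 ((G - G') 0)) := hc.tendsto.mono_left nhdsWithin_le_nhds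
  have h2 : Tendsto (G - G') (𝓝[≠] 0) (𝓝 0) :=
    tendsto_const_nhds.congr' (htop0.mono fun s hs => hs.symm)
  exact sub_eq_zero.1 (tendsto_nhds_unique h1 h2)

lemma kloostermanZetaValue_eq {κ : ℝ} {Γ : Subgroup SL(2, ℤ)} {ν : SL(2, ℤ) → ℂ}
    {σ : SL(2, ℝ)} {n : ℕ} {v : ℂ} (h : IsKloostermanZetaValue κ Γ ν σ n v) :
    kloostermanZetaValue κ Γ ν σ n = v := by
  have hex : ∃ v, IsKloostermanZetaValue κ Γ ν σ n v := ⟨v, h⟩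
  rw [kloostermanZetaValue, dif_pos hex]
  exact hex.choose_spec.unique h

end ThetaEisenstein
end

/-! ### The cusps ∞ and 0 in weight 3/2, and the conclusion. -/

noncomputable section
namespace ThetaEisenstein
open Complex Filter Topology CongruenceSubgroup

lemma isCoprime_of_rowCoeff_ne_zero {k : ℕ} {c d : ℤ} (h : rowCoeff k c d ≠ 0) :
    4 ∣ c ∧ IsCoprime c d := by
  by_contra hn
  exact h (by rw [rowCoeff, if_neg hn])

lemma eq_trans_of_lower {g : SL(2, ℝ)} {m : ℤ} (h10 : g 1 0 = 0) (h11 : g 1 1 = 1)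
    (h01 : g 0 1 = m) : g = trans m := by
  have hdet : g 0 0 * g 1 1 - g 0 1 * g 1 0 = 1 := by
    have := g.2
    rwa [Matrix.det_fin_two] at this
  rw [h10, h11] at hdet
  obtain ⟨h1, h2, h3, h4⟩ := trans_apply m
  ext i l
  fin_cases i <;> fin_cases l
  · simp only [Fin.zero_eta, h1]; linarith
  · simp only [Fin.zero_eta, Fin.mk_one, h2, h01]
  · simp only [Fin.zero_eta, Fin.mk_one, h3, h10]
  · simp only [Fin.mk_one, h4, h11]

lemma cuspData_one : CuspData 1 1 (fun γ => γ 1 0) (fun γ => γ 1 1)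
    (fun c d => rowCoeff 3 c d) 1 where
  pos := one_pos
  lower γ := by rw [inv_one, one_mul, toReal_apply, one_mul]
  right γ := by rw [inv_one, one_mul, toReal_apply, one_mul]
  unipotent M _ h10 h11 := by
    rw [inv_one, one_mul, mul_one] at *
    exact ⟨M 0 1, eq_trans_of_lower h10 h11 (toReal_apply _ _ _)⟩
  exists_row c _ d h := by
    obtain ⟨h1, h2⟩ := isCoprime_of_rowCoeff_ne_zero h
    exact exists_Gamma0_of_lower h1 h2
  periodic c d := rowCoeff_add (by decide) c d
  norm_le c d := norm_rowCoeff_le _ _ _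
  multiplier γ hγ hc := by
    rw [inv_one, star_mul', w_one, star_one, star_Psi_eq_rowCoeff hγ, Int.toNat_of_nonneg hc.le]
    ring

/-- The constant by which the multipliers at the cusp `0` differ from `rowCoeffZero`. -/
def cuspConst : ℂ := (((1 - Complex.I) / (Real.sqrt 2 : ℂ)) ^ 3)⁻¹ *
  (2 ^ (3 / 2 : ℂ) * ((-2 * Complex.I) ^ (3 / 2 : ℂ))⁻¹)

/-- The multiplier is extracted from `eisTerm_sigmaZero` at z = i. The row is negated, because the
lower left entry -2a of σ₀⁻¹γ is positive for a < 0. -/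
lemma star_Psi_mul_w_sigmaZero {γ : SL(2, ℤ)} (hγ : γ ∈ Gamma0 4) (h : 0 < -γ 0 0) :
    star (Psi 3 γ * w (((3 : ℕ) : ℝ) / 2) sigmaZero⁻¹ (toReal γ) UpperHalfPlane.I) =
      cuspConst * rowCoeffZero 3 (-γ 0 0).toNat (-γ 0 1) := by
  have h1 := eisTerm_sigmaZero (k := 3) (by decide) hγ UpperHalfPlane.I
  have hI : ((UpperHalfPlane.I : UpperHalfPlane) : ℂ) ∈ Hset := coe_mem_Hset _
  rw [← rowTerm_neg (by decide) _ (W_mem hI), eisTerm, j_sigmaZero_inv_mul, rowTerm, uW] at h1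
  rw [rowCoeffZero, Int.toNat_of_nonneg h.le, star_mul']
  set X := star (Psi 3 γ) * star (w (((3 : ℕ) : ℝ) / 2) sigmaZero⁻¹ (toReal γ) UpperHalfPlane.I)
  set z : ℂ := ((UpperHalfPlane.I : UpperHalfPlane) : ℂ) with hz
  have hz0 : z ≠ 0 := ne_zero_of_Hset hI
  set u : ℂ := (-γ 0 0 : ℤ) * z + (-γ 0 1 : ℤ) with hu
  have huH : u ∈ Hset := by
    have h2 : (0 : ℝ) < (-γ 0 0 : ℤ) := by exact_mod_cast h
    have h3 : u.im = (-γ 0 0 : ℤ) * z.im := by simp [hu]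
    show 0 < u.im
    rw [h3]
    exact mul_pos h2 hI
  have hu0 : u ≠ 0 := ne_zero_of_Hset huH
  have e1 : (-2 * ((γ 0 0 : ℂ) * z + γ 0 1)) = ((2 : ℝ) : ℂ) * u := by
    rw [hu]; push_cast; ring
  have e2 : ((-(-4 * γ 0 1, γ 0 0) : ℤ × ℤ).1 : ℂ) * (-1 / (4 * z)) + ((-(-4 * γ 0 1, γ 0 0) : ℤ × ℤ).2 : ℂ)
      = u / z := by
    rw [hu, Prod.neg_mk]; push_cast; field_simp; ring
  have e3 : (((((3 : ℕ) : ℝ) / 2 : ℝ)) : ℂ) = 3 / 2 := by push_cast; rfl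
  have e4 : ((3 : ℕ) : ℂ) / 2 = 3 / 2 := by push_cast; rfl
  have e5 : rowCoeff 3 (-(-4 * γ 0 1, γ 0 0) : ℤ × ℤ).1 (-(-4 * γ 0 1, γ 0 0) : ℤ × ℤ).2 =
      rowCoeff 3 (-4 * -γ 0 1) (-γ 0 0) := by
    congr 1; simp
  rw [e1, e2, e3, e4, e5, ofReal_mul_cpow two_pos hu0, mul_zero, cpow_zero, mul_one] at h1
  have h2 := cpow_div_of_Hset huH hI (3 / 2)
  have n1 : (-2 * Complex.I * z) ^ (3 / 2 : ℂ) ≠ 0 := by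
    rw [Ne, cpow_eq_zero_iff]; simp [hz0]
  have n2 : (u / z) ^ (3 / 2 : ℂ) ≠ 0 := by
    rw [Ne, cpow_eq_zero_iff]; simp [hz0, hu0]
  have n3 : u ^ (3 / 2 : ℂ) ≠ 0 := by
    rw [Ne, cpow_eq_zero_iff]; simp [hu0]
  have n4 : (-2 * Complex.I) ^ (3 / 2 : ℂ) ≠ 0 := by
    rw [Ne, cpow_eq_zero_iff]; simp
  have n5 : (2 : ℂ) ^ (3 / 2 : ℂ) ≠ 0 := by
    rw [Ne, cpow_eq_zero_iff]; simp
  have n6 := one_sub_I_pow_ne_zero 3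
  set t := ((1 - Complex.I) / (Real.sqrt 2 : ℂ)) ^ 3
  set R := rowCoeff 3 (-4 * -γ 0 1) (-γ 0 0)
  rw [cpow_neg, cpow_neg, cpow_neg, ofReal_ofNat] at h1
  replace h1 : t * (X * ((2 ^ (3 / 2 : ℂ))⁻¹ * (u ^ (3 / 2 : ℂ))⁻¹)) =
      R * ((-2 * Complex.I) ^ (3 / 2 : ℂ) * u ^ (3 / 2 : ℂ))⁻¹ := by
    rw [← h2]
    linear_combination h1
  change X = t⁻¹ * (2 ^ (3 / 2 : ℂ) * ((-2 * Complex.I) ^ (3 / 2 : ℂ))⁻¹) * R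
  clear_value X t R
  field_simp at h1 ⊢
  linear_combination h1

lemma cuspData_sigmaZero : CuspData sigmaZero 2 (fun γ => -γ 0 0) (fun γ => -γ 0 1)
    (rowCoeffZero 3) cuspConst where
  pos := two_pos
  lower γ := by rw [(sigmaZero_inv_mul_apply γ).1]; push_cast; ring
  right γ := by rw [(sigmaZero_inv_mul_apply γ).2]; push_cast; ring
  unipotent M hM h10 h11 := by
    obtain ⟨m, hm⟩ := mem_Gamma0_four.1 hM
    refine ⟨-m, eq_trans_of_lower h10 h11 ?_⟩
    rw [Matrix.SpecialLinearGroup.coe_mul, Matrix.SpecialLinearGroup.coe_mul]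
    simp only [Matrix.mul_apply, Fin.sum_univ_two, coe_sigmaZero_inv, toReal_apply, hm]
    simp [sigmaZero]
    ring
  exists_row c _ d h := by
    obtain ⟨h1, h2⟩ := isCoprime_of_rowCoeff_ne_zero h
    have h3 : IsCoprime (-4 * -d) (-c : ℤ) := by
      rw [IsCoprime.neg_right_iff, mul_neg, IsCoprime.neg_left_iff]
      exact h2
    obtain ⟨γ, h4, h5⟩ := exists_Gamma0_of_upper h3
    exact ⟨γ, by simp only [h4]; ring, by simp only [h5]; ring⟩
  periodic c d := rowCoeffZero_add c d
  norm_le c d := norm_rowCoeffZero_le _ _ _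
  multiplier γ hγ hc := star_Psi_mul_w_sigmaZero hγ hc

/-! ### The Eisenstein series of weight `3/2` -/

/-- For n > 0 the mean of ψ is zero, so the zeta function of this cusp is regular at 0 without help
from the other. -/
lemma isKloostermanZetaValue_one {n : ℕ} (hn : 1 ≤ n) :
    IsKloostermanZetaValue (((3 : ℕ) : ℝ) / 2) (Gamma0 4) (Psi 3) 1 n (deriv (inftyPart n) 0) := by
  have h0 : inftyPart n 0 = 0 := by
    rw [inftyPart, oddPart_zero (by omega) (psiMean_of_pos (by omega))]
    simp
  have h := cuspData_one.isKloostermanZetaValue n (differentiableOn_inftyPart n) h0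
    fun s hs => inftyPart_eq n hs
  simpa using h

lemma isKloostermanZetaValue_sigmaZero {n : ℕ} (hn : 1 ≤ n) :
    IsKloostermanZetaValue (((3 : ℕ) : ℝ) / 2) (Gamma0 4) (Psi 3) sigmaZero n
      ((((1 - Complex.I) / (Real.sqrt 2 : ℂ)) ^ 3)⁻¹ * (((-2 * Complex.I) ^ (3 / 2 : ℂ))⁻¹ *
        deriv (oddPart n) 0)) := by
  have h := cuspData_sigmaZero.isKloostermanZetaValue n (differentiableOn_oddPart n)
    (oddPart_zero (by omega) (psiMean_of_pos (by omega))) fun s hs => oddPart_eq_klZeta n hs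
  have n5 : (2 : ℂ) ^ (3 / 2 : ℂ) ≠ 0 := by
    rw [Ne, cpow_eq_zero_iff]; simp
  convert h using 1
  rw [cuspConst, cpow_neg]
  push_cast
  field_simp

/-- Since `oddPart` vanishes at 0, the factor 2^{-2s} contributes only its value 1. -/
lemma deriv_bothPart {n : ℕ} (hn : 1 ≤ n) : deriv (bothPart n) 0 =
    deriv (inftyPart n) 0 + ((-2 * Complex.I) ^ (3 / 2 : ℂ))⁻¹ * deriv (oddPart n) 0 := by
  have hU := isOpen_sHalf.mem_nhds zero_mem_sHalf
  have h1 := ((differentiableOn_inftyPart n).differentiableAt hU).hasDerivAt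
  have h2 := ((differentiableOn_oddPart n).differentiableAt hU).hasDerivAt
  have h3 : DifferentiableAt ℂ (fun s : ℂ => ((-2 * Complex.I) ^ (3 / 2 : ℂ))⁻¹ * (2 : ℂ) ^ (-2 * s)) 0 :=
    ((Differentiable.const_cpow (by fun_prop) (Or.inl two_ne_zero)).const_mul _) 0
  have h0 : oddPart n 0 = 0 := oddPart_zero (by omega) (psiMean_of_pos (by omega))
  have h4 := (h1.add (h3.hasDerivAt.mul h2)).deriv
  refine (show deriv (bothPart n) 0 = _ from h4).trans ?_
  rw [h0]
  simp

/-- The factor of the Fourier coefficients of weight `3/2`. -/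
lemma eta_eq {σ : SL(2, ℝ)} {n : ℕ} {v : ℂ}
    (h : IsKloostermanZetaValue (((3 : ℕ) : ℝ) / 2) (Gamma0 4) (Psi 3) σ n v) :
    eta (((3 : ℕ) : ℝ) / 2) (Gamma0 4) (Psi 3) σ n =
      v * ((2 * Real.pi / Complex.I) ^ (3 / 2 : ℂ) / Complex.Gamma (3 / 2) * Real.sqrt n) := by
  have e3 : (((((3 : ℕ) : ℝ) / 2 : ℝ)) : ℂ) = 3 / 2 := by push_cast; rfl
  have e4 : (n : ℂ) ^ ((3 / 2 : ℂ) - 1) = Real.sqrt n := by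
    rw [Real.sqrt_eq_rpow, ofReal_cpow (Nat.cast_nonneg n)]
    push_cast
    norm_num
  rw [eta, kloostermanZetaValue_eq h, e3, e4]
  ring

/-- The constant of the theorem cancels its inverse in the value at the cusp 0, which leaves the
derivative of the combined function. -/
lemma eta_add {n : ℕ} (hn : 1 ≤ n) : eta (((3 : ℕ) : ℝ) / 2) (Gamma0 4) (Psi 3) 1 n +
    ((1 - Complex.I) / (Real.sqrt 2 : ℂ)) ^ 3 * eta (((3 : ℕ) : ℝ) / 2) (Gamma0 4) (Psi 3) sigmaZero n =
      centreCoeff n := by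
  rw [eta_eq (isKloostermanZetaValue_one hn), eta_eq (isKloostermanZetaValue_sigmaZero hn),
    centreCoeff, deriv_bothPart hn]
  have n6 := one_sub_I_pow_ne_zero 3
  set t := ((1 - Complex.I) / (Real.sqrt 2 : ℂ)) ^ 3
  linear_combination (((-2 * Complex.I) ^ (3 / 2 : ℂ))⁻¹ * deriv (oddPart n) 0 *
    ((2 * Real.pi / Complex.I) ^ (3 / 2 : ℂ) / Complex.Gamma (3 / 2) * Real.sqrt n)) *
      mul_inv_cancel₀ n6

lemma summable_fourierTerm {σ : SL(2, ℝ)} {v : ℕ → ℂ} {C : ℝ}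
    (h : ∀ n, 1 ≤ n → IsKloostermanZetaValue (((3 : ℕ) : ℝ) / 2) (Gamma0 4) (Psi 3) σ n (v n))
    (hv : ∀ n, ‖v n‖ ≤ C * (1 + (n : ℝ)) ^ 7) (z : UpperHalfPlane) :
    Summable fun n : ℕ => fourierTerm (((3 : ℕ) : ℝ) / 2) (Gamma0 4) (Psi 3) σ z (n + 1) := by
  set k := ‖(2 * Real.pi / Complex.I) ^ (3 / 2 : ℂ) / Complex.Gamma (3 / 2)‖ with hk
  have hb : ∀ n : ℕ, ‖eta (((3 : ℕ) : ℝ) / 2) (Gamma0 4) (Psi 3) σ (n + 1)‖ ≤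
      C * k * (1 + ((n + 1 : ℕ) : ℝ)) ^ 8 := fun n => by
    rw [eta_eq (h (n + 1) (by omega)), norm_mul, norm_mul, ← hk]
    have h1 := hv (n + 1)
    set m : ℝ := ((n + 1 : ℕ) : ℝ) with hm
    have hm1 : 1 ≤ m := by rw [hm]; exact_mod_cast Nat.succ_pos n
    have h2 : ‖(Real.sqrt m : ℂ)‖ ≤ 1 + m := by
      rw [norm_real, Real.norm_of_nonneg (Real.sqrt_nonneg _)]
      refine (Real.sqrt_le_left (by linarith)).2 (by nlinarith)
    calc _ ≤ C * (1 + m) ^ 7 * (k * (1 + m)) :=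
          mul_le_mul h1 (by gcongr) (by positivity) ((norm_nonneg _).trans h1)
      _ = _ := by ring
  exact Summable.of_norm_bounded
    ((summable_succ_sq_inv.mul_right _).mul_left _) fun n =>
      norm_fourier_term_le (hb n) (coe_mem_Hset z)

lemma summable_fourierTerm_one_and_sigmaZero (z : UpperHalfPlane) :
    (Summable fun n : ℕ => fourierTerm (((3 : ℕ) : ℝ) / 2) (Gamma0 4) (Psi 3) 1 z (n + 1)) ∧
    Summable fun n : ℕ => fourierTerm (((3 : ℕ) : ℝ) / 2) (Gamma0 4) (Psi 3) sigmaZero z (n + 1) := by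
  obtain ⟨C, hC0, hC⟩ := exists_norm_bothPart_le
  have hn : ∀ n : ℕ, |((n : ℤ) : ℝ)| = n := fun n => by
    rw [Int.cast_natCast, abs_of_nonneg (by positivity)]
  constructor
  · refine summable_fourierTerm (C := 16 * C) (fun n => isKloostermanZetaValue_one) (fun n => ?_) z
    have := norm_deriv_zero_le (differentiableOn_inftyPart n) fun s hs hs1 => (hC n s hs hs1).1
    rw [hn] at this
    linarith
  · refine summable_fourierTerm
      (C := ‖(((1 - Complex.I) / (Real.sqrt 2 : ℂ)) ^ 3)⁻¹‖ * ‖((-2 * Complex.I) ^ (3 / 2 : ℂ))⁻¹‖ *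
        (16 * C)) (fun n => isKloostermanZetaValue_sigmaZero) (fun n => ?_) z
    have := norm_deriv_zero_le (differentiableOn_oddPart n) fun s hs hs1 => (hC n s hs hs1).2.1
    rw [hn] at this
    rw [norm_mul, norm_mul, ← mul_assoc, mul_assoc (_ * _) (16 * C)]
    gcongr
    linarith

lemma wellDefined_three :
    EisensteinWellDefined (((3 : ℕ) : ℝ) / 2) (Gamma0 4) (Psi 3) 1 ∧
      EisensteinWellDefined (((3 : ℕ) : ℝ) / 2) (Gamma0 4) (Psi 3) sigmaZero := by
  have h : ¬ 2 < (((3 : ℕ) : ℝ) / 2) := by norm_num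
  rw [EisensteinWellDefined, EisensteinWellDefined, if_neg h, if_neg h]
  exact ⟨⟨fun n hn => ⟨_, isKloostermanZetaValue_one hn⟩,
      fun z => (summable_fourierTerm_one_and_sigmaZero z).1⟩,
    ⟨fun n hn => ⟨_, isKloostermanZetaValue_sigmaZero hn⟩,
      fun z => (summable_fourierTerm_one_and_sigmaZero z).2⟩⟩

lemma deltaInfty_one : deltaInfty (Gamma0 4) 1 = 1 :=
  if_pos ⟨1, by simp⟩

lemma deltaInfty_sigmaZero : deltaInfty (Gamma0 4) sigmaZero = 0 := by
  refine if_neg ?_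
  rintro ⟨γ, hγ⟩
  rw [(sigmaZero_inv_mul_apply _).1] at hγ
  have h1 : ((γ : SL(2, ℤ)) 0 0 : ℝ) = 0 := by linarith
  have h2 : (γ : SL(2, ℤ)) 0 0 = 0 := by exact_mod_cast h1
  have := odd_of_isCoprime ⟨-(γ : SL(2, ℤ)) 0 1, by ring⟩ (isCoprime_upper γ.2)
  rw [h2] at this
  exact absurd this (by decide)

lemma Theta_pow_three (z : UpperHalfPlane) :
    Theta z ^ 3 = E 3 z + ((1 - Complex.I) / (Real.sqrt 2 : ℂ)) ^ 3 * F 3 z := by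
  have h : ¬ 2 < (((3 : ℕ) : ℝ) / 2) := by norm_num
  obtain ⟨h1, h2⟩ := summable_fourierTerm_one_and_sigmaZero z
  have h3 := hasSum_centreVal_nat (coe_mem_Hset z)
  have e : ∀ n : ℕ, centreCoeff (n + 1) * cexp (2 * Real.pi * Complex.I * (n + 1 : ℕ) * z) =
      fourierTerm (((3 : ℕ) : ℝ) / 2) (Gamma0 4) (Psi 3) 1 z (n + 1) +
        ((1 - Complex.I) / (Real.sqrt 2 : ℂ)) ^ 3 *
          fourierTerm (((3 : ℕ) : ℝ) / 2) (Gamma0 4) (Psi 3) sigmaZero z (n + 1) := fun n => by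
    rw [← eta_add (by omega), fourierTerm, fourierTerm]
    ring
  simp_rw [e] at h3
  replace h3 := h3.unique
    (h1.hasSum.add (h2.hasSum.mul_left (((1 - Complex.I) / (Real.sqrt 2 : ℂ)) ^ 3)))
  rw [E, F, eisenstein, eisenstein, if_neg h, if_neg h, deltaInfty_one, deltaInfty_sigmaZero, zero_add,
    Theta_eq_th, ← centreVal_eq (coe_mem_Hset z)]
  linear_combination h3

end ThetaEisenstein
end

theorem mainTheorem9 (k : ℕ) (hk : k = 3 ∨ k = 5 ∨ k = 7) :
    ThetaEisenstein.EisensteinWellDefined ((k : ℝ) / 2) (CongruenceSubgroup.Gamma0 4)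
      (ThetaEisenstein.Psi k) 1 ∧
    ThetaEisenstein.EisensteinWellDefined ((k : ℝ) / 2) (CongruenceSubgroup.Gamma0 4)
      (ThetaEisenstein.Psi k) ThetaEisenstein.sigmaZero ∧
    ∀ z : UpperHalfPlane,
      ThetaEisenstein.Theta z ^ k =
        ThetaEisenstein.E k z +
          ((1 - Complex.I) / (Real.sqrt 2 : ℂ)) ^ k * ThetaEisenstein.F k z := by
  -- Absolute convergence for k = 5, 7; analytic continuation for k = 3.
  by_cases h : 2 < (k : ℝ) / 2
  · have hodd : Odd k := by
      rcases hk with rfl | rfl | rfl <;> decide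
    refine ⟨(ThetaEisenstein.wellDefined_of_two_lt hodd h).1,
      (ThetaEisenstein.wellDefined_of_two_lt hodd h).2, fun z => ?_⟩
    rw [ThetaEisenstein.E_eq_Es hodd h, ThetaEisenstein.F_eq_EsW hodd h, ThetaEisenstein.Theta_eq_th,
      ← ThetaEisenstein.th_pow_eq_of_two_lt hodd h (by omega) (ThetaEisenstein.coe_mem_Hset z),
      ThetaEisenstein.Gs]
  · obtain rfl : k = 3 := by
      rcases hk with rfl | rfl | rfl
      · rfl
      all_goals exact absurd (by norm_num) h
    exact ⟨ThetaEisenstein.wellDefined_three.1, ThetaEisenstein.wellDefined_three.2,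
      ThetaEisenstein.Theta_pow_three⟩
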